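/- **Setting.** Let $\sigma^2>0$, $\vartheta_2>0$, $\vartheta_1,\vartheta_0\in\mathbb R$, put $\kappa=\vartheta_1/\vartheta_2$, $\Gamma=\vartheta_1^2/(4\vartheta_2^2)-\vartheta_0/\vartheta_2$ and assume $\Gamma+\pi^2>0$. For $\ell\ge 1$ let $\lambda_\ell=\vartheta_2(\pi^2\ell^2+\Gamma)$ and $e_\ell(y)=\sqrt2\sin(\pi\ell y)e^{-\kappa y/2}$. Let $X$ be the stationary solution of the SPDE $dX_t=(\vartheta_2\partial_x^2+\vartheta_1\partial_x+\vartheta_0)X_t\,dt+\sigma\,dW_t$ on $[0,1]$ with Dirichlet boundary conditions, i.e. $X_t(x)=\sum_{\ell\ge1}u_\ell(t)e_\ell(x)$ (convergence in $L^2(\mathbb P)$) for $t\ge0$, $x\in[0,1]$, where $du_\ell(t)=-\lambda_\ell u_\ell(t)\,dt+\sigma\,d\beta_\ell(t)$ with Brownian motions $\beta_\ell$, $u_\ell(0)\sim\mathcal N(0,\sigma^2/(2\lambda_\ell))$, and $\{\beta_\ell,u_\ell(0):\ell\ge1\}$ is an independent family. Let $T>0$, $b\in(0,1/2)$, $\delta=(1-2b)/M$,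 $\Delta=T/N$, $y_k=b+k\delta$, $t_i=i\Delta$, $z_k=(y_k+y_{k+1})/2$, and $$D_{ik}=X_{t_{i+1}}(y_{k+1})-X_{t_{i+1}}(y_k)-X_{t_i}(y_{k+1})+X_{t_i}(y_k),\qquad \bar D_{ik}=D_{ik}+D_{(i+1)k}.$$ For $\tilde\eta=(\tilde\sigma^2,\tilde\vartheta_2,\tilde\kappa)$ and $\nu\in\{1,2\}$ let $f^\nu_{\tilde\eta}(z)=\tilde\sigma^2e^{-\tilde\kappa z}\psi_{\tilde\vartheta_2}(r/\sqrt\nu)$ with $$\psi_{\vartheta}(r)=\frac{2}{\sqrt{\pi\vartheta}}\Big(1-e^{-r^2/(4\vartheta)}+\frac{r}{\sqrt{\vartheta}}\int_{r/(2\sqrt{\vartheta})}^\infty e^{-z^2}dz\Big),$$ $$K_{M,N}(\tilde\eta)=\frac1M\sum_{k=0}^{M-1}\Big(\frac1{N\sqrt\Delta}\sum_{i=0}^{N-1}D_{ik}^2-f^1_{\tilde\eta}(z_k)\Big)^2+\frac1M\sum_{k=0}^{M-1}\Big(\frac1{N\sqrt{2\Delta}}\sum_{i=0}^{N-2}\bar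 D_{ik}^2-f^2_{\tilde\eta}(z_k)\Big)^2 .$$ **Theorem.** Let $r>0$, let $H\subset(0,\infty)^2\times\mathbb R$ be compact and let $\eta=(\sigma^2,\vartheta_2,\kappa)$ lie in the interior of $H$. Let $M,N\to\infty$ along a sequence with $\delta/\sqrt\Delta\equiv r$, and let $\hat\eta$ be a (measurable) minimizer of $K_{M,N}$ over $H$. Then $$\sqrt{MN}\,(\hat\eta-\eta)\xrightarrow{\ \mathcal D\ }\mathcal N(0,\Omega^r_\eta),\qquad \Omega_\eta^r=V^{-1}UV^{-1},$$ where $V$ is invertible and $\Omega^r_\eta$ is strictly positive definite. Here, with $\langle f,g\rangle_b=\frac1{1-2b}\int_b^{1-b}fg$ and $i,j\in\{1,2,3\}$, $$U_{ij}=4\sigma^4\Big(2A_r\langle h^1_i,h^1_j\rangle_b+B_r\langle h^2_i,h^2_j\rangle_b+\sqrt2\,C_r\big(\langle h^1_i,h^2_j\rangle_b+\langle h^2_i,h^1_j\rangle_b\big)\Big),$$ $$V_{ij}=2\big(\langle g^1_i,g^1_j\rangle_b+\langle g^2_i,g^2_j\rangle_b\big),$$ where $h^\nu(z)=e^{-\kappa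 z}g^\nu(z)$ and, with $r_\nu=r/\sqrt\nu$ and $a_\nu=r_\nu/(2\sqrt{\vartheta_2})$, $$g^\nu(z)=e^{-\kappa z}\Big(\tfrac1{r_\nu}\mathcal H(a_\nu),\;-\tfrac{\sigma^2}{4\vartheta_2^{3/2}}\mathcal H'(a_\nu),\;-z\tfrac{\sigma^2}{r_\nu}\mathcal H(a_\nu)\Big)^{\top}$$ is the gradient of $\eta\mapsto f^\nu_\eta(z)$, $\mathcal H(x)=\frac{4x}{\sqrt\pi}\big(1-e^{-x^2}+2x\int_x^\infty e^{-z^2}dz\big)$, $\mathcal H'(x)=\frac{4}{\sqrt\pi}\big(1-e^{-x^2}+4x\int_x^\infty e^{-z^2}dz\big)$. Moreover $A_r=\sum_{i,k\in\mathbb Z}A_{ik}^2$, $B_r=\sum_{i,k\in\mathbb Z}(2A_{ik}+A_{(i-1)k}+A_{(i+1)k})^2$, $C_r=\sum_{i,k\in\mathbb Z}(A_{ik}+A_{(i-1)k})^2$ are convergent series with $A_{ik}=-\Lambda_{ik}(r/\sqrt{\vartheta_2})/\sqrt{\vartheta_2}$ and $\Lambda_{jl}(h)=(D_x^2D_y^2G_h)(|j|-1,|l|-1)$,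 where $D_x^2f(x,y)=f(x+2,y)+f(x,y)-2f(x+1,y)$, $D^2_yf(x,y)=f(x,y+2)+f(x,y)-2f(x,y+1)$, $G_h(j,l)=\sqrt{|j|}\,Q(h|l|/\sqrt{|j|})$ for $j\ne0$, $G_h(0,l)=0$, and $Q(x)=\frac1{2\sqrt\pi}\big(e^{-x^2/4}-x\int_{x/2}^\infty e^{-z^2}dz\big)$. -/

import Mathlib

open MeasureTheory ProbabilityTheory Filter Set
open scoped Topology NNReal ENNReal

noncomputable section

namespace ParabolicSPDE

/-! ### The model -/

/-- The parameters `(σ², ϑ₂, ϑ₁, ϑ₀)` of the equation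
`dX_t = (ϑ₂ ∂²_x X_t + ϑ₁ ∂_x X_t + ϑ₀ X_t) dt + σ dW_t` on `[0,1]` with Dirichlet boundary
conditions. -/
structure Params where
  sigmaSq : ℝ
  theta2 : ℝ
  theta1 : ℝ
  theta0 : ℝ

/-- `κ = ϑ₁ / ϑ₂`. -/
def Params.kappa (p : Params) : ℝ := p.theta1 / p.theta2

/-- `Γ = ϑ₁² / (4 ϑ₂²) - ϑ₀ / ϑ₂`. -/
def Params.Gamma (p : Params) : ℝ :=
  p.theta1 ^ 2 / (4 * p.theta2 ^ 2) - p.theta0 / p.theta2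

/-- The parameter space `Θ`. -/
structure Params.Admissible (p : Params) : Prop where
  sigmaSq_pos : 0 < p.sigmaSq
  theta2_pos : 0 < p.theta2
  spectrum_neg : 0 < p.Gamma + Real.pi ^ 2

/-- `λ_ℓ = ϑ₂ (π² ℓ² + Γ)`, for `ℓ ≥ 1`: the operator has the eigenvalues `-λ_ℓ`. -/
def Params.eigenvalue (p : Params) (l : ℕ) : ℝ :=
  p.theta2 * (Real.pi ^ 2 * (l : ℝ) ^ 2 + p.Gamma)

/-- `e_ℓ(y) = √2 sin(π ℓ y) exp(-κ y / 2)`, for `ℓ ≥ 1`. -/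
def Params.eigenfunction (p : Params) (l : ℕ) (y : ℝ) : ℝ :=
  Real.sqrt 2 * Real.sin (Real.pi * (l : ℝ) * y) * Real.exp (-(p.kappa * y / 2))

/-- The identifiable parameter `η = (σ², ϑ₂, κ)`. -/
def Params.eta (p : Params) : EuclideanSpace ℝ (Fin 3) :=
  !₂[p.sigmaSq, p.theta2, p.kappa]

section Solution

variable {Ω : Type*} [MeasurableSpace Ω]

/-- `u` solves the Ornstein-Uhlenbeck equation `du(t) = -a u(t) dt + s dβ(t)`, `t ≥ 0`, with driving
process `β`: almost surely, the path is continuous and satisfies the integrated equation. -/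
def IsOrnsteinUhlenbeck (a s : ℝ) (β : ℝ≥0 → Ω → ℝ) (u : ℝ → Ω → ℝ) (P : Measure Ω) : Prop :=
  ∀ᵐ ω ∂P, ContinuousOn (fun t => u t ω) (Ici 0) ∧
    ∀ t : ℝ≥0, u t ω = u 0 ω - a * (∫ v in (0 : ℝ)..t, u v ω) + s * β t ω

/-- `u` is a sequence of stationary Fourier modes of the equation, driven by the sequence `β` of
Brownian motions. The index `l` stands for the mode `ℓ = l + 1`. The last two fields say together
that all the `β l` and all the `u l 0` form one independent family. -/
structure IsModeSequence (p : Params) (β : ℕ → ℝ≥0 → Ω → ℝ) (u : ℕ → ℝ → Ω → ℝ)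
    (P : Measure Ω) : Prop where
  measurable_noise : ∀ l t, Measurable (β l t)
  measurable_mode : ∀ l t, Measurable (u l t)
  brownian : ∀ l, IsBrownianReal (β l) P
  ornsteinUhlenbeck : ∀ l,
    IsOrnsteinUhlenbeck (p.eigenvalue (l + 1)) (Real.sqrt p.sigmaSq) (β l) (u l) P
  initial_law : ∀ l,
    HasLaw (u l 0) (gaussianReal 0 (p.sigmaSq / (2 * p.eigenvalue (l + 1))).toNNReal) P
  indep_modes : iIndepFun (fun l ω => (u l 0 ω, fun t => β l t ω)) P
  indep_initial : ∀ l, IndepFun (u l 0) (fun ω t => β l t ω) P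

/-- `X` is the stationary solution field of the equation,
`X_t(x) = ∑_{ℓ ≥ 1} u_ℓ(t) e_ℓ(x)` for `t ≥ 0` and `x ∈ [0,1]`, with convergence in `L²(P)`. -/
def IsStationarySolution (p : Params) (X : ℝ → ℝ → Ω → ℝ) (P : Measure Ω) : Prop :=
  ∃ (β : ℕ → ℝ≥0 → Ω → ℝ) (u : ℕ → ℝ → Ω → ℝ), IsModeSequence p β u P ∧
    ∀ t : ℝ, 0 ≤ t → ∀ x ∈ Icc (0 : ℝ) 1, AEMeasurable (X t x) P ∧
      Tendsto (fun n : ℕ => eLpNorm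
        (fun ω => X t x ω - ∑ l ∈ Finset.range n, u l t ω * p.eigenfunction (l + 1) x) 2 P)
        atTop (𝓝 0)

end Solution

/-! ### Observations and contrast process -/

/-- The spatial mesh `δ = (1 - 2b) / M`. -/
def meshSpace (b : ℝ) (M : ℕ) : ℝ := (1 - 2 * b) / M

/-- The temporal mesh `Δ = T / N`. -/
def meshTime (T : ℝ) (N : ℕ) : ℝ := T / N

/-- The spatial grid points `y_k = b + k δ`. -/
def gridSpace (b : ℝ) (M k : ℕ) : ℝ := b + k * meshSpace b M

/-- The temporal grid points `t_i = i Δ`. -/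
def gridTime (T : ℝ) (N i : ℕ) : ℝ := i * meshTime T N

/-- The midpoints `z_k = (y_k + y_{k+1}) / 2`. -/
def gridMid (b : ℝ) (M k : ℕ) : ℝ := (gridSpace b M k + gridSpace b M (k + 1)) / 2

/-- The double increment `D_{ik}` of a field `x : (t, y) ↦ x t y`. -/
def doubleIncr (T b : ℝ) (M N : ℕ) (x : ℝ → ℝ → ℝ) (i k : ℕ) : ℝ :=
  x (gridTime T N (i + 1)) (gridSpace b M (k + 1)) - x (gridTime T N (i + 1)) (gridSpace b M k)
    - x (gridTime T N i) (gridSpace b M (k + 1)) + x (gridTime T N i) (gridSpace b M k)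

/-- `D̄_{ik} = D_{ik} + D_{(i+1)k}`. -/
def doubleIncrBar (T b : ℝ) (M N : ℕ) (x : ℝ → ℝ → ℝ) (i k : ℕ) : ℝ :=
  doubleIncr T b M N x i k + doubleIncr T b M N x (i + 1) k

/-- The Gaussian tail integral `∫_x^∞ exp(-z²) dz`. -/
def gaussTail (x : ℝ) : ℝ := ∫ z in Ioi x, Real.exp (-z ^ 2)

/-- `ψ_ϑ(r) = 2/√(πϑ) (1 - exp(-r²/(4ϑ)) + (r/√ϑ) ∫_{r/(2√ϑ)}^∞ exp(-z²) dz)`. -/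
def psi (th r : ℝ) : ℝ :=
  2 / Real.sqrt (Real.pi * th) *
    (1 - Real.exp (-(r ^ 2 / (4 * th)))
      + r / Real.sqrt th * gaussTail (r / (2 * Real.sqrt th)))

/-- `f_η^ν(z) = σ² exp(-κ z) ψ_{ϑ₂}(r/√ν)` for `η = (σ², ϑ₂, κ)`. -/
def meanFun (r : ℝ) (ν : ℕ) (η : EuclideanSpace ℝ (Fin 3)) (z : ℝ) : ℝ :=
  η 0 * Real.exp (-(η 2 * z)) * psi (η 1) (r / Real.sqrt ν)

/-- The contrast `K¹_{M,N}`. -/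
def contrast1 (T b r : ℝ) (M N : ℕ) (x : ℝ → ℝ → ℝ) (η : EuclideanSpace ℝ (Fin 3)) : ℝ :=
  1 / (M : ℝ) * ∑ k ∈ Finset.range M,
    (1 / (N * Real.sqrt (meshTime T N)) * ∑ i ∈ Finset.range N, doubleIncr T b M N x i k ^ 2
      - meanFun r 1 η (gridMid b M k)) ^ 2

/-- The contrast `K²_{M,N}`; the inner sum runs over `i = 0, …, N - 2`. -/
def contrast2 (T b r : ℝ) (M N : ℕ) (x : ℝ → ℝ → ℝ) (η : EuclideanSpace ℝ (Fin 3)) : ℝ :=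
  1 / (M : ℝ) * ∑ k ∈ Finset.range M,
    (1 / (N * Real.sqrt (2 * meshTime T N)) *
        ∑ i ∈ Finset.range (N - 1), doubleIncrBar T b M N x i k ^ 2
      - meanFun r 2 η (gridMid b M k)) ^ 2

/-- The contrast process `K_{M,N} = K¹_{M,N} + K²_{M,N}`. -/
def contrast (T b r : ℝ) (M N : ℕ) (x : ℝ → ℝ → ℝ) (η : EuclideanSpace ℝ (Fin 3)) : ℝ :=
  contrast1 T b r M N x η + contrast2 T b r M N x η

/-- `est` is a least squares estimator: a random vector which almost surely is a minimizer over `H`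
of the contrast process of the observed field `X`. -/
structure IsLeastSquaresEstimator {Ω : Type*} [MeasurableSpace Ω] (T b r : ℝ) (M N : ℕ)
    (X : ℝ → ℝ → Ω → ℝ) (H : Set (EuclideanSpace ℝ (Fin 3)))
    (est : Ω → EuclideanSpace ℝ (Fin 3)) (P : Measure Ω) : Prop where
  aemeasurable : AEMeasurable est P
  argmin : ∀ᵐ ω ∂P, est ω ∈ H ∧
    IsMinOn (contrast T b r M N (fun t y => X t y ω)) H (est ω)

/-! ### The asymptotic covariance matrix -/

/-- `(2√π)⁻¹ (exp(-x²/4) - x ∫_{x/2}^∞ exp(-z²) dz)`. -/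
def covProfile (x : ℝ) : ℝ :=
  1 / (2 * Real.sqrt Real.pi) * (Real.exp (-(x ^ 2 / 4)) - x * gaussTail (x / 2))

/-- `G_h(j,l)`, the function `√|j| · covProfile (h|l|/√|j|)` for `j ≠ 0` and `0` for `j = 0`. -/
def covG (h : ℝ) (j l : ℤ) : ℝ :=
  if j = 0 then 0 else
    Real.sqrt |(j : ℝ)| * covProfile (h * |(l : ℝ)| / Real.sqrt |(j : ℝ)|)

/-- Second difference in the first variable. -/
def secondDiffX (f : ℤ → ℤ → ℝ) (x y : ℤ) : ℝ := f (x + 2) y + f x y - 2 * f (x + 1) y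

/-- Second difference in the second variable. -/
def secondDiffY (f : ℤ → ℤ → ℝ) (x y : ℤ) : ℝ := f x (y + 2) + f x y - 2 * f x (y + 1)

/-- `Λ_{j,l}(h) = (D²_x D²_y G_h)(|j| - 1, |l| - 1)`. -/
def Lam (h : ℝ) (j l : ℤ) : ℝ := secondDiffX (secondDiffY (covG h)) (|j| - 1) (|l| - 1)

/-- `A^r_{ik} = -Λ_{ik}(r/√ϑ₂)/√ϑ₂`. -/
def coefA (th r : ℝ) (i k : ℤ) : ℝ := -Lam (r / Real.sqrt th) i k / Real.sqrt th

/-- `B^r_{ik} = 2 A^r_{ik} + A^r_{(i-1)k} + A^r_{(i+1)k}`. -/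
def coefB (th r : ℝ) (i k : ℤ) : ℝ :=
  2 * coefA th r i k + coefA th r (i - 1) k + coefA th r (i + 1) k

/-- `C^r_{ik} = A^r_{ik} + A^r_{(i-1)k}`. -/
def coefC (th r : ℝ) (i k : ℤ) : ℝ := coefA th r i k + coefA th r (i - 1) k

/-- `∑_{i,k ∈ ℤ} c_{ik}²`. -/
def sumSq (c : ℤ → ℤ → ℝ) : ℝ := ∑' q : ℤ × ℤ, c q.1 q.2 ^ 2

/-- `H(x) = 4x/√π (1 - exp(-x²) + 2x ∫_x^∞ exp(-z²) dz)`. -/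
def meanProfile (x : ℝ) : ℝ :=
  4 * x / Real.sqrt Real.pi * (1 - Real.exp (-x ^ 2) + 2 * x * gaussTail x)

/-- The derivative `H'(x) = 4/√π (1 - exp(-x²) + 4x ∫_x^∞ exp(-z²) dz)`. -/
def meanProfileDeriv (x : ℝ) : ℝ :=
  4 / Real.sqrt Real.pi * (1 - Real.exp (-x ^ 2) + 4 * x * gaussTail x)

/-- The vector `g_η^ν(z)`, the gradient of `η ↦ f_η^ν(z)`; here `r_ν = r/√ν`. -/
def gradVec (r : ℝ) (ν : ℕ) (η : EuclideanSpace ℝ (Fin 3)) (z : ℝ) : Fin 3 → ℝ :=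
  let rν := r / Real.sqrt ν
  let a := rν / (2 * Real.sqrt (η 1))
  Real.exp (-(η 2 * z)) •
    ![1 / rν * meanProfile a,
      -(η 0 / (4 * (η 1 * Real.sqrt (η 1)))) * meanProfileDeriv a,
      -z * (η 0 / rν) * meanProfile a]

/-- `h_η^ν(z) = exp(-κ z) g_η^ν(z)`. -/
def weightedGradVec (r : ℝ) (ν : ℕ) (η : EuclideanSpace ℝ (Fin 3)) (z : ℝ) : Fin 3 → ℝ :=
  Real.exp (-(η 2 * z)) • gradVec r ν η z

/-- `⟨f, g⟩_b = (1 - 2b)⁻¹ ∫_b^{1-b} f g`. -/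
def innerB (b : ℝ) (f g : ℝ → ℝ) : ℝ := 1 / (1 - 2 * b) * ∫ x in b..(1 - b), f x * g x

/-- The matrix `U(η)`. -/
def matU (b r : ℝ) (η : EuclideanSpace ℝ (Fin 3)) : Matrix (Fin 3) (Fin 3) ℝ :=
  Matrix.of fun i j =>
    let h : ℕ → Fin 3 → ℝ → ℝ := fun ν e z => weightedGradVec r ν η z e
    4 * η 0 ^ 2 *
      (2 * sumSq (coefA (η 1) r) * innerB b (h 1 i) (h 1 j)
        + sumSq (coefB (η 1) r) * innerB b (h 2 i) (h 2 j)
        + Real.sqrt 2 * sumSq (coefC (η 1) r) *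
          (innerB b (h 1 i) (h 2 j) + innerB b (h 2 i) (h 1 j)))

/-- The matrix `V(η)`. -/
def matV (b r : ℝ) (η : EuclideanSpace ℝ (Fin 3)) : Matrix (Fin 3) (Fin 3) ℝ :=
  Matrix.of fun i j =>
    let g : ℕ → Fin 3 → ℝ → ℝ := fun ν e z => gradVec r ν η z e
    2 * (innerB b (g 1 i) (g 1 j) + innerB b (g 2 i) (g 2 j))

/-- The asymptotic covariance matrix `Ω_η^r = V⁻¹ U V⁻¹`. -/
def asymptoticCov (b r : ℝ) (η : EuclideanSpace ℝ (Fin 3)) : Matrix (Fin 3) (Fin 3) ℝ :=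
  (matV b r η)⁻¹ * matU b r η * (matV b r η)⁻¹

end ParabolicSPDE

end

open ParabolicSPDE

/-! The field is Gaussian, so the sums in the contrast are quadratic forms in a Gaussian vector of
increments, and a least squares estimator in a smooth identifiable model is asymptotically linear in
such forms. Three ingredients are needed: the covariances of the increments to sufficient order, a
central limit theorem for quadratic forms, and the fact that two time scales together identify η.

Covariances. In the spectral series, exp(-λτ)/λ equals 1/λ minus the integral of exp(-λv) over
[0,τ], so differences in time only see the time integral of a Dirichlet heat kernel. Poisson
summation splits that kernel into the free heat kernel and images, and the images are harmless
because observation points keep distance b from the boundary (`fieldCov_eq`). Under δ = r√Δ,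
parabolic scaling turns the free part into σ²√Δ times exponential weights times an array A depending
on the lags only. What remains is a second time difference of a primitive of a 1/2-Hölder function,
hence O(Δ^(3/2)), and the variation of the weights costs the same order (`exists_covIncr_approx`).
The bound 1/((1+|j|)(1+|l|)) on A gives square summability but not absolute summability, so row sums
are only known to be o(√(MN)). This suffices. The relative covariance error Δ is also affordable,
since Δ²MN is a constant over M.

Central limit theorem. A diagonal quadratic form with coefficients c in a Gaussian vector with
covariance S is distributed like ∑ μ_j(ξ_j² - 1) with independent standard normal ξ_j. Here ∑ μ_j² =
∑ c_a c_b S_ab², and |μ_j| is at most the largest row sum of (|c_a S_ab|)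
(`IsGaussianVec.exists_eigenvalues`). If the row sums vanish and ∑ μ_j² converges, a second order
expansion of the characteristic function of ξ² - 1 gives a normal limit. The squared sums converge
by sorting pairs of grid points by lag (`tendsto_sum_sq_lag`), which produces the constants A_r,
B_r, C_r. The mean functions are exactly the limiting variances (`limCov_self_zero`), so the bias is
O(Δ) and disappears after multiplication by √(MN).

Estimation. The quantity x𝓗'(x)/𝓗(x) is strictly decreasing. Therefore 𝓗(a)/𝓗(a/√2) determines a,
hence ϑ₂, and the gradients of the mean functions are linearly independent. By compactness of H, a
minimizer is close to η whenever the mean squared residual is small, and the latter tends to 0 in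
L¹. Linearizing the first order condition yields √(MN)(η̂ - η) = W + o(‖W‖) on that event, where W
is 2V⁻¹ applied to √(MN) times the score. As W is bounded in L² and asymptotically normal with
covariance V⁻¹UV⁻¹, Slutsky's lemma concludes.

Definiteness. V is twice the limiting Gram matrix of the gradients. For U one completes the square
and needs C_r² < A_r B_r. Equality in Cauchy-Schwarz would make A satisfy a linear recurrence in
time that has no nonzero even solution tending to 0 (`eq_zero_of_recurrence`). -/

namespace ParabolicSPDE

/-! ### Gaussian law of the observed field -/

section ExpI

variable {Ω : Type*} [MeasurableSpace Ω]

/-- The characteristic function of `Y` at `1`. -/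
noncomputable def expI (P : Measure Ω) (Y : Ω → ℝ) : ℂ := ∫ ω, Complex.exp (Y ω * Complex.I) ∂P

lemma norm_exp_ofReal_mul_I_le (x : ℝ) : ‖Complex.exp (x * Complex.I)‖ ≤ 1 := by
  rw [Complex.norm_exp_ofReal_mul_I]

lemma aestronglyMeasurable_exp_mul_I {P : Measure Ω} {Y : Ω → ℝ} (hY : AEMeasurable Y P) :
    AEStronglyMeasurable (fun ω => Complex.exp (Y ω * Complex.I)) P := by
  have : Measurable (fun x : ℝ => Complex.exp (x * Complex.I)) := by fun_prop
  exact (this.comp_aemeasurable hY).aestronglyMeasurable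

lemma expI_eq_charFun {P : Measure Ω} {Y : Ω → ℝ} (hY : AEMeasurable Y P) :
    expI P Y = charFun (P.map Y) 1 := by
  rw [charFun_apply_real, integral_map hY]
  · simp [expI]
  · exact (by fun_prop : Measurable fun x : ℝ => Complex.exp ((1 : ℝ) * x * Complex.I)).aestronglyMeasurable

lemma tendsto_expI {P : Measure Ω} [IsProbabilityMeasure P] {Y : ℕ → Ω → ℝ} {Z : Ω → ℝ}
    (hY : ∀ n, AEMeasurable (Y n) P)
    (h : ∀ᵐ ω ∂P, Tendsto (fun n => Y n ω) atTop (𝓝 (Z ω))) :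
    Tendsto (fun n => expI P (Y n)) atTop (𝓝 (expI P Z)) := by
  refine tendsto_integral_of_dominated_convergence (fun _ => 1)
    (fun n => aestronglyMeasurable_exp_mul_I (hY n)) (integrable_const _)
    (fun n => ae_of_all _ fun ω => norm_exp_ofReal_mul_I_le _) ?_
  filter_upwards [h] with ω hω
  have hc : Continuous (fun x : ℝ => Complex.exp (x * Complex.I)) := by fun_prop
  exact (hc.tendsto _).comp hω

lemma expI_add {P : Measure Ω} [IsProbabilityMeasure P] {Y Z : Ω → ℝ} (hY : AEMeasurable Y P)
    (hZ : AEMeasurable Z P) (h : IndepFun Y Z P) :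
    expI P (fun ω => Y ω + Z ω) = expI P Y * expI P Z := by
  rw [expI_eq_charFun hY, expI_eq_charFun hZ, expI_eq_charFun (Y := fun ω => Y ω + Z ω) (by fun_prop),
    h.charFun_map_fun_add_eq_mul hY hZ]
  rfl

lemma expI_sum {P : Measure Ω} [IsProbabilityMeasure P] {ι : Type*} [Fintype ι] {Y : ι → Ω → ℝ}
    (hY : ∀ i, AEMeasurable (Y i) P) (h : iIndepFun Y P) :
    expI P (fun ω => ∑ i, Y i ω) = ∏ i, expI P (Y i) := by
  rw [expI_eq_charFun (by fun_prop), h.charFun_map_fun_sum_eq_prod hY, Finset.prod_apply]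
  exact Finset.prod_congr rfl fun i _ => (expI_eq_charFun (hY i)).symm

lemma expI_const_mul_of_hasLaw {P : Measure Ω} {Y : Ω → ℝ} {v : ℝ≥0}
    (h : HasLaw Y (gaussianReal 0 v) P) (c : ℝ) :
    expI P (fun ω => c * Y ω) = Complex.exp ((-(c ^ 2 * v / 2) : ℝ)) := by
  have h2 := charFun_gaussianReal (μ := 0) (v := v) c
  rw [charFun_apply_real, ← h.map_eq, integral_map h.aemeasurable] at h2
  · simp only [expI, Complex.ofReal_mul]
    rw [h2]
    congr 1
    push_cast
    ring
  · exact (by fun_prop : Measurable fun x : ℝ => Complex.exp (c * x * Complex.I)).aestronglyMeasurable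

lemma norm_exp_mul_I_sub_le (x y : ℝ) :
    ‖Complex.exp (x * Complex.I) - Complex.exp (y * Complex.I)‖ ≤ |x - y| := by
  have h : Complex.exp (x * Complex.I) - Complex.exp (y * Complex.I)
      = Complex.exp (y * Complex.I) * (Complex.exp (Complex.I * ((x - y : ℝ) : ℂ)) - 1) := by
    rw [mul_sub, mul_one, ← Complex.exp_add]
    congr 2
    push_cast
    ring
  rw [h, norm_mul, Complex.norm_exp_ofReal_mul_I, one_mul]
  exact Real.norm_exp_I_mul_ofReal_sub_one_le

/-- The map x ↦ exp(ix) is 1-Lipschitz, so the difference of the expectations is at most the L¹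
distance, which the L² distance dominates on a probability space. -/
lemma tendsto_expI_of_eLpNorm {P : Measure Ω} [IsProbabilityMeasure P] {Y : ℕ → Ω → ℝ} {Z : Ω → ℝ}
    (hY : ∀ n, AEMeasurable (Y n) P) (hZ : AEMeasurable Z P)
    (h : Tendsto (fun n => eLpNorm (fun ω => Z ω - Y n ω) 2 P) atTop (𝓝 0)) :
    Tendsto (fun n => expI P (Y n)) atTop (𝓝 (expI P Z)) := by
  have hfin : ∀ᶠ n in atTop, eLpNorm (fun ω => Z ω - Y n ω) 2 P < 1 :=
    h.eventually_lt_const (by norm_num)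
  have hr : Tendsto (fun n => (eLpNorm (fun ω => Z ω - Y n ω) 2 P).toReal) atTop (𝓝 0) := by
    have := (ENNReal.tendsto_toReal ENNReal.zero_ne_top).comp h
    rwa [ENNReal.toReal_zero] at this
  rw [tendsto_iff_norm_sub_tendsto_zero]
  refine squeeze_zero' (Eventually.of_forall fun _ => norm_nonneg _) ?_ hr
  filter_upwards [hfin] with n hn
  have hm : AEStronglyMeasurable (fun ω => Z ω - Y n ω) P :=
    (hZ.sub (hY n)).aestronglyMeasurable
  have hinteg : ∀ {W : Ω → ℝ}, AEMeasurable W P →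
      Integrable (fun ω => Complex.exp (W ω * Complex.I)) P := fun hW =>
    Integrable.of_bound (aestronglyMeasurable_exp_mul_I hW) 1
      (ae_of_all _ fun ω => norm_exp_ofReal_mul_I_le _)
  have hL2 : MemLp (fun ω => Z ω - Y n ω) 2 P := ⟨hm, hn.trans ENNReal.one_lt_top⟩
  have hL : MemLp (fun ω => Z ω - Y n ω) 1 P := hL2.mono_exponent (by norm_num)
  rw [expI, expI, ← integral_sub (hinteg (hY n)) (hinteg hZ)]
  calc ‖∫ ω, (Complex.exp (Y n ω * Complex.I) - Complex.exp (Z ω * Complex.I)) ∂P‖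
      ≤ ∫ ω, ‖Z ω - Y n ω‖ ∂P := by
        refine norm_integral_le_of_norm_le (memLp_one_iff_integrable.mp hL).norm
          (ae_of_all _ fun ω => ?_)
        rw [Real.norm_eq_abs, abs_sub_comm]
        exact norm_exp_mul_I_sub_le _ _
    _ = (eLpNorm (fun ω => Z ω - Y n ω) 1 P).toReal := by
        rw [integral_norm_eq_lintegral_enorm hm, eLpNorm_one_eq_lintegral_enorm]
    _ ≤ _ := by
        refine ENNReal.toReal_mono (hn.trans ENNReal.one_lt_top).ne ?_
        exact eLpNorm_le_eLpNorm_of_exponent_le (by norm_num) hm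

end ExpI

/-! ### Pathwise approximation of Ornstein-Uhlenbeck innovations -/

section Path

/-- A discretized stochastic convolution approximates the innovation of an Ornstein-Uhlenbeck
path. -/
lemma tendsto_innovation {a s D : ℝ} (ha : 0 < a) (hD : 0 < D) {u : ℝ → ℝ} {β : ℝ≥0 → ℝ}
    (hu : ContinuousOn u (Ici 0))
    (heq : ∀ t : ℝ≥0, u t = u 0 - a * (∫ v in (0 : ℝ)..t, u v) + s * β t) (j : ℕ) :
    Tendsto (fun m : ℕ => ∑ i ∈ Finset.range (m + 1),
      Real.exp (-(a * (D - i * (D / (m + 1 : ℕ))))) *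
        (s * (β (Real.toNNReal (((j * (m + 1) + i + 1 : ℕ) : ℝ) * (D / (m + 1 : ℕ))))
          - β (Real.toNNReal (((j * (m + 1) + i : ℕ) : ℝ) * (D / (m + 1 : ℕ)))))))
      atTop (𝓝 (u ((j + 1 : ℕ) * D) - Real.exp (-(a * D)) * u (j * D))) := by
  have hj0 : (0 : ℝ) ≤ j * D := by positivity
  have hcomp : IsCompact (Icc (j * D) ((j + 1 : ℕ) * D)) := isCompact_Icc
  have hsub : Icc (j * D) ((j + 1 : ℕ) * D) ⊆ Ici 0 := fun x hx => hj0.trans hx.1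
  have hucont := hcomp.uniformContinuousOn_of_continuous (hu.mono hsub)
  obtain ⟨U, hU⟩ := hcomp.exists_bound_of_continuousOn (hu.mono hsub)
  have hU0 : 0 ≤ U := (norm_nonneg _).trans (hU (j * D) ⟨le_rfl, by push_cast; nlinarith⟩)
  have hinteg : ∀ x y : ℝ, 0 ≤ x → 0 ≤ y → IntervalIntegrable u volume x y := fun x y hx hy =>
    (hu.mono fun z hz => (le_inf hx hy).trans hz.1).intervalIntegrable
  have hincr : ∀ x y : ℝ, 0 ≤ x → 0 ≤ y → s * (β (Real.toNNReal y) - β (Real.toNNReal x))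
      = u y - u x + a * ∫ v in x..y, u v := by
    intro x y hx hy
    have h1 := heq (Real.toNNReal x)
    have h2 := heq (Real.toNNReal y)
    rw [Real.coe_toNNReal _ hx] at h1
    rw [Real.coe_toNNReal _ hy] at h2
    rw [← intervalIntegral.integral_interval_sub_left (hinteg 0 y le_rfl hy) (hinteg 0 x le_rfl hx)]
    linarith
  rw [Metric.tendsto_atTop]
  intro ε hε
  -- This modulus is chosen so that the oscillation of the path, multiplied by a and summed over
  -- steps of total length D, contributes ε/2. The other ε/2 pays for the second order error of the
  -- exponential weights.
  obtain ⟨η, hη, hηu⟩ := Metric.uniformContinuousOn_iff.1 hucont (ε / (2 * a * D)) (by positivity)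
  have hlim : Tendsto (fun m : ℕ => D / ((m + 1 : ℕ) : ℝ)) atTop (𝓝 0) :=
    (tendsto_const_div_atTop_nhds_zero_nat D).comp (tendsto_add_atTop_nat 1)
  have hlim2 : Tendsto (fun m : ℕ => U * a ^ 2 * D * (D / ((m + 1 : ℕ) : ℝ))) atTop (𝓝 0) := by
    simpa using hlim.const_mul (U * a ^ 2 * D)
  have hev := (hlim.eventually_lt_const hη).and ((hlim.eventually_lt_const (by positivity :
    (0 : ℝ) < 1 / a)).and (hlim2.eventually_lt_const (by positivity : 0 < ε / 2)))
  obtain ⟨m₀, hm₀⟩ := eventually_atTop.1 hev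
  refine ⟨m₀, fun m hm => ?_⟩
  obtain ⟨hm1, hm2, hm3⟩ := hm₀ m hm
  set h : ℝ := D / ((m + 1 : ℕ) : ℝ) with hh
  have hmpos : (0 : ℝ) < ((m + 1 : ℕ) : ℝ) := by positivity
  have hhpos : 0 < h := by positivity
  have hmh : ((m + 1 : ℕ) : ℝ) * h = D := by rw [hh]; field_simp
  have hah : a * h ≤ 1 := by
    have := (lt_div_iff₀ ha).1 hm2
    linarith
  set w : ℕ → ℝ := fun i => Real.exp (-(a * (D - i * h))) with hw
  set x : ℕ → ℝ := fun i => ((j * (m + 1) + i : ℕ) : ℝ) * h with hx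
  have hx0 : x 0 = j * D := by
    simp only [hx]; push_cast; rw [add_zero, mul_assoc]; rw [← hmh]; push_cast; ring
  have hxi : ∀ i, x i = j * D + i * h := by
    intro i; simp only [hx]; rw [← hmh]; push_cast; ring
  have hxm : x (m + 1) = (j + 1 : ℕ) * D := by
    rw [hxi, hmh]; push_cast; ring
  have hxpos : ∀ i, 0 ≤ x i := fun i => by simp only [hx]; positivity
  have hwm : w (m + 1) = 1 := by simp only [hw]; rw [hmh]; simp
  have hw0 : w 0 = Real.exp (-(a * D)) := by simp [hw]
  have hws : ∀ i, w (i + 1) = w i * Real.exp (a * h) := by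
    intro i; simp only [hw]; rw [← Real.exp_add]; congr 1; push_cast; ring
  -- The weights w run from exp(-aD) to 1, so the innovation telescopes over the fine grid and can
  -- be compared with the stochastic sum term by term. No stochastic integral is needed: the
  -- integrated equation expresses noise increments through the path.
  have htel : u ((j + 1 : ℕ) * D) - Real.exp (-(a * D)) * u (j * D)
      = ∑ i ∈ Finset.range (m + 1), (w (i + 1) * u (x (i + 1)) - w i * u (x i)) := by
    rw [Finset.sum_range_sub (fun i => w i * u (x i)), hwm, hw0, hxm, hx0, one_mul]
  rw [htel, Real.dist_eq, ← Finset.sum_sub_distrib]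
  have hterm : ∀ i ∈ Finset.range (m + 1),
      |w i * (s * (β (Real.toNNReal (((j * (m + 1) + i + 1 : ℕ) : ℝ) * h))
        - β (Real.toNNReal (((j * (m + 1) + i : ℕ) : ℝ) * h))))
        - (w (i + 1) * u (x (i + 1)) - w i * u (x i))| ≤ a * (ε / (2 * a * D) * h) + U * (a * h) ^ 2 := by
    intro i hi
    have hi' : i + 1 ≤ m + 1 := Finset.mem_range.1 hi
    have hmem : ∀ k : ℕ, k ≤ m + 1 → x k ∈ Icc (j * D) ((j + 1 : ℕ) * D) := by
      intro k hk
      have hk' : (k : ℝ) ≤ ((m + 1 : ℕ) : ℝ) := by exact_mod_cast hk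
      rw [hxi]
      refine ⟨le_add_of_nonneg_right (by positivity), ?_⟩
      have : (k : ℝ) * h ≤ D := by rw [← hmh]; gcongr
      push_cast
      linarith
    have hwle : |w i| ≤ 1 := by
      simp only [hw]
      rw [abs_of_pos (Real.exp_pos _), Real.exp_le_one_iff]
      have hk' : (i : ℝ) ≤ ((m + 1 : ℕ) : ℝ) := by exact_mod_cast (Nat.le_of_succ_le hi')
      have : (i : ℝ) * h ≤ D := by rw [← hmh]; gcongr
      have := mul_nonneg ha.le (sub_nonneg.2 this)
      linarith
    have hxx : x (i + 1) = x i + h := by rw [hxi, hxi]; push_cast; ring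
    have e1 : s * (β (Real.toNNReal (((j * (m + 1) + i + 1 : ℕ) : ℝ) * h))
        - β (Real.toNNReal (((j * (m + 1) + i : ℕ) : ℝ) * h)))
        = u (x (i + 1)) - u (x i) + a * ∫ v in x i..x (i + 1), u v :=
      hincr (x i) (x (i + 1)) (hxpos _) (hxpos _)
    have e2 : ∫ v in x i..x (i + 1), u v
        = (∫ v in x i..x (i + 1), (u v - u (x (i + 1)))) + h * u (x (i + 1)) := by
      rw [intervalIntegral.integral_sub (hinteg _ _ (hxpos _) (hxpos _)) (by simp),
        intervalIntegral.integral_const, hxx]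
      simp
    have hb1 : |∫ v in x i..x (i + 1), (u v - u (x (i + 1)))| ≤ ε / (2 * a * D) * h := by
      have := intervalIntegral.norm_integral_le_of_norm_le_const (a := x i) (b := x (i + 1))
        (f := fun v => u v - u (x (i + 1))) (C := ε / (2 * a * D)) ?_
      · rwa [hxx, add_sub_cancel_left, abs_of_pos hhpos, ← hxx] at this
      · intro v hv
        rw [uIoc_of_le (by linarith)] at hv
        have hv' : v ∈ Icc (j * D) ((j + 1 : ℕ) * D) :=
          ⟨(hmem i (by omega)).1.trans hv.1.le, hv.2.trans (hmem (i + 1) hi').2⟩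
        rw [← dist_eq_norm]
        refine (hηu v hv' _ (hmem _ hi') ?_).le
        rw [Real.dist_eq, abs_lt]
        constructor <;> linarith [hv.1, hv.2]
    have hb2 : |Real.exp (a * h) - 1 - a * h| ≤ (a * h) ^ 2 :=
      Real.abs_exp_sub_one_sub_id_le (by rw [abs_of_pos (by positivity)]; exact hah)
    have e3 : w i * (s * (β (Real.toNNReal (((j * (m + 1) + i + 1 : ℕ) : ℝ) * h))
        - β (Real.toNNReal (((j * (m + 1) + i : ℕ) : ℝ) * h))))
        - (w (i + 1) * u (x (i + 1)) - w i * u (x i))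
        = w i * (a * (∫ v in x i..x (i + 1), (u v - u (x (i + 1))))
          - u (x (i + 1)) * (Real.exp (a * h) - 1 - a * h)) := by
      rw [e1, e2, hws]; ring
    rw [e3, abs_mul]
    have hUi : |u (x (i + 1))| ≤ U := hU _ (hmem _ hi')
    calc |w i| * |a * (∫ v in x i..x (i + 1), (u v - u (x (i + 1))))
          - u (x (i + 1)) * (Real.exp (a * h) - 1 - a * h)|
        ≤ 1 * (|a * (∫ v in x i..x (i + 1), (u v - u (x (i + 1))))|
          + |u (x (i + 1)) * (Real.exp (a * h) - 1 - a * h)|) := by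
          gcongr; exact abs_sub _ _
      _ ≤ _ := by
          rw [one_mul, abs_mul, abs_mul, abs_of_pos ha]
          gcongr
  calc |∑ i ∈ Finset.range (m + 1), (_ - _)| ≤ ∑ i ∈ Finset.range (m + 1), |_| :=
        Finset.abs_sum_le_sum_abs _ _
    _ ≤ ∑ _i ∈ Finset.range (m + 1), (a * (ε / (2 * a * D) * h) + U * (a * h) ^ 2) :=
        Finset.sum_le_sum hterm
    _ = ε / 2 + U * a ^ 2 * D * h := by
        rw [Finset.sum_const, Finset.card_range, nsmul_eq_mul]
        calc ((m + 1 : ℕ) : ℝ) * (a * (ε / (2 * a * D) * h) + U * (a * h) ^ 2)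
            = (((m + 1 : ℕ) : ℝ) * h) * (a * (ε / (2 * a * D)) + U * a ^ 2 * h) := by ring
          _ = _ := by rw [hmh]; field_simp
    _ < ε := by linarith

end Path


/-! ### Growth of the eigenvalues -/

section Eigenvalues

/-- If Γ is negative, then Γ ≥ Γℓ² for ℓ ≥ 1, so ϑ₂(π² + min(Γ,0)) serves as constant. It is
positive exactly because of Γ + π² > 0. -/
lemma Params.Admissible.exists_eigenvalue_ge {p : Params} (hp : p.Admissible) :
    ∃ c : ℝ, 0 < c ∧ ∀ l : ℕ, c * ((l : ℝ) + 1) ^ 2 ≤ p.eigenvalue (l + 1) := by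
  have h1 := hp.spectrum_neg
  have h2 := hp.theta2_pos
  refine ⟨p.theta2 * (Real.pi ^ 2 + min p.Gamma 0), ?_, fun l => ?_⟩
  · refine mul_pos h2 ?_
    rcases min_cases p.Gamma 0 with h | h <;> rw [h.1]
    · linarith
    · positivity
  · have hl : (1 : ℝ) ≤ ((l : ℝ) + 1) ^ 2 := one_le_pow₀ (by linarith [(Nat.cast_nonneg l : (0 : ℝ) ≤ l)])
    have h3 : min p.Gamma 0 * ((l : ℝ) + 1) ^ 2 ≤ p.Gamma :=
      (by nlinarith [min_le_right p.Gamma 0] : _ ≤ min p.Gamma 0 * 1).trans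
        (by rw [mul_one]; exact min_le_left _ _)
    rw [Params.eigenvalue, mul_assoc]
    push_cast
    gcongr
    linarith

lemma Params.Admissible.eigenvalue_pos {p : Params} (hp : p.Admissible) (l : ℕ) :
    0 < p.eigenvalue (l + 1) := by
  obtain ⟨c, hc, h⟩ := hp.exists_eigenvalue_ge
  exact (by positivity : 0 < c * ((l : ℝ) + 1) ^ 2).trans_le (h l)

lemma Params.Admissible.summable_inv_eigenvalue {p : Params} (hp : p.Admissible) :
    Summable fun l : ℕ => (p.eigenvalue (l + 1))⁻¹ := by
  obtain ⟨c, hc, h⟩ := hp.exists_eigenvalue_ge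
  have hs : Summable fun l : ℕ => c⁻¹ * (((l + 1 : ℕ) : ℝ) ^ 2)⁻¹ :=
    ((summable_nat_add_iff 1).2 (Real.summable_nat_pow_inv.2 (by norm_num : 1 < 2))).mul_left _
  refine Summable.of_nonneg_of_le (fun l => (inv_pos.2 (hp.eigenvalue_pos l)).le) (fun l => ?_) hs
  rw [← mul_inv]
  refine inv_anti₀ (by positivity) ?_
  push_cast
  exact h l

/-- The stationary variance of a mode. -/
noncomputable def Params.modeVar (p : Params) (l : ℕ) : ℝ := p.sigmaSq / (2 * p.eigenvalue (l + 1))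

/-- The autocorrelation of a mode at lag `D`. -/
noncomputable def Params.modeCorr (p : Params) (D : ℝ) (l : ℕ) : ℝ :=
  Real.exp (-(p.eigenvalue (l + 1) * D))

end Eigenvalues

/-! ### Gaussian law of the modes and of the field -/

section Modes

variable {Ω : Type*} [MeasurableSpace Ω]

lemma expI_brownian_increments {P : Measure Ω} [IsProbabilityMeasure P] {β : ℝ≥0 → Ω → ℝ}
    (hβ : IsPreBrownianReal β P) {h : ℝ} (hh : 0 ≤ h) (d : ℕ → ℝ) (R : ℕ) :
    expI P (fun ω => ∑ r ∈ Finset.range R, d r * (β (Real.toNNReal ((r + 1 : ℕ) * h)) ω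
      - β (Real.toNNReal (r * h)) ω))
      = Complex.exp ((-(∑ r ∈ Finset.range R, d r ^ 2 * h) / 2 : ℝ)) := by
  have hind := hβ.hasIndepIncrements R (fun i => Real.toNNReal ((i : ℕ) * h))
    (fun i j hij => Real.toNNReal_le_toNNReal (by gcongr; exact_mod_cast hij))
  have hind2 := hind.comp (fun i x => d i * x) (fun i => by fun_prop)
  have hmeas := hβ.aemeasurable
  have key := expI_sum (P := P) (fun i => ?_) hind2
  · have e1 : (fun ω => ∑ r ∈ Finset.range R, d r * (β (Real.toNNReal ((r + 1 : ℕ) * h)) ω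
        - β (Real.toNNReal (r * h)) ω)) = fun ω => ∑ i : Fin R, ((fun x => d i * x) ∘
          fun ω => β (Real.toNNReal ((i.succ : ℕ) * h)) ω
            - β (Real.toNNReal ((i.castSucc : ℕ) * h)) ω) ω := by
      funext ω
      rw [Finset.sum_range]
      simp
    rw [e1]
    refine key.trans ?_
    have e2 : ∀ i : Fin R, expI P ((fun x => d i * x) ∘
          fun ω => β (Real.toNNReal ((i.succ : ℕ) * h)) ω
            - β (Real.toNNReal ((i.castSucc : ℕ) * h)) ω)
          = Complex.exp ((-(d i ^ 2 * h / 2) : ℝ)) := by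
      intro i
      have hl := hβ.hasLaw_sub (Real.toNNReal ((i.succ : ℕ) * h))
        (Real.toNNReal ((i.castSucc : ℕ) * h))
      have := expI_const_mul_of_hasLaw hl (d i)
      refine this.trans ?_
      congr 3
      have h1 : (0 : ℝ) ≤ (i.succ : ℕ) * h := by positivity
      have h2 : (0 : ℝ) ≤ (i.castSucc : ℕ) * h := by positivity
      rw [coe_nndist]
      simp only [NNReal.val_eq_coe]
      rw [Real.coe_toNNReal _ h1, Real.coe_toNNReal _ h2, Real.dist_eq]
      simp only [Fin.val_succ, Fin.val_castSucc]
      rw [← sub_mul]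
      push_cast
      rw [add_sub_cancel_left, one_mul, abs_of_nonneg hh]
    rw [Finset.prod_congr rfl fun i _ => e2 i, ← Complex.exp_sum, ← Complex.ofReal_sum]
    congr 2
    rw [Finset.sum_range, ← Finset.sum_neg_distrib, Finset.sum_div]
    exact Finset.sum_congr rfl fun i _ => by ring
  · exact ((hmeas _).sub (hmeas _)).const_mul _

/-- A discretized linear functional of the initial value `x.1` and the innovations of the mode driven
by the path `x.2`. -/
noncomputable def approxMode (a s D c : ℝ) (d : ℕ → ℝ) (J m : ℕ) (x : ℝ × (ℝ≥0 → ℝ)) : ℝ :=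
  c * x.1 + ∑ j ∈ Finset.range J, d j * ∑ i ∈ Finset.range (m + 1),
      Real.exp (-(a * (D - i * (D / (m + 1 : ℕ))))) *
        (s * (x.2 (Real.toNNReal (((j * (m + 1) + i + 1 : ℕ) : ℝ) * (D / (m + 1 : ℕ))))
          - x.2 (Real.toNNReal (((j * (m + 1) + i : ℕ) : ℝ) * (D / (m + 1 : ℕ))))))

lemma measurable_approxMode (a s D c : ℝ) (d : ℕ → ℝ) (J m : ℕ) :
    Measurable (approxMode a s D c d J m) := by
  unfold approxMode
  have h : ∀ t : ℝ≥0, Measurable fun x : ℝ × (ℝ≥0 → ℝ) => x.2 t :=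
    fun t => (measurable_pi_apply t).comp measurable_snd
  refine (measurable_fst.const_mul _).add ?_
  refine Finset.measurable_sum _ fun j _ => Measurable.const_mul ?_ _
  refine Finset.measurable_sum _ fun i _ => Measurable.const_mul ?_ _
  exact ((h _).sub (h _)).const_mul _

lemma sum_range_mul_eq {M : Type*} [AddCommMonoid M] (F : ℕ → M) (J m : ℕ) :
    ∑ r ∈ Finset.range (J * m), F r
      = ∑ j ∈ Finset.range J, ∑ i ∈ Finset.range m, F (j * m + i) := by
  induction J with
  | zero => simp
  | succ J ih => rw [Nat.succ_mul, Finset.sum_range_add, ih, Finset.sum_range_succ]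

/-- The initial value is independent of the noise path, so the expectation factors. The blocks j and
substeps i are merged into one index r = j(m+1) + i, recovered by division with remainder, and
independence of Brownian increments applies to the single sum over r. -/
lemma expI_approxMode {P : Measure Ω} [IsProbabilityMeasure P] {β : ℝ≥0 → Ω → ℝ} {x : Ω → ℝ}
    (hβm : ∀ t, Measurable (β t)) (hxm : Measurable x)
    (hβ : IsPreBrownianReal β P) {v : ℝ≥0} (hx : HasLaw x (gaussianReal 0 v) P)
    (hind : IndepFun x (fun ω t => β t ω) P)
    {a s D c : ℝ} (hD : 0 ≤ D) (d : ℕ → ℝ) (J m : ℕ) :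
    expI P (fun ω => approxMode a s D c d J m (x ω, fun t => β t ω))
      = Complex.exp ((-(c ^ 2 * v + ∑ j ∈ Finset.range J, d j ^ 2 * (s ^ 2 *
        ∑ i ∈ Finset.range (m + 1), Real.exp (-(2 * a * (D - i * (D / (m + 1 : ℕ)))))
          * (D / (m + 1 : ℕ)))) / 2 : ℝ)) := by
  set h : ℝ := D / (m + 1 : ℕ) with hh
  have hh0 : 0 ≤ h := by positivity
  set δ : ℕ → ℝ := fun r => d (r / (m + 1)) * (Real.exp (-(a * (D - (r % (m + 1) : ℕ) * h))) * s)
  have hdiv : ∀ j i : ℕ, i < m + 1 → (j * (m + 1) + i) / (m + 1) = j := by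
    intro j i hi
    rw [Nat.add_comm, Nat.add_mul_div_right _ _ (Nat.succ_pos m), Nat.div_eq_of_lt hi, zero_add]
  have hmod : ∀ j i : ℕ, i < m + 1 → (j * (m + 1) + i) % (m + 1) = i := by
    intro j i hi
    rw [Nat.add_comm, Nat.add_mul_mod_self_right, Nat.mod_eq_of_lt hi]
  set f : (ℝ≥0 → ℝ) → ℝ := fun b => approxMode a s D 0 d J m (0, b) with hf
  have hfm : Measurable f := (measurable_approxMode a s D 0 d J m).comp (by fun_prop)
  have hpath : Measurable fun ω => (fun t => β t ω) := measurable_pi_lambda _ hβm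
  have e1 : (fun ω => approxMode a s D c d J m (x ω, fun t => β t ω))
      = fun ω => c * x ω + f (fun t => β t ω) := by
    funext ω
    simp [hf, approxMode]
  have e2 : (fun ω => f (fun t => β t ω)) = fun ω => ∑ r ∈ Finset.range (J * (m + 1)), δ r *
      (β (Real.toNNReal ((r + 1 : ℕ) * h)) ω - β (Real.toNNReal (r * h)) ω) := by
    funext ω
    rw [sum_range_mul_eq]
    simp only [hf, approxMode, zero_mul, zero_add]
    refine Finset.sum_congr rfl fun j _ => ?_
    rw [Finset.mul_sum]
    refine Finset.sum_congr rfl fun i hi => ?_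
    have hi' := Finset.mem_range.1 hi
    simp only [δ, hdiv j i hi', hmod j i hi', ← hh]
    ring
  rw [e1, expI_add (Y := fun ω => c * x ω) (Z := fun ω => f (fun t => β t ω)) (by fun_prop)
    (hfm.comp hpath).aemeasurable (hind.comp (measurable_const_mul c) hfm), expI_const_mul_of_hasLaw hx, e2,
    expI_brownian_increments hβ hh0, ← Complex.exp_add, ← Complex.ofReal_add]
  congr 2
  rw [sum_range_mul_eq]
  have e3 : ∀ j ∈ Finset.range J, ∑ i ∈ Finset.range (m + 1), δ (j * (m + 1) + i) ^ 2 * h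
      = d j ^ 2 * (s ^ 2 *
        ∑ i ∈ Finset.range (m + 1), Real.exp (-(2 * a * (D - i * h))) * h) := by
    intro j _
    rw [Finset.mul_sum, Finset.mul_sum]
    refine Finset.sum_congr rfl fun i hi => ?_
    have hi' := Finset.mem_range.1 hi
    simp only [δ, hdiv j i hi', hmod j i hi']
    rw [show -(2 * a * (D - i * h)) = -(a * (D - i * h)) + -(a * (D - i * h)) by ring, Real.exp_add]
    ring
  rw [Finset.sum_congr rfl e3]
  ring

/-- These are Riemann sums for the integral of exp(-2a(D-v)) over [0,D], the variance of a
stochastic convolution. They are geometric series, which reduces the limit to (exp x - 1)/x → 1. -/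
lemma tendsto_geom_exp {a D : ℝ} (ha : 0 < a) (hD : 0 < D) :
    Tendsto (fun m : ℕ => ∑ i ∈ Finset.range (m + 1),
      Real.exp (-(2 * a * (D - i * (D / (m + 1 : ℕ))))) * (D / (m + 1 : ℕ))) atTop
      (𝓝 ((1 - Real.exp (-(a * D)) ^ 2) / (2 * a))) := by
  have hlim : Tendsto (fun m : ℕ => 2 * a * (D / ((m + 1 : ℕ) : ℝ))) atTop (𝓝[≠] 0) := by
    refine tendsto_nhdsWithin_iff.2 ⟨?_, Eventually.of_forall fun m => ?_⟩
    · simpa using ((tendsto_const_div_atTop_nhds_zero_nat D).comp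
        (tendsto_add_atTop_nat 1)).const_mul (2 * a)
    · have : (0 : ℝ) < 2 * a * (D / ((m + 1 : ℕ) : ℝ)) := by positivity
      exact this.ne'
  have hexp : Tendsto (fun x : ℝ => (Real.exp x - 1) / x) (𝓝[≠] 0) (𝓝 1) := by
    have := (Real.hasDerivAt_exp 0).tendsto_slope
    rw [Real.exp_zero] at this
    refine this.congr fun x => ?_
    rw [slope_def_field, Real.exp_zero, sub_zero]
  have h1 := ((hexp.comp hlim).inv₀ one_ne_zero).mul_const ((1 - Real.exp (-(a * D)) ^ 2) / (2 * a))
  rw [inv_one, one_mul] at h1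
  refine h1.congr fun m => ?_
  set h : ℝ := D / ((m + 1 : ℕ) : ℝ) with hh
  have hhpos : 0 < h := by positivity
  have hmh : ((m + 1 : ℕ) : ℝ) * h = D := by rw [hh]; field_simp
  have hne : Real.exp (2 * a * h) ≠ 1 := by
    have : (1 : ℝ) < Real.exp (2 * a * h) := Real.one_lt_exp_iff.2 (by positivity)
    exact this.ne'
  have e : ∀ i : ℕ, Real.exp (-(2 * a * (D - i * h))) * h
      = Real.exp (-(a * D)) ^ 2 * h * Real.exp (2 * a * h) ^ i := by
    intro i
    rw [← Real.exp_nat_mul, ← Real.exp_nat_mul, mul_right_comm (Real.exp _) h, ← Real.exp_add]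
    congr 2
    push_cast
    ring
  simp only [Function.comp_apply]
  rw [Finset.sum_congr rfl fun i _ => e i, ← Finset.mul_sum, geom_sum_eq hne,
    ← Real.exp_nat_mul (2 * a * h), show ((m + 1 : ℕ) : ℝ) * (2 * a * h) = (a * D) + (a * D) by
      rw [← hmh]; ring, Real.exp_add, Real.exp_neg, ← hh]
  have h3 : Real.exp (2 * a * h) - 1 ≠ 0 := sub_ne_zero.2 hne
  have h4 := (Real.exp_pos (a * D)).ne'
  field_simp

variable {p : Params} {β : ℕ → ℝ≥0 → Ω → ℝ} {u : ℕ → ℝ → Ω → ℝ} {P : Measure Ω}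
  [IsProbabilityMeasure P]

/-- The initial values and the innovations of the modes are independent Gaussian variables. -/
lemma IsModeSequence.expI_innovations (hp : p.Admissible) (h : IsModeSequence p β u P) {D : ℝ}
    (hD : 0 < D) (L J : ℕ) (c : ℕ → ℝ) (d : ℕ → ℕ → ℝ) :
    expI P (fun ω => ∑ l ∈ Finset.range L, (c l * u l 0 ω + ∑ j ∈ Finset.range J, d l j *
      (u l ((j + 1 : ℕ) * D) ω - p.modeCorr D l * u l (j * D) ω)))
    = Complex.exp ((-(∑ l ∈ Finset.range L, (c l ^ 2 * p.modeVar l + ∑ j ∈ Finset.range J,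
      d l j ^ 2 * (p.modeVar l * (1 - p.modeCorr D l ^ 2)))) / 2 : ℝ)) := by
  have hs := hp.sigmaSq_pos
  set s := Real.sqrt p.sigmaSq with hsdef
  have hs2 : s ^ 2 = p.sigmaSq := Real.sq_sqrt hs.le
  set W : ℕ → ℕ → Ω → ℝ := fun m l ω => approxMode (p.eigenvalue (l + 1)) s D (c l) (d l) J m
    (u l 0 ω, fun t => β l t ω) with hW
  have hWm : ∀ m l, Measurable (W m l) := fun m l => by
    refine (measurable_approxMode _ _ _ _ _ _ _).comp ?_
    exact (h.measurable_mode l 0).prodMk (measurable_pi_lambda _ (h.measurable_noise l))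
  have hlim1 : Tendsto (fun m => expI P (fun ω => ∑ l ∈ Finset.range L, W m l ω)) atTop
      (𝓝 (expI P (fun ω => ∑ l ∈ Finset.range L, (c l * u l 0 ω + ∑ j ∈ Finset.range J, d l j *
      (u l ((j + 1 : ℕ) * D) ω - p.modeCorr D l * u l (j * D) ω))))) := by
    refine tendsto_expI (fun m => (Finset.measurable_sum _ fun l _ => hWm m l).aemeasurable) ?_
    filter_upwards [ae_all_iff.2 h.ornsteinUhlenbeck] with ω hω
    refine tendsto_finsetSum _ fun l _ => ?_
    refine Tendsto.add tendsto_const_nhds (tendsto_finsetSum _ fun j _ => ?_)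
    refine Tendsto.const_mul _ ?_
    exact tendsto_innovation (hp.eigenvalue_pos l) hD (hω l).1 (hω l).2 j
  have hprod : ∀ m, expI P (fun ω => ∑ l ∈ Finset.range L, W m l ω)
      = ∏ l ∈ Finset.range L, expI P (W m l) := by
    intro m
    have hind : iIndepFun (fun l : Fin L => W m l) P := by
      have := h.indep_modes.comp (fun l => approxMode (p.eigenvalue (l + 1)) s D (c l) (d l) J m)
        (fun l => measurable_approxMode _ _ _ _ _ _ _)
      exact this.precomp Fin.val_injective
    have := expI_sum (fun l : Fin L => (hWm m l).aemeasurable) hind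
    rw [Finset.prod_range, ← this]
    congr 1
    funext ω
    rw [Finset.sum_range]
  -- The characteristic functions of the discretized functionals converge to the one in question by
  -- pathwise convergence. They are also explicit, so their limit can be computed a second time.
  refine tendsto_nhds_unique hlim1 ?_
  have hval : ∀ m l, expI P (W m l) = _ := fun m l =>
    expI_approxMode (h.measurable_noise l) (h.measurable_mode l 0) (h.brownian l).toIsPreBrownianReal
      (h.initial_law l) (h.indep_initial l) hD.le (d l) J m
  simp only [hprod, hval, ← Complex.exp_sum, ← Complex.ofReal_sum]
  have hc : Continuous fun x : ℝ => Complex.exp (x : ℂ) := by fun_prop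
  refine (hc.tendsto _).comp ?_
  rw [neg_div, Finset.sum_div, ← Finset.sum_neg_distrib]
  refine tendsto_finsetSum _ fun l _ => ?_
  rw [← neg_div]
  refine Tendsto.div_const (Tendsto.neg (Tendsto.add ?_ (tendsto_finsetSum _ fun j _ => ?_))) _
  · rw [Real.coe_toNNReal _ (by have := hp.eigenvalue_pos l; positivity)]
    exact tendsto_const_nhds
  · refine Tendsto.const_mul _ ?_
    have := (tendsto_geom_exp (hp.eigenvalue_pos l) hD).const_mul (s ^ 2)
    convert this using 2
    rw [hs2, Params.modeVar, Params.modeCorr]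
    have := (hp.eigenvalue_pos l).ne'
    field_simp

lemma sum_range_succ_quad (c : ℕ → ℝ) (K : ℕ → ℕ → ℝ) (hK : ∀ i j, K i j = K j i) (n : ℕ) :
    ∑ i ∈ Finset.range (n + 1), ∑ j ∈ Finset.range (n + 1), c i * c j * K i j
      = ∑ i ∈ Finset.range n, ∑ j ∈ Finset.range n, c i * c j * K i j
        + 2 * c n * ∑ i ∈ Finset.range n, c i * K i n + c n ^ 2 * K n n := by
  rw [Finset.sum_range_succ]
  simp only [Finset.sum_range_succ, Finset.sum_add_distrib]
  have h1 : ∑ i ∈ Finset.range n, c i * c n * K i n = c n * ∑ i ∈ Finset.range n, c i * K i n := by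
    rw [Finset.mul_sum]; exact Finset.sum_congr rfl fun i _ => by ring
  have h2 : ∑ i ∈ Finset.range n, c n * c i * K n i = c n * ∑ i ∈ Finset.range n, c i * K i n := by
    rw [Finset.mul_sum]; exact Finset.sum_congr rfl fun i _ => by rw [hK n i]; ring
  rw [h1, h2]
  ring

/-- The quadratic form is the variance of ∑ c_i u_i for a stationary autoregression with correlation
q. Substituting u_{n+1} = q u_n + innovation changes the coefficient of u_n to c_n + q c_{n+1} and
splits off an independent term of variance v(1 - q²). -/
lemma ar_quad_step (c : ℕ → ℝ) (q v : ℝ) (n : ℕ) :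
    ∑ i ∈ Finset.range (n + 2), ∑ j ∈ Finset.range (n + 2),
        c i * c j * (v * q ^ ((i : ℤ) - j).natAbs)
      = ∑ i ∈ Finset.range (n + 1), ∑ j ∈ Finset.range (n + 1),
        (Function.update c n (c n + q * c (n + 1))) i * (Function.update c n (c n + q * c (n + 1))) j
          * (v * q ^ ((i : ℤ) - j).natAbs) + c (n + 1) ^ 2 * (v * (1 - q ^ 2)) := by
  have hK : ∀ i j : ℕ, v * q ^ ((i : ℤ) - j).natAbs = v * q ^ ((j : ℤ) - i).natAbs := by
    intro i j; rw [← Int.natAbs_neg, neg_sub]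
  rw [sum_range_succ_quad _ _ hK, sum_range_succ_quad c _ hK, sum_range_succ_quad _ _ hK]
  have hu : ∀ i ∈ Finset.range n, Function.update c n (c n + q * c (n + 1)) i = c i :=
    fun i hi => Function.update_of_ne (Finset.mem_range.1 hi).ne _ _
  have e1 : ∑ i ∈ Finset.range n, ∑ j ∈ Finset.range n,
        (Function.update c n (c n + q * c (n + 1))) i * (Function.update c n (c n + q * c (n + 1))) j
          * (v * q ^ ((i : ℤ) - j).natAbs) = ∑ i ∈ Finset.range n, ∑ j ∈ Finset.range n,
        c i * c j * (v * q ^ ((i : ℤ) - j).natAbs) :=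
    Finset.sum_congr rfl fun i hi => Finset.sum_congr rfl fun j hj => by rw [hu i hi, hu j hj]
  have e2 : ∑ i ∈ Finset.range n, Function.update c n (c n + q * c (n + 1)) i
      * (v * q ^ ((i : ℤ) - n).natAbs) = ∑ i ∈ Finset.range n, c i * (v * q ^ ((i : ℤ) - n).natAbs) :=
    Finset.sum_congr rfl fun i hi => by rw [hu i hi]
  have e3 : ∑ i ∈ Finset.range (n + 1), c i * (v * q ^ ((i : ℤ) - (n + 1 : ℕ)).natAbs)
      = q * (∑ i ∈ Finset.range n, c i * (v * q ^ ((i : ℤ) - n).natAbs)) + q * c n * v := by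
    rw [Finset.sum_range_succ, Finset.mul_sum]
    congr 1
    · refine Finset.sum_congr rfl fun i hi => ?_
      have := Finset.mem_range.1 hi
      rw [show ((i : ℤ) - (n + 1 : ℕ)).natAbs = ((i : ℤ) - n).natAbs + 1 by omega, pow_succ]
      ring
    · rw [show ((n : ℤ) - (n + 1 : ℕ)).natAbs = 1 by omega]
      ring
  rw [e1, e2, e3, Function.update_self]
  simp only [sub_self, Int.natAbs_zero, pow_zero]
  ring

/-- The finite-dimensional distributions of the modes on an equidistant time grid. -/
lemma IsModeSequence.expI_modes (hp : p.Admissible) (h : IsModeSequence p β u P) {D : ℝ}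
    (hD : 0 < D) (L J n : ℕ) (hn : n ≤ J) (c d : ℕ → ℕ → ℝ) :
    expI P (fun ω => ∑ l ∈ Finset.range L, (∑ i ∈ Finset.range (n + 1), c l i * u l (i * D) ω
      + ∑ j ∈ Finset.Ico n J, d l j *
      (u l ((j + 1 : ℕ) * D) ω - p.modeCorr D l * u l (j * D) ω)))
    = Complex.exp ((-(∑ l ∈ Finset.range L, (∑ i ∈ Finset.range (n + 1),
      ∑ i' ∈ Finset.range (n + 1), c l i * c l i' *
        (p.modeVar l * p.modeCorr D l ^ ((i : ℤ) - i').natAbs) + ∑ j ∈ Finset.Ico n J,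
      d l j ^ 2 * (p.modeVar l * (1 - p.modeCorr D l ^ 2)))) / 2 : ℝ)) := by
  -- The induction trades innovations for values. At n = 0 the functional involves initial values
  -- and innovations only. In the step, the value at n + 1 is written as a multiple of the value at
  -- n plus the n-th innovation, and `ar_quad_step` matches the variances.
  induction n generalizing c d with
  | zero =>
    have := h.expI_innovations hp hD L J (fun l => c l 0) d
    simpa [pow_two] using this
  | succ n ih =>
    have h2 := ih (by omega) (fun l => Function.update (c l) n (c l n + p.modeCorr D l * c l (n + 1)))
      (fun l => Function.update (d l) n (c l (n + 1)))
    have hico : ∀ F : ℕ → ℝ, ∑ j ∈ Finset.Ico n J, F j = F n + ∑ j ∈ Finset.Ico (n + 1) J, F j :=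
      fun F => Finset.sum_eq_sum_Ico_succ_bot (by omega) F
    convert h2 using 1
    · congr 1
      funext ω
      refine Finset.sum_congr rfl fun l _ => ?_
      rw [hico, Function.update_self, Finset.sum_range_succ, Finset.sum_range_succ,
        Finset.sum_range_succ _ n, Function.update_self]
      have e1 : ∑ i ∈ Finset.range n, Function.update (c l) n (c l n + p.modeCorr D l * c l (n + 1)) i
          * u l (i * D) ω = ∑ i ∈ Finset.range n, c l i * u l (i * D) ω :=
        Finset.sum_congr rfl fun i hi => by
          rw [Function.update_of_ne (Finset.mem_range.1 hi).ne]
      have e2 : ∑ j ∈ Finset.Ico (n + 1) J, Function.update (d l) n (c l (n + 1)) j *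
          (u l ((j + 1 : ℕ) * D) ω - p.modeCorr D l * u l (j * D) ω)
          = ∑ j ∈ Finset.Ico (n + 1) J, d l j *
          (u l ((j + 1 : ℕ) * D) ω - p.modeCorr D l * u l (j * D) ω) :=
        Finset.sum_congr rfl fun j hj => by
          rw [Function.update_of_ne (by have := (Finset.mem_Ico.1 hj).1; omega)]
      rw [e1, e2]
      ring
    · congr 3
      congr 1
      refine Finset.sum_congr rfl fun l _ => ?_
      rw [hico, Function.update_self, ar_quad_step]
      have e2 : ∑ j ∈ Finset.Ico (n + 1) J, Function.update (d l) n (c l (n + 1)) j ^ 2 *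
          (p.modeVar l * (1 - p.modeCorr D l ^ 2))
          = ∑ j ∈ Finset.Ico (n + 1) J, d l j ^ 2 * (p.modeVar l * (1 - p.modeCorr D l ^ 2)) :=
        Finset.sum_congr rfl fun j hj => by
          rw [Function.update_of_ne (by have := (Finset.mem_Ico.1 hj).1; omega)]
      rw [e2]
      ring

/-- The covariance of `X_{iD}(x)` and `X_{jD}(y)` where `n = i - j`. -/
noncomputable def fieldCov (p : Params) (D : ℝ) (n : ℤ) (x y : ℝ) : ℝ :=
  ∑' l : ℕ, p.modeVar l * p.modeCorr D l ^ n.natAbs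
    * (p.eigenfunction (l + 1) x * p.eigenfunction (l + 1) y)

lemma abs_eigenfunction_le (p : Params) {x : ℝ} (hx : x ∈ Icc (0 : ℝ) 1) (l : ℕ) :
    |p.eigenfunction l x| ≤ Real.sqrt 2 * Real.exp |p.kappa| := by
  rw [Params.eigenfunction, abs_mul, abs_mul, abs_of_nonneg (Real.sqrt_nonneg 2),
    abs_of_pos (Real.exp_pos _)]
  have h1 : Real.exp (-(p.kappa * x / 2)) ≤ Real.exp |p.kappa| := by
    rw [Real.exp_le_exp]
    have h2 : |p.kappa * x| ≤ |p.kappa| := by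
      rw [abs_mul, abs_of_nonneg hx.1]
      exact mul_le_of_le_one_right (abs_nonneg _) hx.2
    have := neg_abs_le (p.kappa * x)
    have := abs_nonneg p.kappa
    linarith
  calc Real.sqrt 2 * |Real.sin (Real.pi * l * x)| * Real.exp (-(p.kappa * x / 2))
      ≤ Real.sqrt 2 * 1 * Real.exp |p.kappa| := by
        gcongr
        exact Real.abs_sin_le_one _
    _ = _ := by ring

lemma Params.modeVar_nonneg (hp : p.Admissible) (l : ℕ) : 0 ≤ p.modeVar l := by
  have := hp.eigenvalue_pos l
  have := hp.sigmaSq_pos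
  unfold Params.modeVar
  positivity

lemma Params.modeCorr_mem (hp : p.Admissible) {D : ℝ} (hD : 0 ≤ D) (l : ℕ) :
    p.modeCorr D l ∈ Icc (0 : ℝ) 1 := by
  refine ⟨(Real.exp_pos _).le, ?_⟩
  have := hp.eigenvalue_pos l
  rw [Params.modeCorr, Real.exp_le_one_iff]
  have := mul_nonneg this.le hD
  linarith

lemma summable_modeVar (hp : p.Admissible) : Summable p.modeVar := by
  refine (hp.summable_inv_eigenvalue.mul_left (p.sigmaSq / 2)).congr fun l => ?_
  rw [Params.modeVar]
  have := (hp.eigenvalue_pos l).ne'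
  field_simp

lemma summable_fieldCov (hp : p.Admissible) {D : ℝ} (hD : 0 ≤ D) (n : ℤ) {x y : ℝ}
    (hx : x ∈ Icc (0 : ℝ) 1) (hy : y ∈ Icc (0 : ℝ) 1) :
    Summable fun l : ℕ => p.modeVar l * p.modeCorr D l ^ n.natAbs
      * (p.eigenfunction (l + 1) x * p.eigenfunction (l + 1) y) := by
  refine Summable.of_norm_bounded ((summable_modeVar hp).mul_right
    ((Real.sqrt 2 * Real.exp |p.kappa|) * (Real.sqrt 2 * Real.exp |p.kappa|))) fun l => ?_
  have h1 := Params.modeVar_nonneg hp l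
  have h2 := Params.modeCorr_mem hp hD l
  rw [norm_mul, norm_mul, norm_mul, norm_pow, Real.norm_of_nonneg h1, Real.norm_of_nonneg h2.1]
  have h3 := abs_eigenfunction_le p hx (l + 1)
  have h4 := abs_eigenfunction_le p hy (l + 1)
  rw [← Real.norm_eq_abs] at h3 h4
  have h5 : p.modeCorr D l ^ n.natAbs ≤ 1 := pow_le_one₀ h2.1 h2.2
  calc p.modeVar l * p.modeCorr D l ^ n.natAbs
      * (‖p.eigenfunction (l + 1) x‖ * ‖p.eigenfunction (l + 1) y‖)
      ≤ p.modeVar l * 1 * ((Real.sqrt 2 * Real.exp |p.kappa|) * (Real.sqrt 2 * Real.exp |p.kappa|)) := by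
        gcongr
    _ = _ := by rw [mul_one]

/-- Linear functionals of the solution field, observed on an equidistant time grid, are centred
Gaussian. -/
lemma expI_field (hp : p.Admissible) {X : ℝ → ℝ → Ω → ℝ} (hX : IsStationarySolution p X P) {D : ℝ}
    (hD : 0 < D) {ι : Type*} [Fintype ι] (t : ι → ℕ) (x : ι → ℝ) (hx : ∀ j, x j ∈ Icc (0 : ℝ) 1)
    (a : ι → ℝ) :
    expI P (fun ω => ∑ j, a j * X (t j * D) (x j) ω)
      = Complex.exp ((-(∑ j, ∑ j', a j * a j' * fieldCov p D ((t j : ℤ) - t j') (x j) (x j')) / 2 : ℝ))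
      := by
  obtain ⟨β, u, h, hXu⟩ := hX
  set e : ℕ → ι → ℝ := fun l j => p.eigenfunction (l + 1) (x j) with he
  have htD : ∀ j, 0 ≤ (t j : ℝ) * D := fun j => by positivity
  set Y : ℕ → Ω → ℝ := fun L ω => ∑ l ∈ Finset.range L, ∑ j, a j * e l j * u l (t j * D) ω with hY
  have hYm : ∀ L, AEMeasurable (Y L) P := fun L =>
    (Finset.measurable_sum _ fun l _ => Finset.measurable_sum _ fun j _ =>
      (h.measurable_mode l _).const_mul _).aemeasurable
  have hXm : ∀ j, AEMeasurable (X (t j * D) (x j)) P := fun j => (hXu _ (htD j) _ (hx j)).1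
  have hlim1 : Tendsto (fun L => expI P (Y L)) atTop
      (𝓝 (expI P (fun ω => ∑ j, a j * X (t j * D) (x j) ω))) := by
    refine tendsto_expI_of_eLpNorm hYm (by fun_prop) ?_
    set E : ℕ → ι → Ω → ℝ := fun L j ω =>
      X (t j * D) (x j) ω - ∑ l ∈ Finset.range L, u l (t j * D) ω * e l j with hE
    have hdiff : ∀ L, (fun ω => ∑ j, a j * X (t j * D) (x j) ω - Y L ω)
        = ∑ j, a j • E L j := by
      intro L
      funext ω
      simp only [hY, hE, Finset.sum_apply, Pi.smul_apply, smul_eq_mul]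
      rw [Finset.sum_comm, ← Finset.sum_sub_distrib]
      refine Finset.sum_congr rfl fun j _ => ?_
      rw [mul_sub, Finset.mul_sum]
      congr 1
      exact Finset.sum_congr rfl fun l _ => by ring
    have hEm : ∀ L j, AEStronglyMeasurable (E L j) P := fun L j =>
      ((hXm j).sub (Finset.measurable_sum _ fun l _ =>
        (h.measurable_mode l _).mul_const _).aemeasurable).aestronglyMeasurable
    have hb : Tendsto (fun L => ∑ j, ‖a j‖ₑ * eLpNorm (E L j) 2 P) atTop (𝓝 0) := by
      have : Tendsto (fun L => ∑ j, ‖a j‖ₑ * eLpNorm (E L j) 2 P) atTop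
          (𝓝 (∑ j, ‖a j‖ₑ * 0)) :=
        tendsto_finsetSum _ fun j _ => ENNReal.Tendsto.const_mul (hXu _ (htD j) _ (hx j)).2
          (Or.inr (by simp))
      simpa using this
    refine tendsto_of_tendsto_of_tendsto_of_le_of_le tendsto_const_nhds hb (fun _ => zero_le) ?_
    intro L
    simp only [hdiff]
    refine (eLpNorm_sum_le (fun j _ => (hEm L j).const_smul _) (by norm_num)).trans ?_
    refine Finset.sum_le_sum fun j _ => ?_
    rw [eLpNorm_const_smul]
  refine tendsto_nhds_unique hlim1 ?_
  set J : ℕ := ∑ j, t j with hJ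
  have htJ : ∀ j, t j < J + 1 := fun j =>
    Nat.lt_succ_of_le (Finset.single_le_sum (f := t) (fun _ _ => Nat.zero_le _) (Finset.mem_univ j))
  have hval : ∀ L, expI P (Y L) = Complex.exp ((-(∑ l ∈ Finset.range L, ∑ j, ∑ j',
      a j * a j' * (p.modeVar l * p.modeCorr D l ^ ((t j : ℤ) - t j').natAbs * (e l j * e l j')))
        / 2 : ℝ)) := by
    intro L
    -- With n = J no innovations are left. The coefficient at time index i collects all j with t j =
    -- i, so repeated times are allowed; J is just some upper bound for the time indices.
    have key := h.expI_modes hp hD L J J le_rfl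
      (fun l i => ∑ j, if t j = i then a j * e l j else 0) (fun _ _ => 0)
    have hcomb : ∀ (l : ℕ) (F : ℕ → ℝ), ∑ i ∈ Finset.range (J + 1),
        (∑ j, if t j = i then a j * e l j else 0) * F i = ∑ j, a j * e l j * F (t j) := by
      intro l F
      simp only [Finset.sum_mul]
      rw [Finset.sum_comm]
      refine Finset.sum_congr rfl fun j _ => ?_
      simp only [ite_mul, zero_mul]
      rw [Finset.sum_ite_eq, if_pos (Finset.mem_range.2 (htJ j))]
    simp only [Finset.Ico_self, Finset.sum_empty, add_zero] at key
    convert key using 1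
    · congr 1
      funext ω
      exact Finset.sum_congr rfl fun l _ => (hcomb l fun i => u l (i * D) ω).symm
    · congr 3
      congr 1
      refine Finset.sum_congr rfl fun l _ => ?_
      have : ∀ i ∈ Finset.range (J + 1), ∑ i' ∈ Finset.range (J + 1),
          (∑ j, if t j = i then a j * e l j else 0) * (∑ j, if t j = i' then a j * e l j else 0) *
            (p.modeVar l * p.modeCorr D l ^ ((i : ℤ) - i').natAbs)
          = (∑ j, if t j = i then a j * e l j else 0) * ∑ j', a j' * e l j' *
            (p.modeVar l * p.modeCorr D l ^ ((i : ℤ) - t j').natAbs) := by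
        intro i _
        rw [← hcomb l fun i' => p.modeVar l * p.modeCorr D l ^ ((i : ℤ) - i').natAbs, Finset.mul_sum]
        exact Finset.sum_congr rfl fun i' _ => by ring
      rw [Finset.sum_congr rfl this, hcomb l fun i => ∑ j', a j' * e l j' *
            (p.modeVar l * p.modeCorr D l ^ ((i : ℤ) - t j').natAbs)]
      refine Finset.sum_congr rfl fun j _ => ?_
      rw [Finset.mul_sum]
      exact Finset.sum_congr rfl fun j' _ => by ring
  simp only [hval]
  have hc : Continuous fun x : ℝ => Complex.exp (x : ℂ) := by fun_prop
  refine (hc.tendsto _).comp (Tendsto.div_const (Tendsto.neg ?_) _)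
  have hsum : HasSum (fun l : ℕ => ∑ j, ∑ j',
      a j * a j' * (p.modeVar l * p.modeCorr D l ^ ((t j : ℤ) - t j').natAbs * (e l j * e l j')))
      (∑ j, ∑ j', a j * a j' * fieldCov p D ((t j : ℤ) - t j') (x j) (x j')) :=
    hasSum_sum fun j _ => hasSum_sum fun j' _ =>
      (summable_fieldCov hp hD.le _ (hx j) (hx j')).hasSum.mul_left _
  exact hsum.tendsto_sum_nat

end Modes


/-! ### The Gaussian tail integral and the heat kernel -/

section GaussTail

lemma integrable_exp_neg_sq : Integrable fun z : ℝ => Real.exp (-z ^ 2) := by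
  simpa using integrable_exp_neg_mul_sq (b := 1) one_pos

lemma hasDerivAt_gaussTail (x : ℝ) : HasDerivAt gaussTail (-Real.exp (-x ^ 2)) x := by
  have hc : Continuous fun z : ℝ => Real.exp (-z ^ 2) := by fun_prop
  have h1 : ∀ y, gaussTail y = gaussTail 0 - ∫ z in (0 : ℝ)..y, Real.exp (-z ^ 2) := by
    intro y
    have := intervalIntegral.integral_Ioi_sub_Ioi' (a := (0 : ℝ)) (b := y)
      integrable_exp_neg_sq.integrableOn integrable_exp_neg_sq.integrableOn
    simp only [gaussTail]
    linarith
  have h2 : HasDerivAt (fun y => ∫ z in (0 : ℝ)..y, Real.exp (-z ^ 2)) (Real.exp (-x ^ 2)) x :=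
    intervalIntegral.integral_hasDerivAt_right (hc.intervalIntegrable _ _)
      hc.stronglyMeasurable.stronglyMeasurableAtFilter hc.continuousAt
  have h3 := h2.const_sub (gaussTail 0)
  exact h3.congr_of_eventuallyEq (Eventually.of_forall h1)

lemma gaussTail_pos (x : ℝ) : 0 < gaussTail x := by
  rw [gaussTail, setIntegral_pos_iff_support_of_nonneg_ae
    (ae_of_all _ fun z => (Real.exp_pos _).le) integrable_exp_neg_sq.integrableOn]
  have : Function.support (fun z : ℝ => Real.exp (-z ^ 2)) = univ := by
    ext z; simp [(Real.exp_pos _).ne']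
  rw [this, univ_inter]
  simp

/-- The right side is the integral of 2z exp(-z²) over z > x, where 2x < 2z. Subtracting leaves an
integral of a positive function. -/
lemma two_mul_gaussTail_lt (x : ℝ) : 2 * x * gaussTail x < Real.exp (-x ^ 2) := by
  have hd : ∀ z : ℝ, HasDerivAt (fun z : ℝ => -Real.exp (-z ^ 2)) (2 * z * Real.exp (-z ^ 2)) z := by
    intro z
    refine (((hasDerivAt_pow 2 z).fun_neg.exp).fun_neg).congr_deriv ?_
    push_cast
    ring
  have hlim : Tendsto (fun z : ℝ => -Real.exp (-z ^ 2)) atTop (𝓝 0) := by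
    rw [← neg_zero]
    refine (Real.tendsto_exp_atBot.comp ?_).neg
    exact tendsto_neg_atTop_atBot.comp (tendsto_pow_atTop two_ne_zero)
  have hinteg : Integrable fun z : ℝ => 2 * z * Real.exp (-z ^ 2) := by
    have := (integrable_mul_exp_neg_mul_sq (b := 1) one_pos).const_mul 2
    refine this.congr (ae_of_all _ fun z => ?_)
    simp only [neg_mul, one_mul]
    ring
  have h1 : ∫ z in Ioi x, 2 * z * Real.exp (-z ^ 2) = Real.exp (-x ^ 2) := by
    have := integral_Ioi_of_hasDerivAt_of_tendsto (a := x) (hd x).continuousAt.continuousWithinAt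
      (fun z _ => hd z) hinteg.integrableOn hlim
    rw [this]; ring
  have h2 : 0 < ∫ z in Ioi x, 2 * (z - x) * Real.exp (-z ^ 2) := by
    have hi : Integrable fun z : ℝ => 2 * (z - x) * Real.exp (-z ^ 2) := by
      refine (hinteg.sub (integrable_exp_neg_sq.const_mul (2 * x))).congr (ae_of_all _ fun z => ?_)
      simp only [Pi.sub_apply]
      ring
    rw [setIntegral_pos_iff_support_of_nonneg_ae ?_ hi.integrableOn]
    · have : Ioi x ⊆ Function.support (fun z : ℝ => 2 * (z - x) * Real.exp (-z ^ 2)) ∩ Ioi x := by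
        intro z hz
        refine ⟨?_, hz⟩
        have := sub_pos.2 (mem_Ioi.1 hz)
        exact (by positivity : 0 < 2 * (z - x) * Real.exp (-z ^ 2)).ne'
      refine lt_of_lt_of_le ?_ (measure_mono this)
      simp
    · filter_upwards [ae_restrict_mem measurableSet_Ioi] with z hz
      have := sub_pos.2 (mem_Ioi.1 hz)
      simp only [Pi.zero_apply]
      positivity
  have h3 : ∫ z in Ioi x, 2 * (z - x) * Real.exp (-z ^ 2)
      = (∫ z in Ioi x, 2 * z * Real.exp (-z ^ 2)) - 2 * x * gaussTail x := by
    rw [gaussTail, ← integral_const_mul, ← integral_sub hinteg.integrableOn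
      (integrable_exp_neg_sq.const_mul _).integrableOn]
    refine integral_congr_ae (ae_of_all _ fun z => ?_)
    ring
  linarith

/-- The Gaussian terms produced by the two summands cancel, and only the tail integral survives. -/
lemma hasDerivAt_covProfile (z : ℝ) :
    HasDerivAt covProfile (-(gaussTail (z / 2) / (2 * Real.sqrt Real.pi))) z := by
  have h1 : HasDerivAt (fun x : ℝ => Real.exp (-(x ^ 2 / 4)))
      (Real.exp (-(z ^ 2 / 4)) * (-(2 * z / 4))) z := by
    refine ((((hasDerivAt_pow 2 z).div_const 4).fun_neg).exp).congr_deriv ?_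
    push_cast
    ring
  have h2 : HasDerivAt (fun x : ℝ => gaussTail (x / 2)) (-Real.exp (-(z / 2) ^ 2) * (1 / 2)) z :=
    HasDerivAt.comp z (h₂ := gaussTail) (h := fun x => x / 2) (hasDerivAt_gaussTail (z / 2))
      ((hasDerivAt_id' z).div_const 2)
  refine ((h1.fun_sub ((hasDerivAt_id' z).fun_mul h2)).const_mul
    (1 / (2 * Real.sqrt Real.pi))).congr_deriv ?_
  have : -(z / 2) ^ 2 = -(z ^ 2 / 4) := by ring
  rw [this]
  ring

lemma covProfile_mem {z : ℝ} (hz : 0 ≤ z) : covProfile z ∈ Icc (0 : ℝ) 1 := by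
  have h1 := two_mul_gaussTail_lt (z / 2)
  have h2 := gaussTail_pos (z / 2)
  have h3 : -(z / 2) ^ 2 = -(z ^ 2 / 4) := by ring
  have h4 : Real.exp (-(z ^ 2 / 4)) ≤ 1 := Real.exp_le_one_iff.2 (by have := sq_nonneg z; linarith)
  rw [h3] at h1
  have h5 : 1 ≤ Real.sqrt Real.pi := Real.one_le_sqrt.2 (by linarith [Real.pi_gt_three])
  have h6 : 1 / (2 * Real.sqrt Real.pi) ≤ 1 := by
    rw [div_le_one (by positivity)]; linarith
  have h7 : 0 ≤ Real.exp (-(z ^ 2 / 4)) - z * gaussTail (z / 2) := by linarith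
  rw [covProfile]
  refine ⟨by positivity, ?_⟩
  refine mul_le_one₀ h6 h7 ?_
  have := mul_nonneg hz h2.le
  linarith

end GaussTail

/-! ### Bounds for the heat kernel and its time integral -/

section Heat

/-- The heat kernel `(4πs)^{-1/2} exp(-x²/(4s))`, equal to `0` for `s ≤ 0`. -/
noncomputable def heat (s x : ℝ) : ℝ := (Real.sqrt (4 * Real.pi * s))⁻¹ * Real.exp (-(x ^ 2 / (4 * s)))

/-- The time derivative of the heat kernel. -/
noncomputable def heatDeriv (s x : ℝ) : ℝ := heat s x * (x ^ 2 / (4 * s ^ 2) - 1 / (2 * s))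

@[simp] lemma heat_zero (x : ℝ) : heat 0 x = 0 := by simp [heat]

lemma heat_nonneg (s x : ℝ) : 0 ≤ heat s x := by unfold heat; positivity

lemma hasDerivAt_heat {s : ℝ} (hs : 0 < s) (x : ℝ) :
    HasDerivAt (fun s => heat s x) (heatDeriv s x) s := by
  have hpos : 0 < 4 * Real.pi * s := by positivity
  have h1 : HasDerivAt (fun s : ℝ => Real.sqrt (4 * Real.pi * s))
      ((4 * Real.pi) / (2 * Real.sqrt (4 * Real.pi * s))) s := by
    have := ((hasDerivAt_id s).const_mul (4 * Real.pi)).sqrt hpos.ne'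
    simpa using this
  have h2 := h1.fun_inv (Real.sqrt_pos.2 hpos).ne'
  have h3 : HasDerivAt (fun s : ℝ => Real.exp (-(x ^ 2 / (4 * s))))
      (Real.exp (-(x ^ 2 / (4 * s))) * (x ^ 2 / (4 * s ^ 2))) s := by
    have h4 : HasDerivAt (fun s : ℝ => -(x ^ 2 / (4 * s))) (x ^ 2 / (4 * s ^ 2)) s := by
      refine (((hasDerivAt_const s (x ^ 2)).fun_div ((hasDerivAt_id' s).const_mul 4) (by
        simp [hs.ne'])).fun_neg).congr_deriv ?_
      field_simp
      ring
    exact h4.exp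
  refine (h2.fun_mul h3).congr_deriv ?_
  rw [heatDeriv, heat, Real.sq_sqrt hpos.le]
  have := (Real.sqrt_pos.2 hpos).ne'
  have := Real.pi_pos.ne'
  field_simp
  ring

lemma inv_sqrt_four_pi_mul_le {s : ℝ} : (Real.sqrt (4 * Real.pi * s))⁻¹ ≤ (Real.sqrt s)⁻¹ := by
  rcases le_or_gt s 0 with hs | hs
  · rw [Real.sqrt_eq_zero_of_nonpos hs, Real.sqrt_eq_zero_of_nonpos]
    have := Real.pi_pos
    nlinarith
  · refine inv_anti₀ (Real.sqrt_pos.2 hs) (Real.sqrt_le_sqrt ?_)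
    have := Real.pi_gt_three
    nlinarith

lemma heat_le_inv_sqrt {s : ℝ} (hs : 0 ≤ s) (x : ℝ) : heat s x ≤ (Real.sqrt s)⁻¹ := by
  have h2 : Real.exp (-(x ^ 2 / (4 * s))) ≤ 1 := Real.exp_le_one_iff.2 (by
    have : 0 ≤ x ^ 2 / (4 * s) := by positivity
    linarith)
  calc heat s x ≤ (Real.sqrt s)⁻¹ * 1 :=
        mul_le_mul inv_sqrt_four_pi_mul_le h2 (Real.exp_pos _).le (by positivity)
    _ = _ := mul_one _

/-- Used with u = x²/(4s), this controls the heat kernel and its time derivative: a power of u may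
be traded for decay in x. The constant comes from 1 + u ≤ 2(1 + u/2) and (1 + u/2)² ≤ exp u. -/
lemma poly_mul_exp_neg_le {u : ℝ} (hu : 0 ≤ u) : (1 + u) ^ 2 * Real.exp (-u) ≤ 4 := by
  have h1 : (1 + u / 2) ≤ Real.exp (u / 2) := by linarith [Real.add_one_le_exp (u / 2)]
  have h2 : (1 + u / 2) ^ 2 ≤ Real.exp u := by
    calc (1 + u / 2) ^ 2 ≤ Real.exp (u / 2) ^ 2 := by gcongr
      _ = Real.exp u := by rw [← Real.exp_nat_mul]; congr 1; push_cast; ring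
  rw [Real.exp_neg, ← div_eq_mul_inv, div_le_iff₀ (Real.exp_pos _)]
  nlinarith

lemma heat_le_sqrt_div_sq {s : ℝ} (hs : 0 ≤ s) {x : ℝ} (hx : x ≠ 0) :
    heat s x ≤ 16 * Real.sqrt s / x ^ 2 := by
  rcases hs.eq_or_lt with rfl | hs
  · simp
  have hx2 : 0 < x ^ 2 := by positivity
  set u := x ^ 2 / (4 * s) with hu
  have hu0 : 0 < u := by positivity
  have h1 := poly_mul_exp_neg_le hu0.le
  have h2 : Real.exp (-u) ≤ 4 / u := by
    rw [le_div_iff₀ hu0]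
    refine le_trans ?_ h1
    rw [mul_comm]
    gcongr
    nlinarith
  calc heat s x ≤ (Real.sqrt s)⁻¹ * (4 / u) :=
        mul_le_mul inv_sqrt_four_pi_mul_le h2 (Real.exp_pos _).le (by positivity)
    _ = _ := by
      rw [hu]
      have := Real.sqrt_pos.2 hs
      nth_rewrite 2 [← Real.sq_sqrt hs.le]
      field_simp
      ring

lemma abs_heatDeriv_le {s : ℝ} (hs : 0 < s) (x : ℝ) :
    |heatDeriv s x| ≤ 4 * ((Real.sqrt s)⁻¹ / s) := by
  set u := x ^ 2 / (4 * s) with hu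
  have hu0 : 0 ≤ u := by positivity
  have h1 := poly_mul_exp_neg_le hu0
  have e : heatDeriv s x = (Real.sqrt (4 * Real.pi * s))⁻¹ / s * (Real.exp (-u) * (u - 1 / 2)) := by
    rw [heatDeriv, heat, ← hu, hu]
    field_simp
  rw [e, abs_mul, abs_of_nonneg (by positivity), mul_comm (4 : ℝ) ((Real.sqrt s)⁻¹ / s)]
  refine mul_le_mul (div_le_div_of_nonneg_right inv_sqrt_four_pi_mul_le hs.le) ?_ (abs_nonneg _) (by positivity)
  rw [abs_mul, abs_of_pos (Real.exp_pos _), mul_comm]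
  refine le_trans ?_ h1
  gcongr
  rw [abs_le]
  constructor <;> nlinarith

lemma abs_heatDeriv_le_inv_sq {s : ℝ} (hs : 0 < s) {x : ℝ} (hx : x ≠ 0) :
    |heatDeriv s x| ≤ 16 * ((Real.sqrt s)⁻¹ / x ^ 2) := by
  have hx2 : 0 < x ^ 2 := by positivity
  set u := x ^ 2 / (4 * s) with hu
  have hu0 : 0 ≤ u := by positivity
  have h1 := poly_mul_exp_neg_le hu0
  have e : heatDeriv s x
      = (Real.sqrt (4 * Real.pi * s))⁻¹ / x ^ 2 * (4 * (Real.exp (-u) * (u * (u - 1 / 2)))) := by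
    rw [heatDeriv, heat, ← hu, hu]
    field_simp
  rw [e, abs_mul, abs_of_nonneg (by positivity), mul_comm 16]
  refine mul_le_mul (div_le_div_of_nonneg_right inv_sqrt_four_pi_mul_le hx2.le) ?_ (abs_nonneg _)
    (by positivity)
  rw [abs_mul, abs_mul, abs_of_pos (Real.exp_pos _), mul_comm (Real.exp _), abs_of_pos (by norm_num)]
  have : |u * (u - 1 / 2)| * Real.exp (-u) ≤ 4 := by
    refine le_trans ?_ h1
    gcongr
    rw [abs_le]
    constructor <;> nlinarith
  linarith

/-- The geometric mean of the bounds s^(-3/2) and s^(-1/2)x^(-2), with 8² = 4 · 16. It decays in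
both variables at once, which is what the summability of squared covariances over both lags
requires. -/
lemma abs_heatDeriv_le_inv_mul {s : ℝ} (hs : 0 < s) {x : ℝ} (hx : x ≠ 0) :
    |heatDeriv s x| ≤ 8 * (s⁻¹ * |x|⁻¹) := by
  have h1 := abs_heatDeriv_le hs x
  have h2 := abs_heatDeriv_le_inv_sq hs hx
  have hsq := Real.sqrt_pos.2 hs
  refine (sq_le_sq₀ (abs_nonneg _) (by positivity)).1 ?_
  calc |heatDeriv s x| ^ 2 = |heatDeriv s x| * |heatDeriv s x| := sq _
    _ ≤ (4 * ((Real.sqrt s)⁻¹ / s)) * (16 * ((Real.sqrt s)⁻¹ / x ^ 2)) := by gcongr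
    _ = _ := by
      have : Real.sqrt s * Real.sqrt s = s := Real.mul_self_sqrt hs.le
      rw [← sq_abs x]
      have := abs_pos.2 hx
      field_simp
      rw [Real.sq_sqrt hs.le]
      ring

/-- The time integral of the heat kernel. -/
noncomputable def heatInt (t x : ℝ) : ℝ := 2 * Real.sqrt t * covProfile (|x| / Real.sqrt t)

/-- This is the origin of `covProfile`: the primitive in time of a self-similar kernel is √t times a
function of |x|/√t. -/
lemma hasDerivAt_heatInt {t : ℝ} (ht : 0 < t) (x : ℝ) :
    HasDerivAt (fun t => heatInt t x) (heat t x) t := by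
  have hst := Real.sqrt_pos.2 ht
  have h1 : HasDerivAt (fun t : ℝ => Real.sqrt t) (1 / (2 * Real.sqrt t)) t :=
    Real.hasDerivAt_sqrt ht.ne'
  have h2 : HasDerivAt (fun t : ℝ => |x| / Real.sqrt t)
      (-(|x| * (1 / (2 * Real.sqrt t))) / Real.sqrt t ^ 2) t := by
    refine ((hasDerivAt_const t |x|).fun_div h1 hst.ne').congr_deriv ?_
    rw [zero_mul, zero_sub]
  have h3 : HasDerivAt (fun t => covProfile (|x| / Real.sqrt t)) _ t :=
    HasDerivAt.comp t (h₂ := covProfile) (hasDerivAt_covProfile (|x| / Real.sqrt t)) h2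
  refine ((h1.const_mul 2).fun_mul h3).congr_deriv ?_
  have e1 : x ^ 2 / (4 * t) = (|x| / Real.sqrt t) ^ 2 / 4 := by
    rw [div_pow, sq_abs, Real.sq_sqrt ht.le]; field_simp
  have e2 : Real.sqrt (4 * Real.pi * t) = 2 * Real.sqrt Real.pi * Real.sqrt t := by
    rw [Real.sqrt_mul (by positivity), Real.sqrt_mul (by norm_num),
      show (4 : ℝ) = 2 ^ 2 by norm_num, Real.sqrt_sq (by norm_num)]
  rw [heat, e1, e2]
  simp only [covProfile]
  have := Real.sqrt_pos.2 Real.pi_pos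
  field_simp
  ring

lemma continuous_heatInt (x : ℝ) : ContinuousOn (fun t => heatInt t x) (Ici 0) := by
  intro t ht
  rcases (mem_Ici.1 ht).eq_or_lt with rfl | ht
  · have h0 : heatInt 0 x = 0 := by simp [heatInt]
    rw [ContinuousWithinAt, h0]
    have hb : ∀ t, ‖heatInt t x‖ ≤ 2 * Real.sqrt t := by
      intro t
      have := covProfile_mem (z := |x| / Real.sqrt t) (by positivity)
      rw [heatInt, norm_mul, Real.norm_of_nonneg (by positivity), Real.norm_of_nonneg this.1]
      exact mul_le_of_le_one_right (by positivity) this.2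
    refine squeeze_zero_norm hb ?_
    have : Tendsto (fun t : ℝ => 2 * Real.sqrt t) (𝓝 0) (𝓝 (2 * Real.sqrt 0)) := by
      exact (by fun_prop : Continuous fun t : ℝ => 2 * Real.sqrt t).tendsto 0
    rw [Real.sqrt_zero, mul_zero] at this
    exact this.mono_left nhdsWithin_le_nhds
  · exact (hasDerivAt_heatInt ht x).continuousAt.continuousWithinAt

/-- For x = 0 the kernel blows up like v^(-1/2) at the origin. Integrability follows since the
kernel is a nonnegative derivative of a function continuous up to 0. -/
lemma intervalIntegrable_heat {s t : ℝ} (hs : 0 ≤ s) (ht : 0 ≤ t) (x : ℝ) :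
    IntervalIntegrable (fun v => heat v x) volume s t := by
  have key : ∀ t, 0 ≤ t → IntervalIntegrable (fun v => heat v x) volume 0 t := fun t ht => by
    rw [intervalIntegrable_iff_integrableOn_Ioc_of_le ht]
    exact intervalIntegral.integrableOn_deriv_of_nonneg
      ((continuous_heatInt x).mono fun v hv => hv.1)
      (fun v hv => hasDerivAt_heatInt hv.1 x) (fun v _ => heat_nonneg v x)
  exact (key s hs).symm.trans (key t ht)

lemma integral_heat {t : ℝ} (ht : 0 ≤ t) (x : ℝ) : ∫ v in (0 : ℝ)..t, heat v x = heatInt t x := by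
  rw [intervalIntegral.integral_eq_sub_of_hasDerivAt_of_le ht
    ((continuous_heatInt x).mono fun v hv => hv.1)
    (fun v hv => hasDerivAt_heatInt hv.1 x) (intervalIntegrable_heat le_rfl ht x)]
  simp [heatInt]

end Heat

/-! ### Poisson summation and the Dirichlet heat kernel -/

section Poisson

lemma summable_exp_neg_sq {s : ℝ} (hs : 0 < s) :
    Summable fun l : ℕ => Real.exp (-(Real.pi ^ 2 * (l + 1 : ℕ) ^ 2 * s)) := by
  have hs' : Summable fun l : ℕ => (Real.pi ^ 2 * s)⁻¹ * (((l + 1 : ℕ) : ℝ) ^ 2)⁻¹ :=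
    ((summable_nat_add_iff 1).2 (Real.summable_nat_pow_inv.2 (by norm_num : 1 < 2))).mul_left _
  refine Summable.of_nonneg_of_le (fun l => (Real.exp_pos _).le) (fun l => ?_) hs'
  have hpos : 0 < Real.pi ^ 2 * s * ((l + 1 : ℕ) : ℝ) ^ 2 := by positivity
  rw [← mul_inv, Real.exp_neg]
  refine inv_anti₀ hpos ?_
  have := Real.add_one_le_exp (Real.pi ^ 2 * (l + 1 : ℕ) ^ 2 * s)
  nlinarith

lemma summable_inv_one_add_abs_sq : Summable fun n : ℤ => ((1 + |(n : ℝ)|) ^ 2)⁻¹ := by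
  have h0 := Real.summable_one_div_int_pow.2 (by norm_num : 1 < 2)
  have h2 : Summable fun n : ℤ => (((|(n : ℝ)|) ^ 2)⁻¹ : ℝ) := by
    refine h0.congr fun n => ?_
    rw [sq_abs, one_div]
  refine h2.of_norm_bounded_eventually ?_
  have hfin : Set.Finite {n : ℤ | n = 0} := by simp
  filter_upwards [hfin.compl_mem_cofinite] with n hn
  have hn0 : (n : ℝ) ≠ 0 := by exact_mod_cast hn
  have := abs_pos.2 hn0
  rw [Real.norm_of_nonneg (by positivity)]
  gcongr
  linarith

lemma summable_heat {s : ℝ} (hs : 0 ≤ s) {x : ℤ → ℝ} {b : ℝ} (hb : 0 < b)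
    (hx : ∀ n : ℤ, b * (1 + |(n : ℝ)|) ≤ |x n|) : Summable fun n => heat s (x n) := by
  refine Summable.of_nonneg_of_le (fun n => heat_nonneg _ _) (fun n => ?_)
    (summable_inv_one_add_abs_sq.mul_left (16 * Real.sqrt s / b ^ 2))
  have hpos : 0 < b * (1 + |(n : ℝ)|) := by positivity
  have hxn : x n ≠ 0 := abs_pos.1 (hpos.trans_le (hx n))
  refine (heat_le_sqrt_div_sq hs hxn).trans ?_
  rw [div_eq_mul_inv, div_eq_mul_inv, mul_assoc (16 * Real.sqrt s), ← mul_inv, ← mul_pow,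
    ← sq_abs (x n)]
  gcongr
  exact hx n

/-- Poisson summation for the theta function. -/
lemma tsum_exp_cos {s : ℝ} (hs : 0 < s) (y : ℝ) :
    1 + 2 * ∑' l : ℕ, Real.exp (-(Real.pi ^ 2 * (l + 1 : ℕ) ^ 2 * s))
      * Real.cos (Real.pi * (l + 1 : ℕ) * y) = 2 * ∑' n : ℤ, heat s (y - 2 * n) := by
  have hπ := Real.pi_pos
  -- Jacobi's identity with quadratic parameter πs and imaginary linear parameter iy/2. Pairing n
  -- with -n turns the spectral side into cosines, and completing the square turns the other side
  -- into heat kernels centred at 2n.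
  have key := Complex.tsum_exp_neg_quadratic (a := ((Real.pi * s : ℝ) : ℂ))
    (by rw [Complex.ofReal_re]; positivity) (Complex.I * ((y / 2 : ℝ) : ℂ))
  set f : ℤ → ℂ := fun n => Complex.exp (-Real.pi * ((Real.pi * s : ℝ) : ℂ) * n ^ 2
    + 2 * Real.pi * (Complex.I * ((y / 2 : ℝ) : ℂ)) * n) with hf
  set E : ℕ → ℝ := fun l => Real.exp (-(Real.pi ^ 2 * (l + 1 : ℕ) ^ 2 * s)) with hE
  have hfpos : ∀ l : ℕ, f ((l + 1 : ℕ) : ℤ) = E l * Complex.exp ((Real.pi * (l + 1 : ℕ) * y : ℝ) * Complex.I) := by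
    intro l
    simp only [hf, hE]
    rw [Complex.ofReal_exp, ← Complex.exp_add]
    congr 1
    push_cast
    ring
  have hfneg : ∀ l : ℕ, f (-((l : ℤ) + 1)) = E l * Complex.exp ((-(Real.pi * (l + 1 : ℕ) * y) : ℝ) * Complex.I) := by
    intro l
    simp only [hf, hE]
    rw [Complex.ofReal_exp, ← Complex.exp_add]
    congr 1
    push_cast
    ring
  have hEs := summable_exp_neg_sq hs
  have hs1 : Summable fun l : ℕ => f ((l + 1 : ℕ) : ℤ) := by
    refine Summable.of_norm_bounded hEs fun l => ?_
    rw [hfpos, norm_mul, Complex.norm_exp_ofReal_mul_I, mul_one, Complex.norm_real,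
      Real.norm_of_nonneg (Real.exp_pos _).le]
  have hs2 : Summable fun l : ℕ => f (-((l : ℤ) + 1)) := by
    refine Summable.of_norm_bounded hEs fun l => ?_
    rw [hfneg, norm_mul, Complex.norm_exp_ofReal_mul_I, mul_one, Complex.norm_real,
      Real.norm_of_nonneg (Real.exp_pos _).le]
  have hs0 : Summable fun l : ℕ => f (l : ℤ) := (summable_nat_add_iff 1).1 hs1
  have hL : ∑' n : ℤ, f n = ((1 + 2 * ∑' l : ℕ, E l * Real.cos (Real.pi * (l + 1 : ℕ) * y) : ℝ) : ℂ) := by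
    rw [tsum_of_nat_of_neg_add_one hs0 hs2, hs0.tsum_eq_zero_add, add_assoc,
      ← hs1.tsum_add hs2]
    have h0 : f ((0 : ℕ) : ℤ) = 1 := by simp [hf]
    rw [h0]
    push_cast
    congr 1
    rw [← tsum_mul_left]
    refine tsum_congr fun l => ?_
    have h1 := hfpos l
    have h2 := hfneg l
    push_cast at h1 h2 ⊢
    rw [h1, h2, Complex.cos]
    ring_nf
  have hR : ∀ n : ℤ, Complex.exp (-Real.pi / ((Real.pi * s : ℝ) : ℂ)
      * (n + Complex.I * (Complex.I * ((y / 2 : ℝ) : ℂ))) ^ 2)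
      = ((Real.exp (-((y - 2 * n) ^ 2 / (4 * s))) : ℝ) : ℂ) := by
    intro n
    rw [Complex.ofReal_exp]
    congr 1
    rw [← mul_assoc, Complex.I_mul_I]
    push_cast
    have hπc : (Real.pi : ℂ) ≠ 0 := by exact_mod_cast hπ.ne'
    have hsc : (s : ℂ) ≠ 0 := by exact_mod_cast hs.ne'
    field_simp
    ring
  rw [hL, tsum_congr hR, ← Complex.ofReal_tsum] at key
  have hpow : (1 : ℂ) / ((Real.pi * s : ℝ) : ℂ) ^ (1 / 2 : ℂ)
      = ((1 / Real.sqrt (Real.pi * s) : ℝ) : ℂ) := by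
    rw [Real.sqrt_eq_rpow, Complex.ofReal_div, Complex.ofReal_cpow (by positivity)]
    norm_num
  rw [hpow, ← Complex.ofReal_mul, Complex.ofReal_inj] at key
  rw [key]
  simp only [heat]
  rw [tsum_mul_left]
  have e2 : Real.sqrt (4 * Real.pi * s) = 2 * Real.sqrt (Real.pi * s) := by
    rw [mul_assoc, Real.sqrt_mul (by norm_num), show (4 : ℝ) = 2 ^ 2 by norm_num,
      Real.sqrt_sq (by norm_num)]
  rw [e2]
  have : 0 < Real.sqrt (Real.pi * s) := Real.sqrt_pos.2 (by positivity)
  field_simp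

/-- The image terms of the Dirichlet heat kernel on `[0,1]`. -/
noncomputable def heatImages (s y y' : ℝ) : ℝ :=
  (∑' n : ℤ, if n = 0 then 0 else heat s (y - y' - 2 * n)) - ∑' n : ℤ, heat s (y + y' - 2 * n)

variable {b y y' : ℝ}

/-- The observation window keeps distance b from the boundary, so the reflected images never
approach the observation points, and they recede linearly in n. This makes sums over images converge
with constants uniform over the window. -/
lemma image_point_ge (hb : b ∈ Ioo (0 : ℝ) (1 / 2)) (hy : y ∈ Icc b (1 - b))
    (hy' : y' ∈ Icc b (1 - b)) (n : ℤ) :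
    b * (1 + |(n : ℝ)|) ≤ |y + y' - 2 * n| := by
  have hb0 := hb.1
  have hb1 := hb.2
  rcases le_or_gt n 0 with hn | hn
  · have hn' : (n : ℝ) ≤ 0 := by exact_mod_cast hn
    rw [abs_of_nonpos hn', abs_of_nonneg (by linarith [hy.1, hy'.1])]
    nlinarith [hy.1, hy'.1]
  · have hn' : (1 : ℝ) ≤ n := by exact_mod_cast hn
    rw [abs_of_nonneg (by linarith : (0 : ℝ) ≤ n), abs_of_nonpos (by linarith [hy.2, hy'.2])]
    nlinarith [hy.2, hy'.2]

lemma image_point_sub_ge (hb : b ∈ Ioo (0 : ℝ) (1 / 2)) (hy : y ∈ Icc b (1 - b))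
    (hy' : y' ∈ Icc b (1 - b)) {n : ℤ} (hn : n ≠ 0) :
    b * (1 + |(n : ℝ)|) ≤ |y - y' - 2 * n| := by
  have hb0 := hb.1
  have hb1 := hb.2
  have h1 : |y - y'| ≤ 1 := by rw [abs_le]; constructor <;> linarith [hy.1, hy'.1, hy.2, hy'.2]
  have h2 : (1 : ℝ) ≤ |(n : ℝ)| := by exact_mod_cast Int.one_le_abs hn
  have h3 : |(2 * n : ℝ)| - |y - y'| ≤ |y - y' - 2 * n| := by
    rw [abs_sub_comm (y - y')]; exact abs_sub_abs_le_abs_sub _ _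
  rw [abs_mul, abs_of_pos (by norm_num : (0 : ℝ) < 2)] at h3
  nlinarith

/-- By 2 sin·sin = cos(difference) - cos(sum), Poisson summation applies to each part. The n = 0
term of the first series is the free kernel, and all other terms are images. -/
lemma tsum_exp_sin_sin (hb : b ∈ Ioo (0 : ℝ) (1 / 2)) (hy : y ∈ Icc b (1 - b))
    (hy' : y' ∈ Icc b (1 - b)) {s : ℝ} (hs : 0 < s) :
    ∑' l : ℕ, Real.exp (-(Real.pi ^ 2 * (l + 1 : ℕ) ^ 2 * s))
      * (2 * Real.sin (Real.pi * (l + 1 : ℕ) * y) * Real.sin (Real.pi * (l + 1 : ℕ) * y'))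
      = heat s (y - y') + heatImages s y y' := by
  have hE := summable_exp_neg_sq hs
  have hcos : ∀ z : ℝ, Summable fun l : ℕ => Real.exp (-(Real.pi ^ 2 * (l + 1 : ℕ) ^ 2 * s))
      * Real.cos (Real.pi * (l + 1 : ℕ) * z) := fun z => by
    refine Summable.of_norm_bounded hE fun l => ?_
    rw [norm_mul, Real.norm_of_nonneg (Real.exp_pos _).le]
    exact mul_le_of_le_one_right (Real.exp_pos _).le (Real.abs_cos_le_one _)
  have h1 := tsum_exp_cos hs (y - y')
  have h2 := tsum_exp_cos hs (y + y')
  have e : ∀ l : ℕ, Real.exp (-(Real.pi ^ 2 * (l + 1 : ℕ) ^ 2 * s))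
      * (2 * Real.sin (Real.pi * (l + 1 : ℕ) * y) * Real.sin (Real.pi * (l + 1 : ℕ) * y'))
      = Real.exp (-(Real.pi ^ 2 * (l + 1 : ℕ) ^ 2 * s)) * Real.cos (Real.pi * (l + 1 : ℕ) * (y - y'))
       - Real.exp (-(Real.pi ^ 2 * (l + 1 : ℕ) ^ 2 * s)) * Real.cos (Real.pi * (l + 1 : ℕ) * (y + y')) := by
    intro l
    rw [mul_sub (Real.pi * _), mul_add (Real.pi * _), Real.cos_sub, Real.cos_add]
    ring
  rw [tsum_congr e, (hcos _).tsum_sub (hcos _)]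
  have hs1 : Summable fun n : ℤ => if n = 0 then (0 : ℝ) else heat s (y - y' - 2 * n) := by
    have := summable_heat (x := fun n : ℤ => if n = 0 then b else y - y' - 2 * n) hs.le hb.1 (fun n : ℤ => by
      by_cases hn : n = 0
      · simp [hn, abs_of_pos hb.1]
      · simp only [hn, if_false]; exact image_point_sub_ge hb hy hy' hn)
    refine Summable.of_nonneg_of_le (fun n => ?_) (fun n => ?_) this
    · split_ifs
      · exact le_rfl
      · exact heat_nonneg _ _
    · split_ifs
      · exact heat_nonneg _ _
      · exact le_rfl
  have hsplit : ∑' n : ℤ, heat s (y - y' - 2 * n)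
      = heat s (y - y') + ∑' n : ℤ, if n = 0 then 0 else heat s (y - y' - 2 * n) := by
    have hsum : Summable fun n : ℤ => heat s (y - y' - 2 * n) := by
      have h3 : Summable fun n : ℤ => if n = 0 then heat s (y - y') else 0 :=
        summable_of_hasFiniteSupport (Set.Finite.subset (Set.finite_singleton (0 : ℤ)) (by
          intro n hn; by_contra h; simp only [mem_singleton_iff] at h; simp [h] at hn))
      refine (h3.add hs1).congr fun n => ?_
      by_cases hn : n = 0 <;> simp [hn]
    rw [hsum.tsum_eq_add_tsum_ite 0]
    simp
  rw [heatImages]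
  linarith

end Poisson


/-! ### Second differences in time -/

section Holder

lemma sqrt_le_sqrt_add_sqrt_sub {s t : ℝ} (hs : 0 ≤ s) (hst : s ≤ t) :
    Real.sqrt t ≤ Real.sqrt s + Real.sqrt (t - s) := by
  rw [Real.sqrt_le_left (by positivity)]
  have h1 := Real.sq_sqrt hs
  have h2 := Real.sq_sqrt (sub_nonneg.2 hst)
  nlinarith [mul_nonneg (Real.sqrt_nonneg s) (Real.sqrt_nonneg (t - s))]

/-- Since 2C√v has derivative C/√v, both 2C√v + m and 2C√v - m are nondecreasing, and the square
root is subadditive. Nothing is known about the derivative at 0, so increments starting there use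
the size bound instead. -/
lemma holder_of_deriv {m m' : ℝ → ℝ} {C τ : ℝ} (hC : 0 ≤ C) (h0 : m 0 = 0)
    (hd : ∀ s ∈ Ioc 0 τ, HasDerivAt m (m' s) s) (hb : ∀ s ∈ Ioc 0 τ, |m' s| ≤ C * (Real.sqrt s)⁻¹)
    (hm : ∀ s ∈ Ioc 0 τ, |m s| ≤ C * Real.sqrt s) {s t : ℝ} (hs : 0 ≤ s) (hst : s ≤ t) (ht : t ≤ τ) :
    |m t - m s| ≤ 2 * C * Real.sqrt (t - s) := by
  rcases hst.eq_or_lt with rfl | hlt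
  · simp
  rcases hs.eq_or_lt with rfl | hs
  · rw [h0, sub_zero, sub_zero]
    refine (hm t ⟨hlt, ht⟩).trans ?_
    nlinarith [mul_nonneg hC (Real.sqrt_nonneg t)]
  have hsub : ∀ v ∈ Icc s t, v ∈ Ioc 0 τ := fun v hv => ⟨hs.trans_le hv.1, hv.2.trans ht⟩
  have hsq : ∀ v ∈ Icc s t, HasDerivAt (fun v => 2 * C * Real.sqrt v) (C * (Real.sqrt v)⁻¹) v := by
    intro v hv
    refine ((Real.hasDerivAt_sqrt (hsub v hv).1.ne').const_mul (2 * C)).congr_deriv ?_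
    have := Real.sqrt_pos.2 (hsub v hv).1
    field_simp
  have mono : ∀ ε : ℝ, |ε| ≤ 1 → MonotoneOn (fun v => 2 * C * Real.sqrt v + ε * m v) (Icc s t) := by
    intro ε hε
    have hder : ∀ v ∈ Icc s t, HasDerivAt (fun v => 2 * C * Real.sqrt v + ε * m v)
        (C * (Real.sqrt v)⁻¹ + ε * m' v) v := fun v hv =>
      (hsq v hv).add ((hd v (hsub v hv)).const_mul ε)
    refine monotoneOn_of_deriv_nonneg (convex_Icc s t)
      (fun v hv => (hder v hv).continuousAt.continuousWithinAt)
      (fun v hv => (hder v (interior_subset hv)).differentiableAt.differentiableWithinAt) ?_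
    intro v hv
    have hv' := interior_subset hv
    rw [(hder v hv').deriv]
    have h1 := hb v (hsub v hv')
    have h2 : |ε * m' v| ≤ C * (Real.sqrt v)⁻¹ := by
      rw [abs_mul]
      exact (mul_le_of_le_one_left (abs_nonneg _) hε).trans h1
    linarith [(abs_le.1 h2).1]
  have h1 := mono 1 (by simp) (left_mem_Icc.2 hst) (right_mem_Icc.2 hst) hst
  have h2 := mono (-1) (by simp) (left_mem_Icc.2 hst) (right_mem_Icc.2 hst) hst
  have h3 := sqrt_le_sqrt_add_sqrt_sub hs.le hst
  simp only at h1 h2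
  have h4 : 2 * C * Real.sqrt t ≤ 2 * C * (Real.sqrt s + Real.sqrt (t - s)) := by gcongr
  rw [abs_le]
  constructor <;> linarith

/-- Central second difference at `J` of the even extension of `F`, with step `D`. -/
noncomputable def diff2 (F : ℝ → ℝ) (D : ℝ) (J : ℤ) : ℝ :=
  F ((J + 1).natAbs * D) + F ((J - 1).natAbs * D) - 2 * F (J.natAbs * D)

lemma diff2_zero (F : ℝ → ℝ) (D : ℝ) : diff2 F D 0 = 2 * (F D - F 0) := by
  simp [diff2]; ring

lemma diff2_of_ne_zero (F : ℝ → ℝ) (D : ℝ) {J : ℤ} (hJ : J ≠ 0) :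
    ∃ n : ℕ, J.natAbs = n + 1 ∧ diff2 F D J = (F ((n + 2 : ℕ) * D) - F ((n + 1 : ℕ) * D))
      - (F ((n + 1 : ℕ) * D) - F (n * D)) := by
  obtain ⟨n, hn⟩ : ∃ n, J.natAbs = n + 1 := ⟨J.natAbs - 1, by omega⟩
  refine ⟨n, hn, ?_⟩
  rw [diff2, hn]
  rcases le_total 0 J with h | h
  · rw [show (J + 1).natAbs = n + 2 by omega, show (J - 1).natAbs = n by omega]
    ring
  · rw [show (J + 1).natAbs = n by omega, show (J - 1).natAbs = n + 2 by omega]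
    ring

lemma abs_diff2_le_of_holder {F : ℝ → ℝ} {C τ D : ℝ} (hD : 0 ≤ D)
    (hF : ∀ s t, 0 ≤ s → s ≤ t → t ≤ τ → |F t - F s| ≤ C * Real.sqrt (t - s)) {J : ℤ}
    (hJ : ((J.natAbs + 1 : ℕ) : ℝ) * D ≤ τ) : |diff2 F D J| ≤ 2 * C * Real.sqrt D := by
  by_cases h0 : J = 0
  · subst h0
    rw [diff2_zero, abs_mul, abs_of_pos (by norm_num : (0 : ℝ) < 2)]
    have := hF 0 D le_rfl hD (by simpa using hJ)
    rw [sub_zero] at this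
    linarith
  · obtain ⟨n, hn, e⟩ := diff2_of_ne_zero F D h0
    rw [hn] at hJ
    have h1 := hF ((n + 1 : ℕ) * D) ((n + 2 : ℕ) * D) (by positivity) (by gcongr; omega)
      (by exact_mod_cast hJ)
    have h2 := hF (n * D) ((n + 1 : ℕ) * D) (by positivity) (by gcongr; omega)
      (le_trans (by gcongr; omega) hJ)
    rw [show ((n + 2 : ℕ) : ℝ) * D - (n + 1 : ℕ) * D = D by push_cast; ring] at h1
    rw [show ((n + 1 : ℕ) : ℝ) * D - n * D = D by push_cast; ring] at h2
    rw [e]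
    have := abs_sub (F ((n + 2 : ℕ) * D) - F ((n + 1 : ℕ) * D)) (F ((n + 1 : ℕ) * D) - F (n * D))
    linarith

lemma continuousOn_of_holder {m : ℝ → ℝ} {C τ : ℝ}
    (hm : ∀ s t, 0 ≤ s → s ≤ t → t ≤ τ → |m t - m s| ≤ C * Real.sqrt (t - s)) :
    ContinuousOn m (Icc 0 τ) := by
  intro s hs
  rw [ContinuousWithinAt, tendsto_iff_norm_sub_tendsto_zero]
  have hlim : Tendsto (fun t => C * Real.sqrt |t - s|) (𝓝[Icc 0 τ] s) (𝓝 0) := by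
    have : Tendsto (fun t => C * Real.sqrt |t - s|) (𝓝 s) (𝓝 (C * Real.sqrt |s - s|)) :=
      (by fun_prop : Continuous fun t => C * Real.sqrt |t - s|).tendsto s
    simp only [sub_self, abs_zero, Real.sqrt_zero, mul_zero] at this
    exact this.mono_left nhdsWithin_le_nhds
  refine squeeze_zero' (Eventually.of_forall fun _ => norm_nonneg _) ?_ hlim
  filter_upwards [self_mem_nhdsWithin] with t ht
  rw [Real.norm_eq_abs]
  rcases le_total s t with h | h
  · rw [abs_of_nonneg (sub_nonneg.2 h)]; exact hm s t hs.1 h ht.2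
  · rw [abs_sub_comm, abs_sub_comm t s, abs_of_nonneg (sub_nonneg.2 h)]; exact hm t s ht.1 h hs.2

/-- The second difference of a primitive of a `1/2`-Hölder function that vanishes at `0`. -/
lemma abs_diff2_integral_le {m : ℝ → ℝ} {C τ D : ℝ} (hC : 0 ≤ C) (hD : 0 ≤ D) (h0 : m 0 = 0)
    (hm : ∀ s t, 0 ≤ s → s ≤ t → t ≤ τ → |m t - m s| ≤ C * Real.sqrt (t - s)) {J : ℤ}
    (hJ : ((J.natAbs + 1 : ℕ) : ℝ) * D ≤ τ) :
    |diff2 (fun t => ∫ v in (0 : ℝ)..t, m v) D J| ≤ 2 * C * (D * Real.sqrt D) := by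
  have hcont := continuousOn_of_holder hm
  have hinteg : ∀ s t, 0 ≤ s → s ≤ τ → 0 ≤ t → t ≤ τ → IntervalIntegrable m volume s t :=
    fun s t hs hs' ht ht' => (hcont.mono fun v hv =>
      ⟨(le_inf hs ht).trans hv.1, hv.2.trans (sup_le hs' ht')⟩).intervalIntegrable
  by_cases hJ0 : J = 0
  · subst hJ0
    rw [diff2_zero, abs_mul, abs_of_pos (by norm_num : (0 : ℝ) < 2)]
    simp only [intervalIntegral.integral_same, sub_zero]
    have hDτ : D ≤ τ := by simpa using hJ
    have := intervalIntegral.norm_integral_le_of_norm_le_const (a := 0) (b := D) (f := m)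
      (C := C * Real.sqrt D) (fun v hv => by
        rw [uIoc_of_le hD] at hv
        have := hm 0 v le_rfl hv.1.le (hv.2.trans hDτ)
        rw [h0, sub_zero, sub_zero] at this
        refine this.trans ?_
        gcongr
        exact hv.2)
    rw [sub_zero, abs_of_nonneg hD, Real.norm_eq_abs] at this
    linarith
  · obtain ⟨n, hn, e⟩ := diff2_of_ne_zero (fun t => ∫ v in (0 : ℝ)..t, m v) D hJ0
    rw [hn] at hJ
    have hn2 : ((n + 2 : ℕ) : ℝ) * D ≤ τ := by exact_mod_cast hJ
    have hn1 : ((n + 1 : ℕ) : ℝ) * D ≤ τ := le_trans (by gcongr; omega) hn2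
    have hn0 : (n : ℝ) * D ≤ τ := le_trans (by gcongr; omega) hn1
    have p2 : (0 : ℝ) ≤ ((n + 2 : ℕ) : ℝ) * D := by positivity
    have p1 : (0 : ℝ) ≤ ((n + 1 : ℕ) : ℝ) * D := by positivity
    have p0 : (0 : ℝ) ≤ (n : ℝ) * D := by positivity
    have hτ := p1.trans hn1
    rw [e, intervalIntegral.integral_interval_sub_left (hinteg _ _ le_rfl hτ p2 hn2)
      (hinteg _ _ le_rfl hτ p1 hn1), intervalIntegral.integral_interval_sub_left
      (hinteg _ _ le_rfl hτ p1 hn1) (hinteg _ _ le_rfl hτ p0 hn0)]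
    -- After a shift by D, the second difference of the primitive is the integral of m(v + D) - m(v)
    -- over an interval of length D. This gains a factor D over the Hölder bound √D.
    have e2 : ∫ v in ((n + 1 : ℕ) : ℝ) * D..((n + 2 : ℕ) : ℝ) * D, m v
        = ∫ v in (n : ℝ) * D..((n + 1 : ℕ) : ℝ) * D, m (v + D) := by
      rw [intervalIntegral.integral_comp_add_right]
      congr 1 <;> push_cast <;> ring
    have hle : (n : ℝ) * D ≤ ((n + 1 : ℕ) : ℝ) * D := by gcongr; omega
    have hint2 : IntervalIntegrable (fun v => m (v + D)) volume ((n : ℝ) * D) (((n + 1 : ℕ) : ℝ) * D) := by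
      refine ContinuousOn.intervalIntegrable ?_
      rw [uIcc_of_le hle]
      refine hcont.comp (by fun_prop) fun v hv => ⟨by linarith [hv.1], ?_⟩
      refine le_trans ?_ hn2
      have := hv.2
      push_cast at this ⊢
      linarith
    rw [e2, ← intervalIntegral.integral_sub hint2 (hinteg _ _ p0 hn0 p1 hn1)]
    have := intervalIntegral.norm_integral_le_of_norm_le_const (a := (n : ℝ) * D)
      (b := ((n + 1 : ℕ) : ℝ) * D) (f := fun v => m (v + D) - m v)
      (C := C * Real.sqrt D) (fun v hv => by
        rw [uIoc_of_le hle] at hv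
        have h2 := hv.2
        have := hm v (v + D) (p0.trans hv.1.le) (by linarith) (by
          refine le_trans ?_ hn2
          push_cast at h2 ⊢
          linarith)
        rwa [add_sub_cancel_left] at this)
    rw [show ((n + 1 : ℕ) : ℝ) * D - n * D = D by push_cast; ring, abs_of_nonneg hD,
      Real.norm_eq_abs] at this
    refine this.trans ?_
    have : 0 ≤ C * (D * Real.sqrt D) := by positivity
    linarith

end Holder

/-! ### Hölder continuity of the non-singular part of the kernel -/

section HeatHolder

variable {g τ : ℝ}

lemma exp_neg_mul_le {v : ℝ} (hv : v ∈ Icc 0 τ) : Real.exp (-(g * v)) ≤ Real.exp (|g| * τ) := by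
  rw [Real.exp_le_exp]
  have h1 := neg_abs_le (g * v)
  rw [abs_mul, abs_of_nonneg hv.1] at h1
  have : |g| * v ≤ |g| * τ := by gcongr; exact hv.2
  linarith

lemma abs_exp_sub_one_le {v : ℝ} (hv : v ∈ Icc 0 τ) :
    |Real.exp (-(g * v)) - 1| ≤ |g| * v * Real.exp (|g| * τ) := by
  have h1 : ∀ x : ℝ, |Real.exp x - 1| ≤ |x| * Real.exp |x| := by
    intro x
    rw [abs_le]
    have h2 := Real.add_one_le_exp x
    have h3 := Real.add_one_le_exp (-x)
    have h4 : 1 ≤ Real.exp |x| := Real.one_le_exp (abs_nonneg x)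
    have h5 : |x| ≤ |x| * Real.exp |x| := le_mul_of_one_le_right (abs_nonneg x) h4
    constructor
    · linarith [neg_abs_le x]
    · have h6 : Real.exp x - 1 ≤ x * Real.exp x := by
        rw [Real.exp_neg] at h3
        have := Real.exp_pos x
        have h7 : (-x + 1) * Real.exp x ≤ 1 := by
          calc (-x + 1) * Real.exp x ≤ (Real.exp x)⁻¹ * Real.exp x := by gcongr
            _ = 1 := inv_mul_cancel₀ this.ne'
        linarith
      refine h6.trans ?_
      rcases le_total 0 x with hx | hx
      · rw [abs_of_nonneg hx]
      · exact (mul_nonpos_of_nonpos_of_nonneg hx (Real.exp_pos _).le).trans (by positivity)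
  refine (h1 _).trans ?_
  rw [abs_neg, abs_mul, abs_of_nonneg hv.1]
  have := hv.1
  gcongr
  exact hv.2

lemma hasDerivAt_exp_neg_mul (v : ℝ) :
    HasDerivAt (fun v => Real.exp (-(g * v))) (-g * Real.exp (-(g * v))) v := by
  refine (((hasDerivAt_id' v).const_mul g).fun_neg.exp).congr_deriv ?_
  ring

/-- The factor exp(-gv) - 1 is O(v) and compensates one power of v in the time derivative v^(-3/2)
of the kernel, uniformly in x, even at x = 0. The constant 5 is 1 from the exponential plus 4 from
`abs_heatDeriv_le`. -/
lemma holder_exp_sub_one_mul_heat (x : ℝ) {s t : ℝ} (hs : 0 ≤ s) (hst : s ≤ t) (ht : t ≤ τ) :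
    |(Real.exp (-(g * t)) - 1) * heat t x - (Real.exp (-(g * s)) - 1) * heat s x|
      ≤ 2 * (5 * |g| * Real.exp (|g| * τ)) * Real.sqrt (t - s) := by
  refine holder_of_deriv (m := fun v => (Real.exp (-(g * v)) - 1) * heat v x)
    (m' := fun v => -g * Real.exp (-(g * v)) * heat v x + (Real.exp (-(g * v)) - 1) * heatDeriv v x)
    (τ := τ) (by positivity) (by simp) ?_ ?_ ?_ hs hst ht
  · intro v hv
    exact ((hasDerivAt_exp_neg_mul v).sub_const 1).fun_mul (hasDerivAt_heat hv.1 x)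
  · intro v hv
    have hv' : v ∈ Icc 0 τ := ⟨hv.1.le, hv.2⟩
    have hsq := Real.sqrt_pos.2 hv.1
    have hv0 := hv.1
    have h1 := abs_exp_sub_one_le (g := g) hv'
    have h2 := abs_heatDeriv_le hv.1 x
    have h3 := heat_le_inv_sqrt hv.1.le x
    have h4 := exp_neg_mul_le (g := g) hv'
    calc _ ≤ |-g * Real.exp (-(g * v)) * heat v x| + |(Real.exp (-(g * v)) - 1) * heatDeriv v x| :=
          abs_add_le _ _
      _ ≤ |g| * Real.exp (|g| * τ) * (Real.sqrt v)⁻¹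
          + |g| * v * Real.exp (|g| * τ) * (4 * ((Real.sqrt v)⁻¹ / v)) := by
          rw [abs_mul, abs_mul, abs_mul, abs_neg, abs_of_pos (Real.exp_pos _),
            abs_of_nonneg (heat_nonneg _ _)]
          gcongr
          exact heat_nonneg _ _
      _ = _ := by field_simp; ring
  · intro v hv
    have hv' : v ∈ Icc 0 τ := ⟨hv.1.le, hv.2⟩
    have hsq := Real.sqrt_pos.2 hv.1
    have hv0 := hv.1
    have h1 := abs_exp_sub_one_le (g := g) hv'
    have h3 := heat_le_inv_sqrt hv.1.le x
    rw [abs_mul, abs_of_nonneg (heat_nonneg _ _)]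
    calc _ ≤ |g| * v * Real.exp (|g| * τ) * (Real.sqrt v)⁻¹ := by
          gcongr
          exact heat_nonneg _ _
      _ = |g| * Real.exp (|g| * τ) * Real.sqrt v := by
          nth_rewrite 1 [← Real.sq_sqrt hv.1.le]
          field_simp
      _ ≤ _ := by
          have : 0 ≤ |g| * Real.exp (|g| * τ) * Real.sqrt v := by positivity
          linarith

/-- Away from x = 0 the kernel itself has time derivative O(v^(-1/2)/x²), so no compensating factor
is needed. The dependence 1/x² is summable over the images. -/
lemma holder_exp_mul_heat {x : ℝ} (hx : x ≠ 0) {s t : ℝ} (hs : 0 ≤ s) (hst : s ≤ t) (ht : t ≤ τ) :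
    |Real.exp (-(g * t)) * heat t x - Real.exp (-(g * s)) * heat s x|
      ≤ 2 * (16 * Real.exp (|g| * τ) * (|g| * τ + 1) / x ^ 2) * Real.sqrt (t - s) := by
  have hτ : 0 ≤ τ := hs.trans (hst.trans ht)
  have hx2 : 0 < x ^ 2 := by positivity
  refine holder_of_deriv (m := fun v => Real.exp (-(g * v)) * heat v x)
    (m' := fun v => -g * Real.exp (-(g * v)) * heat v x + Real.exp (-(g * v)) * heatDeriv v x)
    (τ := τ) (by positivity) (by simp) ?_ ?_ ?_ hs hst ht
  · intro v hv
    exact (hasDerivAt_exp_neg_mul v).fun_mul (hasDerivAt_heat hv.1 x)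
  · intro v hv
    have hv' : v ∈ Icc 0 τ := ⟨hv.1.le, hv.2⟩
    have hsq := Real.sqrt_pos.2 hv.1
    have hv0 := hv.1
    have h2 := abs_heatDeriv_le_inv_sq hv.1 hx
    have h3 := heat_le_sqrt_div_sq hv.1.le hx
    have h4 := exp_neg_mul_le (g := g) hv'
    calc _ ≤ |-g * Real.exp (-(g * v)) * heat v x| + |Real.exp (-(g * v)) * heatDeriv v x| :=
          abs_add_le _ _
      _ ≤ |g| * Real.exp (|g| * τ) * (16 * Real.sqrt v / x ^ 2)
          + Real.exp (|g| * τ) * (16 * ((Real.sqrt v)⁻¹ / x ^ 2)) := by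
          rw [abs_mul, abs_mul, abs_mul, abs_neg, abs_of_pos (Real.exp_pos _),
            abs_of_nonneg (heat_nonneg _ _)]
          gcongr
          exact heat_nonneg _ _
      _ = 16 * Real.exp (|g| * τ) * (|g| * v + 1) / x ^ 2 * (Real.sqrt v)⁻¹ := by
          nth_rewrite 3 [← Real.sq_sqrt hv.1.le]
          field_simp
      _ ≤ _ := by gcongr; exact hv.2
  · intro v hv
    have hv' : v ∈ Icc 0 τ := ⟨hv.1.le, hv.2⟩
    have hsq := Real.sqrt_pos.2 hv.1
    have h3 := heat_le_sqrt_div_sq hv.1.le hx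
    have h4 := exp_neg_mul_le (g := g) hv'
    rw [abs_mul, abs_of_nonneg (heat_nonneg _ _), abs_of_pos (Real.exp_pos _)]
    calc _ ≤ Real.exp (|g| * τ) * (16 * Real.sqrt v / x ^ 2) := by
          gcongr
          exact heat_nonneg _ _
      _ = 16 * Real.exp (|g| * τ) * 1 / x ^ 2 * Real.sqrt v := by ring
      _ ≤ _ := by
          gcongr
          have : 0 ≤ |g| * τ := by positivity
          linarith

/-- The constants of the single terms decay like 1/(1 + |n|)². The multipliers ε make it possible to
delete the central term of a family of images. -/
lemma holder_tsum_heat {b : ℝ} (hb : 0 < b) {x : ℤ → ℝ}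
    (hx : ∀ n : ℤ, b * (1 + |(n : ℝ)|) ≤ |x n|) {ε : ℤ → ℝ} (hε : ∀ n, |ε n| ≤ 1)
    {s t : ℝ} (hs : 0 ≤ s) (hst : s ≤ t) (ht : t ≤ τ) :
    |Real.exp (-(g * t)) * ∑' n, ε n * heat t (x n) - Real.exp (-(g * s)) * ∑' n, ε n * heat s (x n)|
      ≤ 2 * (16 * Real.exp (|g| * τ) * (|g| * τ + 1) / b ^ 2
        * ∑' n : ℤ, ((1 + |(n : ℝ)|) ^ 2)⁻¹) * Real.sqrt (t - s) := by
  have hτ : 0 ≤ τ := hs.trans (hst.trans ht)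
  have hsum : ∀ v, 0 ≤ v → Summable fun n => ε n * heat v (x n) := fun v hv =>
    Summable.of_norm_bounded (summable_heat hv hb hx) fun n => by
      rw [norm_mul, Real.norm_of_nonneg (heat_nonneg _ _)]
      exact mul_le_of_le_one_left (heat_nonneg _ _) (hε n)
  have hxne : ∀ n, x n ≠ 0 := fun n =>
    abs_pos.1 ((by positivity : 0 < b * (1 + |(n : ℝ)|)).trans_le (hx n))
  rw [← tsum_mul_left, ← tsum_mul_left, ← ((hsum t (hs.trans hst)).mul_left _).tsum_sub
    ((hsum s hs).mul_left _), ← tsum_mul_left, ← tsum_mul_left, ← tsum_mul_right]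
  rw [← Real.norm_eq_abs]
  refine tsum_of_norm_bounded (Summable.hasSum ?_) fun n => ?_
  · exact ((summable_inv_one_add_abs_sq.mul_left _).mul_left _).mul_right _
  · have := holder_exp_mul_heat (g := g) (hxne n) hs hst ht
    calc ‖Real.exp (-(g * t)) * (ε n * heat t (x n)) - Real.exp (-(g * s)) * (ε n * heat s (x n))‖
        = |ε n| * |Real.exp (-(g * t)) * heat t (x n) - Real.exp (-(g * s)) * heat s (x n)| := by
          rw [← abs_mul, Real.norm_eq_abs]; congr 1; ring
      _ ≤ 1 * (2 * (16 * Real.exp (|g| * τ) * (|g| * τ + 1) / x n ^ 2) * Real.sqrt (t - s)) := by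
          gcongr
          exact hε n
      _ ≤ 1 * (2 * (16 * Real.exp (|g| * τ) * (|g| * τ + 1) / (b * (1 + |(n : ℝ)|)) ^ 2)
          * Real.sqrt (t - s)) := by
          rw [← sq_abs (x n)]
          gcongr
          exact hx n
      _ = _ := by
          rw [mul_pow]
          field_simp

/-- The difference between the Dirichlet heat kernel, with potential `g`, and the free heat kernel. -/
noncomputable def heatRem (g y y' v : ℝ) : ℝ :=
  Real.exp (-(g * v)) * (heat v (y - y') + heatImages v y y') - heat v (y - y')

/-- The remainder consists of three pieces: the effect of the potential on the free kernel, the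
translated images and the reflected images. Each is 1/2-Hölder in time, uniformly in the two space
points. -/
lemma exists_holder_heatRem (g τ : ℝ) {b : ℝ} (hb : b ∈ Ioo (0 : ℝ) (1 / 2)) :
    ∃ C : ℝ, 0 ≤ C ∧ ∀ y ∈ Icc b (1 - b), ∀ y' ∈ Icc b (1 - b), ∀ s t, 0 ≤ s → s ≤ t → t ≤ τ →
      |heatRem g y y' t - heatRem g y y' s| ≤ C * Real.sqrt (t - s) := by
  set C1 := 2 * (5 * |g| * Real.exp (|g| * τ)) with hC1
  set C2 := 2 * (16 * Real.exp (|g| * τ) * (|g| * |τ| + 1) / b ^ 2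
        * ∑' n : ℤ, ((1 + |(n : ℝ)|) ^ 2)⁻¹) with hC2
  have hZ : 0 ≤ ∑' n : ℤ, ((1 + |(n : ℝ)|) ^ 2)⁻¹ := tsum_nonneg fun n => by positivity
  have hb0 := hb.1
  refine ⟨C1 + C2 + C2, by positivity, fun y hy y' hy' s t hs hst ht => ?_⟩
  have hτ : |τ| = τ := abs_of_nonneg (hs.trans (hst.trans ht))
  rw [hτ] at hC2
  have h1 := holder_exp_sub_one_mul_heat (g := g) (y - y') hs hst ht
  set x1 : ℤ → ℝ := fun n => if n = 0 then b else y - y' - 2 * n with hx1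
  have h2 := holder_tsum_heat (g := g) (x := x1) (ε := fun n => if n = 0 then 0 else 1) hb.1 (fun n => by
      by_cases hn : n = 0
      · simp [hx1, hn, abs_of_pos hb.1]
      · simp only [hx1, hn, if_false]; exact image_point_sub_ge hb hy hy' hn)
      (fun n => by by_cases hn : n = 0 <;> simp [hn]) hs hst ht
  have h3 := holder_tsum_heat (g := g) (x := fun n => y + y' - 2 * n) (ε := fun _ => 1) hb.1
    (fun n => image_point_ge hb hy hy' n) (fun n => by simp) hs hst ht
  have e1 : ∀ v, ∑' n, (if n = 0 then (0 : ℝ) else 1) * heat v (x1 n)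
      = ∑' n : ℤ, if n = 0 then 0 else heat v (y - y' - 2 * n) := fun v => tsum_congr fun n => by
    by_cases hn : n = 0 <;> simp [hn, hx1]
  simp only [e1, one_mul] at h2 h3
  rw [← hC2] at h2 h3
  have e2 : heatRem g y y' t - heatRem g y y' s
      = ((Real.exp (-(g * t)) - 1) * heat t (y - y') - (Real.exp (-(g * s)) - 1) * heat s (y - y'))
      + (Real.exp (-(g * t)) * (∑' n : ℤ, if n = 0 then 0 else heat t (y - y' - 2 * n))
        - Real.exp (-(g * s)) * (∑' n : ℤ, if n = 0 then 0 else heat s (y - y' - 2 * n)))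
      - (Real.exp (-(g * t)) * (∑' n : ℤ, heat t (y + y' - 2 * n))
        - Real.exp (-(g * s)) * (∑' n : ℤ, heat s (y + y' - 2 * n))) := by
    simp only [heatRem, heatImages]; ring
  rw [e2]
  refine (abs_sub _ _).trans ?_
  refine (add_le_add (abs_add_le _ _) le_rfl).trans ?_
  rw [add_mul, add_mul]
  exact add_le_add (add_le_add h1 h2) h3

lemma heatRem_zero (g y y' : ℝ) : heatRem g y y' 0 = 0 := by
  simp [heatRem, heatImages]

end HeatHolder


/-! ### The covariance of the double increments -/

section FieldCov

variable {p : Params} {b : ℝ}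

/-- `w(y) = exp(-κ y / 2)`. -/
noncomputable def Params.weight (p : Params) (y : ℝ) : ℝ := Real.exp (-(p.kappa * y / 2))

/-- In time rescaled by ϑ₂, the deviation of exp(-λτ)/λ from 1/λ is an integral of exponentials, and
sum and integral may be exchanged because ∑ 1/λ converges. The integrand is then the Dirichlet
kernel with potential Γ. The variance term does not depend on n, so it cancels in every time
increment, and only an explicit singular part and a Hölder part remain. -/
lemma fieldCov_eq (hp : p.Admissible) (hb : b ∈ Ioo (0 : ℝ) (1 / 2)) {D : ℝ} (hD : 0 ≤ D) (n : ℤ)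
    {y y' : ℝ} (hy : y ∈ Icc b (1 - b)) (hy' : y' ∈ Icc b (1 - b)) :
    fieldCov p D n y y' = fieldCov p D 0 y y' - p.sigmaSq / (2 * p.theta2) *
      (p.weight y * p.weight y') * ((heatInt (n.natAbs * (p.theta2 * D)) (y - y')) +
        ∫ v in (0 : ℝ)..(n.natAbs * (p.theta2 * D)), heatRem p.Gamma y y' v) := by
  have hth := hp.theta2_pos
  have hy01 : y ∈ Icc (0 : ℝ) 1 := ⟨hb.1.le.trans hy.1, hy.2.trans (by linarith [hb.1])⟩
  have hy01' : y' ∈ Icc (0 : ℝ) 1 := ⟨hb.1.le.trans hy'.1, hy'.2.trans (by linarith [hb.1])⟩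
  set τ : ℝ := n.natAbs * (p.theta2 * D) with hτ
  have hτ0 : 0 ≤ τ := by positivity
  set ss : ℕ → ℝ := fun l => 2 * Real.sin (Real.pi * (l + 1 : ℕ) * y)
    * Real.sin (Real.pi * (l + 1 : ℕ) * y') with hss
  have hss2 : ∀ l, |ss l| ≤ 2 := by
    intro l
    simp only [hss]
    rw [abs_mul, abs_mul, abs_of_pos (by norm_num : (0 : ℝ) < 2)]
    have h1 := Real.abs_sin_le_one (Real.pi * (l + 1 : ℕ) * y)
    have h2 := Real.abs_sin_le_one (Real.pi * (l + 1 : ℕ) * y')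
    have := mul_le_one₀ h1 (abs_nonneg _) h2
    linarith
  set μ : ℕ → ℝ := fun l => p.eigenvalue (l + 1) / p.theta2 with hμ
  have hμpos : ∀ l, 0 < μ l := fun l => div_pos (hp.eigenvalue_pos l) hth
  have hμe : ∀ l, μ l = Real.pi ^ 2 * (l + 1 : ℕ) ^ 2 + p.Gamma := by
    intro l; simp only [hμ, Params.eigenvalue]; field_simp
  set F : ℕ → ℝ → ℝ := fun l v => Real.exp (-(μ l * v)) * ss l with hF
  have hinteg : ∀ l, ∫ v in (0 : ℝ)..τ, Real.exp (-(μ l * v)) = (1 - Real.exp (-(μ l * τ))) / μ l := by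
    intro l
    have hd : ∀ v ∈ uIcc 0 τ, HasDerivAt (fun v => -Real.exp (-(μ l * v)) / μ l)
        (Real.exp (-(μ l * v))) v := by
      intro v _
      refine (((hasDerivAt_exp_neg_mul (g := μ l) v).fun_neg).div_const (μ l)).congr_deriv ?_
      have := (hμpos l).ne'
      field_simp
    rw [intervalIntegral.integral_eq_sub_of_hasDerivAt hd
      (by apply Continuous.intervalIntegrable; fun_prop)]
    simp
    ring
  have hFint : ∀ l, Integrable (F l) (volume.restrict (Ioc 0 τ)) := by
    intro l
    have : Continuous (F l) := by fun_prop
    exact (this.integrableOn_Icc (a := 0) (b := τ)).mono_set Ioc_subset_Icc_self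
  have hsum := hasSum_integral_of_summable_integral_norm (μ := volume.restrict (Ioc 0 τ))
    (F := F) hFint (by
      refine Summable.of_nonneg_of_le (fun l => integral_nonneg fun v => norm_nonneg _)
        (fun l => ?_) ((hp.summable_inv_eigenvalue.mul_left (2 * p.theta2)))
      calc ∫ v in Ioc 0 τ, ‖F l v‖ ≤ ∫ v in Ioc 0 τ, Real.exp (-(μ l * v)) * 2 := by
            refine integral_mono (hFint l).norm ?_ fun v => ?_
            · have : Continuous fun v => Real.exp (-(μ l * v)) * 2 := by fun_prop
              exact (this.integrableOn_Icc (a := 0) (b := τ)).mono_set Ioc_subset_Icc_self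
            · simp only [hF]
              rw [norm_mul, Real.norm_of_nonneg (Real.exp_pos _).le]
              gcongr
              exact hss2 l
        _ = (1 - Real.exp (-(μ l * τ))) / μ l * 2 := by
            rw [← intervalIntegral.integral_of_le hτ0, intervalIntegral.integral_mul_const, hinteg]
        _ ≤ 1 / μ l * 2 := by
            have := hμpos l
            gcongr
            linarith [Real.exp_pos (-(μ l * τ))]
        _ = _ := by
            simp only [hμ]
            have := hp.eigenvalue_pos l
            field_simp)
  have hval : ∀ l, ∫ v in Ioc 0 τ, F l v = (1 - Real.exp (-(μ l * τ))) / μ l * ss l := by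
    intro l
    rw [← intervalIntegral.integral_of_le hτ0, intervalIntegral.integral_mul_const, hinteg]
  have hker : ∫ v in Ioc 0 τ, ∑' l, F l v
      = heatInt τ (y - y') + ∫ v in (0 : ℝ)..τ, heatRem p.Gamma y y' v := by
    obtain ⟨C, hC, hH⟩ := exists_holder_heatRem p.Gamma τ hb
    have hcont := continuousOn_of_holder (hH y hy y' hy')
    have hi2 : IntervalIntegrable (heatRem p.Gamma y y') volume 0 τ := by
      refine ContinuousOn.intervalIntegrable ?_
      rwa [uIcc_of_le hτ0]
    rw [← integral_heat hτ0, ← intervalIntegral.integral_add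
      (intervalIntegrable_heat le_rfl hτ0 _) hi2, intervalIntegral.integral_of_le hτ0]
    refine setIntegral_congr_fun measurableSet_Ioc fun v hv => ?_
    simp only [hF, heatRem, add_sub_cancel]
    rw [← tsum_exp_sin_sin hb hy hy' hv.1, ← tsum_mul_left]
    refine tsum_congr fun l => ?_
    rw [hμe, ← mul_assoc (Real.exp (-(p.Gamma * v))), ← Real.exp_add]
    congr 2
    ring
  have hfinal : ∀ l, p.modeVar l * p.modeCorr D l ^ n.natAbs
      * (p.eigenfunction (l + 1) y * p.eigenfunction (l + 1) y')
      = p.modeVar l * p.modeCorr D l ^ (0 : ℤ).natAbs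
      * (p.eigenfunction (l + 1) y * p.eigenfunction (l + 1) y')
      - p.sigmaSq / (2 * p.theta2) * (p.weight y * p.weight y') *
        ((1 - Real.exp (-(μ l * τ))) / μ l * ss l) := by
    intro l
    have e1 : p.modeCorr D l ^ n.natAbs = Real.exp (-(μ l * τ)) := by
      rw [Params.modeCorr, ← Real.exp_nat_mul]
      congr 1
      simp only [hμ, hτ]
      field_simp
    have e2 : p.eigenfunction (l + 1) y * p.eigenfunction (l + 1) y'
        = ss l * (p.weight y * p.weight y') := by
      simp only [Params.eigenfunction, hss, Params.weight]
      have : Real.sqrt 2 * Real.sqrt 2 = 2 := Real.mul_self_sqrt (by norm_num)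
      linear_combination (Real.sin (Real.pi * (l + 1 : ℕ) * y) * Real.exp (-(p.kappa * y / 2))
        * (Real.sin (Real.pi * (l + 1 : ℕ) * y') * Real.exp (-(p.kappa * y' / 2)))) * this
    rw [e1, e2, Params.modeVar]
    simp only [hμ, Int.natAbs_zero, pow_zero]
    have := (hp.eigenvalue_pos l).ne'
    field_simp
    ring
  rw [fieldCov, tsum_congr hfinal, (summable_fieldCov hp hD 0 hy01 hy01').tsum_sub, ← fieldCov,
    tsum_mul_left]
  · simp only [hval] at hsum
    rw [hsum.tsum_eq, hker]
  · simp only [hval] at hsum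
    exact hsum.summable.mul_left _

/-- The signs in an increment. -/
def incrSign (s : Fin 2) : ℝ := if s = 0 then -1 else 1

/-- The covariance of the double increments `D_{ik}` and `D_{jl}`. -/
noncomputable def covIncr (p : Params) (T b : ℝ) (M N i k j l : ℕ) : ℝ :=
  ∑ s : Fin 2, ∑ q : Fin 2, ∑ s' : Fin 2, ∑ q' : Fin 2,
    (incrSign s * incrSign q) * (incrSign s' * incrSign q') *
      fieldCov p (meshTime T N) (((i + s : ℕ) : ℤ) - ((j + s' : ℕ) : ℤ))
        (gridSpace b M (k + q)) (gridSpace b M (l + q'))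

/-- Parabolic scaling: with spatial mesh r√D the ratio of spatial lag to square root of temporal lag
is free of D, so the mesh enters only through the factor √(ϑD). -/
lemma covG_eq_heatInt {D : ℝ} (hD : 0 < D) {th : ℝ} (hth : 0 < th) (r : ℝ) (hr : 0 ≤ r) (j l : ℤ) :
    heatInt (j.natAbs * (th * D)) (r * Real.sqrt D * l)
      = 2 * Real.sqrt (th * D) * covG (r / Real.sqrt th) j l := by
  have hj : ((j.natAbs : ℕ) : ℝ) = |(j : ℝ)| := by
    rw [Nat.cast_natAbs]; simp
  rw [covG, heatInt, hj]
  split_ifs with h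
  · simp [h]
  · have hj0 : 0 < |(j : ℝ)| := abs_pos.2 (by exact_mod_cast h)
    rw [Real.sqrt_mul hj0.le, Real.sqrt_mul hth.le, abs_mul, abs_of_nonneg (by positivity : 0 ≤ r * Real.sqrt D)]
    have h1 := Real.sqrt_pos.2 hj0
    have h2 := Real.sqrt_pos.2 hth
    have h3 := Real.sqrt_pos.2 hD
    have e : r * Real.sqrt D * |(l : ℝ)| / (Real.sqrt |(j : ℝ)| * (Real.sqrt th * Real.sqrt D))
        = r / Real.sqrt th * |(l : ℝ)| / Real.sqrt |(j : ℝ)| := by field_simp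
    rw [e]
    ring

lemma covG_neg_left (h : ℝ) (j l : ℤ) : covG h (-j) l = covG h j l := by
  simp [covG]

lemma covG_neg_right (h : ℝ) (j l : ℤ) : covG h j (-l) = covG h j l := by
  simp [covG]

/-- `covG` is even in both variables, so forward second differences based at |j| - 1 and |l| - 1 are
central second differences at (j, l). -/
lemma Lam_eq (h : ℝ) (j l : ℤ) : Lam h j l =
    (covG h (j + 1) (l + 1) + covG h (j - 1) (l + 1) - 2 * covG h j (l + 1))
    + (covG h (j + 1) (l - 1) + covG h (j - 1) (l - 1) - 2 * covG h j (l - 1))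
    - 2 * (covG h (j + 1) l + covG h (j - 1) l - 2 * covG h j l) := by
  have hl : ∀ j, secondDiffY (covG h) j (|l| - 1)
      = covG h j (l + 1) + covG h j (l - 1) - 2 * covG h j l := by
    intro j
    rw [secondDiffY]
    rcases abs_choice l with h1 | h1 <;> rw [h1]
    · rw [show l - 1 + 2 = l + 1 by ring, show l - 1 + 1 = l by ring]
    · rw [show -l - 1 + 2 = -(l - 1) by ring, show -l - 1 + 1 = -l by ring,
        show -l - 1 = -(l + 1) by ring, covG_neg_right, covG_neg_right, covG_neg_right]
      ring
  rw [Lam, secondDiffX]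
  simp only [hl]
  rcases abs_choice j with h1 | h1 <;> rw [h1]
  · rw [show j - 1 + 2 = j + 1 by ring, show j - 1 + 1 = j by ring]
    ring
  · rw [show -j - 1 + 2 = -(j - 1) by ring, show -j - 1 + 1 = -j by ring,
        show -j - 1 = -(j + 1) by ring]
    simp only [covG_neg_left]
    ring

lemma holder_heatInt (x : ℝ) {s t : ℝ} (hs : 0 ≤ s) (hst : s ≤ t) :
    |heatInt t x - heatInt s x| ≤ 4 * Real.sqrt (t - s) := by
  have := holder_of_deriv (m := fun t => heatInt t x) (m' := fun t => heat t x) (C := 2) (τ := t)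
    (by norm_num) (by simp [heatInt]) (fun v hv => hasDerivAt_heatInt hv.1 x) (fun v hv => by
      rw [abs_of_nonneg (heat_nonneg _ _)]
      have := heat_le_inv_sqrt hv.1.le x
      have h2 : 0 ≤ (Real.sqrt v)⁻¹ := by positivity
      linarith) (fun v hv => by
      have := covProfile_mem (z := |x| / Real.sqrt v) (by positivity)
      rw [heatInt, abs_mul, abs_of_nonneg (by positivity), abs_of_nonneg this.1]
      exact mul_le_of_le_one_right (by positivity) this.2) hs hst le_rfl
  linarith

lemma weight_le {y : ℝ} (hy : y ∈ Icc (0 : ℝ) 1) : p.weight y ≤ Real.exp |p.kappa| := by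
  rw [Params.weight, Real.exp_le_exp]
  have h2 : |p.kappa * y| ≤ |p.kappa| := by
    rw [abs_mul, abs_of_nonneg hy.1]
    exact mul_le_of_le_one_right (abs_nonneg _) hy.2
  have := neg_abs_le (p.kappa * y)
  have := abs_nonneg p.kappa
  linarith

lemma gridSpace_mem (hb : b ∈ Ioo (0 : ℝ) (1 / 2)) {M k : ℕ} (hM : 0 < M) (hk : k ≤ M) :
    gridSpace b M k ∈ Icc b (1 - b) := by
  have hM' : (0 : ℝ) < M := by exact_mod_cast hM
  have hk' : (k : ℝ) ≤ M := by exact_mod_cast hk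
  have hb1 : 0 ≤ 1 - 2 * b := by linarith [hb.2]
  have h1 : 0 ≤ (k : ℝ) * ((1 - 2 * b) / M) := by positivity
  have h2 : (k : ℝ) * ((1 - 2 * b) / M) ≤ M * ((1 - 2 * b) / M) := by gcongr
  rw [mul_div_cancel₀ _ hM'.ne'] at h2
  rw [gridSpace, meshSpace]
  constructor <;> linarith

/-- The weights at opposite corners of a grid cell pair are exp(a) and exp(-a) relative to the
midpoints. Their first order deviations cancel, so evaluating at midpoints costs only O(δ²) = O(Δ).
-/
lemma cosh_defect_le (a : ℝ) : |Real.exp a + Real.exp (-a) - 2| ≤ a ^ 2 * Real.exp (a ^ 2 / 2) := by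
  have h1 := Real.cosh_le_exp_half_sq a
  have h0 := Real.one_le_cosh a
  rw [Real.cosh_eq] at h1 h0
  have h2 := Real.add_one_le_exp (-(a ^ 2 / 2))
  have h3 : Real.exp (a ^ 2 / 2) - 1 ≤ a ^ 2 / 2 * Real.exp (a ^ 2 / 2) := by
    rw [Real.exp_neg] at h2
    have hp := Real.exp_pos (a ^ 2 / 2)
    have h7 : (-(a ^ 2 / 2) + 1) * Real.exp (a ^ 2 / 2) ≤ 1 := by
      calc _ ≤ (Real.exp (a ^ 2 / 2))⁻¹ * Real.exp (a ^ 2 / 2) := by gcongr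
        _ = 1 := inv_mul_cancel₀ hp.ne'
    linarith
  rw [abs_of_nonneg (by linarith)]
  linarith

theorem abs_add_sub_sub_le {a b c d B : ℝ} (ha : |a| ≤ B) (hb : |b| ≤ B) (hc : |c| ≤ B)
    (hd : |d| ≤ B) : |a + b - c - d| ≤ 4 * B := by
  rw [abs_le] at *
  constructor <;> linarith [ha.1, ha.2]

set_option maxHeartbeats 1000000 in
/-- The covariance of the double increments, up to a uniform error. -/
theorem exists_covIncr_approx (hp : p.Admissible) {T r : ℝ} (hT : 0 < T)
    (hb : b ∈ Ioo (0 : ℝ) (1 / 2)) (hr : 0 < r) :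
    ∃ C : ℝ, 0 ≤ C ∧ ∀ M N : ℕ, meshSpace b M / Real.sqrt (meshTime T N) = r →
      ∀ i k j l : ℕ, i < N → j < N → k < M → l < M →
      |covIncr p T b M N i k j l - p.sigmaSq * Real.sqrt (meshTime T N) *
        (p.weight (gridMid b M k) * p.weight (gridMid b M l)) *
          coefA p.theta2 r ((i : ℤ) - j) ((k : ℤ) - l)|
      ≤ C * (meshTime T N * Real.sqrt (meshTime T N)) := by
  have hth := hp.theta2_pos
  have hsig := hp.sigmaSq_pos
  obtain ⟨C₀, hC₀, hrem⟩ := exists_holder_heatRem p.Gamma (p.theta2 * T) hb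
  set W := Real.exp |p.kappa| with hW
  have hW0 : 0 < W := Real.exp_pos _
  set th := p.theta2 with hthdef
  set c := p.sigmaSq / (2 * th) with hc
  have hc0 : 0 < c := by positivity
  set K := p.kappa ^ 2 / 4 * r ^ 2 * Real.exp (p.kappa ^ 2 / 8) with hK
  -- The first summand bounds the four Hölder remainders at the corners, the second the deviation of
  -- the corner weights from the midpoint weights.
  refine ⟨c * (4 * (W * W * (2 * C₀ * (th * Real.sqrt th)))) + c * (W * W * (K * (8 * Real.sqrt th))),
    by positivity, ?_⟩
  intro M N hbal i k j l hi hj hk hl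
  have hM0 : 0 < M := by omega
  have hN0 : 0 < N := by omega
  have hN' : (0 : ℝ) < N := by exact_mod_cast hN0
  have hM' : (0 : ℝ) < M := by exact_mod_cast hM0
  set D := meshTime T N with hDdef
  have hD : 0 < D := by rw [hDdef, meshTime]; positivity
  have hND : N * D = T := by rw [hDdef, meshTime]; field_simp
  have hsD := Real.sqrt_pos.2 hD
  set δ := meshSpace b M with hδ
  have hδr : δ = r * Real.sqrt D := by rw [← hbal]; field_simp
  have hδ0 : 0 < δ := by rw [hδr]; positivity
  have hδ1 : δ ≤ 1 := by
    rw [hδ, meshSpace, div_le_one hM']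
    have : (1 : ℝ) ≤ M := by exact_mod_cast hM0
    linarith [hb.1]
  have hmem : ∀ k, k < M → ∀ q : Fin 2, gridSpace b M (k + q) ∈ Icc b (1 - b) := fun k hk q =>
    gridSpace_mem hb hM0 (by have := q.2; omega)
  have hmem01 : ∀ k, k < M → ∀ q : Fin 2, gridSpace b M (k + q) ∈ Icc (0 : ℝ) 1 := fun k hk q =>
    ⟨hb.1.le.trans (hmem k hk q).1, (hmem k hk q).2.trans (by linarith [hb.1])⟩
  set J : ℤ := (i : ℤ) - j with hJ
  set L : ℤ := (k : ℤ) - l with hL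
  set h := r / Real.sqrt th with hh
  -- second time differences of the free part
  set G : ℤ → ℝ := fun L => covG h (J + 1) L + covG h (J - 1) L - 2 * covG h J L with hG
  set E2 : ℝ → ℝ → ℝ := fun y y' => diff2 (fun t => ∫ v in (0 : ℝ)..t, heatRem p.Gamma y y' v)
    (th * D) J with hE2
  have hJb : ((J.natAbs + 1 : ℕ) : ℝ) * (th * D) ≤ th * T := by
    have h1 : J.natAbs + 1 ≤ N := by omega
    have h2 : ((J.natAbs + 1 : ℕ) : ℝ) ≤ N := by exact_mod_cast h1
    calc ((J.natAbs + 1 : ℕ) : ℝ) * (th * D) ≤ N * (th * D) := by gcongr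
      _ = th * T := by rw [← hND]; ring
  have hfree : ∀ L : ℤ, diff2 (fun t => heatInt t (r * Real.sqrt D * L)) (th * D) J
      = 2 * Real.sqrt (th * D) * G L := by
    intro L
    simp only [diff2, hG]
    rw [covG_eq_heatInt hD hth r hr.le, covG_eq_heatInt hD hth r hr.le,
      covG_eq_heatInt hD hth r hr.le]
    ring
  have hGb : ∀ L : ℤ, |2 * Real.sqrt (th * D) * G L| ≤ 8 * Real.sqrt (th * D) := by
    intro L
    rw [← hfree L]
    have := abs_diff2_le_of_holder (F := fun t => heatInt t (r * Real.sqrt D * L)) (D := th * D)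
      (C := 4) (τ := th * T) (by positivity) (fun s t hs hst _ => holder_heatInt _ hs hst) hJb
    linarith
  have hE2b : ∀ q q' : Fin 2, |E2 (gridSpace b M (k + q)) (gridSpace b M (l + q'))|
      ≤ 2 * C₀ * ((th * D) * Real.sqrt (th * D)) := by
    intro q q'
    exact abs_diff2_integral_le hC₀ (by positivity) (heatRem_zero _ _ _)
      (hrem _ (hmem k hk q) _ (hmem l hl q')) hJb
  have hdiffpt : ∀ q q' : Fin 2, gridSpace b M (k + q) - gridSpace b M (l + q')
      = r * Real.sqrt D * ((L + q - q' : ℤ) : ℝ) := by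
    intro q q'
    simp only [gridSpace, ← hδ, hδr, hL]
    push_cast
    ring
  -- the four space terms
  set w : ℕ → ℝ := fun k => p.weight (gridSpace b M k) with hw
  have hterm : ∀ q q' : Fin 2, ∑ s : Fin 2, ∑ s' : Fin 2, incrSign s * incrSign s' *
      fieldCov p D (((i + s : ℕ) : ℤ) - ((j + s' : ℕ) : ℤ))
        (gridSpace b M (k + q)) (gridSpace b M (l + q'))
      = c * (w (k + q) * w (l + q')) * (2 * Real.sqrt (th * D) * G (L + q - q')
        + E2 (gridSpace b M (k + q)) (gridSpace b M (l + q'))) := by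
    intro q q'
    simp only [Fin.sum_univ_two, incrSign]
    have e00 : (((i + (0 : Fin 2) : ℕ) : ℤ) - ((j + (0 : Fin 2) : ℕ) : ℤ)) = J := by simp [hJ]
    have e01 : (((i + (0 : Fin 2) : ℕ) : ℤ) - ((j + (1 : Fin 2) : ℕ) : ℤ)) = J - 1 := by
      simp [hJ]; ring
    have e10 : (((i + (1 : Fin 2) : ℕ) : ℤ) - ((j + (0 : Fin 2) : ℕ) : ℤ)) = J + 1 := by
      simp [hJ]; ring
    have e11 : (((i + (1 : Fin 2) : ℕ) : ℤ) - ((j + (1 : Fin 2) : ℕ) : ℤ)) = J := by simp [hJ]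
    rw [e00, e01, e10, e11, fieldCov_eq hp hb hD.le J (hmem k hk q) (hmem l hl q'),
      fieldCov_eq hp hb hD.le (J - 1) (hmem k hk q) (hmem l hl q'),
      fieldCov_eq hp hb hD.le (J + 1) (hmem k hk q) (hmem l hl q'), ← hfree]
    rw [hdiffpt q q']
    simp only [hE2, diff2, hw, hc]
    norm_num
    ring
  have hcov : covIncr p T b M N i k j l = ∑ q : Fin 2, ∑ q' : Fin 2, incrSign q * incrSign q' *
      (c * (w (k + q) * w (l + q')) * (2 * Real.sqrt (th * D) * G (L + q - q')
        + E2 (gridSpace b M (k + q)) (gridSpace b M (l + q')))) := by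
    simp only [← hterm]
    rw [covIncr]
    simp only [Fin.sum_univ_two]
    ring
  -- weights
  set κ := p.kappa
  set E := p.weight (gridMid b M k) * p.weight (gridMid b M l) with hE
  set a := κ * δ / 2 with ha
  have hw00 : w k * w l = E * Real.exp a := by
    simp only [hw, hE, Params.weight, ← Real.exp_add, gridMid, gridSpace, ha, ← hδ]
    congr 1; push_cast; ring
  have hw11 : w (k + 1) * w (l + 1) = E * Real.exp (-a) := by
    simp only [hw, hE, Params.weight, ← Real.exp_add, gridMid, gridSpace, ha, ← hδ]
    congr 1; push_cast; ring
  have hw10 : w (k + 1) * w l = E := by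
    simp only [hw, hE, Params.weight, ← Real.exp_add, gridMid, gridSpace]
    congr 1; push_cast; ring
  have hw01 : w k * w (l + 1) = E := by
    simp only [hw, hE, Params.weight, ← Real.exp_add, gridMid, gridSpace]
    congr 1; push_cast; ring
  have hE0 : 0 ≤ E := by simp only [hE, Params.weight]; positivity
  have hwb : ∀ q q' : Fin 2, 0 ≤ w (k + q) * w (l + q') ∧ w (k + q) * w (l + q') ≤ W * W := by
    intro q q'
    have h1 := weight_le (p := p) (hmem01 k hk q)
    have h2 := weight_le (p := p) (hmem01 l hl q')
    have h3 : 0 ≤ p.weight (gridSpace b M (k + q)) := (Real.exp_pos _).le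
    have h4 : 0 ≤ p.weight (gridSpace b M (l + q')) := (Real.exp_pos _).le
    exact ⟨mul_nonneg h3 h4, mul_le_mul h1 h2 h4 hW0.le⟩
  have hEW : E ≤ W * W := by
    have := (hwb 1 0).2
    simpa [hw10] using this
  set R : Fin 2 → Fin 2 → ℝ := fun q q' => E2 (gridSpace b M (k + q)) (gridSpace b M (l + q')) with hR
  have hcA : p.sigmaSq * Real.sqrt D * E * coefA th r J L
      = c * E * (2 * Real.sqrt (th * D)) * (2 * G L - G (L + 1) - G (L - 1)) := by
    rw [coefA, Lam_eq, Real.sqrt_mul hth.le, hc]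
    simp only [hG]
    have h1 := Real.sqrt_pos.2 hth
    have h2 : th = Real.sqrt th * Real.sqrt th := (Real.mul_self_sqrt hth.le).symm
    rw [← hh, h2]
    have h3 : Real.sqrt (Real.sqrt th * Real.sqrt th) = Real.sqrt th := by rw [← h2]
    rw [h3]
    field_simp
    ring
  -- The corners (0,0) and (1,1) share the spatial lag L, so their weights exp(a) and exp(-a) appear
  -- only through the sum. The mixed corners carry exactly the midpoint weight. Hence the whole
  -- error is the remainder terms plus one cosh defect.
  have hexp : covIncr p T b M N i k j l - p.sigmaSq * Real.sqrt D * E * coefA th r J L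
      = c * (w (k + (1 : Fin 2)) * w (l + (1 : Fin 2)) * R 1 1 + w (k + (0 : Fin 2)) * w (l + (0 : Fin 2)) * R 0 0
        - w (k + (1 : Fin 2)) * w (l + (0 : Fin 2)) * R 1 0 - w (k + (0 : Fin 2)) * w (l + (1 : Fin 2)) * R 0 1)
        + c * (E * ((Real.exp a + Real.exp (-a) - 2) * (2 * Real.sqrt (th * D) * G L))) := by
    rw [hcov, hcA]
    simp only [Fin.sum_univ_two, incrSign, hR]
    simp only [Fin.isValue, ↓reduceIte, one_ne_zero, Fin.val_zero, Fin.val_one, add_zero,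
      Nat.cast_one, sub_zero, CharP.cast_eq_zero]
    rw [hw00, hw11, hw10, hw01, add_sub_cancel_right]
    ring
  rw [hexp]
  have hsplit : th * D * Real.sqrt (th * D) = th * Real.sqrt th * (D * Real.sqrt D) := by
    rw [Real.sqrt_mul hth.le]; ring
  have hb1 : ∀ q q' : Fin 2, |w (k + q) * w (l + q') * R q q'|
      ≤ W * W * (2 * C₀ * (th * Real.sqrt th * (D * Real.sqrt D))) := by
    intro q q'
    rw [abs_mul, abs_of_nonneg (hwb q q').1, ← hsplit]
    exact mul_le_mul (hwb q q').2 (hE2b q q') (abs_nonneg _) (by positivity)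
  have hcosh : |Real.exp a + Real.exp (-a) - 2| ≤ K * D := by
    refine (cosh_defect_le a).trans ?_
    have e1 : a ^ 2 = κ ^ 2 / 4 * r ^ 2 * D := by
      rw [ha, hδr, div_pow, mul_pow, mul_pow, Real.sq_sqrt hD.le]; ring
    have e2 : a ^ 2 / 2 ≤ κ ^ 2 / 8 := by
      have : δ ^ 2 ≤ 1 := pow_le_one₀ hδ0.le hδ1
      rw [ha]
      nlinarith [sq_nonneg κ]
    calc a ^ 2 * Real.exp (a ^ 2 / 2) ≤ a ^ 2 * Real.exp (κ ^ 2 / 8) := by gcongr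
      _ = K * D := by rw [e1, hK]; ring
  have hb2 : |E * ((Real.exp a + Real.exp (-a) - 2) * (2 * Real.sqrt (th * D) * G L))|
      ≤ W * W * (K * (8 * Real.sqrt th)) * (D * Real.sqrt D) := by
    rw [abs_mul E, abs_mul (_ - _), abs_of_nonneg hE0]
    calc _ ≤ W * W * (K * D * (8 * Real.sqrt (th * D))) := by
          gcongr
          exact hGb L
      _ = _ := by rw [Real.sqrt_mul hth.le]; ring
  calc _ ≤ c * (4 * (W * W * (2 * C₀ * (th * Real.sqrt th * (D * Real.sqrt D)))))
      + c * (W * W * (K * (8 * Real.sqrt th)) * (D * Real.sqrt D)) := by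
        refine (abs_add_le _ _).trans (add_le_add ?_ ?_)
        · rw [abs_mul, abs_of_pos hc0]
          refine mul_le_mul_of_nonneg_left ?_ hc0.le
          exact abs_add_sub_sub_le (hb1 1 1) (hb1 0 0) (hb1 1 0) (hb1 0 1)
        · rw [abs_mul, abs_of_pos hc0]
          exact mul_le_mul_of_nonneg_left hb2 hc0.le
    _ = _ := by ring

end FieldCov


/-! ### Decay of the limiting covariances -/

section Decay

/-- The array `c` decays like `1 / ((1 + |j|) (1 + |l|))`. -/
def Decays (c : ℤ → ℤ → ℝ) : Prop :=
  ∃ C : ℝ, 0 ≤ C ∧ ∀ j l : ℤ, |c j l| ≤ C * ((1 + |(j : ℝ)|)⁻¹ * (1 + |(l : ℝ)|)⁻¹)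

lemma inv_one_add_abs_shift_le (j a : ℤ) :
    (1 + |((j + a : ℤ) : ℝ)|)⁻¹ ≤ (1 + |(a : ℝ)|) * (1 + |(j : ℝ)|)⁻¹ := by
  have h1 : |(j : ℝ)| ≤ |((j + a : ℤ) : ℝ)| + |(a : ℝ)| := by
    have := abs_sub ((j + a : ℤ) : ℝ) (a : ℝ)
    push_cast at this ⊢
    simpa using this
  rw [inv_le_iff_one_le_mul₀ (by positivity), mul_comm, ← mul_assoc, ← div_eq_mul_inv,
    le_div_iff₀ (by positivity)]
  nlinarith [abs_nonneg ((j + a : ℤ) : ℝ), abs_nonneg (a : ℝ),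
    mul_nonneg (abs_nonneg ((j + a : ℤ) : ℝ)) (abs_nonneg (a : ℝ))]

lemma Decays.add {c d : ℤ → ℤ → ℝ} (hc : Decays c) (hd : Decays d) :
    Decays fun j l => c j l + d j l := by
  obtain ⟨C, hC, h⟩ := hc
  obtain ⟨C', hC', h'⟩ := hd
  refine ⟨C + C', by positivity, fun j l => (abs_add_le _ _).trans ?_⟩
  rw [add_mul]
  exact add_le_add (h j l) (h' j l)

lemma Decays.const_mul {c : ℤ → ℤ → ℝ} (hc : Decays c) (a : ℝ) : Decays fun j l => a * c j l := by
  obtain ⟨C, hC, h⟩ := hc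
  refine ⟨|a| * C, by positivity, fun j l => ?_⟩
  rw [abs_mul, mul_assoc]
  gcongr
  exact h j l

lemma Decays.shift {c : ℤ → ℤ → ℝ} (hc : Decays c) (a b : ℤ) :
    Decays fun j l => c (j + a) (l + b) := by
  obtain ⟨C, hC, h⟩ := hc
  refine ⟨C * ((1 + |(a : ℝ)|) * (1 + |(b : ℝ)|)), by positivity, fun j l => (h _ _).trans ?_⟩
  calc _ ≤ C * (((1 + |(a : ℝ)|) * (1 + |(j : ℝ)|)⁻¹) * ((1 + |(b : ℝ)|) * (1 + |(l : ℝ)|)⁻¹)) := by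
        gcongr
        · exact inv_one_add_abs_shift_le j a
        · exact inv_one_add_abs_shift_le l b
    _ = _ := by ring

lemma Decays.summable_sq {c : ℤ → ℤ → ℝ} (hc : Decays c) :
    Summable fun q : ℤ × ℤ => c q.1 q.2 ^ 2 := by
  obtain ⟨C, hC, h⟩ := hc
  have h1 := summable_inv_one_add_abs_sq
  have h2 := (h1.mul_of_nonneg h1 (fun _ => by positivity) (fun _ => by positivity)).mul_left (C ^ 2)
  refine Summable.of_nonneg_of_le (fun _ => by positivity) (fun q => ?_) h2
  calc c q.1 q.2 ^ 2 = |c q.1 q.2| ^ 2 := (sq_abs _).symm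
    _ ≤ (C * ((1 + |(q.1 : ℝ)|)⁻¹ * (1 + |(q.2 : ℝ)|)⁻¹)) ^ 2 := by gcongr; exact h _ _
    _ = _ := by rw [mul_pow, mul_pow, inv_pow, inv_pow]

/-- Two applications of the mean value theorem. The condition n ≥ 1 keeps the intermediate point
away from the singularity at time 0. -/
lemma exists_diff2_heatInt_eq (x : ℝ) {n : ℕ} (hn : 1 ≤ n) :
    ∃ ζ : ℝ, (n : ℝ) ≤ ζ ∧ (heatInt ((n + 2 : ℕ) * 1) x - heatInt ((n + 1 : ℕ) * 1) x)
      - (heatInt ((n + 1 : ℕ) * 1) x - heatInt (n * 1) x) = heatDeriv ζ x := by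
  have hn0 : (0 : ℝ) < n := by exact_mod_cast hn
  have hφ : ∀ t : ℝ, 0 < t → HasDerivAt (fun t => heatInt (t + 1) x - heatInt t x)
      (heat (t + 1) x - heat t x) t := fun t ht =>
    ((hasDerivAt_heatInt (by linarith : 0 < t + 1) x).comp_add_const t 1).fun_sub
      (hasDerivAt_heatInt ht x)
  obtain ⟨ξ, hξ, e1⟩ := exists_hasDerivAt_eq_slope (fun t => heatInt (t + 1) x - heatInt t x)
    (fun t => heat (t + 1) x - heat t x) (a := (n : ℝ)) (b := n + 1) (by linarith)
    (fun t ht => (hφ t (hn0.trans_le ht.1)).continuousAt.continuousWithinAt)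
    (fun t ht => hφ t (hn0.trans ht.1))
  have hξ0 : 0 < ξ := hn0.trans hξ.1
  obtain ⟨ζ, hζ, e2⟩ := exists_hasDerivAt_eq_slope (fun t => heat t x)
    (fun t => heatDeriv t x) (a := ξ) (b := ξ + 1) (by linarith)
    (fun t ht => (hasDerivAt_heat (hξ0.trans_le ht.1) x).continuousAt.continuousWithinAt)
    (fun t ht => hasDerivAt_heat (hξ0.trans ht.1) x)
  refine ⟨ζ, (hξ.1.trans hζ.1).le, ?_⟩
  rw [e2, add_sub_cancel_left, div_one, e1, add_sub_cancel_left, div_one]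
  push_cast
  simp only [mul_one]
  rw [add_assoc, one_add_one_eq_two]

lemma heatInt_le_of_le_two {t x : ℝ} (ht : 0 ≤ t) (ht2 : t ≤ 2) (hx : x ≠ 0) :
    |heatInt t x| ≤ 64 / x ^ 2 := by
  have hx2 : 0 < x ^ 2 := by positivity
  rw [← integral_heat ht]
  have := intervalIntegral.norm_integral_le_of_norm_le_const (a := 0) (b := t)
    (f := fun v => heat v x) (C := 32 / x ^ 2) (fun v hv => by
      rw [uIoc_of_le ht] at hv
      rw [Real.norm_of_nonneg (heat_nonneg _ _)]
      refine (heat_le_sqrt_div_sq hv.1.le hx).trans ?_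
      gcongr
      have : Real.sqrt v ≤ 2 := by
        rw [Real.sqrt_le_left (by norm_num)]
        nlinarith [hv.2]
      linarith)
  rw [Real.norm_eq_abs, sub_zero, abs_of_nonneg ht] at this
  refine this.trans ?_
  calc 32 / x ^ 2 * t ≤ 32 / x ^ 2 * 2 := by gcongr
    _ = _ := by ring

/-- For |j| ≥ 2 the second difference is a value of the kernel's time derivative at a time
comparable to |j|, bounded by 1/(ζ|x|), or by ζ^(-3/2) when l = 0. For |j| ≤ 1 only times up to 2
occur, where the time integral itself is O(1/x²). The constants are generous. -/
lemma decays_diff2_heatInt {h : ℝ} (hh : 0 < h) :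
    Decays fun j l => diff2 (fun t => heatInt t (h * l)) 1 j := by
  refine ⟨48 * (1 + h⁻¹) + 1600 * (1 + (h ^ 2)⁻¹), by positivity, fun j l => ?_⟩
  beta_reduce
  have hl : (l : ℝ) = 0 ∨ 1 ≤ |(l : ℝ)| := by
    rcases eq_or_ne l 0 with rfl | h0
    · simp
    · right; exact_mod_cast Int.one_le_abs h0
  have hP : 0 ≤ (1 + |(j : ℝ)|)⁻¹ * (1 + |(l : ℝ)|)⁻¹ := by positivity
  have hj : ((j.natAbs : ℕ) : ℝ) = |(j : ℝ)| := by rw [Nat.cast_natAbs]; simp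
  rcases le_or_gt 2 j.natAbs with h2 | h2
  · obtain ⟨n, hn, e⟩ := diff2_of_ne_zero (fun t => heatInt t (h * l)) 1 (J := j) (by omega)
    obtain ⟨ζ, hζ, e2⟩ := exists_diff2_heatInt_eq (h * l) (n := n) (by omega)
    rw [e, e2]
    have hn1 : (1 : ℝ) ≤ n := by exact_mod_cast (by omega : 1 ≤ n)
    have hjn : |(j : ℝ)| = n + 1 := by rw [← hj, hn]; push_cast; rfl
    have hζ0 : 0 < ζ := by linarith
    have hζi : ζ⁻¹ ≤ 3 * (1 + |(j : ℝ)|)⁻¹ := by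
      rw [hjn, ← div_eq_mul_inv, inv_eq_one_div, div_le_div_iff₀ hζ0 (by positivity)]
      linarith
    have key : |heatDeriv ζ (h * l)| ≤ 48 * (1 + h⁻¹) * ((1 + |(j : ℝ)|)⁻¹ * (1 + |(l : ℝ)|)⁻¹) := by
      rcases hl with hl | hl
      · have h3 := abs_heatDeriv_le hζ0 (h * l)
        have h4 : (Real.sqrt ζ)⁻¹ ≤ 1 := inv_le_one_of_one_le₀ (Real.one_le_sqrt.2 (by linarith))
        rw [hl, abs_zero, add_zero, inv_one, mul_one]
        rw [hl] at h3
        calc _ ≤ 4 * (1 * ζ⁻¹) := by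
              refine h3.trans ?_
              rw [div_eq_mul_inv]
              gcongr
          _ ≤ 48 * (1 + 0) * (1 + |(j : ℝ)|)⁻¹ := by linarith [inv_nonneg.2 hζ0.le]
          _ ≤ _ := by gcongr; positivity
      · have hl0 : 0 < |(l : ℝ)| := by linarith
        have hl1 : (l : ℝ) ≠ 0 := abs_pos.1 hl0
        have h3 := abs_heatDeriv_le_inv_mul hζ0 (x := h * l) (by positivity)
        have h5 : |(l : ℝ)|⁻¹ ≤ 2 * (1 + |(l : ℝ)|)⁻¹ := by
          rw [← div_eq_mul_inv, inv_eq_one_div, div_le_div_iff₀ hl0 (by positivity)]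
          linarith
        calc _ ≤ 8 * ((3 * (1 + |(j : ℝ)|)⁻¹) * (h⁻¹ * (2 * (1 + |(l : ℝ)|)⁻¹))) := by
              refine h3.trans ?_
              rw [abs_mul, abs_of_pos hh, mul_inv]
              gcongr
          _ = 48 * (0 + h⁻¹) * ((1 + |(j : ℝ)|)⁻¹ * (1 + |(l : ℝ)|)⁻¹) := by ring
          _ ≤ _ := by gcongr; norm_num
    refine key.trans (mul_le_mul_of_nonneg_right ?_ hP)
    have : 0 ≤ 1600 * (1 + (h ^ 2)⁻¹) := by positivity
    linarith
  · have hj1 : |(j : ℝ)| ≤ 1 := by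
      rw [← hj]; exact_mod_cast (by omega : j.natAbs ≤ 1)
    have hji : 1 ≤ 2 * (1 + |(j : ℝ)|)⁻¹ := by
      rw [← div_eq_mul_inv, le_div_iff₀ (by positivity)]
      linarith
    have key : |diff2 (fun t => heatInt t (h * l)) 1 j|
        ≤ 1600 * (1 + (h ^ 2)⁻¹) * ((1 + |(j : ℝ)|)⁻¹ * (1 + |(l : ℝ)|)⁻¹) := by
      rcases hl with hl | hl
      · have h3 := abs_diff2_le_of_holder (F := fun t => heatInt t (h * l)) (C := 4) (D := 1)
          (τ := ((j.natAbs + 1 : ℕ) : ℝ) * 1) zero_le_one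
          (fun s t hs hst _ => holder_heatInt _ hs hst) (J := j) le_rfl
        rw [Real.sqrt_one] at h3
        calc _ ≤ 1600 * (1 + 0) * ((1 + |(j : ℝ)|)⁻¹ * 1) := by linarith
          _ ≤ _ := by
            have h6 : 0 ≤ (h ^ 2)⁻¹ * (1 + |(j : ℝ)|)⁻¹ := by positivity
            rw [hl, abs_zero, add_zero (1 : ℝ), inv_one]
            linarith
      · have hl0 : 0 < |(l : ℝ)| := by linarith
        have hl1 : (l : ℝ) ≠ 0 := abs_pos.1 hl0
        have hb : ∀ t : ℝ, 0 ≤ t → t ≤ 2 → |heatInt t (h * l)| ≤ 64 / (h * l) ^ 2 := fun t h0 h2 =>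
          heatInt_le_of_le_two h0 h2 (by positivity)
        have h3 : |diff2 (fun t => heatInt t (h * l)) 1 j| ≤ 4 * (64 / (h * l) ^ 2) := by
          rcases eq_or_ne j 0 with rfl | h0
          · rw [diff2_zero, show ∀ a b : ℝ, 2 * (a - b) = a + a - b - b by intros; ring]
            exact abs_add_sub_sub_le (hb _ (by norm_num) (by norm_num)) (hb _ (by norm_num) (by norm_num))
              (hb _ (by norm_num) (by norm_num)) (hb _ (by norm_num) (by norm_num))
          · obtain ⟨n, hn, e⟩ := diff2_of_ne_zero (fun t => heatInt t (h * l)) 1 (J := j) h0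
            obtain rfl : n = 0 := by omega
            rw [e, show ∀ a b c : ℝ, a - b - (b - c) = a + c - b - b by intros; ring]
            exact abs_add_sub_sub_le (hb _ (by norm_num) (by norm_num)) (hb _ (by norm_num) (by norm_num))
              (hb _ (by norm_num) (by norm_num)) (hb _ (by norm_num) (by norm_num))
        have h5 : (|(l : ℝ)| ^ 2)⁻¹ ≤ 2 * (1 + |(l : ℝ)|)⁻¹ := by
          rw [← div_eq_mul_inv, inv_eq_one_div, div_le_div_iff₀ (by positivity) (by positivity)]
          nlinarith
        calc _ ≤ 256 * (0 + (h ^ 2)⁻¹) * (1 * (|(l : ℝ)| ^ 2)⁻¹) := by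
              refine h3.trans (le_of_eq ?_)
              rw [sq_abs]
              field_simp
              ring
          _ ≤ 200 * (1 + (h ^ 2)⁻¹) * ((2 * (1 + |(j : ℝ)|)⁻¹) * (2 * (1 + |(l : ℝ)|)⁻¹)) * 2 := by
              have : 256 * (0 + (h ^ 2)⁻¹) ≤ 400 * (1 + (h ^ 2)⁻¹) := by
                have : 0 ≤ (h ^ 2)⁻¹ := by positivity
                linarith
              calc _ ≤ 400 * (1 + (h ^ 2)⁻¹) *
                    ((2 * (1 + |(j : ℝ)|)⁻¹) * (2 * (1 + |(l : ℝ)|)⁻¹)) := by gcongr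
                _ = _ := by ring
          _ ≤ _ := le_of_eq (by ring)
    refine key.trans (mul_le_mul_of_nonneg_right ?_ hP)
    have : 0 ≤ 48 * (1 + h⁻¹) := by positivity
    linarith

/-- The second difference in time already provides decay in both lags, so the difference in space is
treated as a mere linear combination of shifts. -/
theorem decays_coefA {th r : ℝ} (hth : 0 < th) (hr : 0 < r) : Decays (coefA th r) := by
  set h := r / Real.sqrt th with hh
  have hth' := Real.sqrt_pos.2 hth
  have hh0 : 0 < h := by positivity
  have hd := decays_diff2_heatInt hh0
  have key : ∀ j l : ℤ, covG h (j + 1) l + covG h (j - 1) l - 2 * covG h j l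
      = 2⁻¹ * diff2 (fun t => heatInt t (h * l)) 1 j := by
    intro j l
    have e : ∀ j : ℤ, heatInt (j.natAbs * 1) (h * l) = 2 * covG h j l := by
      intro j
      have := covG_eq_heatInt one_pos one_pos h hh0.le j l
      simpa using this
    rw [diff2, e, e, e]
    ring
  have h1 := ((((hd.shift 0 1).add (hd.shift 0 (-1))).add (hd.const_mul (-2))).const_mul
    (-(2⁻¹ * (Real.sqrt th)⁻¹)))
  convert h1 using 3 with j l
  rw [coefA, Lam_eq, key, key, key]
  simp only [add_zero, ← sub_eq_add_neg]
  field_simp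
  ring

theorem decays_coefC {th r : ℝ} (hth : 0 < th) (hr : 0 < r) : Decays (coefC th r) := by
  have h := decays_coefA hth hr
  change Decays fun j l => coefA th r j l + coefA th r (j - 1) l
  simpa [← sub_eq_add_neg] using h.add (h.shift (-1) 0)

theorem decays_coefB {th r : ℝ} (hth : 0 < th) (hr : 0 < r) : Decays (coefB th r) := by
  have h := decays_coefA hth hr
  change Decays fun j l => 2 * coefA th r j l + coefA th r (j - 1) l + coefA th r (j + 1) l
  simpa [← sub_eq_add_neg] using ((h.const_mul 2).add (h.shift (-1) 0)).add (h.shift 1 0)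

end Decay


/-! ### Quadratic forms of Gaussian vectors -/

section GaussianQuadratic

lemma integral_pow_four_gaussianReal : ∫ x, x ^ 4 ∂(gaussianReal 0 1) = 3 := by
  rw [integral_gaussianReal_eq_integral_smul (by norm_num)]
  have h1 : ∀ x : ℝ, gaussianPDFReal 0 1 x • x ^ 4
      = (Real.sqrt (2 * Real.pi))⁻¹ * (|x| ^ (4 : ℝ) * Real.exp (-(1 / 2) * |x| ^ (2 : ℝ))) := by
    intro x
    rw [gaussianPDFReal, smul_eq_mul]
    have e4 : |x| ^ (4 : ℝ) = x ^ 4 := by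
      rw [show (4 : ℝ) = ((4 : ℕ) : ℝ) by norm_num, Real.rpow_natCast, Even.pow_abs (by decide)]
    have e2 : |x| ^ (2 : ℝ) = x ^ 2 := by
      rw [show (2 : ℝ) = ((2 : ℕ) : ℝ) by norm_num, Real.rpow_natCast, Even.pow_abs (by decide)]
    rw [e4, e2]
    have : -(x - 0) ^ 2 / (2 * ((1 : ℝ≥0) : ℝ)) = -(1 / 2) * x ^ 2 := by simp; ring
    rw [this]
    simp
    ring
  simp only [h1]
  rw [integral_const_mul, integral_comp_abs (f := fun x => x ^ (4 : ℝ) * Real.exp (-(1 / 2) * x ^ (2 : ℝ))),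
    integral_rpow_mul_exp_neg_mul_rpow (by norm_num) (by norm_num) (by norm_num)]
  have hG : Real.Gamma ((4 + 1) / 2) = 3 / 4 * Real.sqrt Real.pi := by
    rw [show ((4 : ℝ) + 1) / 2 = (1 / 2 + 1) + 1 by norm_num, Real.Gamma_add_one (by norm_num),
      Real.Gamma_add_one (by norm_num), Real.Gamma_one_half_eq]
    ring
  have hp : (1 / 2 : ℝ) ^ (-(4 + 1) / 2 : ℝ) = 4 * Real.sqrt 2 := by
    rw [one_div, Real.inv_rpow (by norm_num), ← Real.rpow_neg (by norm_num),
      show -(-((4 : ℝ) + 1) / 2) = ((2 : ℕ) : ℝ) + 1 / 2 by norm_num, Real.rpow_add (by norm_num),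
      Real.rpow_natCast, ← Real.sqrt_eq_rpow]
    norm_num
  rw [hG, hp, Real.sqrt_mul (by norm_num)]
  have h2 := Real.sqrt_pos.2 (by norm_num : (0 : ℝ) < 2)
  have h3 := Real.sqrt_pos.2 Real.pi_pos
  field_simp

lemma integral_sq_gaussianReal : ∫ x, x ^ 2 ∂(gaussianReal 0 1) = 1 := by
  have h := variance_id_gaussianReal (μ := 0) (v := 1)
  rw [variance_eq_integral (by fun_prop)] at h
  simpa using h

lemma integrable_pow_gaussianReal (n : ℕ) : Integrable (fun x : ℝ => x ^ n) (gaussianReal 0 1) := by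
  have h := memLp_id_gaussianReal (μ := 0) (v := 1) n
  have := h.integrable_norm_pow'
  refine (integrable_norm_iff (by fun_prop)).1 ?_
  simpa using this

lemma integral_sq_sub_one_gaussianReal : ∫ x, (x ^ 2 - 1) ∂(gaussianReal 0 1) = 0 := by
  rw [integral_sub (integrable_pow_gaussianReal 2) (integrable_const _), integral_sq_gaussianReal]
  simp

lemma integral_sq_sub_one_sq_gaussianReal :
    ∫ x, (x ^ 2 - 1) ^ 2 ∂(gaussianReal 0 1) = 2 := by
  have : ∀ x : ℝ, (x ^ 2 - 1) ^ 2 = x ^ 4 - 2 * x ^ 2 + 1 := by intro x; ring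
  simp only [this]
  have hi : Integrable (fun x : ℝ => x ^ 4 - 2 * x ^ 2) (gaussianReal 0 1) :=
    (integrable_pow_gaussianReal 4).sub ((integrable_pow_gaussianReal 2).const_mul 2)
  rw [integral_add hi (integrable_const _), integral_sub (integrable_pow_gaussianReal 4)
    ((integrable_pow_gaussianReal 2).const_mul 2), integral_const_mul, integral_sq_gaussianReal,
    integral_pow_four_gaussianReal]
  simp
  norm_num

/-- The characteristic function of `ξ² - 1` for a standard normal variable `ξ`. -/
noncomputable def chiChar (t : ℝ) : ℂ := expI (gaussianReal 0 1) fun x => t * (x ^ 2 - 1)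

lemma norm_expI_le {Ω : Type*} [MeasurableSpace Ω] (P : Measure Ω) [IsProbabilityMeasure P]
    (Y : Ω → ℝ) : ‖expI P Y‖ ≤ 1 := by
  refine (norm_integral_le_of_norm_le_const (C := 1)
    (ae_of_all _ fun ω => norm_exp_ofReal_mul_I_le _)).trans ?_
  simp

/-- A standard normal ξ makes ξ² - 1 centred with variance 2, so both functions are 1 - t² + o(t²).
Division by √2 normalizes the variance for the second order expansion. -/
lemma chiChar_sub_isLittleO :
    (fun t : ℝ => chiChar t - Complex.exp ((-t ^ 2 : ℝ))) =o[𝓝 0] fun t => t ^ 2 := by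
  set X : ℝ → ℝ := fun x => (x ^ 2 - 1) / Real.sqrt 2 with hX
  have hs : Real.sqrt 2 ≠ 0 := by positivity
  have h0 : (gaussianReal 0 1)[X] = 0 := by
    simp only [hX]
    rw [integral_div, integral_sq_sub_one_gaussianReal, zero_div]
  have h1 : (gaussianReal 0 1)[X ^ 2] = 1 := by
    have : ∀ x, (X ^ 2) x = (x ^ 2 - 1) ^ 2 / 2 := by
      intro x; simp only [hX, Pi.pow_apply, div_pow]; rw [Real.sq_sqrt (by norm_num)]
    simp only [this]
    rw [integral_div, integral_sq_sub_one_sq_gaussianReal]; norm_num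
  have hXm : Measurable X := by fun_prop
  have ht := taylor_charFun_two hXm.aemeasurable h0 h1
  have hlim : Tendsto (fun t : ℝ => Real.sqrt 2 * t) (𝓝 0) (𝓝 0) := by
    have : Continuous fun t : ℝ => Real.sqrt 2 * t := by fun_prop
    simpa using this.tendsto 0
  have ht2 := ht.comp_tendsto hlim
  have e1 : ∀ t : ℝ, charFun ((gaussianReal 0 1).map X) (Real.sqrt 2 * t) = chiChar t := by
    intro t
    rw [chiChar, expI, charFun_apply_real, integral_map hXm.aemeasurable (by fun_prop)]
    congr 1 with x
    congr 1
    simp only [hX]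
    push_cast
    have : ((Real.sqrt 2 : ℝ) : ℂ) ≠ 0 := by exact_mod_cast hs
    field_simp
  have h3 : (fun t : ℝ => chiChar t - (1 - (t : ℂ) ^ 2)) =o[𝓝 0] fun t => t ^ 2 := by
    have h4 : (fun t : ℝ => chiChar t - (1 - (t : ℂ) ^ 2)) =o[𝓝 0]
        fun t : ℝ => (Real.sqrt 2 * t) ^ 2 := by
      refine ht2.congr' (Eventually.of_forall fun t => ?_) (Eventually.of_forall fun t => rfl)
      simp only [Function.comp_apply, e1]
      push_cast
      rw [mul_pow, show ((Real.sqrt 2 : ℝ) : ℂ) ^ 2 = 2 by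
        exact_mod_cast congrArg Complex.ofReal (Real.sq_sqrt (by norm_num : (0:ℝ) ≤ 2))]
      ring
    refine h4.trans_isBigO ?_
    refine Asymptotics.IsBigO.of_bound 2 (Eventually.of_forall fun t => ?_)
    rw [mul_pow, Real.sq_sqrt (by norm_num), norm_mul]
    simp
  have h5 : (fun t : ℝ => (1 - (t : ℂ) ^ 2) - Complex.exp ((-t ^ 2 : ℝ))) =o[𝓝 0] fun t => t ^ 2 := by
    have hd : HasDerivAt Real.exp 1 0 := by simpa using Real.hasDerivAt_exp 0
    have h6 := hd.isLittleO
    have hl : Tendsto (fun t : ℝ => -t ^ 2) (𝓝 0) (𝓝 0) := by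
      have : Continuous fun t : ℝ => -t ^ 2 := by fun_prop
      simpa using this.tendsto 0
    have h7 := h6.comp_tendsto hl
    refine Asymptotics.IsLittleO.of_norm_left ?_
    have h8 := h7.norm_left.trans_isBigO (k := fun t : ℝ => t ^ 2)
      (Asymptotics.IsBigO.of_bound 1 (Eventually.of_forall fun t => by simp))
    refine h8.congr' (Eventually.of_forall fun t => ?_) (Eventually.of_forall fun t => rfl)
    simp only [Function.comp_apply]
    rw [← Complex.norm_real, ← norm_neg]
    congr 1
    push_cast
    simp
    ring
  refine (h3.add h5).congr' (Eventually.of_forall fun t => ?_) (Eventually.of_forall fun t => rfl)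
  ring

/-- Replace the factors one at a time; all other factors have modulus at most 1. -/
lemma norm_prod_sub_prod_le {ι : Type*} (s : Finset ι) {a b : ι → ℂ} (ha : ∀ i, ‖a i‖ ≤ 1)
    (hb : ∀ i, ‖b i‖ ≤ 1) : ‖∏ i ∈ s, a i - ∏ i ∈ s, b i‖ ≤ ∑ i ∈ s, ‖a i - b i‖ := by
  classical
  induction s using Finset.induction_on with
  | empty => simp
  | insert i s hi ih =>
    rw [Finset.prod_insert hi, Finset.prod_insert hi, Finset.sum_insert hi]
    have hbs : ‖∏ i ∈ s, b i‖ ≤ 1 := by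
      rw [norm_prod]; exact Finset.prod_le_one (fun _ _ => norm_nonneg _) fun j _ => hb j
    calc _ = ‖a i * (∏ i ∈ s, a i - ∏ i ∈ s, b i) + (a i - b i) * ∏ i ∈ s, b i‖ := by ring_nf
      _ ≤ ‖a i‖ * ‖∏ i ∈ s, a i - ∏ i ∈ s, b i‖ + ‖a i - b i‖ * ‖∏ i ∈ s, b i‖ := by
          refine (norm_add_le _ _).trans ?_
          rw [norm_mul, norm_mul]
      _ ≤ 1 * (∑ i ∈ s, ‖a i - b i‖) + ‖a i - b i‖ * 1 := by gcongr; exact ha i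
      _ = _ := by ring

/-- A Lindeberg replacement: exchanging one factor for its Gaussian counterpart costs o(μ_j²),
uniformly because the largest |μ_j| vanishes, and ∑ μ_j² stays bounded. -/
theorem tendsto_prod_chiChar {ι : ℕ → Type*} [∀ n, Fintype (ι n)] {μ : ∀ n, ι n → ℝ}
    {v : ℝ} (hμ : ∀ ε > 0, ∀ᶠ n in atTop, ∀ j, |μ n j| < ε)
    (hv : Tendsto (fun n => ∑ j, μ n j ^ 2) atTop (𝓝 v)) :
    Tendsto (fun n => ∏ j, chiChar (μ n j)) atTop (𝓝 (Complex.exp ((-v : ℝ)))) := by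
  have hb : ∀ n, ∏ j, Complex.exp ((-μ n j ^ 2 : ℝ)) = Complex.exp ((-∑ j, μ n j ^ 2 : ℝ)) := by
    intro n
    rw [← Complex.exp_sum, ← Finset.sum_neg_distrib]
    push_cast; rfl
  have hc : Continuous fun x : ℝ => Complex.exp ((-x : ℝ)) := by fun_prop
  have h1 : Tendsto (fun n => ∏ j, Complex.exp ((-μ n j ^ 2 : ℝ))) atTop
      (𝓝 (Complex.exp ((-v : ℝ)))) := by
    simp only [hb]
    exact (hc.tendsto v).comp hv
  have h2 : Tendsto (fun n => ∏ j, chiChar (μ n j) - ∏ j, Complex.exp ((-μ n j ^ 2 : ℝ))) atTop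
      (𝓝 0) := by
    rw [Metric.tendsto_atTop]
    intro ε hε
    have hv1 : 0 < |v| + 1 := by positivity
    have hev := chiChar_sub_isLittleO.def (show 0 < ε / (2 * (|v| + 1)) by positivity)
    rw [Metric.eventually_nhds_iff] at hev
    obtain ⟨d, hd, hev⟩ := hev
    have hB' := hμ d hd
    have hv' := hv.eventually (gt_mem_nhds (show v < |v| + 1 by linarith [le_abs_self v]))
    obtain ⟨n0, hn0⟩ := eventually_atTop.1 (hB'.and hv')
    refine ⟨n0, fun n hn => ?_⟩
    obtain ⟨hBn, hvn⟩ := hn0 n hn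
    rw [dist_zero_right]
    calc _ ≤ ∑ j, ‖chiChar (μ n j) - Complex.exp ((-μ n j ^ 2 : ℝ))‖ :=
          norm_prod_sub_prod_le _ (fun j => norm_expI_le _ _) (fun j => by
            rw [Complex.norm_exp, Complex.ofReal_re, Real.exp_le_one_iff]
            nlinarith [sq_nonneg (μ n j)])
      _ ≤ ∑ j, ε / (2 * (|v| + 1)) * μ n j ^ 2 := by
          refine Finset.sum_le_sum fun j _ => ?_
          have := hev (y := μ n j) (by rw [Real.dist_eq, sub_zero]; exact hBn j)
          simpa using this
      _ = ε / (2 * (|v| + 1)) * ∑ j, μ n j ^ 2 := by rw [Finset.mul_sum]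
      _ ≤ ε / (2 * (|v| + 1)) * (|v| + 1) := by gcongr
      _ = ε / 2 := by field_simp
      _ < ε := by linarith
  have := h2.add h1
  simpa using this

/-- `Y` is a centred Gaussian vector with covariance matrix `S`. -/
structure IsGaussianVec {Ω ι : Type*} [MeasurableSpace Ω] [Fintype ι] (P : Measure Ω)
    (Y : ι → Ω → ℝ) (S : Matrix ι ι ℝ) : Prop where
  aemeasurable : ∀ j, AEMeasurable (Y j) P
  symm : S.IsHermitian
  expI_eq : ∀ a : ι → ℝ, expI P (fun ω => ∑ j, a j * Y j ω)
    = Complex.exp ((-(∑ j, ∑ j', a j * a j' * S j j') / 2 : ℝ))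

variable {Ω ι : Type*} [MeasurableSpace Ω] [Fintype ι] {P : Measure Ω} [IsProbabilityMeasure P]
  {Y : ι → Ω → ℝ} {S : Matrix ι ι ℝ}

lemma dotProduct_mulVec_eq (a : ι → ℝ) : a ⬝ᵥ S.mulVec a = ∑ j, ∑ j', a j * a j' * S j j' := by
  simp only [dotProduct, Matrix.mulVec, Finset.mul_sum]
  refine Finset.sum_congr rfl fun j _ => Finset.sum_congr rfl fun j' _ => ?_
  ring

/-- A characteristic function has modulus at most 1, so the exponent cannot be positive.
Semidefiniteness therefore need not be assumed in `IsGaussianVec`. -/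
lemma IsGaussianVec.posSemidef (h : IsGaussianVec P Y S) : S.PosSemidef := by
  refine Matrix.PosSemidef.of_dotProduct_mulVec_nonneg h.symm fun a => ?_
  have h1 := norm_expI_le P fun ω => ∑ j, a j * Y j ω
  rw [h.expI_eq, Complex.norm_exp, Complex.ofReal_re, Real.exp_le_one_iff] at h1
  rw [star_trivial, dotProduct_mulVec_eq]
  linarith

lemma IsGaussianVec.map_eq [DecidableEq ι] (h : IsGaussianVec P Y S) :
    P.map (fun ω => WithLp.toLp 2 fun j => Y j ω) = multivariateGaussian 0 S := by
  have hm : AEMeasurable (fun ω => WithLp.toLp 2 fun j => Y j ω) P := by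
    have h1 : AEMeasurable (fun ω j => Y j ω) P := aemeasurable_pi_lambda _ h.aemeasurable
    exact (by fun_prop : Measurable (WithLp.toLp (V := ι → ℝ) 2)).comp_aemeasurable h1
  have : IsProbabilityMeasure (P.map (fun ω => WithLp.toLp 2 fun j => Y j ω)) :=
    Measure.isProbabilityMeasure_map hm
  refine Measure.ext_of_charFun (funext fun t => ?_)
  rw [charFun_multivariateGaussian h.posSemidef, charFun_apply, integral_map hm (by fun_prop)]
  have h2 := h.expI_eq (fun j => t j)
  rw [expI] at h2
  have e : ∀ ω, inner ℝ (WithLp.toLp 2 fun j => Y j ω) t = ∑ j, t j * Y j ω := by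
    intro ω; simp [PiLp.inner_apply]
  simp only [e, h2, ← dotProduct_mulVec_eq]
  congr 1
  simp
  ring

end GaussianQuadratic


/-! ### Diagonalization of Gaussian quadratic forms and their central limit theorem -/

section GaussianQuadraticSpectral

variable {Ω ι : Type*} [MeasurableSpace Ω] [Fintype ι] {P : Measure Ω}
  {Y : ι → Ω → ℝ} {S : Matrix ι ι ℝ}

lemma trace_mul_self_eq_sum_eigenvalues [DecidableEq ι] {A : Matrix ι ι ℝ} (hA : A.IsHermitian) :
    (A * A).trace = ∑ j, hA.eigenvalues j ^ 2 := by
  conv_lhs => rw [hA.spectral_theorem, ← map_mul, Matrix.diagonal_mul_diagonal,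
    Unitary.conjStarAlgAut_apply, Matrix.trace_mul_comm, ← Matrix.mul_assoc]
  simp [Matrix.trace_diagonal, sq]

/-- Evaluate the eigenvalue equation at a coordinate where the eigenvector has maximal modulus.
Symmetry of the matrix is not needed. -/
lemma abs_le_of_mulVec_eq_smul {A : Matrix ι ι ℝ} {μ B : ℝ} {w : ι → ℝ} (hw : w ≠ 0)
    (h : A.mulVec w = μ • w) (hB : ∀ a, ∑ b, |A a b| ≤ B) : |μ| ≤ B := by
  obtain ⟨i, hi⟩ : ∃ i, w i ≠ 0 := Function.ne_iff.1 hw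
  have : Nonempty ι := ⟨i⟩
  obtain ⟨a, ha⟩ := Finite.exists_max fun a => |w a|
  have ha0 : 0 < |w a| := (abs_pos.2 hi).trans_le (ha i)
  have h1 : ∑ b, A a b * w b = μ * w a := by simpa [Matrix.mulVec, dotProduct] using congrFun h a
  have h2 : |μ| * |w a| ≤ B * |w a| := by
    rw [← abs_mul, ← h1]
    calc _ ≤ ∑ b, |A a b * w b| := Finset.abs_sum_le_sum_abs _ _
      _ ≤ ∑ b, |A a b| * |w a| := by
          refine Finset.sum_le_sum fun b _ => ?_
          rw [abs_mul]
          exact mul_le_mul_of_nonneg_left (ha b) (abs_nonneg _)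
      _ = (∑ b, |A a b|) * |w a| := by rw [Finset.sum_mul]
      _ ≤ _ := by gcongr; exact hB a
  exact le_of_mul_le_mul_right h2 ha0

/-- The centred diagonal quadratic form with coefficients `c`. -/
def quadForm (Y : ι → Ω → ℝ) (S : Matrix ι ι ℝ) (c : ι → ℝ) (ω : Ω) : ℝ :=
  ∑ a, c a * (Y a ω ^ 2 - S a a)

lemma IsGaussianVec.aemeasurable_quadForm (h : IsGaussianVec P Y S) (c : ι → ℝ) :
    AEMeasurable (quadForm Y S c) P := by
  have hY := h.aemeasurable
  unfold quadForm
  fun_prop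

variable [IsProbabilityMeasure P]

open scoped MatrixOrder in
/-- Diagonal quadratic forms of a Gaussian vector are weighted sums of independent `χ²` variables. -/
theorem IsGaussianVec.exists_eigenvalues (h : IsGaussianVec P Y S) (c : ι → ℝ) :
    ∃ μ : ι → ℝ, ∑ j, μ j = ∑ a, c a * S a a ∧
      ∑ j, μ j ^ 2 = ∑ a, ∑ b, c a * c b * S a b ^ 2 ∧
      (∀ B, (∀ a, |c a| * ∑ b, |S a b| ≤ B) → ∀ j, |μ j| ≤ B) ∧
      P.map (fun ω => ∑ a, c a * Y a ω ^ 2)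
        = (Measure.pi fun _ : ι => gaussianReal 0 1).map fun z => ∑ j, μ j * z j ^ 2 := by
  classical
  -- The vector has the law of Rξ with R the root of S and ξ standard normal. The form becomes ξᵀAξ
  -- for the symmetric matrix A = R diag(c) R, and the required numbers are its eigenvalues. In an
  -- eigenbasis of A the coordinates of ξ are again independent standard normal.
  set R := CFC.sqrt S with hR
  have hRR : R * R = S := CFC.sqrt_mul_sqrt_self _ h.posSemidef.nonneg
  have hRs : R.transpose = R := by
    have : R.IsHermitian := (CFC.sqrt_nonneg S).isSelfAdjoint
    rw [← Matrix.conjTranspose_eq_transpose_of_trivial]; exact this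
  set C := Matrix.diagonal c with hC
  set A := R * C * R with hA
  have hAh : A.IsHermitian := by
    rw [Matrix.IsHermitian, Matrix.conjTranspose_eq_transpose_of_trivial, hA,
      Matrix.transpose_mul, Matrix.transpose_mul, hRs, hC, Matrix.diagonal_transpose, Matrix.mul_assoc]
  have hSs : ∀ a b, S b a = S a b := fun a b => by simpa using h.symm.apply a b
  refine ⟨hAh.eigenvalues, ?_, ?_, ?_, ?_⟩
  · have := hAh.trace_eq_sum_eigenvalues
    simp only [RCLike.ofReal_real_eq_id, id_eq] at this
    rw [← this, hA, Matrix.trace_mul_comm, ← Matrix.mul_assoc, hRR, Matrix.trace_mul_comm, hC]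
    simp [Matrix.trace, Matrix.diagonal_mul]
  · rw [← trace_mul_self_eq_sum_eigenvalues, hA,
      show R * C * R * (R * C * R) = R * (C * (R * R) * C * R) by simp only [Matrix.mul_assoc],
      Matrix.trace_mul_comm, Matrix.mul_assoc, hRR, Matrix.mul_assoc, hC]
    simp only [Matrix.trace, Matrix.diag_apply, Matrix.mul_apply]
    refine Finset.sum_congr rfl fun a _ => ?_
    simp only [Matrix.diagonal_apply, ite_mul, zero_mul, Finset.sum_ite_eq, Finset.mem_univ, if_true]
    refine Finset.sum_congr rfl fun b _ => ?_
    rw [hSs a b]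
    ring
  · intro B hB j
    set v : ι → ℝ := ⇑(hAh.eigenvectorBasis j) with hv
    have hv0 : v ≠ 0 := by
      intro h0
      have := hAh.eigenvectorBasis.orthonormal.1 j
      rw [show hAh.eigenvectorBasis j = 0 from by ext i; exact congrFun h0 i, norm_zero] at this
      exact zero_ne_one this
    have hev : A.mulVec v = hAh.eigenvalues j • v := hAh.mulVec_eigenvectorBasis j
    rcases eq_or_ne (hAh.eigenvalues j) 0 with h0 | h0
    · rw [h0, abs_zero]
      obtain ⟨i, -⟩ := Function.ne_iff.1 hv0
      exact le_trans (by positivity) (hB i)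
    -- A nonzero eigenvalue of RCR is also one of CS, with eigenvector CRv. The row sums of CS
    -- involve covariances only, whereas those of A would involve the root R.
    refine abs_le_of_mulVec_eq_smul (A := C * S) (w := (C * R).mulVec v) ?_ ?_ ?_
    · intro hw
      have : A.mulVec v = 0 := by
        rw [hA, Matrix.mul_assoc, ← Matrix.mulVec_mulVec, hw, Matrix.mulVec_zero]
      rw [hev] at this
      exact (smul_ne_zero h0 hv0) this
    · rw [Matrix.mulVec_mulVec, ← hRR, show C * (R * R) * (C * R) = C * R * A by
        rw [hA]; simp only [Matrix.mul_assoc], ← Matrix.mulVec_mulVec, hev, Matrix.mulVec_smul]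
    · intro a
      refine le_of_eq_of_le ?_ (hB a)
      simp only [hC, Matrix.diagonal_mul, abs_mul]
      rw [Finset.mul_sum]
  · set Q : EuclideanSpace ℝ ι → ℝ := fun x => ∑ a, c a * x a ^ 2 with hQ
    have hQm : Measurable Q := by fun_prop
    have hm : AEMeasurable (fun ω => WithLp.toLp 2 fun j => Y j ω) P := by
      have h1 : AEMeasurable (fun ω j => Y j ω) P := aemeasurable_pi_lambda _ h.aemeasurable
      exact (by fun_prop : Measurable (WithLp.toLp (V := ι → ℝ) 2)).comp_aemeasurable h1
    have e1 : P.map (fun ω => ∑ a, c a * Y a ω ^ 2) = (multivariateGaussian 0 S).map Q := by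
      rw [← h.map_eq, AEMeasurable.map_map_of_aemeasurable hQm.aemeasurable hm]
      rfl
    rw [e1, multivariateGaussian, stdGaussian_eq_map_pi_orthonormalBasis hAh.eigenvectorBasis,
      Measure.map_map (by fun_prop) (by fun_prop), Measure.map_map (by fun_prop) (by fun_prop)]
    congr 1
    funext z
    simp only [Function.comp_apply, zero_add]
    set ξ : EuclideanSpace ℝ ι := ∑ i, z i • hAh.eigenvectorBasis i with hξ
    have e2 : Q (Matrix.toEuclideanCLM (𝕜 := ℝ) R ξ)
        = inner ℝ ξ (Matrix.toEuclideanCLM (𝕜 := ℝ) A ξ) := by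
      rw [Matrix.inner_toEuclideanCLM, hA, Matrix.mul_assoc, ← Matrix.mulVec_mulVec,
        Matrix.dotProduct_mulVec, ← Matrix.mulVec_transpose, hRs, ← Matrix.mulVec_mulVec]
      simp only [hQ, Matrix.ofLp_toEuclideanCLM, hC, Matrix.mulVec_diagonal, dotProduct]
      refine Finset.sum_congr rfl fun a _ => ?_
      ring
    have e3 : Matrix.toEuclideanCLM (𝕜 := ℝ) A ξ
        = ∑ i, (hAh.eigenvalues i * z i) • hAh.eigenvectorBasis i := by
      rw [hξ, map_sum]
      refine Finset.sum_congr rfl fun i _ => ?_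
      rw [map_smul]
      have : Matrix.toEuclideanCLM (𝕜 := ℝ) A (hAh.eigenvectorBasis i)
          = hAh.eigenvalues i • hAh.eigenvectorBasis i := by
        ext k
        rw [Matrix.ofLp_toEuclideanCLM, hAh.mulVec_eigenvectorBasis i]
        rfl
      rw [this, smul_smul, mul_comm]
    rw [e2, e3, hξ, hAh.eigenvectorBasis.orthonormal.inner_sum]
    refine Finset.sum_congr rfl fun i _ => ?_
    simp
    ring

/-- The trace identity ∑ μ_j = ∑ c_a S_aa makes the centrings of both sides agree. -/
lemma IsGaussianVec.exists_map_quadForm (h : IsGaussianVec P Y S) (c : ι → ℝ) :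
    ∃ μ : ι → ℝ, ∑ j, μ j ^ 2 = ∑ a, ∑ b, c a * c b * S a b ^ 2 ∧
      (∀ B, (∀ a, |c a| * ∑ b, |S a b| ≤ B) → ∀ j, |μ j| ≤ B) ∧
      P.map (quadForm Y S c)
        = (Measure.pi fun _ : ι => gaussianReal 0 1).map fun z => ∑ j, μ j * (z j ^ 2 - 1) := by
  obtain ⟨μ, h1, h2, h3, h4⟩ := h.exists_eigenvalues c
  have hY := h.aemeasurable
  refine ⟨μ, h2, h3, ?_⟩
  have e1 : quadForm Y S c = (fun x => x - ∑ a, c a * S a a) ∘ fun ω => ∑ a, c a * Y a ω ^ 2 := by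
    funext ω
    simp only [quadForm, Function.comp_apply, mul_sub, Finset.sum_sub_distrib]
  have e2 : (fun z : ι → ℝ => ∑ j, μ j * (z j ^ 2 - 1))
      = (fun x => x - ∑ a, c a * S a a) ∘ fun z => ∑ j, μ j * z j ^ 2 := by
    funext z
    simp only [Function.comp_apply, mul_sub, Finset.sum_sub_distrib, ← h1, mul_one]
  rw [e1, e2, ← AEMeasurable.map_map_of_aemeasurable (by fun_prop) (by fun_prop), h4,
    Measure.map_map (by fun_prop) (by fun_prop)]

lemma memLp_chi : MemLp (fun x : ℝ => x ^ 2 - 1) 2 (gaussianReal 0 1) := by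
  rw [memLp_two_iff_integrable_sq (by fun_prop)]
  refine Integrable.of_integral_ne_zero ?_
  rw [integral_sq_sub_one_sq_gaussianReal]; norm_num

lemma variance_chi : Var[fun x : ℝ => x ^ 2 - 1; gaussianReal 0 1] = 2 := by
  rw [variance_eq_integral (by fun_prop), integral_sq_sub_one_gaussianReal]
  simpa using integral_sq_sub_one_sq_gaussianReal

lemma memLp_pi_chi (μ : ι → ℝ) : MemLp (fun z : ι → ℝ => ∑ j, μ j * (z j ^ 2 - 1)) 2
    (Measure.pi fun _ : ι => gaussianReal 0 1) := by
  refine memLp_finsetSum _ fun j _ => ?_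
  have h1 : MemLp (fun x : ℝ => μ j * (x ^ 2 - 1)) 2 (gaussianReal 0 1) := memLp_chi.const_mul _
  exact h1.comp_measurePreserving (measurePreserving_eval _ j)

/-- Second moment of a centred quadratic form. -/
theorem IsGaussianVec.integral_quadForm_sq (h : IsGaussianVec P Y S) (c : ι → ℝ) :
    Integrable (fun ω => quadForm Y S c ω ^ 2) P ∧
    ∫ ω, quadForm Y S c ω ^ 2 ∂P = 2 * ∑ a, ∑ b, c a * c b * S a b ^ 2 := by
  obtain ⟨μ, h1, -, h3⟩ := h.exists_map_quadForm c
  have hm := h.aemeasurable_quadForm c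
  have hmem := memLp_pi_chi μ
  have hz : Measurable fun z : ι → ℝ => ∑ j, μ j * (z j ^ 2 - 1) := by fun_prop
  constructor
  · have e : Integrable (fun x : ℝ => x ^ 2) (P.map (quadForm Y S c)) := by
      rw [h3, integrable_map_measure (by fun_prop) hz.aemeasurable]
      exact hmem.integrable_sq
    rw [integrable_map_measure (by fun_prop) hm] at e
    exact e
  have e1 : ∫ ω, quadForm Y S c ω ^ 2 ∂P = ∫ x, x ^ 2 ∂(P.map (quadForm Y S c)) := by
    rw [integral_map hm (by fun_prop)]
  have e0 : ∫ z : ι → ℝ, ∑ j, μ j * (z j ^ 2 - 1) ∂(Measure.pi fun _ : ι => gaussianReal 0 1) = 0 := by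
    rw [integral_finsetSum]
    · refine Finset.sum_eq_zero fun j _ => ?_
      have := integral_comp_eval (μ := fun _ : ι => gaussianReal 0 1) (i := j)
        (f := fun x : ℝ => μ j * (x ^ 2 - 1)) (by fun_prop)
      rw [this, integral_const_mul, integral_sq_sub_one_gaussianReal, mul_zero]
    · intro j _
      have h1 : MemLp (fun x : ℝ => μ j * (x ^ 2 - 1)) 2 (gaussianReal 0 1) := memLp_chi.const_mul _
      exact (h1.comp_measurePreserving (measurePreserving_eval _ j)).integrable (by norm_num)
  have e2 := variance_sum_pi (μ := fun _ : ι => gaussianReal 0 1)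
    (X := fun j x => μ j * (x ^ 2 - 1)) (fun j => memLp_chi.const_mul _)
  simp_rw [variance_const_mul, variance_chi] at e2
  rw [variance_eq_integral (by fun_prop)] at e2
  simp only [Finset.sum_apply, e0, sub_zero] at e2
  rw [e1, h3, integral_map hz.aemeasurable (by fun_prop), e2, ← h1, Finset.mul_sum]
  exact Finset.sum_congr rfl fun j _ => mul_comm _ _

lemma IsGaussianVec.expI_quadForm (h : IsGaussianVec P Y S) (c : ι → ℝ) :
    ∃ μ : ι → ℝ, ∑ j, μ j ^ 2 = ∑ a, ∑ b, c a * c b * S a b ^ 2 ∧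
      (∀ B, (∀ a, |c a| * ∑ b, |S a b| ≤ B) → ∀ j, |μ j| ≤ B) ∧
      expI P (quadForm Y S c) = ∏ j, chiChar (μ j) := by
  obtain ⟨μ, h1, h2, h3⟩ := h.exists_map_quadForm c
  refine ⟨μ, h1, h2, ?_⟩
  have hz : Measurable fun z : ι → ℝ => ∑ j, μ j * (z j ^ 2 - 1) := by fun_prop
  rw [expI_eq_charFun (h.aemeasurable_quadForm c), h3, ← expI_eq_charFun hz.aemeasurable]
  have := integral_fintype_prod_eq_prod (μ := fun _ : ι => gaussianReal 0 1)
    (f := fun j (x : ℝ) => Complex.exp ((μ j * (x ^ 2 - 1) : ℝ) * Complex.I))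
  simp only [chiChar, expI]
  rw [← this]
  congr 1 with z
  rw [← Complex.exp_sum, Complex.ofReal_sum, Finset.sum_mul]

/-- Central limit theorem for quadratic forms of Gaussian vectors. -/
theorem tendsto_expI_quadForm {ι : ℕ → Type*} [∀ n, Fintype (ι n)] {Y : ∀ n, ι n → Ω → ℝ}
    {S : ∀ n, Matrix (ι n) (ι n) ℝ} (h : ∀ n, IsGaussianVec P (Y n) (S n)) {c : ∀ n, ι n → ℝ}
    {v : ℝ} (hrow : ∀ ε > 0, ∀ᶠ n in atTop, ∀ a, |c n a| * ∑ b, |S n a b| ≤ ε)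
    (hv : Tendsto (fun n => ∑ a, ∑ b, c n a * c n b * S n a b ^ 2) atTop (𝓝 v)) :
    Tendsto (fun n => expI P (quadForm (Y n) (S n) (c n))) atTop (𝓝 (Complex.exp ((-v : ℝ)))) := by
  choose μ h1 h2 h3 using fun n => (h n).expI_quadForm (c n)
  simp only [h3]
  simp only [← h1] at hv
  refine tendsto_prod_chiChar (fun ε hε => ?_) hv
  filter_upwards [hrow (ε / 2) (half_pos hε)] with n hn j
  exact (h2 n _ hn j).trans_lt (half_lt_self hε)

end GaussianQuadraticSpectral


/-! ### The Gaussian vector of observed increments -/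

section Observations

variable {Ω : Type*} [MeasurableSpace Ω] {P : Measure Ω} {p : Params}
  {X : ℝ → ℝ → Ω → ℝ}

lemma fieldCov_symm (p : Params) (D : ℝ) (n : ℤ) (x y : ℝ) : fieldCov p D (-n) y x = fieldCov p D n x y := by
  simp only [fieldCov, Int.natAbs_neg]
  refine tsum_congr fun l => ?_
  ring

/-- Finite linear combinations of the field on a time grid form Gaussian vectors. -/
theorem isGaussianVec_field [IsProbabilityMeasure P] (hp : p.Admissible)
    (hX : IsStationarySolution p X P) {D : ℝ} (hD : 0 < D) {ι : Type*} [Fintype ι] {κ : ι → Type*}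
    [∀ a, Fintype (κ a)] (c : ∀ a, κ a → ℝ) (t : ∀ a, κ a → ℕ) (x : ∀ a, κ a → ℝ)
    (hx : ∀ a u, x a u ∈ Icc (0 : ℝ) 1) :
    IsGaussianVec P (fun a ω => ∑ u, c a u * X (t a u * D) (x a u) ω)
      (Matrix.of fun a b => ∑ u, ∑ u', c a u * c b u' *
        fieldCov p D ((t a u : ℤ) - t b u') (x a u) (x b u')) where
  aemeasurable a := by
    obtain ⟨β, v, -, h⟩ := hX
    exact Finset.aemeasurable_fun_sum _ fun u _ =>
      ((h _ (by positivity) _ (hx a u)).1).const_mul _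
  symm := by
    ext a b
    simp only [Matrix.conjTranspose_apply, Matrix.of_apply, star_trivial]
    rw [Finset.sum_comm]
    refine Finset.sum_congr rfl fun u _ => Finset.sum_congr rfl fun u' _ => ?_
    rw [← fieldCov_symm, neg_sub]
    ring
  expI_eq a := by
    have h := expI_field hp hX hD (ι := Σ a, κ a) (fun j => t j.1 j.2) (fun j => x j.1 j.2)
      (fun j => hx _ _) (fun j => a j.1 * c j.1 j.2)
    simp only [Fintype.sum_sigma] at h
    have e1 : (fun ω => ∑ j, a j * ∑ u, c j u * X (t j u * D) (x j u) ω)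
        = fun ω => ∑ j, ∑ u, a j * c j u * X (t j u * D) (x j u) ω := by
      funext ω
      refine Finset.sum_congr rfl fun j _ => ?_
      rw [Finset.mul_sum]
      exact Finset.sum_congr rfl fun u _ => by ring
    rw [e1, h]
    refine congrArg (fun x : ℝ => Complex.exp ((-x / 2 : ℝ))) ?_
    refine Finset.sum_congr rfl fun j _ => ?_
    rw [Finset.sum_comm]
    refine Finset.sum_congr rfl fun j' _ => ?_
    simp only [Matrix.of_apply, Finset.mul_sum]
    refine Finset.sum_congr rfl fun u _ => Finset.sum_congr rfl fun u' _ => ?_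
    ring

/-- The index set of the increments `D_{ik}` and `D̄_{ik}`. -/
abbrev ObsIdx (M N : ℕ) : Type := Σ ν : Fin 2, Fin (N - ν) × Fin M

/-- The increments over `ν + 1` time steps: `D_{ik}` for `ν = 0` and `D̄_{ik}` for `ν = 1`. -/
noncomputable def obs (T b : ℝ) (M N : ℕ) (x : ℝ → ℝ → ℝ) (ν : Fin 2) (i k : ℕ) : ℝ :=
  ∑ u : Fin (ν + 1), doubleIncr T b M N x (i + u) k

lemma obs_zero (T b : ℝ) (M N : ℕ) (x : ℝ → ℝ → ℝ) (i k : ℕ) :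
    obs T b M N x 0 i k = doubleIncr T b M N x i k := by
  have : obs T b M N x 0 i k = ∑ u : Fin 1, doubleIncr T b M N x (i + u) k := rfl
  simpa using this

lemma obs_one (T b : ℝ) (M N : ℕ) (x : ℝ → ℝ → ℝ) (i k : ℕ) :
    obs T b M N x 1 i k = doubleIncrBar T b M N x i k := by
  have : obs T b M N x 1 i k = ∑ u : Fin 2, doubleIncr T b M N x (i + u) k := rfl
  rw [this, Fin.sum_univ_two, doubleIncrBar]
  simp

/-- The covariance of the increments. -/
noncomputable def covObs (p : Params) (T b : ℝ) (M N : ℕ) (ν : Fin 2) (i k : ℕ) (μ : Fin 2)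
    (j l : ℕ) : ℝ :=
  ∑ u : Fin (ν + 1), ∑ u' : Fin (μ + 1), covIncr p T b M N (i + u) k (j + u') l

lemma doubleIncr_eq (T b : ℝ) (M N : ℕ) (x : ℝ → ℝ → ℝ) (i k : ℕ) :
    doubleIncr T b M N x i k = ∑ s : Fin 2, ∑ q : Fin 2, incrSign s * incrSign q *
      x (((i + s : ℕ) : ℝ) * meshTime T N) (gridSpace b M (k + q)) := by
  simp only [doubleIncr, Fin.sum_univ_two, incrSign, gridTime]
  norm_num
  ring

theorem isGaussianVec_obs [IsProbabilityMeasure P] (hp : p.Admissible)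
    (hX : IsStationarySolution p X P) {T b : ℝ} (hT : 0 < T) (hb : b ∈ Ioo (0 : ℝ) (1 / 2))
    {M N : ℕ} (hN : 0 < N) :
    IsGaussianVec P (fun (a : ObsIdx M N) ω => obs T b M N (fun t y => X t y ω) a.1 a.2.1 a.2.2)
      (Matrix.of fun a c => covObs p T b M N a.1 a.2.1 a.2.2 c.1 c.2.1 c.2.2) := by
  have hD : 0 < meshTime T N := by unfold meshTime; positivity
  have h := isGaussianVec_field (P := P) hp hX hD (ι := ObsIdx M N)
    (κ := fun a => Fin (a.1 + 1) × Fin 2 × Fin 2)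
    (fun a u => incrSign u.2.1 * incrSign u.2.2) (fun a u => a.2.1 + u.1 + u.2.1)
    (fun a u => gridSpace b M (a.2.2 + u.2.2)) (fun a u => by
      have hk := a.2.2.2
      have := gridSpace_mem (k := a.2.2 + u.2.2) hb (M := M) (by omega) (by omega)
      exact ⟨hb.1.le.trans this.1, this.2.trans (by linarith [hb.1])⟩)
  have e1 : (fun (a : ObsIdx M N) ω => obs T b M N (fun t y => X t y ω) a.1 a.2.1 a.2.2)
      = fun a ω => ∑ u : Fin (a.1 + 1) × Fin 2 × Fin 2, incrSign u.2.1 * incrSign u.2.2 *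
        X (((a.2.1 + u.1 + u.2.1 : ℕ) : ℝ) * meshTime T N) (gridSpace b M (a.2.2 + u.2.2)) ω := by
    funext a ω
    simp only [obs, doubleIncr_eq, Fintype.sum_prod_type]
  have e2 : (Matrix.of fun a c : ObsIdx M N => covObs p T b M N a.1 a.2.1 a.2.2 c.1 c.2.1 c.2.2)
      = Matrix.of fun a c : ObsIdx M N => ∑ u : Fin (a.1 + 1) × Fin 2 × Fin 2,
        ∑ u' : Fin (c.1 + 1) × Fin 2 × Fin 2, incrSign u.2.1 * incrSign u.2.2 *
        (incrSign u'.2.1 * incrSign u'.2.2) * fieldCov p (meshTime T N)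
        (((a.2.1 + u.1 + u.2.1 : ℕ) : ℤ) - ((c.2.1 + u'.1 + u'.2.1 : ℕ) : ℤ))
        (gridSpace b M (a.2.2 + u.2.2)) (gridSpace b M (c.2.2 + u'.2.2)) := by
    ext a c
    simp only [Matrix.of_apply, covObs, covIncr, Fintype.sum_prod_type, Fin.sum_univ_two]
    refine Finset.sum_congr rfl fun u _ => ?_
    simp only [← Finset.sum_add_distrib]
  rw [e1, e2]
  exact h

/-- The limiting covariances of the normalized increments. -/
noncomputable def limCov (th r : ℝ) (ν μ : Fin 2) (J L : ℤ) : ℝ :=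
  ∑ u : Fin (ν + 1), ∑ u' : Fin (μ + 1), coefA th r (J + u - u') L

lemma limCov_zero_zero (th r : ℝ) : limCov th r 0 0 = coefA th r := by
  funext J L
  have : limCov th r 0 0 J L = ∑ u : Fin 1, ∑ u' : Fin 1, coefA th r (J + u - u') L := rfl
  simpa using this

lemma limCov_one_one (th r : ℝ) : limCov th r 1 1 = coefB th r := by
  funext J L
  have : limCov th r 1 1 J L = ∑ u : Fin 2, ∑ u' : Fin 2, coefA th r (J + u - u') L := rfl
  rw [this, coefB]
  simp [Fin.sum_univ_two]
  ring

lemma limCov_zero_one (th r : ℝ) : limCov th r 0 1 = coefC th r := by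
  funext J L
  have : limCov th r 0 1 J L = ∑ u : Fin 1, ∑ u' : Fin 2, coefA th r (J + u - u') L := rfl
  rw [this, coefC]
  simp [Fin.sum_univ_two]

lemma limCov_one_zero (th r : ℝ) : limCov th r 1 0 = fun J L => coefC th r (J + 1) L := by
  funext J L
  have : limCov th r 1 0 J L = ∑ u : Fin 2, ∑ u' : Fin 1, coefA th r (J + u - u') L := rfl
  rw [this, coefC]
  simp [Fin.sum_univ_two]
  ring

lemma decays_limCov {th r : ℝ} (hth : 0 < th) (hr : 0 < r) (ν μ : Fin 2) :
    Decays (limCov th r ν μ) := by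
  fin_cases ν <;> fin_cases μ
  · simpa [limCov_zero_zero] using decays_coefA hth hr
  · simpa [limCov_zero_one] using decays_coefC hth hr
  · simpa [limCov_one_zero] using (decays_coefC hth hr).shift 1 0
  · simpa [limCov_one_one] using decays_coefB hth hr

lemma sumSq_limCov_one_zero (th r : ℝ) : sumSq (limCov th r 1 0) = sumSq (coefC th r) := by
  rw [limCov_one_zero, sumSq, sumSq]
  exact ((Equiv.addRight (1 : ℤ)).prodCongr (Equiv.refl ℤ)).tsum_eq
    fun q : ℤ × ℤ => coefC th r q.1 q.2 ^ 2

theorem exists_covObs_approx (hp : p.Admissible) {T b r : ℝ} (hT : 0 < T)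
    (hb : b ∈ Ioo (0 : ℝ) (1 / 2)) (hr : 0 < r) :
    ∃ C : ℝ, 0 ≤ C ∧ ∀ M N : ℕ, meshSpace b M / Real.sqrt (meshTime T N) = r →
      ∀ (ν μ : Fin 2) (i k j l : ℕ), i < N - ν → j < N - μ → k < M → l < M →
      |covObs p T b M N ν i k μ j l - p.sigmaSq * Real.sqrt (meshTime T N) *
        (p.weight (gridMid b M k) * p.weight (gridMid b M l)) *
          limCov p.theta2 r ν μ ((i : ℤ) - j) ((k : ℤ) - l)|
        ≤ C * (meshTime T N * Real.sqrt (meshTime T N)) := by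
  obtain ⟨C, hC, h⟩ := exists_covIncr_approx hp hT hb hr
  refine ⟨4 * C, by positivity, fun M N hMN ν μ i k j l hi hj hk hl => ?_⟩
  have hD : 0 ≤ meshTime T N := by unfold meshTime; positivity
  rw [covObs, limCov, Finset.mul_sum, ← Finset.sum_sub_distrib]
  calc _ ≤ ∑ u : Fin (ν + 1), ∑ u' : Fin (μ + 1),
      C * (meshTime T N * Real.sqrt (meshTime T N)) := by
        refine (Finset.abs_sum_le_sum_abs _ _).trans (Finset.sum_le_sum fun u _ => ?_)
        rw [Finset.mul_sum, ← Finset.sum_sub_distrib]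
        refine (Finset.abs_sum_le_sum_abs _ _).trans (Finset.sum_le_sum fun u' _ => ?_)
        have := h M N hMN (i + u) k (j + u') l (by omega) (by omega) hk hl
        rw [show (((i + u : ℕ) : ℤ) - ((j + u' : ℕ) : ℤ)) = (i : ℤ) - j + u - u' by push_cast; ring]
          at this
        exact this
    _ = ((ν + 1 : ℕ) : ℝ) * ((μ + 1 : ℕ) : ℝ) * (C * (meshTime T N * Real.sqrt (meshTime T N))) := by
        simp; ring
    _ ≤ 2 * 2 * (C * (meshTime T N * Real.sqrt (meshTime T N))) := by
        gcongr <;> exact_mod_cast (by omega)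
    _ = _ := by ring

lemma psi_eq {th r : ℝ} (hth : 0 < th) :
    psi th r = 4 * (covProfile 0 - covProfile (r / Real.sqrt th)) / Real.sqrt th := by
  have h1 := Real.sqrt_pos.2 hth
  have h2 := Real.sqrt_pos.2 Real.pi_pos
  have e1 : (r / Real.sqrt th) ^ 2 / 4 = r ^ 2 / (4 * th) := by
    rw [div_pow, Real.sq_sqrt hth.le]; field_simp
  have e2 : r / Real.sqrt th / 2 = r / (2 * Real.sqrt th) := by field_simp
  rw [psi, covProfile, covProfile, e1, e2, Real.sqrt_mul Real.pi_pos.le]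
  simp
  field_simp
  ring

lemma covG_one (h : ℝ) (l : ℤ) : covG h 1 l = covProfile (h * |(l : ℝ)|) := by simp [covG]

/-- The covariance profile vanishes at time lag 0, and for the two-step increments the contributions
of lag ±1 cancel: a two-step increment is an increment on the mesh 2Δ. Only lag ν + 1 survives,
which yields the mean function, so realized variances are asymptotically unbiased. -/
lemma limCov_self_zero {th r : ℝ} (hth : 0 < th) (ν : Fin 2) :
    limCov th r ν ν 0 0 = Real.sqrt (ν + 1 : ℕ) * psi th (r / Real.sqrt (ν + 1 : ℕ)) := by
  have e0 : ∀ h : ℝ, ∀ l : ℤ, covG h 0 l = 0 := fun h l => by simp [covG]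
  fin_cases ν
  · have : coefA th r 0 0 = psi th r := by
      rw [coefA, Lam_eq, psi_eq hth]
      have e1 := covG_neg_left (r / Real.sqrt th) 1
      have e2 := covG_neg_right (r / Real.sqrt th) 1 1
      simp only [zero_add, zero_sub, e1, e0, e2, covG_one]
      simp
      ring
    simpa [limCov_zero_zero] using this
  · have : coefB th r 0 0 = Real.sqrt 2 * psi th (r / Real.sqrt 2) := by
      rw [coefB, coefA, coefA, coefA, Lam_eq, Lam_eq, Lam_eq, psi_eq hth]
      set h := r / Real.sqrt th with hh
      have e1 := covG_neg_left h 1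
      have e1' := covG_neg_left h 2
      have e2 := covG_neg_right h 1 1
      have e3 := covG_neg_right h 2 1
      have e4 : ∀ l : ℤ, covG h 2 l = Real.sqrt 2 * covProfile (h * |(l : ℝ)| / Real.sqrt 2) := by
        intro l; simp [covG]
      have e5 : r / Real.sqrt 2 / Real.sqrt th = h / Real.sqrt 2 := by
        rw [hh, div_div, div_div, mul_comm]
      rw [e5]
      simp only [zero_add, zero_sub, show (1 : ℤ) + 1 = 2 by norm_num, show (-1 : ℤ) - 1 = -2 by norm_num,
        show (-1 : ℤ) + 1 = 0 by norm_num, show (1 : ℤ) - 1 = 0 by norm_num, e1, e1', e0, e2, e3, e4]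
      simp
      ring
    have e : limCov th r 1 1 0 0 = Real.sqrt ((1 : ℕ) + 1 : ℕ) * psi th (r / Real.sqrt ((1 : ℕ) + 1 : ℕ)) := by
      rw [limCov_one_one]; simpa [one_add_one_eq_two] using this
    exact e

end Observations


/-! ### Limits of weighted sums over the grid -/

section GridSums

/-- Outside a finite set the ℓ²-norm is at most ε, and Cauchy-Schwarz bounds the remaining sum; the
finite set contributes K. This replaces absolute summability, which the decay bound on the
covariances does not provide. -/
lemma exists_sum_abs_le {α : Type*} {f : α → ℝ} (hf : Summable fun a => f a ^ 2) {ε : ℝ} (hε : 0 < ε) :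
    ∃ K : ℝ, 0 ≤ K ∧ ∀ F : Finset α, ∑ a ∈ F, |f a| ≤ K + ε * Real.sqrt F.card := by
  classical
  obtain ⟨F₀, h₀⟩ := summable_iff_vanishing_norm.1 hf (ε ^ 2) (by positivity)
  refine ⟨∑ a ∈ F₀, |f a|, by positivity, fun F => ?_⟩
  rw [← Finset.sum_inter_add_sum_sdiff F F₀]
  refine add_le_add (Finset.sum_le_sum_of_subset_of_nonneg Finset.inter_subset_right
    fun _ _ _ => abs_nonneg _) ?_
  have h1 : ∑ a ∈ F \ F₀, f a ^ 2 ≤ ε ^ 2 := by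
    have := h₀ (F \ F₀) Finset.sdiff_disjoint
    rw [Real.norm_of_nonneg (by positivity)] at this
    exact this.le
  have h2 := sq_sum_le_card_mul_sum_sq (s := F \ F₀) (f := fun a => |f a|)
  simp only [sq_abs] at h2
  refine abs_le_of_sq_le_sq' ?_ (by positivity) |>.2
  rw [mul_pow, Real.sq_sqrt (by positivity)]
  have h3 : ((F \ F₀).card : ℝ) ≤ F.card := by exact_mod_cast Finset.card_le_card Finset.sdiff_subset
  calc _ ≤ ((F \ F₀).card : ℝ) * ∑ a ∈ F \ F₀, f a ^ 2 := h2
    _ ≤ F.card * ε ^ 2 := by gcongr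
    _ = _ := by ring

/-- For a fixed grid point, distinct partners give distinct lags, so the bound for finite sets
applies and row sums are o(√(MN)), uniformly over rows. -/
lemma exists_row_sum_le {m : ℤ → ℤ → ℝ} (hm : Summable fun q : ℤ × ℤ => m q.1 q.2 ^ 2) {ε : ℝ}
    (hε : 0 < ε) : ∃ K : ℝ, 0 ≤ K ∧ ∀ N M i k : ℕ,
      ∑ j ∈ Finset.range N, ∑ l ∈ Finset.range M, |m ((i : ℤ) - j) ((k : ℤ) - l)|
        ≤ K + ε * Real.sqrt ((M : ℝ) * N) := by
  classical
  obtain ⟨K, hK, h⟩ := exists_sum_abs_le hm hε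
  refine ⟨K, hK, fun N M i k => ?_⟩
  have hinj : Function.Injective fun q : ℕ × ℕ => ((i : ℤ) - q.1, (k : ℤ) - q.2) := by
    rintro ⟨a, b⟩ ⟨c, d⟩ hq
    simp only [Prod.mk.injEq] at hq ⊢
    omega
  have := h ((Finset.range N ×ˢ Finset.range M).map ⟨_, hinj⟩)
  rw [Finset.sum_map, Finset.card_map, Finset.card_product, Finset.sum_product] at this
  simp only [Function.Embedding.coeFn_mk, Finset.card_range, Nat.cast_mul] at this
  rw [mul_comm (M : ℝ)]
  exact this

variable {b : ℝ}

lemma gridMid_mem (hb : b ∈ Ioo (0 : ℝ) (1 / 2)) {M k : ℕ} (hk : k < M) :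
    gridMid b M k ∈ Icc b (1 - b) := by
  have h1 := gridSpace_mem hb (k := k) (M := M) (by omega) hk.le
  have h2 := gridSpace_mem hb (k := k + 1) (M := M) (by omega) hk
  rw [gridMid]
  constructor <;> linarith [h1.1, h1.2, h2.1, h2.2]

lemma gridMid_mem01 (hb : b ∈ Ioo (0 : ℝ) (1 / 2)) {M k : ℕ} (hk : k < M) :
    gridMid b M k ∈ Icc (0 : ℝ) 1 := by
  have := gridMid_mem hb hk
  exact ⟨hb.1.le.trans this.1, this.2.trans (by linarith [hb.1])⟩

lemma exists_abs_le_of_continuous {φ : ℝ → ℝ} (hφ : Continuous φ) :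
    ∃ K : ℝ, 0 ≤ K ∧ ∀ x ∈ Icc (0 : ℝ) 1, |φ x| ≤ K := by
  obtain ⟨K, hK⟩ := isCompact_Icc.exists_bound_of_continuousOn (s := Icc (0 : ℝ) 1) hφ.continuousOn
  exact ⟨|K|, abs_nonneg _, fun x hx => (hK x hx).trans (le_abs_self K)⟩

lemma exists_dist_lt_of_continuous {φ : ℝ → ℝ} (hφ : Continuous φ) {ε : ℝ} (hε : 0 < ε) :
    ∃ d > 0, ∀ x ∈ Icc (0 : ℝ) 1, ∀ y ∈ Icc (0 : ℝ) 1, |x - y| < d → |φ x - φ y| < ε := by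
  have h := isCompact_Icc.uniformContinuousOn_of_continuous (s := Icc (0 : ℝ) 1) hφ.continuousOn
  rw [Metric.uniformContinuousOn_iff] at h
  obtain ⟨d, hd, h⟩ := h ε hε
  exact ⟨d, hd, fun x hx y hy hxy => h x hx y hy hxy⟩

lemma tendsto_meshSpace (b : ℝ) : Tendsto (fun M : ℕ => meshSpace b M) atTop (𝓝 0) :=
  tendsto_const_div_atTop_nhds_zero_nat _

/-- Midpoint sums converge to the integral. -/
theorem tendsto_midpoint_sum (hb : b ∈ Ioo (0 : ℝ) (1 / 2)) {F : ℝ → ℝ} (hF : Continuous F) :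
    Tendsto (fun M : ℕ => 1 / (M : ℝ) * ∑ k ∈ Finset.range M, F (gridMid b M k)) atTop
      (𝓝 (1 / (1 - 2 * b) * ∫ x in b..(1 - b), F x)) := by
  have hb1 : 0 < 1 - 2 * b := by linarith [hb.2]
  rw [Metric.tendsto_atTop]
  intro ε hε
  obtain ⟨d, hd, hFd⟩ := exists_dist_lt_of_continuous hF (half_pos hε)
  obtain ⟨n0, hn0⟩ := eventually_atTop.1 ((tendsto_meshSpace b).eventually (gt_mem_nhds hd))
  refine ⟨max n0 1, fun M hM => ?_⟩
  have hM1 : 1 ≤ M := (le_max_right _ _).trans hM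
  have hM0 : (0 : ℝ) < M := by exact_mod_cast hM1
  have hδd : meshSpace b M < d := hn0 M ((le_max_left _ _).trans hM)
  have hδ0 : 0 < meshSpace b M := by unfold meshSpace; positivity
  have hsum : ∑ k ∈ Finset.range M, ∫ x in gridSpace b M k..gridSpace b M (k + 1), F x
      = ∫ x in b..(1 - b), F x := by
    rw [intervalIntegral.sum_integral_adjacent_intervals fun k _ => hF.intervalIntegrable _ _]
    congr 1
    · simp [gridSpace]
    · rw [gridSpace, meshSpace]; field_simp; ring
  have hMδ : (M : ℝ) * meshSpace b M = 1 - 2 * b := by rw [meshSpace]; field_simp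
  have hstep : ∀ k, gridSpace b M (k + 1) - gridSpace b M k = meshSpace b M := by
    intro k; simp only [gridSpace]; push_cast; ring
  have hterm : ∀ k ∈ Finset.range M, |meshSpace b M * F (gridMid b M k)
      - ∫ x in gridSpace b M k..gridSpace b M (k + 1), F x| ≤ ε / 2 * meshSpace b M := by
    intro k hk
    have hk' := Finset.mem_range.1 hk
    have h1 : meshSpace b M * F (gridMid b M k)
        = ∫ x in gridSpace b M k..gridSpace b M (k + 1), F (gridMid b M k) := by
      rw [intervalIntegral.integral_const, hstep, smul_eq_mul]
    rw [h1, ← intervalIntegral.integral_sub (by simp) (hF.intervalIntegrable _ _)]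
    have := intervalIntegral.norm_integral_le_of_norm_le_const (a := gridSpace b M k)
      (b := gridSpace b M (k + 1)) (f := fun x => F (gridMid b M k) - F x) (C := ε / 2) (by
        intro x hx
        rw [uIoc_of_le (by linarith [hstep k])] at hx
        have g1 := gridSpace_mem hb (k := k) (M := M) (by omega) hk'.le
        have g2 := gridSpace_mem hb (k := k + 1) (M := M) (by omega) hk'
        refine (hFd _ (gridMid_mem01 hb hk') x ⟨?_, ?_⟩ ?_).le
        · linarith [hx.1, g1.1, hb.1]
        · linarith [hx.2, g2.2, hb.1]
        · rw [gridMid, abs_lt]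
          have := hstep k
          constructor <;> linarith [hx.1, hx.2])
    rw [hstep, abs_of_pos hδ0] at this
    exact this
  have hkey : |∑ k ∈ Finset.range M, meshSpace b M * F (gridMid b M k) - ∫ x in b..(1 - b), F x|
      ≤ ε / 2 * (1 - 2 * b) := by
    rw [← hsum, ← Finset.sum_sub_distrib]
    refine (Finset.abs_sum_le_sum_abs _ _).trans ((Finset.sum_le_sum hterm).trans ?_)
    rw [Finset.sum_const, Finset.card_range, nsmul_eq_mul, ← hMδ]
    exact le_of_eq (by ring)
  rw [Real.dist_eq]
  have e : 1 / (M : ℝ) * ∑ k ∈ Finset.range M, F (gridMid b M k)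
      - 1 / (1 - 2 * b) * ∫ x in b..(1 - b), F x
      = 1 / (1 - 2 * b) * (∑ k ∈ Finset.range M, meshSpace b M * F (gridMid b M k)
        - ∫ x in b..(1 - b), F x) := by
    rw [← Finset.mul_sum, meshSpace]
    field_simp
  rw [e, abs_mul, abs_of_pos (by positivity)]
  calc _ ≤ 1 / (1 - 2 * b) * (ε / 2 * (1 - 2 * b)) := by gcongr
    _ = ε / 2 := by field_simp
    _ < ε := half_lt_self hε

/-- The weighted number of pairs of grid points at lag `L`. -/
noncomputable def lagSum (b : ℝ) (φ ψ : ℝ → ℝ) (M : ℕ) (ν μ : ℕ) (L : ℤ) : ℝ :=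
  1 / (M : ℝ) * ∑ k ∈ Finset.range (M - ν), ∑ l ∈ Finset.range (M - μ),
    if (k : ℤ) - l = L then φ (gridMid b M k) * ψ (gridMid b M l) else 0

lemma sum_range_ite_lag (M k : ℕ) (L : ℤ) (g : ℕ → ℝ) :
    (∑ l ∈ Finset.range M, if (k : ℤ) - l = L then g l else 0)
      = if 0 ≤ (k : ℤ) - L ∧ (k : ℤ) - L < M then g ((k : ℤ) - L).toNat else 0 := by
  split_ifs with h
  · rw [Finset.sum_eq_single ((k : ℤ) - L).toNat]
    · rw [if_pos (by omega)]
    · intro l _ hl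
      rw [if_neg (by omega)]
    · intro hn
      simp only [Finset.mem_range] at hn
      omega
  · refine Finset.sum_eq_zero fun l hl => ?_
    have := Finset.mem_range.1 hl
    rw [if_neg (by omega)]

lemma abs_lagSum_le (hb : b ∈ Ioo (0 : ℝ) (1 / 2)) {φ ψ : ℝ → ℝ} {K K' : ℝ} (hK : 0 ≤ K) (hK' : 0 ≤ K')
    (hφ : ∀ x ∈ Icc (0 : ℝ) 1, |φ x| ≤ K) (hψ : ∀ x ∈ Icc (0 : ℝ) 1, |ψ x| ≤ K') (M ν μ : ℕ) (L : ℤ) :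
    |lagSum b φ ψ M ν μ L| ≤ K * K' := by
  rcases Nat.eq_zero_or_pos M with rfl | hM
  · simp [lagSum]; positivity
  have hM0 : (0 : ℝ) < M := by exact_mod_cast hM
  have h1 : ∀ k ∈ Finset.range (M - ν), |∑ l ∈ Finset.range (M - μ),
      if (k : ℤ) - l = L then φ (gridMid b M k) * ψ (gridMid b M l) else 0| ≤ K * K' := by
    intro k hk
    have hk := Finset.mem_range.1 hk
    rw [sum_range_ite_lag]
    split_ifs with h
    · rw [abs_mul]
      exact mul_le_mul (hφ _ (gridMid_mem01 hb (by omega))) (hψ _ (gridMid_mem01 hb (by omega)))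
        (abs_nonneg _) hK
    · rw [abs_zero]; positivity
  rw [lagSum, abs_mul, abs_of_pos (by positivity)]
  calc _ ≤ 1 / (M : ℝ) * ∑ k ∈ Finset.range (M - ν), K * K' := by
        gcongr
        exact (Finset.abs_sum_le_sum_abs _ _).trans (Finset.sum_le_sum h1)
    _ = 1 / (M : ℝ) * ((M - ν : ℕ) * (K * K')) := by simp
    _ ≤ 1 / (M : ℝ) * (M * (K * K')) := by gcongr; omega
    _ = _ := by field_simp

/-- Except for at most ν + μ + |L| indices at each end, every grid point has exactly one partner at
lag L. The partner lies at distance |L|δ → 0, so ψ may be evaluated at the same point, and a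
midpoint sum remains. -/
theorem tendsto_lagSum (hb : b ∈ Ioo (0 : ℝ) (1 / 2)) {φ ψ : ℝ → ℝ} (hφ : Continuous φ)
    (hψ : Continuous ψ) (ν μ : ℕ) (L : ℤ) :
    Tendsto (fun M : ℕ => lagSum b φ ψ M ν μ L) atTop (𝓝 (innerB b φ ψ)) := by
  have h1 := tendsto_midpoint_sum hb (hφ.mul hψ)
  obtain ⟨K, hK, hφK⟩ := exists_abs_le_of_continuous hφ
  obtain ⟨K', hK', hψK⟩ := exists_abs_le_of_continuous hψ
  suffices h : Tendsto (fun M : ℕ => lagSum b φ ψ M ν μ L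
      - 1 / (M : ℝ) * ∑ k ∈ Finset.range M, φ (gridMid b M k) * ψ (gridMid b M k)) atTop (𝓝 0) by
    simpa [innerB] using h.add h1
  set A : ℕ := ν + μ + L.natAbs with hA
  rw [Metric.tendsto_atTop]
  intro ε hε
  obtain ⟨d, hd, hψd⟩ := exists_dist_lt_of_continuous hψ (show 0 < ε / (2 * (K + 1)) by positivity)
  have hlim1 : Tendsto (fun M : ℕ => (L.natAbs : ℝ) * meshSpace b M) atTop (𝓝 0) := by
    simpa using (tendsto_meshSpace b).const_mul (L.natAbs : ℝ)
  have hlim2 : Tendsto (fun M : ℕ => (2 * A * (2 * K * K') : ℝ) / M) atTop (𝓝 0) :=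
    tendsto_const_div_atTop_nhds_zero_nat _
  obtain ⟨n0, hn0⟩ := eventually_atTop.1 ((hlim1.eventually (gt_mem_nhds hd)).and
    (hlim2.eventually (gt_mem_nhds (half_pos hε))))
  refine ⟨max n0 1, fun M hM => ?_⟩
  obtain ⟨hd1, hd2⟩ := hn0 M ((le_max_left _ _).trans hM)
  have hM1 : 1 ≤ M := (le_max_right _ _).trans hM
  have hM0 : (0 : ℝ) < M := by exact_mod_cast hM1
  have hδ0 : 0 ≤ meshSpace b M := div_nonneg (by linarith [hb.2]) hM0.le
  set u : ℕ → ℝ := fun k => if k < M - ν then (∑ l ∈ Finset.range (M - μ),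
      if (k : ℤ) - l = L then φ (gridMid b M k) * ψ (gridMid b M l) else 0) else 0 with hu
  have hlag : lagSum b φ ψ M ν μ L = 1 / (M : ℝ) * ∑ k ∈ Finset.range M, u k := by
    rw [lagSum]
    congr 1
    rw [← Finset.sum_subset (Finset.range_mono (Nat.sub_le M ν)) (f := u)]
    · refine Finset.sum_congr rfl fun k hk => ?_
      simp only [hu, if_pos (Finset.mem_range.1 hk)]
    · intro k _ hk
      simp only [Finset.mem_range] at hk
      simp only [hu, if_neg hk]
  have hterm : ∀ k ∈ Finset.range M, |u k - φ (gridMid b M k) * ψ (gridMid b M k)|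
      ≤ ε / 2 + if k < A ∨ M ≤ k + A then 2 * K * K' else 0 := by
    intro k hk
    have hk := Finset.mem_range.1 hk
    have hφk := hφK _ (gridMid_mem01 hb hk)
    have hψk := hψK _ (gridMid_mem01 hb hk)
    have hprod : |φ (gridMid b M k) * ψ (gridMid b M k)| ≤ K * K' := by
      rw [abs_mul]; exact mul_le_mul hφk hψk (abs_nonneg _) hK
    by_cases hgood : k < A ∨ M ≤ k + A
    · rw [if_pos hgood]
      have huk : |u k| ≤ K * K' := by
        simp only [hu]
        split_ifs with h1
        · rw [sum_range_ite_lag]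
          split_ifs with h2
          · rw [abs_mul]
            exact mul_le_mul hφk (hψK _ (gridMid_mem01 hb (by omega))) (abs_nonneg _) hK
          · rw [abs_zero]; positivity
        · rw [abs_zero]; positivity
      have := abs_sub (u k) (φ (gridMid b M k) * ψ (gridMid b M k))
      linarith
    · rw [if_neg hgood, add_zero]
      push Not at hgood
      simp only [hu]
      rw [if_pos (by omega), sum_range_ite_lag, if_pos (by omega), ← mul_sub, abs_mul]
      have hl : ((k : ℤ) - L).toNat < M := by omega
      have hdist : |gridMid b M ((k : ℤ) - L).toNat - gridMid b M k| < d := by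
        have e1 : ((((k : ℤ) - L).toNat : ℕ) : ℝ) = (k : ℝ) - L := by
          have : ((((k : ℤ) - L).toNat : ℕ) : ℤ) = (k : ℤ) - L := Int.toNat_of_nonneg (by omega)
          exact_mod_cast congrArg (Int.cast (R := ℝ)) this
        have e2 : gridMid b M ((k : ℤ) - L).toNat - gridMid b M k = -(L * meshSpace b M) := by
          simp only [gridMid, gridSpace]
          push_cast
          rw [e1]
          ring
        rw [e2, abs_neg, abs_mul, abs_of_nonneg hδ0]
        have e3 : ((L.natAbs : ℕ) : ℝ) = |(L : ℝ)| := by rw [Nat.cast_natAbs]; simp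
        rwa [← e3]
      have := hψd _ (gridMid_mem01 hb hl) _ (gridMid_mem01 hb hk) hdist
      calc _ ≤ K * (ε / (2 * (K + 1))) := mul_le_mul hφk this.le (abs_nonneg _) hK
        _ ≤ (K + 1) * (ε / (2 * (K + 1))) := by gcongr; linarith
        _ = ε / 2 := by field_simp
  have hcard : ∑ k ∈ Finset.range M, (if k < A ∨ M ≤ k + A then 2 * K * K' else 0)
      ≤ 2 * A * (2 * K * K') := by
    rw [← Finset.sum_filter, Finset.sum_const, nsmul_eq_mul]
    have hsub : (Finset.range M).filter (fun k => k < A ∨ M ≤ k + A)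
        ⊆ Finset.range A ∪ Finset.Ico (M - A) M := by
      intro k hk
      simp only [Finset.mem_filter, Finset.mem_range, Finset.mem_union, Finset.mem_Ico] at hk ⊢
      omega
    have hc : ((Finset.range M).filter (fun k => k < A ∨ M ≤ k + A)).card ≤ 2 * A := by
      refine (Finset.card_le_card hsub).trans ((Finset.card_union_le _ _).trans ?_)
      rw [Finset.card_range, Nat.card_Ico]
      omega
    gcongr
    exact_mod_cast hc
  rw [dist_zero_right, hlag, ← mul_sub, ← Finset.sum_sub_distrib, norm_mul, Real.norm_eq_abs,
    Real.norm_eq_abs, abs_of_pos (by positivity : 0 < 1 / (M : ℝ))]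
  calc _ ≤ 1 / (M : ℝ) * (M * (ε / 2) + 2 * A * (2 * K * K')) := by
        gcongr
        refine (Finset.abs_sum_le_sum_abs _ _).trans ((Finset.sum_le_sum hterm).trans ?_)
        rw [Finset.sum_add_distrib, Finset.sum_const, Finset.card_range, nsmul_eq_mul]
        gcongr
    _ = ε / 2 + 2 * A * (2 * K * K') / M := by field_simp
    _ < ε := by linarith

/-- Weighted sums of squares of a square summable array of lags. -/
theorem tendsto_sum_sq_lag (hb : b ∈ Ioo (0 : ℝ) (1 / 2)) {φ ψ : ℝ → ℝ} (hφ : Continuous φ)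
    (hψ : Continuous ψ) {m : ℤ → ℤ → ℝ} (hm : Summable fun q : ℤ × ℤ => m q.1 q.2 ^ 2) (ν μ : ℕ)
    {M N : ℕ → ℕ} (hM : Tendsto M atTop atTop) (hN : Tendsto N atTop atTop) :
    Tendsto (fun n => 1 / ((M n : ℝ) * N n) * ∑ i ∈ Finset.range (N n - ν), ∑ k ∈ Finset.range (M n),
      ∑ j ∈ Finset.range (N n - μ), ∑ l ∈ Finset.range (M n),
        φ (gridMid b (M n) k) * ψ (gridMid b (M n) l) * m ((i : ℤ) - j) ((k : ℤ) - l) ^ 2) atTop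
      (𝓝 (innerB b φ ψ * sumSq m)) := by
  obtain ⟨K, hK, hφK⟩ := exists_abs_le_of_continuous hφ
  obtain ⟨K', hK', hψK⟩ := exists_abs_le_of_continuous hψ
  have h1 : innerB b (fun _ => 1) (fun _ => 1) = 1 := by
    have : 1 - 2 * b ≠ 0 := by linarith [hb.2]
    simp only [innerB, mul_one, intervalIntegral.integral_const, smul_eq_mul]
    field_simp
    ring
  -- Sorting the quadruple sum by the pair of lags turns it into a series over ℤ × ℤ whose
  -- coefficients are products of a temporal and a spatial lag sum. Dominated convergence then
  -- applies with majorant a multiple of the squared array.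
  have hid : ∀ n, 1 / ((M n : ℝ) * N n) * ∑ i ∈ Finset.range (N n - ν), ∑ k ∈ Finset.range (M n),
      ∑ j ∈ Finset.range (N n - μ), ∑ l ∈ Finset.range (M n),
        φ (gridMid b (M n) k) * ψ (gridMid b (M n) l) * m ((i : ℤ) - j) ((k : ℤ) - l) ^ 2
      = ∑' q : ℤ × ℤ, lagSum b (fun _ => 1) (fun _ => 1) (N n) ν μ q.1
        * lagSum b φ ψ (M n) 0 0 q.2 * m q.1 q.2 ^ 2 := by
    intro n
    have h2 : ∀ i j k l : ℕ, HasSum (fun q : ℤ × ℤ => (if (i : ℤ) - j = q.1 then (1 : ℝ) else 0)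
        * (if (k : ℤ) - l = q.2 then φ (gridMid b (M n) k) * ψ (gridMid b (M n) l) else 0)
        * m q.1 q.2 ^ 2) (φ (gridMid b (M n) k) * ψ (gridMid b (M n) l)
          * m ((i : ℤ) - j) ((k : ℤ) - l) ^ 2) := by
      intro i j k l
      convert hasSum_single ((i : ℤ) - j, (k : ℤ) - l) ?_ using 1
      · simp
      · rintro ⟨a, c⟩ hq
        simp only [ne_eq, Prod.mk.injEq, not_and_or] at hq
        rcases hq with hq | hq
        · rw [if_neg (fun h => hq h.symm)]; simp
        · rw [if_neg (fun h : (k : ℤ) - l = c => hq h.symm)]; simp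
    have h3 := (hasSum_sum fun i (_ : i ∈ Finset.range (N n - ν)) =>
      hasSum_sum fun k (_ : k ∈ Finset.range (M n)) =>
      hasSum_sum fun j (_ : j ∈ Finset.range (N n - μ)) =>
      hasSum_sum fun l (_ : l ∈ Finset.range (M n)) => h2 i j k l).mul_left (1 / ((M n : ℝ) * N n))
    rw [← h3.tsum_eq]
    refine tsum_congr fun q => ?_
    simp only [lagSum, mul_one, Nat.sub_zero]
    have e : 1 / (N n : ℝ) * (∑ i ∈ Finset.range (N n - ν), ∑ j ∈ Finset.range (N n - μ),
          if (i : ℤ) - j = q.1 then (1 : ℝ) else 0)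
        * (1 / (M n : ℝ) * ∑ k ∈ Finset.range (M n), ∑ l ∈ Finset.range (M n),
          if (k : ℤ) - l = q.2 then φ (gridMid b (M n) k) * ψ (gridMid b (M n) l) else 0)
          * m q.1 q.2 ^ 2
        = 1 / ((M n : ℝ) * N n) * (((∑ i ∈ Finset.range (N n - ν), ∑ j ∈ Finset.range (N n - μ),
          if (i : ℤ) - j = q.1 then (1 : ℝ) else 0)
        * ∑ k ∈ Finset.range (M n), ∑ l ∈ Finset.range (M n),
          if (k : ℤ) - l = q.2 then φ (gridMid b (M n) k) * ψ (gridMid b (M n) l) else 0)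
          * m q.1 q.2 ^ 2) := by
      rw [one_div, one_div, one_div, mul_inv]
      ring
    rw [e]
    congr 1
    rw [Finset.sum_mul, Finset.sum_mul]
    refine Finset.sum_congr rfl fun i _ => ?_
    rw [Finset.sum_mul_sum, Finset.sum_comm, Finset.sum_mul]
    refine Finset.sum_congr rfl fun k _ => ?_
    rw [Finset.sum_mul]
    refine Finset.sum_congr rfl fun j _ => ?_
    rw [Finset.mul_sum, Finset.sum_mul]
  simp only [hid]
  have h4 : innerB b φ ψ * sumSq m = ∑' q : ℤ × ℤ, 1 * innerB b φ ψ * m q.1 q.2 ^ 2 := by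
    rw [sumSq, ← tsum_mul_left]
    simp
  rw [h4]
  refine tendsto_tsum_of_dominated_convergence (bound := fun q : ℤ × ℤ => 1 * (K * K') * m q.1 q.2 ^ 2)
    (hm.mul_left _) ?_ ?_
  · intro q
    have t1 := (tendsto_lagSum hb (continuous_const (y := (1 : ℝ))) (continuous_const (y := (1 : ℝ)))
      ν μ q.1).comp hN
    rw [h1] at t1
    have t2 := (tendsto_lagSum hb hφ hψ 0 0 q.2).comp hM
    exact (t1.mul t2).mul_const _
  · refine Eventually.of_forall fun n q => ?_
    rw [norm_mul, norm_mul, norm_pow]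
    simp only [Real.norm_eq_abs, sq_abs]
    have b1 := abs_lagSum_le hb (φ := fun _ => 1) (ψ := fun _ => 1) zero_le_one zero_le_one
      (by simp) (by simp) (N n) ν μ q.1
    have b2 := abs_lagSum_le hb hK hK' hφK hψK (M n) 0 0 q.2
    rw [one_mul] at b1
    gcongr

end GridSums


/-! ### Limit theorem for weighted quadratic functionals of the observations -/

section ObservationLimits

variable {b : ℝ}

lemma abs_sq_sub_sq_le {x y e K : ℝ} (h : |x - y| ≤ e) (hy : |y| ≤ K) :
    |x ^ 2 - y ^ 2| ≤ e * (2 * K + e) := by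
  have he : 0 ≤ e := (abs_nonneg _).trans h
  rw [show x ^ 2 - y ^ 2 = (x - y) * ((x - y) + 2 * y) by ring, abs_mul]
  refine mul_le_mul h ?_ (abs_nonneg _) he
  refine (abs_add_le _ _).trans ?_
  rw [abs_mul, abs_two]
  linarith

/-- An entrywise error CD changes a row sum of squares by at most CD times twice the absolute row
sum, plus MN(CD)². As absolute row sums are O(√(MN)) and D√(MN) → 0, both contributions vanish. -/
theorem tendsto_sum_sq_perturbed (hb : b ∈ Ioo (0 : ℝ) (1 / 2)) {φ ψ w : ℝ → ℝ} (hφ : Continuous φ)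
    (hψ : Continuous ψ) (hw : Continuous w) {m : ℤ → ℤ → ℝ}
    (hm : Summable fun q : ℤ × ℤ => m q.1 q.2 ^ 2) (ν μ : ℕ)
    {M N : ℕ → ℕ} (hM : Tendsto M atTop atTop) (hN : Tendsto N atTop atTop) {D : ℕ → ℝ}
    (hD0 : ∀ n, 0 ≤ D n) (hD : Tendsto (fun n => D n * Real.sqrt ((M n : ℝ) * N n)) atTop (𝓝 0))
    {s : ℕ → ℕ → ℕ → ℕ → ℕ → ℝ} {σ C : ℝ} (hC : 0 ≤ C)
    (hs : ∀ n i k j l, i < N n - ν → k < M n → j < N n - μ → l < M n →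
      |s n i k j l - σ * (w (gridMid b (M n) k) * w (gridMid b (M n) l))
        * m ((i : ℤ) - j) ((k : ℤ) - l)| ≤ C * D n) :
    Tendsto (fun n => 1 / ((M n : ℝ) * N n) * ∑ i ∈ Finset.range (N n - ν), ∑ k ∈ Finset.range (M n),
      ∑ j ∈ Finset.range (N n - μ), ∑ l ∈ Finset.range (M n),
        φ (gridMid b (M n) k) * ψ (gridMid b (M n) l) * s n i k j l ^ 2) atTop
      (𝓝 (σ ^ 2 * innerB b (fun z => w z ^ 2 * φ z) (fun z => w z ^ 2 * ψ z) * sumSq m)) := by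
  obtain ⟨K₁, hK₁, hφK⟩ := exists_abs_le_of_continuous hφ
  obtain ⟨K₂, hK₂, hψK⟩ := exists_abs_le_of_continuous hψ
  obtain ⟨K₃, hK₃, hwK⟩ := exists_abs_le_of_continuous hw
  obtain ⟨K₀, hK₀, hrow⟩ := exists_row_sum_le hm one_pos
  have hmain := (tendsto_sum_sq_lag hb (φ := fun z => w z ^ 2 * φ z) (ψ := fun z => w z ^ 2 * ψ z)
    (by fun_prop) (by fun_prop) hm ν μ hM hN).const_mul (σ ^ 2)
  rw [← mul_assoc] at hmain
  set Q : ℕ → ℝ := fun n => Real.sqrt ((M n : ℝ) * N n) with hQ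
  set G : ℕ → ℝ := fun n => K₁ * K₂ * C * (2 * (|σ| * K₃ ^ 2) * (K₀ * (D n * Q n) + D n * Q n)
    + C * (D n * Q n) ^ 2) with hG
  have hGlim : Tendsto G atTop (𝓝 0) := by
    have : Tendsto G atTop (𝓝 (K₁ * K₂ * C * (2 * (|σ| * K₃ ^ 2) * (K₀ * 0 + 0) + C * 0 ^ 2))) :=
      (((((hD.const_mul K₀).add hD).const_mul _).add ((hD.pow 2).const_mul C)).const_mul _)
    simpa using this
  refine (tendsto_iff_of_dist (squeeze_zero' (Eventually.of_forall fun n => dist_nonneg) ?_ hGlim)).2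
    hmain
  filter_upwards [hM.eventually_ge_atTop 1, hN.eventually_ge_atTop 1] with n hMn hNn
  have hM0 : (1 : ℝ) ≤ M n := by exact_mod_cast hMn
  have hN0 : (1 : ℝ) ≤ N n := by exact_mod_cast hNn
  have hMN : (1 : ℝ) ≤ (M n : ℝ) * N n := by nlinarith
  have hQ1 : 1 ≤ Q n := Real.one_le_sqrt.2 hMN
  have hQ2 : Q n ^ 2 = (M n : ℝ) * N n := Real.sq_sqrt (by linarith)
  have hDn := hD0 n
  -- bound for a single row
  have hrowb : ∀ i ∈ Finset.range (N n - ν), ∀ k ∈ Finset.range (M n),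
      |∑ j ∈ Finset.range (N n - μ), ∑ l ∈ Finset.range (M n),
        φ (gridMid b (M n) k) * ψ (gridMid b (M n) l) * s n i k j l ^ 2
      - σ ^ 2 * ∑ j ∈ Finset.range (N n - μ), ∑ l ∈ Finset.range (M n),
        (w (gridMid b (M n) k) ^ 2 * φ (gridMid b (M n) k)) *
          (w (gridMid b (M n) l) ^ 2 * ψ (gridMid b (M n) l))
          * m ((i : ℤ) - j) ((k : ℤ) - l) ^ 2| ≤ G n := by
    intro i hi k hk
    have hi := Finset.mem_range.1 hi
    have hk := Finset.mem_range.1 hk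
    have hφk := hφK _ (gridMid_mem01 hb hk)
    have hwk := hwK _ (gridMid_mem01 hb hk)
    rw [Finset.mul_sum, ← Finset.sum_sub_distrib]
    calc _ ≤ ∑ j ∈ Finset.range (N n - μ), ∑ l ∈ Finset.range (M n), K₁ * K₂ *
        ((C * D n) * (2 * (|σ| * K₃ ^ 2 * |m ((i : ℤ) - j) ((k : ℤ) - l)|) + C * D n)) := by
          refine (Finset.abs_sum_le_sum_abs _ _).trans (Finset.sum_le_sum fun j hj => ?_)
          rw [Finset.mul_sum, ← Finset.sum_sub_distrib]
          refine (Finset.abs_sum_le_sum_abs _ _).trans (Finset.sum_le_sum fun l hl => ?_)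
          have hj := Finset.mem_range.1 hj
          have hl := Finset.mem_range.1 hl
          have hψl := hψK _ (gridMid_mem01 hb hl)
          have hwl := hwK _ (gridMid_mem01 hb hl)
          have h1 := hs n i k j l hi hk hj hl
          set y := σ * (w (gridMid b (M n) k) * w (gridMid b (M n) l))
            * m ((i : ℤ) - j) ((k : ℤ) - l) with hy
          have hyb : |y| ≤ |σ| * K₃ ^ 2 * |m ((i : ℤ) - j) ((k : ℤ) - l)| := by
            rw [hy, abs_mul, abs_mul, abs_mul, sq]
            gcongr
          rw [show φ (gridMid b (M n) k) * ψ (gridMid b (M n) l) * s n i k j l ^ 2 -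
            σ ^ 2 * (w (gridMid b (M n) k) ^ 2 * φ (gridMid b (M n) k) *
            (w (gridMid b (M n) l) ^ 2 * ψ (gridMid b (M n) l)) * m ((i : ℤ) - j) ((k : ℤ) - l) ^ 2)
            = φ (gridMid b (M n) k) * ψ (gridMid b (M n) l) * (s n i k j l ^ 2 - y ^ 2) by
              rw [hy]; ring, abs_mul, abs_mul]
          exact mul_le_mul (mul_le_mul hφk hψl (abs_nonneg _) hK₁) (abs_sq_sub_sq_le h1 hyb)
            (abs_nonneg _) (by positivity)
      _ = K₁ * K₂ * (C * D n) * (2 * (|σ| * K₃ ^ 2) * (∑ j ∈ Finset.range (N n - μ),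
            ∑ l ∈ Finset.range (M n), |m ((i : ℤ) - j) ((k : ℤ) - l)|)
            + ((N n - μ : ℕ) : ℝ) * (M n * (C * D n))) := by
          rw [Finset.mul_sum, mul_add, Finset.mul_sum]
          have : K₁ * K₂ * (C * D n) * (((N n - μ : ℕ) : ℝ) * (M n * (C * D n)))
            = ∑ j ∈ Finset.range (N n - μ), ∑ l ∈ Finset.range (M n),
              K₁ * K₂ * (C * D n) * (C * D n) := by
            simp only [Finset.sum_const, Finset.card_range, nsmul_eq_mul]; ring
          rw [this, ← Finset.sum_add_distrib]
          refine Finset.sum_congr rfl fun j _ => ?_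
          rw [Finset.mul_sum, Finset.mul_sum, ← Finset.sum_add_distrib]
          refine Finset.sum_congr rfl fun l _ => ?_
          ring
      _ ≤ K₁ * K₂ * (C * D n) * (2 * (|σ| * K₃ ^ 2) * (K₀ + Q n) + N n * (M n * (C * D n))) := by
          have h2 := hrow (N n - μ) (M n) i k
          have h3 : Real.sqrt ((M n : ℝ) * (N n - μ : ℕ)) ≤ Q n := by
            refine Real.sqrt_le_sqrt ?_
            gcongr
            omega
          gcongr
          · linarith
          · omega
      _ = K₁ * K₂ * C * (2 * (|σ| * K₃ ^ 2) * (K₀ * (D n * 1) + D n * Q n)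
            + C * (D n ^ 2 * ((M n : ℝ) * N n))) := by ring
      _ ≤ K₁ * K₂ * C * (2 * (|σ| * K₃ ^ 2) * (K₀ * (D n * Q n) + D n * Q n)
            + C * (D n ^ 2 * ((M n : ℝ) * N n))) := by gcongr
      _ = G n := by rw [hG, ← hQ2]; ring
  have hG0 : 0 ≤ G n := by
    have : 0 ≤ Q n := by linarith
    simp only [hG]; positivity
  rw [dist_comm, Real.dist_eq, abs_sub_comm, mul_left_comm, ← mul_sub, abs_mul,
    abs_of_pos (by positivity), Finset.mul_sum, ← Finset.sum_sub_distrib]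
  calc _ ≤ 1 / ((M n : ℝ) * N n) * ∑ i ∈ Finset.range (N n - ν), ∑ k ∈ Finset.range (M n), G n := by
        gcongr
        refine (Finset.abs_sum_le_sum_abs _ _).trans (Finset.sum_le_sum fun i hi => ?_)
        rw [Finset.mul_sum, ← Finset.sum_sub_distrib]
        refine (Finset.abs_sum_le_sum_abs _ _).trans (Finset.sum_le_sum fun k hk => ?_)
        exact hrowb i hi k hk
    _ = 1 / ((M n : ℝ) * N n) * (((N n - ν : ℕ) : ℝ) * (M n * G n)) := by simp
    _ ≤ 1 / ((M n : ℝ) * N n) * (N n * (M n * G n)) := by gcongr; omega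
    _ = G n := by field_simp

/-- Row sums of the normalized covariances are negligible. -/
theorem eventually_row_sum_le (hb : b ∈ Ioo (0 : ℝ) (1 / 2)) {w : ℝ → ℝ}
    (hw : Continuous w) {m : ℤ → ℤ → ℝ}
    (hm : Summable fun q : ℤ × ℤ => m q.1 q.2 ^ 2) (ν μ : ℕ)
    {M N : ℕ → ℕ} (hM : Tendsto M atTop atTop) (hN : Tendsto N atTop atTop) {D : ℕ → ℝ}
    (hD0 : ∀ n, 0 ≤ D n) (hD : Tendsto (fun n => D n * Real.sqrt ((M n : ℝ) * N n)) atTop (𝓝 0))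
    {s : ℕ → ℕ → ℕ → ℕ → ℕ → ℝ} {σ C : ℝ} (hC : 0 ≤ C)
    (hs : ∀ n i k j l, i < N n - ν → k < M n → j < N n - μ → l < M n →
      |s n i k j l - σ * (w (gridMid b (M n) k) * w (gridMid b (M n) l))
        * m ((i : ℤ) - j) ((k : ℤ) - l)| ≤ C * D n) {ε : ℝ} (hε : 0 < ε) :
    ∀ᶠ n in atTop, ∀ i k, i < N n - ν → k < M n →
      1 / Real.sqrt ((M n : ℝ) * N n) * ∑ j ∈ Finset.range (N n - μ), ∑ l ∈ Finset.range (M n),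
        |s n i k j l| ≤ ε := by
  obtain ⟨K₃, hK₃, hwK⟩ := exists_abs_le_of_continuous hw
  set A := |σ| * K₃ ^ 2 with hA
  have hA0 : 0 ≤ A := by positivity
  obtain ⟨K₀, hK₀, hrow⟩ := exists_row_sum_le hm (show 0 < ε / (3 * (A + 1)) by positivity)
  have hQlim : Tendsto (fun n => Real.sqrt ((M n : ℝ) * N n)) atTop atTop := by
    refine Real.tendsto_sqrt_atTop.comp ?_
    exact (tendsto_natCast_atTop_atTop.comp hM).atTop_mul_atTop₀ (tendsto_natCast_atTop_atTop.comp hN)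
  have h1 : Tendsto (fun n => A * K₀ / Real.sqrt ((M n : ℝ) * N n)) atTop (𝓝 0) :=
    hQlim.const_div_atTop _
  have h2 : Tendsto (fun n => C * (D n * Real.sqrt ((M n : ℝ) * N n))) atTop (𝓝 0) := by
    simpa using hD.const_mul C
  filter_upwards [h1.eventually (gt_mem_nhds (show (0 : ℝ) < ε / 3 by positivity)),
    h2.eventually (gt_mem_nhds (show (0 : ℝ) < ε / 3 by positivity)),
    hM.eventually_ge_atTop 1, hN.eventually_ge_atTop 1] with n hn1 hn2 hMn hNn i k hi hk
  have hM0 : (1 : ℝ) ≤ M n := by exact_mod_cast hMn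
  have hN0 : (1 : ℝ) ≤ N n := by exact_mod_cast hNn
  have hMN : (1 : ℝ) ≤ (M n : ℝ) * N n := by nlinarith
  set Q := Real.sqrt ((M n : ℝ) * N n) with hQ
  have hQ1 : 1 ≤ Q := Real.one_le_sqrt.2 hMN
  have hQ2 : Q ^ 2 = (M n : ℝ) * N n := Real.sq_sqrt (by linarith)
  have hDn := hD0 n
  have hwk := hwK _ (gridMid_mem01 hb hk)
  have hb1 : ∑ j ∈ Finset.range (N n - μ), ∑ l ∈ Finset.range (M n), |s n i k j l|
      ≤ A * (K₀ + ε / (3 * (A + 1)) * Q) + C * D n * Q ^ 2 := by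
    calc _ ≤ ∑ j ∈ Finset.range (N n - μ), ∑ l ∈ Finset.range (M n),
          (A * |m ((i : ℤ) - j) ((k : ℤ) - l)| + C * D n) := by
          refine Finset.sum_le_sum fun j hj => Finset.sum_le_sum fun l hl => ?_
          have hj := Finset.mem_range.1 hj
          have hl := Finset.mem_range.1 hl
          have hwl := hwK _ (gridMid_mem01 hb hl)
          have h1 := hs n i k j l hi hk hj hl
          have h3 := abs_sub_abs_le_abs_sub (s n i k j l)
            (σ * (w (gridMid b (M n) k) * w (gridMid b (M n) l)) * m ((i : ℤ) - j) ((k : ℤ) - l))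
          have hyb : |σ * (w (gridMid b (M n) k) * w (gridMid b (M n) l))
              * m ((i : ℤ) - j) ((k : ℤ) - l)| ≤ A * |m ((i : ℤ) - j) ((k : ℤ) - l)| := by
            rw [abs_mul, abs_mul, abs_mul, hA, sq]
            gcongr
          linarith
      _ = A * (∑ j ∈ Finset.range (N n - μ), ∑ l ∈ Finset.range (M n),
            |m ((i : ℤ) - j) ((k : ℤ) - l)|) + ((N n - μ : ℕ) : ℝ) * (M n * (C * D n)) := by
          simp only [Finset.sum_add_distrib, Finset.mul_sum, Finset.sum_const, Finset.card_range,
            nsmul_eq_mul]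
      _ ≤ A * (K₀ + ε / (3 * (A + 1)) * Q) + N n * (M n * (C * D n)) := by
          have h2 := hrow (N n - μ) (M n) i k
          have h3 : Real.sqrt ((M n : ℝ) * (N n - μ : ℕ)) ≤ Q := by
            refine Real.sqrt_le_sqrt ?_
            gcongr
            omega
          gcongr
          · refine h2.trans ?_
            gcongr
          · omega
      _ = _ := by rw [hQ2]; ring
  have hQ0 : 0 < Q := by linarith
  calc _ ≤ 1 / Q * (A * (K₀ + ε / (3 * (A + 1)) * Q) + C * D n * Q ^ 2) := by gcongr
    _ = A * K₀ / Q + A * (ε / (3 * (A + 1))) + C * (D n * Q) := by field_simp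
    _ ≤ ε / 3 + (A + 1) * (ε / (3 * (A + 1))) + ε / 3 := by gcongr; linarith
    _ = ε := by field_simp; norm_num

end ObservationLimits


/-- A sequence of observation grids with balanced meshes `δ / √Δ = r`. -/
structure IsBalanced (T b r : ℝ) (M N : ℕ → ℕ) : Prop where
  T_pos : 0 < T
  b_mem : b ∈ Ioo (0 : ℝ) (1 / 2)
  r_pos : 0 < r
  tendsto_M : Tendsto M atTop atTop
  tendsto_N : Tendsto N atTop atTop
  ratio : ∀ n, meshSpace b (M n) / Real.sqrt (meshTime T (N n)) = r

/-! ### Consequences of the balanced mesh condition -/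

section Balanced

variable {T b r : ℝ} {M N : ℕ → ℕ}

/-- Division by zero yields 0, so an empty grid would make the ratio 0 rather than r > 0. -/
lemma IsBalanced.M_pos (h : IsBalanced T b r M N) (n : ℕ) : 0 < M n := by
  rcases Nat.eq_zero_or_pos (M n) with h0 | h0
  · have := h.ratio n
    rw [h0] at this
    simp [meshSpace] at this
    exact absurd this h.r_pos.ne
  · exact h0

lemma IsBalanced.N_pos (h : IsBalanced T b r M N) (n : ℕ) : 0 < N n := by
  rcases Nat.eq_zero_or_pos (N n) with h0 | h0
  · have := h.ratio n
    rw [h0] at this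
    simp [meshTime] at this
    exact absurd this h.r_pos.ne
  · exact h0

lemma IsBalanced.meshTime_pos (h : IsBalanced T b r M N) (n : ℕ) : 0 < meshTime T (N n) := by
  have h1 : (0 : ℝ) < N n := by exact_mod_cast h.N_pos n
  have h2 := h.T_pos
  unfold meshTime
  positivity

/-- From ΔN = T and √Δ = (1 - 2b)/(rM) one gets Δ²MN = TΔM, of order 1/M. Thus errors of order Δ
remain negligible after multiplication by √(MN). -/
lemma IsBalanced.meshTime_sq_mul (h : IsBalanced T b r M N) (n : ℕ) :
    meshTime T (N n) ^ 2 * ((M n : ℝ) * N n) = T * ((1 - 2 * b) / r) ^ 2 / M n := by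
  have hD := h.meshTime_pos n
  have hs := Real.sqrt_pos.2 hD
  have hM : (0 : ℝ) < M n := by exact_mod_cast h.M_pos n
  have hN : (0 : ℝ) < N n := by exact_mod_cast h.N_pos n
  have h1 : meshSpace b (M n) = r * Real.sqrt (meshTime T (N n)) := by
    have := h.ratio n
    field_simp at this
    linarith
  have h2 : Real.sqrt (meshTime T (N n)) = (1 - 2 * b) / r / M n := by
    rw [meshSpace] at h1
    have := h.r_pos
    field_simp at h1 ⊢
    linarith
  have h3 : meshTime T (N n) = ((1 - 2 * b) / r / M n) ^ 2 := by
    rw [← h2, Real.sq_sqrt hD.le]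
  have h4 : meshTime T (N n) * N n = T := by rw [meshTime]; field_simp
  calc _ = meshTime T (N n) * (meshTime T (N n) * N n) * M n := by ring
    _ = _ := by rw [h4, h3]; field_simp

lemma IsBalanced.tendsto_meshTime_mul (h : IsBalanced T b r M N) :
    Tendsto (fun n => meshTime T (N n) * Real.sqrt ((M n : ℝ) * N n)) atTop (𝓝 0) := by
  have h1 : Tendsto (fun n => Real.sqrt (T * ((1 - 2 * b) / r) ^ 2 / M n)) atTop (𝓝 0) := by
    have h2 : Tendsto (fun n => T * ((1 - 2 * b) / r) ^ 2 / (M n : ℝ)) atTop (𝓝 0) :=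
      (tendsto_natCast_atTop_atTop.comp h.tendsto_M).const_div_atTop _
    simpa using h2.sqrt
  refine h1.congr fun n => ?_
  rw [← h.meshTime_sq_mul, Real.sqrt_mul (by positivity), Real.sqrt_sq (h.meshTime_pos n).le]

end Balanced

/-! ### Central limit theorem for quadratic functionals of the increments -/

section ObservationCLT

variable {Ω : Type*} [MeasurableSpace Ω] {P : Measure Ω} {p : Params}
  {X : ℝ → ℝ → Ω → ℝ} {T b r : ℝ} {M N : ℕ → ℕ}

lemma sum_obsIdx (M N : ℕ) (f : Fin 2 → ℕ → ℕ → ℝ) :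
    ∑ a : ObsIdx M N, f a.1 a.2.1 a.2.2
      = ∑ ν : Fin 2, ∑ i ∈ Finset.range (N - ν), ∑ k ∈ Finset.range M, f ν i k := by
  rw [Fintype.sum_sigma]
  refine Finset.sum_congr rfl fun ν _ => ?_
  rw [Fintype.sum_prod_type, Finset.sum_range]
  refine Finset.sum_congr rfl fun i _ => ?_
  rw [Finset.sum_range]

/-- The vector of the increments of the field `X`. -/
noncomputable def obsVec (T b : ℝ) (M N : ℕ) (X : ℝ → ℝ → Ω → ℝ) (a : ObsIdx M N) (ω : Ω) : ℝ :=
  obs T b M N (fun t y => X t y ω) a.1 a.2.1 a.2.2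

/-- The covariance matrix of the increments. -/
noncomputable def obsCov (p : Params) (T b : ℝ) (M N : ℕ) : Matrix (ObsIdx M N) (ObsIdx M N) ℝ :=
  Matrix.of fun a c => covObs p T b M N a.1 a.2.1 a.2.2 c.1 c.2.1 c.2.2

/-- Normalized coefficients of a quadratic functional of the increments. -/
noncomputable def obsCoef (T b : ℝ) (M N : ℕ) (φ : Fin 2 → ℝ → ℝ) (a : ObsIdx M N) : ℝ :=
  1 / Real.sqrt ((M : ℝ) * N) * (1 / (Real.sqrt (a.1 + 1 : ℕ) * Real.sqrt (meshTime T N)))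
    * φ a.1 (gridMid b M a.2.2)

/-- The limiting variance, up to a factor `2`, of a quadratic functional of the increments. -/
noncomputable def limVar (p : Params) (b r : ℝ) (φ : Fin 2 → ℝ → ℝ) : ℝ :=
  ∑ ν : Fin 2, ∑ μ : Fin 2, 1 / (Real.sqrt (ν + 1 : ℕ) * Real.sqrt (μ + 1 : ℕ)) *
    (p.sigmaSq ^ 2 * innerB b (fun z => p.weight z ^ 2 * φ ν z) (fun z => p.weight z ^ 2 * φ μ z)
      * sumSq (limCov p.theta2 r ν μ))

lemma continuous_weight (p : Params) : Continuous p.weight := by unfold Params.weight; fun_prop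

lemma exists_normalized_cov (hp : p.Admissible) (h : IsBalanced T b r M N) :
    ∃ C : ℝ, 0 ≤ C ∧ ∀ (ν μ : Fin 2) (n i k j l : ℕ), i < N n - ν → k < M n → j < N n - μ → l < M n →
      |covObs p T b (M n) (N n) ν i k μ j l / Real.sqrt (meshTime T (N n))
        - p.sigmaSq * (p.weight (gridMid b (M n) k) * p.weight (gridMid b (M n) l))
        * limCov p.theta2 r ν μ ((i : ℤ) - j) ((k : ℤ) - l)| ≤ C * meshTime T (N n) := by
  obtain ⟨C, hC, hC'⟩ := exists_covObs_approx hp h.T_pos h.b_mem h.r_pos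
  refine ⟨C, hC, fun ν μ n i k j l hi hk hj hl => ?_⟩
  have h1 := hC' (M n) (N n) (h.ratio n) ν μ i k j l hi hj hk hl
  have hs := Real.sqrt_pos.2 (h.meshTime_pos n)
  set s := Real.sqrt (meshTime T (N n)) with hsdef
  rw [← mul_le_mul_iff_left₀ hs, ← abs_of_pos hs, ← abs_mul, abs_of_pos hs, sub_mul,
    div_mul_cancel₀ _ hs.ne']
  calc _ = _ := by congr 2; ring
    _ ≤ _ := h1
    _ = _ := by ring

/-- The double sum splits into four blocks, one for each pair of time scales. The two factors 1/√Δ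
in the coefficients normalize the squared covariance, and each block converges by
`tendsto_sum_sq_perturbed`. -/
theorem tendsto_obsCoef_sq (hp : p.Admissible) (h : IsBalanced T b r M N) {φ : Fin 2 → ℝ → ℝ}
    (hφ : ∀ ν, Continuous (φ ν)) :
    Tendsto (fun n => ∑ a : ObsIdx (M n) (N n), ∑ c : ObsIdx (M n) (N n),
      obsCoef T b (M n) (N n) φ a * obsCoef T b (M n) (N n) φ c * obsCov p T b (M n) (N n) a c ^ 2)
      atTop (𝓝 (limVar p b r φ)) := by
  obtain ⟨C, hC, hC'⟩ := exists_normalized_cov hp h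
  have hlim : ∀ ν μ : Fin 2, _ := fun ν μ => tendsto_sum_sq_perturbed h.b_mem (hφ ν) (hφ μ)
    (continuous_weight p) (decays_limCov hp.theta2_pos h.r_pos ν μ).summable_sq ν μ h.tendsto_M
    h.tendsto_N (fun n => (h.meshTime_pos n).le) h.tendsto_meshTime_mul hC (hC' ν μ)
  have hsum := tendsto_finsetSum Finset.univ fun ν (_ : ν ∈ Finset.univ) =>
    tendsto_finsetSum Finset.univ fun μ (_ : μ ∈ Finset.univ) =>
      (hlim ν μ).const_mul (1 / (Real.sqrt (ν + 1 : ℕ) * Real.sqrt (μ + 1 : ℕ)))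
  refine hsum.congr fun n => ?_
  have hD := h.meshTime_pos n
  have hM : (0 : ℝ) < M n := by exact_mod_cast h.M_pos n
  have hN : (0 : ℝ) < N n := by exact_mod_cast h.N_pos n
  have e1 : ∀ a : ObsIdx (M n) (N n), ∑ c : ObsIdx (M n) (N n),
      obsCoef T b (M n) (N n) φ a * obsCoef T b (M n) (N n) φ c * obsCov p T b (M n) (N n) a c ^ 2
      = ∑ μ : Fin 2, ∑ j ∈ Finset.range (N n - μ), ∑ l ∈ Finset.range (M n),
        1 / ((M n : ℝ) * N n) * (1 / (Real.sqrt (a.1 + 1 : ℕ) * Real.sqrt (μ + 1 : ℕ))) *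
        (φ a.1 (gridMid b (M n) a.2.2) * φ μ (gridMid b (M n) l) *
          (covObs p T b (M n) (N n) a.1 a.2.1 a.2.2 μ j l / Real.sqrt (meshTime T (N n))) ^ 2) := by
    intro a
    rw [← sum_obsIdx (M n) (N n) fun μ j l => 1 / ((M n : ℝ) * N n)
      * (1 / (Real.sqrt (a.1 + 1 : ℕ) * Real.sqrt (μ + 1 : ℕ))) *
        (φ a.1 (gridMid b (M n) a.2.2) * φ μ (gridMid b (M n) l) *
          (covObs p T b (M n) (N n) a.1 a.2.1 a.2.2 μ j l / Real.sqrt (meshTime T (N n))) ^ 2)]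
    refine Finset.sum_congr rfl fun c _ => ?_
    simp only [obsCoef, obsCov, Matrix.of_apply]
    have q1 : 1 / ((M n : ℝ) * N n)
        = 1 / Real.sqrt ((M n : ℝ) * N n) * (1 / Real.sqrt ((M n : ℝ) * N n)) := by
      rw [div_mul_div_comm, one_mul, Real.mul_self_sqrt (by positivity)]
    rw [q1]
    ring
  rw [Finset.sum_congr rfl fun a _ => e1 a, sum_obsIdx (M n) (N n) fun ν i k => ∑ μ : Fin 2,
    ∑ j ∈ Finset.range (N n - μ), ∑ l ∈ Finset.range (M n),
        1 / ((M n : ℝ) * N n) * (1 / (Real.sqrt (ν + 1 : ℕ) * Real.sqrt (μ + 1 : ℕ))) *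
        (φ ν (gridMid b (M n) k) * φ μ (gridMid b (M n) l) *
          (covObs p T b (M n) (N n) ν i k μ j l / Real.sqrt (meshTime T (N n))) ^ 2)]
  refine Finset.sum_congr rfl fun ν _ => ?_
  rw [Finset.sum_congr rfl fun i _ => Finset.sum_comm, Finset.sum_comm]
  refine Finset.sum_congr rfl fun μ _ => ?_
  simp only [Finset.mul_sum]
  refine Finset.sum_congr rfl fun i _ => Finset.sum_congr rfl fun k _ =>
    Finset.sum_congr rfl fun j _ => Finset.sum_congr rfl fun l _ => ?_
  ring

theorem eventually_obsCoef_row (hp : p.Admissible) (h : IsBalanced T b r M N) {φ : Fin 2 → ℝ → ℝ}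
    (hφ : ∀ ν, Continuous (φ ν)) {ε : ℝ} (hε : 0 < ε) :
    ∀ᶠ n in atTop, ∀ a : ObsIdx (M n) (N n), |obsCoef T b (M n) (N n) φ a|
      * ∑ c, |obsCov p T b (M n) (N n) a c| ≤ ε := by
  obtain ⟨C, hC, hC'⟩ := exists_normalized_cov hp h
  choose K hK hφK using fun ν => exists_abs_le_of_continuous (hφ ν)
  set K' := K 0 + K 1 + 1 with hK'
  have hKK : ∀ ν, K ν ≤ K' := by
    intro ν
    have := hK 0
    have := hK 1
    fin_cases ν <;> simp [hK'] <;> linarith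
  have hK'0 : 0 < K' := by have := hK 0; have := hK 1; positivity
  have hlim : ∀ ν μ : Fin 2, _ := fun ν μ => eventually_row_sum_le h.b_mem
    (continuous_weight p) (decays_limCov hp.theta2_pos h.r_pos ν μ).summable_sq ν μ h.tendsto_M
    h.tendsto_N (fun n => (h.meshTime_pos n).le) h.tendsto_meshTime_mul hC (hC' ν μ)
    (show 0 < ε / (2 * K') by positivity)
  have hall := eventually_all.2 fun ν => eventually_all.2 fun μ => hlim ν μ
  filter_upwards [hall] with n hn a
  have hD := h.meshTime_pos n
  have hs := Real.sqrt_pos.2 hD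
  have hM : (0 : ℝ) < M n := by exact_mod_cast h.M_pos n
  have hN : (0 : ℝ) < N n := by exact_mod_cast h.N_pos n
  have hQ : 0 < Real.sqrt ((M n : ℝ) * N n) := Real.sqrt_pos.2 (by positivity)
  have hν : 1 ≤ Real.sqrt (a.1 + 1 : ℕ) := Real.one_le_sqrt.2 (by exact_mod_cast (by omega))
  have e1 : ∑ c, |obsCov p T b (M n) (N n) a c|
      = Real.sqrt (meshTime T (N n)) * ∑ μ : Fin 2, ∑ j ∈ Finset.range (N n - μ),
        ∑ l ∈ Finset.range (M n),
        |covObs p T b (M n) (N n) a.1 a.2.1 a.2.2 μ j l / Real.sqrt (meshTime T (N n))| := by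
    rw [← sum_obsIdx (M n) (N n) fun μ j l =>
      |covObs p T b (M n) (N n) a.1 a.2.1 a.2.2 μ j l / Real.sqrt (meshTime T (N n))|, Finset.mul_sum]
    refine Finset.sum_congr rfl fun c _ => ?_
    rw [abs_div, abs_of_pos hs, obsCov, Matrix.of_apply]
    field_simp
  have hφa : |φ a.1 (gridMid b (M n) a.2.2)| ≤ K' :=
    (hφK a.1 _ (gridMid_mem01 h.b_mem a.2.2.2)).trans (hKK _)
  have hc : |obsCoef T b (M n) (N n) φ a|
      ≤ 1 / Real.sqrt ((M n : ℝ) * N n) * (1 / Real.sqrt (meshTime T (N n))) * K' := by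
    rw [obsCoef, abs_mul, abs_of_pos (by positivity)]
    gcongr
    exact le_mul_of_one_le_left hs.le hν
  calc _ ≤ 1 / Real.sqrt ((M n : ℝ) * N n) * (1 / Real.sqrt (meshTime T (N n))) * K'
        * (Real.sqrt (meshTime T (N n)) * ∑ μ : Fin 2, ∑ j ∈ Finset.range (N n - μ),
        ∑ l ∈ Finset.range (M n),
        |covObs p T b (M n) (N n) a.1 a.2.1 a.2.2 μ j l / Real.sqrt (meshTime T (N n))|) := by
        rw [e1]; gcongr
    _ = K' * ∑ μ : Fin 2, (1 / Real.sqrt ((M n : ℝ) * N n) * ∑ j ∈ Finset.range (N n - μ),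
        ∑ l ∈ Finset.range (M n),
        |covObs p T b (M n) (N n) a.1 a.2.1 a.2.2 μ j l / Real.sqrt (meshTime T (N n))|) := by
        rw [← Finset.mul_sum]
        generalize (∑ μ : Fin 2, ∑ j ∈ Finset.range (N n - μ), ∑ l ∈ Finset.range (M n),
          |covObs p T b (M n) (N n) a.1 a.2.1 a.2.2 μ j l / Real.sqrt (meshTime T (N n))|) = Z
        field_simp
    _ ≤ K' * ∑ μ : Fin 2, ε / (2 * K') := by
        gcongr with μ
        exact hn a.1 μ a.2.1 a.2.2 a.2.1.2 a.2.2.2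
    _ = ε := by
        simp
        field_simp

/-- The centred quadratic functional of the increments. -/
noncomputable def obsForm (p : Params) (T b : ℝ) (M N : ℕ) (X : ℝ → ℝ → Ω → ℝ) (φ : Fin 2 → ℝ → ℝ) :
    Ω → ℝ :=
  quadForm (obsVec T b M N X) (obsCov p T b M N) (obsCoef T b M N φ)

variable [IsProbabilityMeasure P]

lemma isGaussianVec_obsVec (hp : p.Admissible) (hX : IsStationarySolution p X P)
    (h : IsBalanced T b r M N) (n : ℕ) :
    IsGaussianVec P (obsVec T b (M n) (N n) X) (obsCov p T b (M n) (N n)) :=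
  isGaussianVec_obs hp hX h.T_pos h.b_mem (h.N_pos n)

theorem tendsto_expI_obsForm (hp : p.Admissible) (hX : IsStationarySolution p X P)
    (h : IsBalanced T b r M N) {φ : Fin 2 → ℝ → ℝ} (hφ : ∀ ν, Continuous (φ ν)) :
    Tendsto (fun n => expI P (obsForm p T b (M n) (N n) X φ)) atTop
      (𝓝 (Complex.exp ((-limVar p b r φ : ℝ)))) :=
  tendsto_expI_quadForm (fun n => isGaussianVec_obsVec hp hX h n)
    (fun _ hε => eventually_obsCoef_row hp h hφ hε) (tendsto_obsCoef_sq hp h hφ)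

theorem tendsto_integral_obsForm_sq (hp : p.Admissible) (hX : IsStationarySolution p X P)
    (h : IsBalanced T b r M N) {φ : Fin 2 → ℝ → ℝ} (hφ : ∀ ν, Continuous (φ ν)) :
    Tendsto (fun n => ∫ ω, obsForm p T b (M n) (N n) X φ ω ^ 2 ∂P) atTop
      (𝓝 (2 * limVar p b r φ)) := by
  refine ((tendsto_obsCoef_sq hp h hφ).const_mul 2).congr fun n => ?_
  exact ((isGaussianVec_obsVec hp hX h n).integral_quadForm_sq _).2.symm

end ObservationCLT


/-! ### Identifiability -/

section Profile

lemma psi_eq_meanProfile {th ρ : ℝ} (hth : 0 < th) (hρ : 0 < ρ) :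
    psi th ρ = 1 / ρ * meanProfile (ρ / (2 * Real.sqrt th)) := by
  have h1 := Real.sqrt_pos.2 hth
  have h2 := Real.sqrt_pos.2 Real.pi_pos
  have e1 : (ρ / (2 * Real.sqrt th)) ^ 2 = ρ ^ 2 / (4 * th) := by
    rw [div_pow, mul_pow, Real.sq_sqrt hth.le]; norm_num
  rw [psi, meanProfile, e1, Real.sqrt_mul Real.pi_pos.le]
  field_simp
  ring

lemma hasDerivAt_meanProfile (x : ℝ) : HasDerivAt meanProfile (meanProfileDeriv x) x := by
  have h1 : HasDerivAt (fun x : ℝ => Real.exp (-x ^ 2)) (Real.exp (-x ^ 2) * (-(2 * x))) x := by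
    have : HasDerivAt (fun x : ℝ => -x ^ 2) (-(2 * x)) x := by
      simpa using (hasDerivAt_pow 2 x).fun_neg
    exact this.exp
  have h2 := (((hasDerivAt_id' x).const_mul 4).div_const (Real.sqrt Real.pi)).fun_mul
    ((h1.const_sub 1).fun_add (((hasDerivAt_id' x).const_mul 2).fun_mul (hasDerivAt_gaussTail x)))
  refine h2.congr_deriv ?_
  rw [meanProfileDeriv]
  ring

lemma one_sub_exp_pos {x : ℝ} (hx : 0 < x) : 0 < 1 - Real.exp (-x ^ 2) := by
  rw [sub_pos, Real.exp_lt_one_iff]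
  have : 0 < x ^ 2 := by positivity
  linarith

lemma meanProfile_pos {x : ℝ} (hx : 0 < x) : 0 < meanProfile x := by
  have h1 := one_sub_exp_pos hx
  have h2 := gaussTail_pos x
  have h3 := Real.sqrt_pos.2 Real.pi_pos
  rw [meanProfile]
  positivity

lemma psi_pos {th ρ : ℝ} (hth : 0 < th) (hρ : 0 < ρ) : 0 < psi th ρ := by
  have h1 := Real.sqrt_pos.2 hth
  rw [psi_eq_meanProfile hth hρ]
  have := meanProfile_pos (x := ρ / (2 * Real.sqrt th)) (by positivity)
  positivity

/-- With e = exp(-x²) and t the tail, the derivative has the sign of t(1 - e - 2x²e) - xe(1 - e).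
This is clearly negative if the bracket is nonpositive. Otherwise 2xt < e bounds 2x times it by e(1
- e - 2x²), negative since 1 - e ≤ x². -/
lemma strictAntiOn_tail_ratio :
    StrictAntiOn (fun x => x * gaussTail x / (1 - Real.exp (-x ^ 2))) (Ioi 0) := by
  have hder : ∀ x ∈ Ioi (0 : ℝ), HasDerivAt (fun x => x * gaussTail x / (1 - Real.exp (-x ^ 2)))
      (((1 * gaussTail x + x * (-Real.exp (-x ^ 2))) * (1 - Real.exp (-x ^ 2))
        - x * gaussTail x * (-(Real.exp (-x ^ 2) * (-(2 * x))))) / (1 - Real.exp (-x ^ 2)) ^ 2) x := by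
    intro x hx
    have h1 : HasDerivAt (fun x : ℝ => Real.exp (-x ^ 2)) (Real.exp (-x ^ 2) * (-(2 * x))) x := by
      have : HasDerivAt (fun x : ℝ => -x ^ 2) (-(2 * x)) x := by
        simpa using (hasDerivAt_pow 2 x).fun_neg
      exact this.exp
    exact ((hasDerivAt_id' x).fun_mul (hasDerivAt_gaussTail x)).fun_div (h1.const_sub 1)
      (one_sub_exp_pos hx).ne'
  refine strictAntiOn_of_deriv_neg (convex_Ioi 0)
    (fun x hx => (hder x hx).continuousAt.continuousWithinAt) ?_
  intro x hx
  rw [interior_Ioi] at hx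
  rw [(hder x hx).deriv]
  have hx0 : 0 < x := hx
  have hu := one_sub_exp_pos hx0
  refine div_neg_of_neg_of_pos ?_ (by positivity)
  have h1 := two_mul_gaussTail_lt x
  have h2 := gaussTail_pos x
  have he := Real.exp_pos (-x ^ 2)
  have hu2 : 1 - Real.exp (-x ^ 2) ≤ x ^ 2 := by linarith [Real.add_one_le_exp (-x ^ 2)]
  set e := Real.exp (-x ^ 2) with hedef
  set t := gaussTail x with ht
  have key : (1 * t + x * -e) * (1 - e) - x * t * -(e * -(2 * x))
      = t * ((1 - e) - 2 * x ^ 2 * e) - x * e * (1 - e) := by ring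
  rw [key]
  rcases le_or_gt ((1 - e) - 2 * x ^ 2 * e) 0 with hn | hn
  · have : t * ((1 - e) - 2 * x ^ 2 * e) ≤ 0 := mul_nonpos_of_nonneg_of_nonpos h2.le hn
    have : 0 < x * e * (1 - e) := by positivity
    linarith
  · have h3 : 2 * x * (t * ((1 - e) - 2 * x ^ 2 * e)) < e * ((1 - e) - 2 * x ^ 2 * e) := by
      rw [← mul_assoc]
      exact mul_lt_mul_of_pos_right h1 hn
    have h4 : e * ((1 - e) - 2 * x ^ 2 * e) - 2 * x * (x * e * (1 - e))
        = e * ((1 - e) - 2 * x ^ 2) := by ring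
    have h5 : e * ((1 - e) - 2 * x ^ 2) < 0 :=
      mul_neg_of_pos_of_neg he (by nlinarith [sq_nonneg x, pow_pos hx0 2])
    have h6 : 2 * x * (t * ((1 - e) - 2 * x ^ 2 * e) - x * e * (1 - e)) < 0 := by
      rw [mul_sub]; linarith
    by_contra hcon
    push Not at hcon
    have : 0 ≤ 2 * x * (t * ((1 - e) - 2 * x ^ 2 * e) - x * e * (1 - e)) := by positivity
    linarith

/-- The logarithmic derivative `x H'(x) / H(x)` is strictly decreasing. -/
lemma mul_meanProfileDeriv_div_lt {x y : ℝ} (hx : 0 < x) (hxy : x < y) :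
    y * meanProfileDeriv y / meanProfile y < x * meanProfileDeriv x / meanProfile x := by
  have hy : 0 < y := hx.trans hxy
  -- The logarithmic derivative is an increasing function of the tail ratio, whose monotonicity is
  -- known.
  have key : ∀ z : ℝ, 0 < z → z * meanProfileDeriv z / meanProfile z
      = 2 - 1 / (1 + 2 * (z * gaussTail z / (1 - Real.exp (-z ^ 2)))) := by
    intro z hz
    have h1 := one_sub_exp_pos hz
    have h2 := gaussTail_pos z
    have h3 := Real.sqrt_pos.2 Real.pi_pos
    rw [meanProfile, meanProfileDeriv]
    have h4 : 0 < 1 - Real.exp (-z ^ 2) + 2 * z * gaussTail z := by positivity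
    have h5 : 1 + 2 * (z * gaussTail z / (1 - Real.exp (-z ^ 2)))
        = (1 - Real.exp (-z ^ 2) + 2 * z * gaussTail z) / (1 - Real.exp (-z ^ 2)) := by
      rw [add_div, div_self h1.ne']; ring
    rw [h5, one_div_div]
    rw [show z * (4 / Real.sqrt Real.pi * (1 - Real.exp (-z ^ 2) + 4 * z * gaussTail z))
      = 4 * z / Real.sqrt Real.pi * (1 - Real.exp (-z ^ 2) + 4 * z * gaussTail z) by ring,
      mul_div_mul_left _ _ (by positivity), eq_sub_iff_add_eq, ← add_div, div_eq_iff h4.ne']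
    ring
  rw [key y hy, key x hx]
  have h1 := strictAntiOn_tail_ratio (mem_Ioi.2 hx) (mem_Ioi.2 hy) hxy
  simp only at h1
  have h2 : 0 < y * gaussTail y / (1 - Real.exp (-y ^ 2)) :=
    div_pos (mul_pos hy (gaussTail_pos y)) (one_sub_exp_pos hy)
  have h3 := one_div_lt_one_div_of_lt (show 0 < 1 + 2 * (y * gaussTail y / (1 - Real.exp (-y ^ 2)))
    by linarith) (show _ < 1 + 2 * (x * gaussTail x / (1 - Real.exp (-x ^ 2))) by linarith)
  linarith

/-- The ratio of the profile at two proportional arguments determines the argument. -/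
lemma injOn_meanProfile_ratio {c : ℝ} (hc : 0 < c) (hc1 : c < 1) :
    InjOn (fun x => meanProfile x / meanProfile (c * x)) (Ioi 0) := by
  suffices h : StrictAntiOn (fun x => meanProfile x / meanProfile (c * x)) (Ioi 0) from h.injOn
  have hder : ∀ x ∈ Ioi (0 : ℝ), HasDerivAt (fun x => meanProfile x / meanProfile (c * x))
      ((meanProfileDeriv x * meanProfile (c * x) - meanProfile x * (meanProfileDeriv (c * x) * (c * 1)))
        / meanProfile (c * x) ^ 2) x := by
    intro x hx
    have hx0 : 0 < x := hx
    have h1 : HasDerivAt (fun x => meanProfile (c * x)) (meanProfileDeriv (c * x) * (c * 1)) x :=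
      HasDerivAt.comp x (h₂ := meanProfile) (hasDerivAt_meanProfile (c * x))
        ((hasDerivAt_id' x).const_mul c)
    exact (hasDerivAt_meanProfile x).fun_div h1 (meanProfile_pos (by positivity)).ne'
  refine strictAntiOn_of_deriv_neg (convex_Ioi 0)
    (fun x hx => (hder x hx).continuousAt.continuousWithinAt) ?_
  intro x hx
  rw [interior_Ioi] at hx
  have hx0 : 0 < x := hx
  rw [(hder x hx).deriv]
  have hcx : 0 < c * x := by positivity
  have p1 := meanProfile_pos hx0
  have p2 := meanProfile_pos hcx
  refine div_neg_of_neg_of_pos ?_ (by positivity)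
  -- Up to the factor x, the derivative of the logarithm of the ratio is the difference of the
  -- logarithmic derivatives x𝓗'/𝓗 at x and at cx < x.
  have h1 := mul_meanProfileDeriv_div_lt hcx (show c * x < x by nlinarith)
  rw [div_lt_div_iff₀ p1 p2] at h1
  have h2 : x * (meanProfileDeriv x * meanProfile (c * x)
      - meanProfile x * (meanProfileDeriv (c * x) * (c * 1))) < 0 := by
    have : x * (meanProfileDeriv x * meanProfile (c * x)
      - meanProfile x * (meanProfileDeriv (c * x) * (c * 1)))
      = x * meanProfileDeriv x * meanProfile (c * x)
        - c * x * meanProfileDeriv (c * x) * meanProfile x := by ring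
    rw [this]; linarith
  by_contra hcon
  push Not at hcon
  have := mul_nonneg hx0.le hcon
  linarith

lemma sqrt_nat_one : Real.sqrt ((1 : ℕ) : ℝ) = 1 := by simp

/-- The scaled argument `a_ν = r_ν / (2√ϑ₂)`. -/
noncomputable def scaledArg (r : ℝ) (ν : ℕ) (th : ℝ) : ℝ := r / Real.sqrt ν / (2 * Real.sqrt th)

lemma scaledArg_two (r th : ℝ) : scaledArg r 2 th = (Real.sqrt 2)⁻¹ * scaledArg r 1 th := by
  simp only [scaledArg, Nat.cast_ofNat, sqrt_nat_one]
  ring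

lemma scaledArg_pos {r th : ℝ} (hr : 0 < r) (hth : 0 < th) {ν : ℕ} (hν : 0 < ν) :
    0 < scaledArg r ν th := by
  have : (0 : ℝ) < ν := by exact_mod_cast hν
  unfold scaledArg
  positivity

lemma inv_sqrt_two_mem : 0 < (Real.sqrt 2)⁻¹ ∧ (Real.sqrt 2)⁻¹ < 1 := by
  refine ⟨by positivity, inv_lt_one_of_one_lt₀ ?_⟩
  rw [Real.lt_sqrt (by norm_num)]; norm_num

/-- The parameter is determined by the two mean functions. -/
theorem eq_of_meanFun_eq {r b : ℝ} (hr : 0 < r) (hb : b < 1 / 2) {η η' : EuclideanSpace ℝ (Fin 3)}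
    (h0 : 0 < η 0) (h1 : 0 < η 1) (h0' : 0 < η' 0) (h1' : 0 < η' 1)
    (h : ∀ ν : ℕ, ν = 1 ∨ ν = 2 → ∀ z ∈ Icc b (1 - b), meanFun r ν η z = meanFun r ν η' z) :
    η = η' := by
  have hbb : b ≤ 1 - b := by linarith
  have hpos : ∀ ν : ℕ, 0 < ν → ∀ th : ℝ, 0 < th → 0 < psi th (r / Real.sqrt ν) := by
    intro ν hν th hth
    have : (0 : ℝ) < ν := by exact_mod_cast hν
    exact psi_pos hth (by positivity)
  -- equality of the exponential rates
  have hexp : η 2 = η' 2 := by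
    have e1 := h 1 (Or.inl rfl) b ⟨le_rfl, hbb⟩
    have e2 := h 1 (Or.inl rfl) (1 - b) ⟨hbb, le_rfl⟩
    simp only [meanFun] at e1 e2
    have l1 := congrArg Real.log e1
    have l2 := congrArg Real.log e2
    have p1 := hpos 1 one_pos _ h1
    have p2 := hpos 1 one_pos _ h1'
    rw [Real.log_mul (by positivity) p1.ne', Real.log_mul h0.ne' (by positivity), Real.log_exp,
      Real.log_mul (by positivity) p2.ne', Real.log_mul h0'.ne' (by positivity), Real.log_exp] at l1 l2
    have : (η 2 - η' 2) * (1 - 2 * b) = 0 := by linarith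
    rcases mul_eq_zero.1 this with h | h
    · linarith
    · linarith
  have hamp : ∀ ν : ℕ, ν = 1 ∨ ν = 2 →
      η 0 * psi (η 1) (r / Real.sqrt ν) = η' 0 * psi (η' 1) (r / Real.sqrt ν) := by
    intro ν hν
    have e1 := h ν hν b ⟨le_rfl, hbb⟩
    simp only [meanFun, hexp] at e1
    have := Real.exp_pos (-(η' 2 * b))
    have e2 : Real.exp (-(η' 2 * b)) * (η 0 * psi (η 1) (r / Real.sqrt ν))
        = Real.exp (-(η' 2 * b)) * (η' 0 * psi (η' 1) (r / Real.sqrt ν)) := by linarith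
    exact mul_left_cancel₀ this.ne' e2
  have hps : ∀ ν : ℕ, 0 < ν → ∀ th : ℝ, 0 < th →
      psi th (r / Real.sqrt ν) = 1 / (r / Real.sqrt ν) * meanProfile (scaledArg r ν th) := by
    intro ν hν th hth
    have : (0 : ℝ) < ν := by exact_mod_cast hν
    exact psi_eq_meanProfile hth (by positivity)
  have ha := scaledArg_pos hr h1 one_pos
  have ha' := scaledArg_pos hr h1' one_pos
  have hprof : ∀ ν : ℕ, ν = 1 ∨ ν = 2 →
      η 0 * meanProfile (scaledArg r ν (η 1)) = η' 0 * meanProfile (scaledArg r ν (η' 1)) := by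
    intro ν hν
    have hν0 : 0 < ν := by omega
    have hν' : (0 : ℝ) < ν := by exact_mod_cast hν0
    have := hamp ν hν
    rw [hps ν hν0 _ h1, hps ν hν0 _ h1'] at this
    have hc : (0 : ℝ) < 1 / (r / Real.sqrt ν) := by positivity
    refine mul_left_cancel₀ hc.ne' ?_
    linarith
  -- Dividing the amplitude identities of the two time scales eliminates σ². The arguments at the
  -- two scales differ by the fixed factor 1/√2, so the ratio of profiles determines ϑ₂.
  have hth : η 1 = η' 1 := by
    have e1 := hprof 1 (Or.inl rfl)
    have e2 := hprof 2 (Or.inr rfl)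
    rw [scaledArg_two, scaledArg_two] at e2
    have hi := injOn_meanProfile_ratio inv_sqrt_two_mem.1 inv_sqrt_two_mem.2
      (mem_Ioi.2 ha) (mem_Ioi.2 ha') (by
        simp only
        have q1 := meanProfile_pos (mul_pos inv_sqrt_two_mem.1 ha)
        have q2 := meanProfile_pos (mul_pos inv_sqrt_two_mem.1 ha')
        rw [div_eq_div_iff q1.ne' q2.ne']
        have hne : η 0 * η' 0 ≠ 0 := (mul_pos h0 h0').ne'
        refine mul_left_cancel₀ hne ?_
        linear_combination (η' 0 * meanProfile ((Real.sqrt 2)⁻¹ * scaledArg r 1 (η' 1))) * e1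
          - (η' 0 * meanProfile (scaledArg r 1 (η' 1))) * e2)
    have s1 := Real.sqrt_pos.2 h1
    have s2 := Real.sqrt_pos.2 h1'
    simp only [scaledArg, sqrt_nat_one, div_one] at hi
    rw [div_eq_div_iff (by positivity) (by positivity)] at hi
    have hs : Real.sqrt (η 1) = Real.sqrt (η' 1) := by
      have := mul_left_cancel₀ hr.ne' hi
      linarith
    rw [← Real.sq_sqrt h1.le, hs, Real.sq_sqrt h1'.le]
  have hsig : η 0 = η' 0 := by
    have := hamp 1 (Or.inl rfl)
    rw [hth] at this
    exact mul_right_cancel₀ (hpos 1 one_pos _ h1').ne' this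
  ext i
  fin_cases i
  · exact hsig
  · exact hth
  · exact hexp

lemma sum_mul_gradVec (r : ℝ) (ν : ℕ) (η : EuclideanSpace ℝ (Fin 3)) (z : ℝ) (x : Fin 3 → ℝ) :
    ∑ i, x i * gradVec r ν η z i = Real.exp (-(η 2 * z)) *
      (x 0 * (1 / (r / Real.sqrt ν) * meanProfile (scaledArg r ν (η 1)))
        + x 1 * (-(η 0 / (4 * (η 1 * Real.sqrt (η 1)))) * meanProfileDeriv (scaledArg r ν (η 1)))
        + x 2 * (-z * (η 0 / (r / Real.sqrt ν)) * meanProfile (scaledArg r ν (η 1)))) := by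
  simp only [gradVec, Fin.sum_univ_three, Pi.smul_apply, smul_eq_mul, Matrix.cons_val_zero,
    Matrix.cons_val_one, Matrix.cons_val_two, Matrix.head_cons, Matrix.tail_cons, scaledArg]
  ring

/-- The components of the gradients are linearly independent. -/
theorem eq_zero_of_gradVec {r b : ℝ} (hr : 0 < r) (hb : b < 1 / 2) {η : EuclideanSpace ℝ (Fin 3)}
    (h0 : 0 < η 0) (h1 : 0 < η 1) {x : Fin 3 → ℝ}
    (h : ∀ ν : ℕ, ν = 1 ∨ ν = 2 → ∀ z ∈ Icc b (1 - b), ∑ i, x i * gradVec r ν η z i = 0) :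
    x = 0 := by
  have hbb : b ≤ 1 - b := by linarith
  have s1 := Real.sqrt_pos.2 h1
  -- After removal of positive factors the relation is affine in z. Comparing the two endpoints
  -- gives x 2 = 0, comparing the two scales gives x 1 = 0, and then x 0 = 0.
  have hlin : ∀ ν : ℕ, ν = 1 ∨ ν = 2 → ∀ z ∈ Icc b (1 - b),
      2 * η 1 * (x 0 - z * η 0 * x 2) * meanProfile (scaledArg r ν (η 1))
        = x 1 * η 0 * (scaledArg r ν (η 1) * meanProfileDeriv (scaledArg r ν (η 1))) := by
    intro ν hν z hz
    have hν' : (0 : ℝ) < ν := by exact_mod_cast (by omega : 0 < ν)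
    have hsν := Real.sqrt_pos.2 hν'
    have h2 := h ν hν z hz
    have ha : r / Real.sqrt ν = 2 * Real.sqrt (η 1) * scaledArg r ν (η 1) := by
      rw [scaledArg]; field_simp
    have hap := scaledArg_pos hr h1 (ν := ν) (by omega)
    rw [sum_mul_gradVec, ha] at h2
    have h3 := (mul_eq_zero.1 h2).resolve_left (Real.exp_pos _).ne'
    have e1 : η 1 = Real.sqrt (η 1) ^ 2 := (Real.sq_sqrt h1.le).symm
    set a := scaledArg r ν (η 1)
    set s := Real.sqrt (η 1)
    rw [e1] at h3 ⊢
    field_simp at h3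
    linear_combination h3 / 2
  have ha1 := scaledArg_pos hr h1 one_pos
  have ha2 := scaledArg_pos hr h1 two_pos
  have p1 := meanProfile_pos ha1
  have p2 := meanProfile_pos ha2
  have hx2 : x 2 = 0 := by
    have e1 := hlin 1 (Or.inl rfl) b ⟨le_rfl, hbb⟩
    have e2 := hlin 1 (Or.inl rfl) (1 - b) ⟨hbb, le_rfl⟩
    have : x 2 * (2 * η 1 * (1 - 2 * b) * η 0 * meanProfile (scaledArg r 1 (η 1))) = 0 := by
      linear_combination e1 - e2
    refine (mul_eq_zero.1 this).resolve_right ?_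
    have : 0 < 1 - 2 * b := by linarith
    positivity
  have e1 := hlin 1 (Or.inl rfl) b ⟨le_rfl, hbb⟩
  have e2 := hlin 2 (Or.inr rfl) b ⟨le_rfl, hbb⟩
  rw [hx2] at e1 e2
  simp only [mul_zero, sub_zero] at e1 e2
  -- Eliminating x 0 leaves x 1 times the difference of a𝓗'(a)/𝓗(a) at the two scales, up to
  -- positive factors; strict monotonicity makes this difference nonzero.
  have hx1 : x 1 = 0 := by
    have hlt : scaledArg r 2 (η 1) < scaledArg r 1 (η 1) := by
      rw [scaledArg_two]
      nlinarith [inv_sqrt_two_mem.2]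
    have hR := mul_meanProfileDeriv_div_lt ha2 hlt
    rw [div_lt_div_iff₀ p1 p2] at hR
    have : x 1 * (η 0 * (scaledArg r 2 (η 1) * meanProfileDeriv (scaledArg r 2 (η 1))
        * meanProfile (scaledArg r 1 (η 1)) - scaledArg r 1 (η 1)
        * meanProfileDeriv (scaledArg r 1 (η 1)) * meanProfile (scaledArg r 2 (η 1)))) = 0 := by
      linear_combination meanProfile (scaledArg r 2 (η 1)) * e1 - meanProfile (scaledArg r 1 (η 1)) * e2
    refine (mul_eq_zero.1 this).resolve_right ?_
    exact (mul_pos h0 (sub_pos.2 hR)).ne'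
  have hx0 : x 0 = 0 := by
    rw [hx1] at e1
    have : x 0 * (2 * η 1 * meanProfile (scaledArg r 1 (η 1))) = 0 := by linear_combination e1
    exact (mul_eq_zero.1 this).resolve_right (by positivity)
  funext i
  fin_cases i
  · exact hx0
  · exact hx1
  · exact hx2

end Profile


/-! ### Positive definiteness of the asymptotic covariance -/

section StrictCauchySchwarz

variable {th r : ℝ}

lemma coefA_neg (th r : ℝ) (i k : ℤ) : coefA th r (-i) k = coefA th r i k := by
  simp [coefA, Lam]

lemma coefA_zero_pos (hth : 0 < th) (hr : 0 < r) : 0 < coefA th r 0 0 := by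
  have h := limCov_self_zero (r := r) hth 0
  rw [limCov_zero_zero] at h
  rw [h]
  have := psi_pos hth (show 0 < r / Real.sqrt ((0 : Fin 2) + 1 : ℕ) by simpa using hr)
  have h2 : 0 < Real.sqrt ((0 : Fin 2) + 1 : ℕ) := by simp
  positivity

/-- A square summable even solution of `x_{i+1} + x_{i-1} = τ x_i` vanishes at `0`. -/
lemma eq_zero_of_recurrence {x : ℕ → ℝ} {τ : ℝ} (hlim : Tendsto x atTop (𝓝 0))
    (h0 : 2 * x 1 = τ * x 0) (hrec : ∀ i, x (i + 2) + x i = τ * x (i + 1)) : x 0 = 0 := by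
  -- The recurrence conserves this quadratic form. Along a sequence tending to 0 it must vanish.
  have hinv : ∀ i, x (i + 1) ^ 2 - τ * x i * x (i + 1) + x i ^ 2
      = x 1 ^ 2 - τ * x 0 * x 1 + x 0 ^ 2 := by
    intro i
    induction i with
    | zero => rfl
    | succ i ih =>
      rw [← ih]
      linear_combination (x (i + 2) - x i) * hrec i
  have hlim1 : Tendsto (fun i => x (i + 1)) atTop (𝓝 0) := hlim.comp (tendsto_add_atTop_nat 1)
  have hI : Tendsto (fun i => x (i + 1) ^ 2 - τ * x i * x (i + 1) + x i ^ 2) atTop (𝓝 0) := by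
    have := ((hlim1.pow 2).sub ((hlim.const_mul τ).mul hlim1)).add (hlim.pow 2)
    simpa using this
  simp only [hinv] at hI
  have hI0 := tendsto_nhds_unique tendsto_const_nhds hI
  by_contra hx0
  have hsq : x 1 ^ 2 = x 0 ^ 2 := by linear_combination -hI0 + x 1 * h0
  -- With 2x₁ = τx₀ the conserved quantity is x₀² - x₁², so x₁ = ±x₀ if x₀ ≠ 0. Then τ = ±2 and
  -- |x_i| is constant, which contradicts the limit 0.
  obtain ⟨ε, hε, hx1⟩ : ∃ ε : ℝ, ε ^ 2 = 1 ∧ x 1 = ε * x 0 :=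
    ⟨x 1 / x 0, by rw [div_pow, hsq, div_self (pow_ne_zero 2 hx0)], by field_simp⟩
  have hτ : τ = 2 * ε := by
    refine mul_right_cancel₀ hx0 ?_
    rw [← h0, hx1]; ring
  have hstep : ∀ i, x (i + 1) = ε * x i := by
    intro i
    induction i with
    | zero => exact hx1
    | succ i ih =>
      have := hrec i
      rw [hτ] at this
      linear_combination this + ε * ih + x i * hε
  have hsqc : ∀ i, x i ^ 2 = x 0 ^ 2 := by
    intro i
    induction i with
    | zero => rfl
    | succ i ih => rw [hstep, mul_pow, hε, one_mul, ih]
  have h2 := hlim.pow 2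
  simp only [hsqc] at h2
  have := tendsto_nhds_unique tendsto_const_nhds h2
  exact hx0 (by simpa using this)

lemma summable_mul_of_summable_sq {α : Type*} {f g : α → ℝ} (hf : Summable fun a => f a ^ 2)
    (hg : Summable fun a => g a ^ 2) : Summable fun a => f a * g a := by
  refine (hf.add hg).of_norm_bounded fun a => ?_
  rw [Real.norm_eq_abs, abs_mul]
  nlinarith [sq_abs (f a), sq_abs (g a), sq_nonneg (|f a| - |g a|), sq_nonneg (f a), sq_nonneg (g a)]

/-- The three variance constants satisfy a strict Cauchy-Schwarz inequality. -/
theorem sumSq_coefC_sq_lt (hth : 0 < th) (hr : 0 < r) :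
    0 < sumSq (coefA th r) ∧
      sumSq (coefC th r) ^ 2 < sumSq (coefA th r) * sumSq (coefB th r) := by
  set a : ℤ × ℤ → ℝ := fun q => coefA th r q.1 q.2 with ha
  set am : ℤ × ℤ → ℝ := fun q => coefA th r (q.1 - 1) q.2 with ham
  set ap : ℤ × ℤ → ℝ := fun q => coefA th r (q.1 + 1) q.2 with hap
  set e : ℤ × ℤ ≃ ℤ × ℤ := (Equiv.addRight (1 : ℤ)).prodCongr (Equiv.refl ℤ) with he
  have hae : ∀ q, am (e q) = a q := fun q => by simp [ha, ham, he]
  have hae' : ∀ q, a (e q) = ap q := fun q => by simp [ha, hap, he]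
  have hS : Summable fun q => a q ^ 2 := (decays_coefA hth hr).summable_sq
  have hSp : Summable fun q => ap q ^ 2 := by
    refine (e.summable_iff.2 hS).congr fun q => ?_
    simp only [Function.comp_apply, hae']
  have hSm : Summable fun q => am q ^ 2 := by
    rw [← e.summable_iff]
    refine hS.congr fun q => ?_
    simp only [Function.comp_apply, hae]
  have tA : ∑' q, am q ^ 2 = ∑' q, a q ^ 2 := by
    rw [← e.tsum_eq]; exact tsum_congr fun q => by rw [hae]
  have hSam := summable_mul_of_summable_sq hS hSm
  have hSap := summable_mul_of_summable_sq hS hSp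
  have tM : ∑' q, a q * am q = ∑' q, a q * ap q := by
    rw [← e.tsum_eq]; exact tsum_congr fun q => by rw [hae, hae', mul_comm]
  have hA0 : 0 < sumSq (coefA th r) :=
    hS.tsum_pos (fun q => sq_nonneg _) (0, 0) (by have := coefA_zero_pos hth hr; simp only [ha]; positivity)
  refine ⟨hA0, ?_⟩
  set A := sumSq (coefA th r) with hA
  set B := sumSq (coefB th r) with hB
  set C := sumSq (coefC th r) with hC
  have hC1 : C = 2 * A + 2 * ∑' q, a q * ap q := by
    have : ∀ q : ℤ × ℤ, coefC th r q.1 q.2 ^ 2 = a q ^ 2 + 2 * (a q * am q) + am q ^ 2 := by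
      intro q; simp only [coefC, ha, ham]; ring
    rw [hC, sumSq, tsum_congr this, (hS.add (hSam.mul_left 2)).tsum_add hSm,
      hS.tsum_add (hSam.mul_left 2), tsum_mul_left, tA, tM, hA, sumSq]
    ring
  set bb : ℤ × ℤ → ℝ := fun q => coefB th r q.1 q.2 with hbb
  have hSb : Summable fun q => bb q ^ 2 := (decays_coefB hth hr).summable_sq
  have hSab := summable_mul_of_summable_sq hS hSb
  -- By invariance of the sums under time shifts, C is the ℓ² inner product of the arrays A and B,
  -- so the claim is indeed a Cauchy-Schwarz inequality.
  have hC2 : ∑' q, a q * bb q = C := by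
    have : ∀ q : ℤ × ℤ, a q * bb q = 2 * a q ^ 2 + a q * am q + a q * ap q := by
      intro q; simp only [hbb, coefB, ha, ham, hap]; ring
    rw [tsum_congr this, ((hS.mul_left 2).add hSam).tsum_add hSap, (hS.mul_left 2).tsum_add hSam,
      tsum_mul_left, tM, hC1, hA, sumSq]
    ring
  -- With this s, the vector b - s·a is b minus its projection onto a, and its squared norm is B -
  -- C²/A. If it vanished, the row at spatial lag 0 would satisfy the recurrence with τ = s - 2.
  -- Evenness in time gives the initial relation and square summability the limit 0, although the
  -- entry at (0,0) is positive.
  set s := C / A with hs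
  have hD : ∀ q, (bb q - s * a q) ^ 2 = bb q ^ 2 - 2 * s * (a q * bb q) + s ^ 2 * a q ^ 2 := by
    intro q; ring
  have hSD : Summable fun q => (bb q - s * a q) ^ 2 := by
    simp only [hD]; exact (hSb.sub (hSab.mul_left _)).add (hS.mul_left _)
  have hval : ∑' q, (bb q - s * a q) ^ 2 = B - C ^ 2 / A := by
    rw [tsum_congr hD, (hSb.sub (hSab.mul_left _)).tsum_add (hS.mul_left _),
      hSb.tsum_sub (hSab.mul_left _), tsum_mul_left, tsum_mul_left, hC2]
    change B - 2 * s * C + s ^ 2 * A = _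
    rw [hs]; field_simp; ring
  have hpos : 0 < ∑' q, (bb q - s * a q) ^ 2 := by
    by_contra hcon
    have hzero : ∀ q, bb q = s * a q := by
      intro q
      by_contra hne
      exact hcon (hSD.tsum_pos (fun q => sq_nonneg _) q
        (by have := sub_ne_zero.2 hne; positivity))
    have hx0 := eq_zero_of_recurrence (x := fun i : ℕ => coefA th r i 0) (τ := s - 2) ?_ ?_ ?_
    · exact (coefA_zero_pos hth hr).ne' (by simpa using hx0)
    · have hinj : Function.Injective fun i : ℕ => (((i : ℤ), (0 : ℤ)) : ℤ × ℤ) := by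
        intro i j hij
        simpa using hij
      have h1 := (hS.comp_injective hinj).tendsto_atTop_zero
      have h2 := h1.sqrt
      simp only [Function.comp_apply, ha, Real.sqrt_sq_eq_abs, Real.sqrt_zero] at h2
      exact (tendsto_zero_iff_abs_tendsto_zero _).2 h2
    · have := hzero (0, 0)
      simp only [hbb, ha, coefB, zero_sub, zero_add] at this
      rw [coefA_neg] at this
      push_cast
      linarith
    · intro i
      have := hzero ((i : ℤ) + 1, 0)
      simp only [hbb, ha, coefB] at this
      rw [add_sub_cancel_right, show (i : ℤ) + 1 + 1 = i + 2 by ring] at this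
      push_cast
      linarith
  rw [hval, sub_pos, div_lt_iff₀ hA0] at hpos
  linarith

end StrictCauchySchwarz

/-! ### The matrices U and V are positive definite -/

section InnerB

variable {b : ℝ}

lemma innerB_self_nonneg (hb : b ∈ Ioo (0 : ℝ) (1 / 2)) (f : ℝ → ℝ) : 0 ≤ innerB b f f := by
  have h1 : 0 ≤ 1 - 2 * b := by linarith [hb.2]
  have := intervalIntegral.integral_nonneg (f := fun x => f x * f x) (μ := volume)
    (show b ≤ 1 - b by linarith) fun x _ => mul_self_nonneg (f x)
  unfold innerB
  positivity

lemma eq_zero_of_innerB_self (hb : b ∈ Ioo (0 : ℝ) (1 / 2)) {f : ℝ → ℝ} (hf : Continuous f)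
    (h : innerB b f f = 0) : ∀ z ∈ Icc b (1 - b), f z = 0 := by
  have hlt : b < 1 - b := by linarith [hb.2]
  by_contra! hcon
  obtain ⟨z, hz, hne⟩ := hcon
  have := intervalIntegral.integral_pos hlt (f := fun x => f x * f x) (by fun_prop)
    (fun x _ => mul_self_nonneg (f x)) ⟨z, hz, mul_self_pos.2 hne⟩
  have h1 : 0 < 1 - 2 * b := by linarith
  unfold innerB at h
  have : 0 < 1 / (1 - 2 * b) * ∫ x in b..(1 - b), f x * f x := by positivity
  exact this.ne' h

lemma innerB_sum {ι κ : Type*} (s : Finset ι) (t : Finset κ) {f : ι → ℝ → ℝ} {g : κ → ℝ → ℝ}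
    (hf : ∀ i, Continuous (f i)) (hg : ∀ j, Continuous (g j)) (x : ι → ℝ) (y : κ → ℝ) :
    innerB b (fun z => ∑ i ∈ s, x i * f i z) (fun z => ∑ j ∈ t, y j * g j z)
      = ∑ i ∈ s, ∑ j ∈ t, x i * y j * innerB b (f i) (g j) := by
  simp only [innerB]
  have e : ∀ z, (∑ i ∈ s, x i * f i z) * ∑ j ∈ t, y j * g j z
      = ∑ i ∈ s, ∑ j ∈ t, x i * y j * (f i z * g j z) := by
    intro z
    rw [Finset.sum_mul_sum]
    refine Finset.sum_congr rfl fun i _ => Finset.sum_congr rfl fun j _ => ?_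
    ring
  simp only [e]
  rw [intervalIntegral.integral_finsetSum fun i _ => Continuous.intervalIntegrable
    (by have := hf i; fun_prop) _ _, Finset.mul_sum]
  refine Finset.sum_congr rfl fun i _ => ?_
  rw [intervalIntegral.integral_finsetSum fun j _ => Continuous.intervalIntegrable
    (by have := hf i; have := hg j; fun_prop) _ _, Finset.mul_sum]
  refine Finset.sum_congr rfl fun j _ => ?_
  rw [intervalIntegral.integral_const_mul]
  ring

lemma innerB_comm (f g : ℝ → ℝ) : innerB b f g = innerB b g f := by
  simp only [innerB, mul_comm]

lemma continuous_gradVec (r : ℝ) (ν : ℕ) (η : EuclideanSpace ℝ (Fin 3)) (i : Fin 3) :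
    Continuous fun z => gradVec r ν η z i := by
  fin_cases i <;> simp [gradVec] <;> fun_prop

lemma continuous_weightedGradVec (r : ℝ) (ν : ℕ) (η : EuclideanSpace ℝ (Fin 3)) (i : Fin 3) :
    Continuous fun z => weightedGradVec r ν η z i := by
  have := continuous_gradVec r ν η i
  simp only [weightedGradVec, Pi.smul_apply, smul_eq_mul]
  fun_prop

/-- The function `⟨x, g^ν(z)⟩`. -/
noncomputable def gradForm (r : ℝ) (η : EuclideanSpace ℝ (Fin 3)) (x : Fin 3 → ℝ) (ν : ℕ) (z : ℝ) : ℝ :=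
  ∑ i, x i * gradVec r ν η z i

lemma continuous_gradForm (r : ℝ) (η : EuclideanSpace ℝ (Fin 3)) (x : Fin 3 → ℝ) (ν : ℕ) :
    Continuous (gradForm r η x ν) := by
  have := continuous_gradVec r ν η
  unfold gradForm
  fun_prop

/-- The function `⟨x, h^ν(z)⟩`. -/
noncomputable def weightedGradForm (r : ℝ) (η : EuclideanSpace ℝ (Fin 3)) (x : Fin 3 → ℝ) (ν : ℕ)
    (z : ℝ) : ℝ :=
  ∑ i, x i * weightedGradVec r ν η z i

lemma weightedGradForm_eq (r : ℝ) (η : EuclideanSpace ℝ (Fin 3)) (x : Fin 3 → ℝ) (ν : ℕ) (z : ℝ) :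
    weightedGradForm r η x ν z = Real.exp (-(η 2 * z)) * gradForm r η x ν z := by
  simp only [weightedGradForm, gradForm, weightedGradVec, Pi.smul_apply, smul_eq_mul, Finset.mul_sum]
  exact Finset.sum_congr rfl fun i _ => by ring

lemma continuous_weightedGradForm (r : ℝ) (η : EuclideanSpace ℝ (Fin 3)) (x : Fin 3 → ℝ) (ν : ℕ) :
    Continuous (weightedGradForm r η x ν) := by
  have := continuous_weightedGradVec r ν η
  unfold weightedGradForm
  fun_prop

lemma innerB_gradForm (r : ℝ) (η : EuclideanSpace ℝ (Fin 3)) (x y : Fin 3 → ℝ) (ν μ : ℕ) :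
    innerB b (gradForm r η x ν) (gradForm r η y μ) = ∑ i, ∑ j, x i * y j *
      innerB b (fun z => gradVec r ν η z i) (fun z => gradVec r μ η z j) :=
  innerB_sum _ _ (continuous_gradVec r ν η) (continuous_gradVec r μ η) x y

lemma innerB_weightedGradForm (r : ℝ) (η : EuclideanSpace ℝ (Fin 3)) (x y : Fin 3 → ℝ) (ν μ : ℕ) :
    innerB b (weightedGradForm r η x ν) (weightedGradForm r η y μ) = ∑ i, ∑ j, x i * y j *
      innerB b (fun z => weightedGradVec r ν η z i) (fun z => weightedGradVec r μ η z j) :=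
  innerB_sum _ _ (continuous_weightedGradVec r ν η) (continuous_weightedGradVec r μ η) x y

lemma dotProduct_matV (r : ℝ) (η : EuclideanSpace ℝ (Fin 3)) (x y : Fin 3 → ℝ) :
    x ⬝ᵥ (matV b r η).mulVec y = 2 * (innerB b (gradForm r η x 1) (gradForm r η y 1)
      + innerB b (gradForm r η x 2) (gradForm r η y 2)) := by
  rw [innerB_gradForm, innerB_gradForm, ← Finset.sum_add_distrib, Finset.mul_sum]
  simp only [dotProduct, Matrix.mulVec, Finset.mul_sum, ← Finset.sum_add_distrib, matV, Matrix.of_apply]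
  refine Finset.sum_congr rfl fun i _ => Finset.sum_congr rfl fun j _ => ?_
  ring

lemma dotProduct_matU (r : ℝ) (η : EuclideanSpace ℝ (Fin 3)) (x : Fin 3 → ℝ) :
    x ⬝ᵥ (matU b r η).mulVec x = 4 * η 0 ^ 2 *
      (2 * sumSq (coefA (η 1) r) * innerB b (weightedGradForm r η x 1) (weightedGradForm r η x 1)
        + sumSq (coefB (η 1) r) * innerB b (weightedGradForm r η x 2) (weightedGradForm r η x 2)
        + 2 * (Real.sqrt 2 * sumSq (coefC (η 1) r)) *
          innerB b (weightedGradForm r η x 1) (weightedGradForm r η x 2)) := by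
  rw [show 2 * (Real.sqrt 2 * sumSq (coefC (η 1) r)) *
          innerB b (weightedGradForm r η x 1) (weightedGradForm r η x 2)
      = Real.sqrt 2 * sumSq (coefC (η 1) r) *
        (innerB b (weightedGradForm r η x 1) (weightedGradForm r η x 2)
          + innerB b (weightedGradForm r η x 2) (weightedGradForm r η x 1)) by
    rw [innerB_comm (weightedGradForm r η x 2)]; ring]
  simp only [innerB_weightedGradForm, ← Finset.sum_add_distrib, Finset.mul_sum]
  simp only [dotProduct, Matrix.mulVec, Finset.mul_sum, matU, Matrix.of_apply]
  refine Finset.sum_congr rfl fun i _ => Finset.sum_congr rfl fun j _ => ?_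
  ring

lemma isHermitian_matV (r : ℝ) (η : EuclideanSpace ℝ (Fin 3)) : (matV b r η).IsHermitian := by
  ext i j
  simp only [Matrix.conjTranspose_apply, star_trivial, matV, Matrix.of_apply]
  rw [innerB_comm (fun z => gradVec r 1 η z j), innerB_comm (fun z => gradVec r 2 η z j)]

lemma isHermitian_matU (r : ℝ) (η : EuclideanSpace ℝ (Fin 3)) : (matU b r η).IsHermitian := by
  ext i j
  simp only [Matrix.conjTranspose_apply, star_trivial, matU, Matrix.of_apply]
  rw [innerB_comm (fun z => weightedGradVec r 1 η z j), innerB_comm (fun z => weightedGradVec r 2 η z j),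
    innerB_comm (fun z => weightedGradVec r 1 η z j) (fun z => weightedGradVec r 2 η z i),
    innerB_comm (fun z => weightedGradVec r 2 η z j) (fun z => weightedGradVec r 1 η z i)]
  ring

/-- The quadratic form of V is twice the sum of the squared norms of ⟨x, g¹⟩ and ⟨x, g²⟩. If both
vanish, linear independence of the gradients forces x = 0. -/
theorem posDef_matV (hb : b ∈ Ioo (0 : ℝ) (1 / 2)) {r : ℝ} (hr : 0 < r)
    {η : EuclideanSpace ℝ (Fin 3)} (h0 : 0 < η 0) (h1 : 0 < η 1) : (matV b r η).PosDef := by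
  refine Matrix.PosDef.of_dotProduct_mulVec_pos (isHermitian_matV r η) fun x hx => ?_
  rw [star_trivial, dotProduct_matV]
  have p1 := innerB_self_nonneg hb (gradForm r η x 1)
  have p2 := innerB_self_nonneg hb (gradForm r η x 2)
  rcases (add_nonneg p1 p2).eq_or_lt with h | h
  · exfalso
    have q1 : innerB b (gradForm r η x 1) (gradForm r η x 1) = 0 := by linarith
    have q2 : innerB b (gradForm r η x 2) (gradForm r η x 2) = 0 := by linarith
    refine hx (eq_zero_of_gradVec hr hb.2 h0 h1 fun ν hν z hz => ?_)
    rcases hν with rfl | rfl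
    · exact eq_zero_of_innerB_self hb (continuous_gradForm r η x 1) q1 z hz
    · exact eq_zero_of_innerB_self hb (continuous_gradForm r η x 2) q2 z hz
  · linarith

/-- Completing the square gives 2A‖f + sg‖² + (B - C²/A)‖g‖² with s = √2·C/(2A), where the second
coefficient is positive by the strict Cauchy-Schwarz inequality. Both norms vanish only if f = g = 0
on the window. As the weights are positive, linear independence of the gradients applies again. -/
theorem posDef_matU (hb : b ∈ Ioo (0 : ℝ) (1 / 2)) {r : ℝ} (hr : 0 < r)
    {η : EuclideanSpace ℝ (Fin 3)} (h0 : 0 < η 0) (h1 : 0 < η 1) : (matU b r η).PosDef := by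
  refine Matrix.PosDef.of_dotProduct_mulVec_pos (isHermitian_matU r η) fun x hx => ?_
  rw [star_trivial, dotProduct_matU]
  obtain ⟨hA, hlt⟩ := sumSq_coefC_sq_lt h1 hr
  set A := sumSq (coefA (η 1) r)
  set B := sumSq (coefB (η 1) r)
  set C := sumSq (coefC (η 1) r)
  set f := weightedGradForm r η x 1 with hf
  set g := weightedGradForm r η x 2 with hg
  have hfc : Continuous f := continuous_weightedGradForm r η x 1
  have hgc : Continuous g := continuous_weightedGradForm r η x 2
  set s := Real.sqrt 2 * C / (2 * A) with hs
  have h2 : Real.sqrt 2 ^ 2 = 2 := Real.sq_sqrt (by norm_num)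
  have hsplit : 2 * A * innerB b f f + B * innerB b g g + 2 * (Real.sqrt 2 * C) * innerB b f g
      = 2 * A * innerB b (fun z => f z + s * g z) (fun z => f z + s * g z)
        + (B - C ^ 2 / A) * innerB b g g := by
    have e := innerB_sum (b := b) Finset.univ Finset.univ (f := fun i : Fin 2 => ![f, g] i)
      (g := fun i : Fin 2 => ![f, g] i) (by intro i; fin_cases i <;> assumption)
      (by intro i; fin_cases i <;> assumption) ![1, s] ![1, s]
    simp only [Fin.sum_univ_two, Matrix.cons_val_zero, Matrix.cons_val_one, one_mul, mul_one] at e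
    rw [e, innerB_comm g f, hs]
    field_simp
    linear_combination (-(C ^ 2 * innerB b g g)) * h2
  rw [hsplit]
  have hBC : 0 < B - C ^ 2 / A := by
    rw [sub_pos, div_lt_iff₀ hA]; linarith
  have p1 := innerB_self_nonneg hb fun z => f z + s * g z
  have p2 := innerB_self_nonneg hb g
  have hne : ¬ (innerB b (fun z => f z + s * g z) (fun z => f z + s * g z) = 0 ∧ innerB b g g = 0) := by
    rintro ⟨q1, q2⟩
    have z2 := eq_zero_of_innerB_self hb hgc q2
    have z1 := eq_zero_of_innerB_self hb (f := fun z => f z + s * g z) (by fun_prop) q1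
    refine hx (eq_zero_of_gradVec hr hb.2 h0 h1 fun ν hν z hz => ?_)
    have hz2 := z2 z hz
    have hz1 := z1 z hz
    simp only [hz2, mul_zero, add_zero] at hz1
    rcases hν with rfl | rfl
    · rw [hf, weightedGradForm_eq] at hz1
      exact (mul_eq_zero.1 hz1).resolve_left (Real.exp_pos _).ne'
    · rw [hg, weightedGradForm_eq] at hz2
      exact (mul_eq_zero.1 hz2).resolve_left (Real.exp_pos _).ne'
  have hη : 0 < 4 * η 0 ^ 2 := by positivity
  refine mul_pos hη ?_
  rcases p1.eq_or_lt with h | h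
  · rcases p2.eq_or_lt with h' | h'
    · exact absurd ⟨h.symm, h'.symm⟩ hne
    · have := mul_pos hBC h'
      have := mul_nonneg (by linarith : 0 ≤ 2 * A) p1
      linarith
  · have := mul_pos (by linarith : 0 < 2 * A) h
    have := mul_nonneg hBC.le p2
    linarith

theorem posDef_asymptoticCov (hb : b ∈ Ioo (0 : ℝ) (1 / 2)) {r : ℝ} (hr : 0 < r)
    {η : EuclideanSpace ℝ (Fin 3)} (h0 : 0 < η 0) (h1 : 0 < η 1) : (asymptoticCov b r η).PosDef := by
  have hV := posDef_matV hb hr h0 h1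
  have hVi : (matV b r η)⁻¹.PosDef := hV.inv
  have hU := posDef_matU hb hr h0 h1
  have h := hU.conjTranspose_mul_mul_same (B := (matV b r η)⁻¹)
    (Matrix.mulVec_injective_of_isUnit hVi.isUnit)
  rw [hVi.isHermitian.eq] at h
  exact h

end InnerB


/-! ### Regularity of the mean function in the parameter -/

section Calculus

variable {r : ℝ} {ν : ℕ}

lemma contDiff_gaussTail : ContDiff ℝ 1 gaussTail := by
  have h : deriv gaussTail = fun x => -Real.exp (-x ^ 2) :=
    funext fun x => (hasDerivAt_gaussTail x).deriv
  refine contDiff_one_iff_deriv.2 ⟨fun x => (hasDerivAt_gaussTail x).differentiableAt, ?_⟩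
  rw [h]
  fun_prop

lemma contDiff_meanProfile : ContDiff ℝ 1 meanProfile := by
  have := contDiff_gaussTail
  unfold meanProfile
  fun_prop

lemma contDiff_meanProfileDeriv : ContDiff ℝ 1 meanProfileDeriv := by
  have := contDiff_gaussTail
  unfold meanProfileDeriv
  fun_prop

lemma contDiffAt_gradVec (r : ℝ) (ν : ℕ) (i : Fin 3) {q : EuclideanSpace ℝ (Fin 3) × ℝ}
    (hq : 0 < q.1 1) :
    ContDiffAt ℝ 1 (fun q : EuclideanSpace ℝ (Fin 3) × ℝ => gradVec r ν q.1 q.2 i) q := by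
  have h0 : ∀ j, ContDiffAt ℝ 1 (fun q : EuclideanSpace ℝ (Fin 3) × ℝ => q.1 j) q := by
    intro j
    fun_prop
  have hs : ContDiffAt ℝ 1 (fun q : EuclideanSpace ℝ (Fin 3) × ℝ => Real.sqrt (q.1 1)) q :=
    (h0 1).sqrt hq.ne'
  have hs0 := Real.sqrt_pos.2 hq
  have hz : ContDiffAt ℝ 1 (fun q : EuclideanSpace ℝ (Fin 3) × ℝ => q.2) q := contDiffAt_snd
  have ha : ContDiffAt ℝ 1 (fun q : EuclideanSpace ℝ (Fin 3) × ℝ =>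
      r / Real.sqrt ν / (2 * Real.sqrt (q.1 1))) q :=
    contDiffAt_const.div (contDiffAt_const.mul hs) (by positivity)
  have hm : ContDiffAt ℝ 1 (fun q : EuclideanSpace ℝ (Fin 3) × ℝ =>
      meanProfile (r / Real.sqrt ν / (2 * Real.sqrt (q.1 1)))) q :=
    contDiff_meanProfile.contDiffAt.fun_comp q ha
  have hm' : ContDiffAt ℝ 1 (fun q : EuclideanSpace ℝ (Fin 3) × ℝ =>
      meanProfileDeriv (r / Real.sqrt ν / (2 * Real.sqrt (q.1 1)))) q :=
    contDiff_meanProfileDeriv.contDiffAt.fun_comp q ha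
  have he : ContDiffAt ℝ 1 (fun q : EuclideanSpace ℝ (Fin 3) × ℝ => Real.exp (-(q.1 2 * q.2))) q :=
    ((h0 2).mul hz).neg.exp
  have hd : ContDiffAt ℝ 1 (fun q : EuclideanSpace ℝ (Fin 3) × ℝ =>
      q.1 0 / (4 * (q.1 1 * Real.sqrt (q.1 1)))) q :=
    (h0 0).div (contDiffAt_const.mul ((h0 1).mul hs)) (by positivity)
  fin_cases i
  · exact he.mul (contDiffAt_const.mul hm)
  · exact he.mul (hd.neg.mul hm')
  · exact he.mul ((hz.neg.mul ((h0 0).div_const _)).mul hm)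

/-- A continuously differentiable function is locally Lipschitz, hence Lipschitz on the compact
product of the ball and [0,1]. The constant is therefore uniform in z. -/
lemma exists_gradVec_lipschitz (r : ℝ) (ν : ℕ) {η : EuclideanSpace ℝ (Fin 3)} {ρ : ℝ} (hρ : 0 ≤ ρ)
    (hball : ∀ η' ∈ Metric.closedBall η ρ, 0 < η' 1) (i : Fin 3) :
    ∃ C, 0 ≤ C ∧ ∀ η' ∈ Metric.closedBall η ρ, ∀ z ∈ Icc (0 : ℝ) 1,
      |gradVec r ν η' z i - gradVec r ν η z i| ≤ C * ‖η' - η‖ ∧ |gradVec r ν η' z i| ≤ C := by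
  set s : Set (EuclideanSpace ℝ (Fin 3) × ℝ) := Metric.closedBall η ρ ×ˢ Icc (0 : ℝ) 1
  have hs : IsCompact s := (isCompact_closedBall η ρ).prod isCompact_Icc
  have hc : ∀ q ∈ s, ContDiffAt ℝ 1
      (fun q : EuclideanSpace ℝ (Fin 3) × ℝ => gradVec r ν q.1 q.2 i) q :=
    fun q hq => contDiffAt_gradVec r ν i (hball q.1 hq.1)
  have hl : LocallyLipschitzOn s
      (fun q : EuclideanSpace ℝ (Fin 3) × ℝ => gradVec r ν q.1 q.2 i) := by
    intro q hq
    obtain ⟨K, t, ht, hK⟩ := (hc q hq).exists_lipschitzOnWith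
    exact ⟨K, t, mem_nhdsWithin_of_mem_nhds ht, hK⟩
  obtain ⟨K, hK⟩ := hl.exists_lipschitzOnWith_of_compact hs
  obtain ⟨B, hB⟩ := hs.exists_bound_of_continuousOn
    (fun q hq => (hc q hq).continuousAt.continuousWithinAt)
  refine ⟨max K B, le_max_of_le_left K.2, fun η' hη' z hz => ⟨?_, ?_⟩⟩
  · have h1 := hK.dist_le_mul (η', z) ⟨hη', hz⟩ (η, z) ⟨Metric.mem_closedBall_self hρ, hz⟩
    rw [Real.dist_eq, Prod.dist_eq, dist_self, max_eq_left dist_nonneg, dist_eq_norm] at h1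
    exact h1.trans (mul_le_mul_of_nonneg_right (le_max_left _ _) (norm_nonneg _))
  · exact (hB (η', z) ⟨hη', hz⟩).trans (le_max_right _ _)

lemma exists_gradForm_lipschitz (r : ℝ) (ν : ℕ) {η : EuclideanSpace ℝ (Fin 3)} {ρ : ℝ} (hρ : 0 ≤ ρ)
    (hball : ∀ η' ∈ Metric.closedBall η ρ, 0 < η' 1) :
    ∃ C, 0 ≤ C ∧ ∀ η' ∈ Metric.closedBall η ρ, ∀ z ∈ Icc (0 : ℝ) 1, ∀ x : EuclideanSpace ℝ (Fin 3),
      |gradForm r η' x.ofLp ν z - gradForm r η x.ofLp ν z| ≤ C * ‖η' - η‖ * ‖x‖ ∧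
        |gradForm r η' x.ofLp ν z| ≤ C * ‖x‖ := by
  choose C hC0 hC using exists_gradVec_lipschitz r ν hρ hball
  refine ⟨∑ i, C i, Finset.sum_nonneg fun i _ => hC0 i, fun η' hη' z hz x => ⟨?_, ?_⟩⟩
  · rw [gradForm, gradForm, ← Finset.sum_sub_distrib, Finset.sum_mul, Finset.sum_mul]
    refine (Finset.abs_sum_le_sum_abs _ _).trans (Finset.sum_le_sum fun i _ => ?_)
    rw [← mul_sub, abs_mul, mul_comm]
    exact mul_le_mul (hC i η' hη' z hz).1 (PiLp.norm_apply_le x i) (abs_nonneg _)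
      (mul_nonneg (hC0 i) (norm_nonneg _))
  · rw [gradForm, Finset.sum_mul]
    refine (Finset.abs_sum_le_sum_abs _ _).trans (Finset.sum_le_sum fun i _ => ?_)
    rw [abs_mul, mul_comm]
    exact mul_le_mul (hC i η' hη' z hz).2 (PiLp.norm_apply_le x i) (abs_nonneg _) (hC0 i)

lemma hasDerivAt_meanFun_line (hr : 0 < r) (hν : 0 < ν) (η x : EuclideanSpace ℝ (Fin 3)) (z s : ℝ)
    (hs : 0 < (η + s • x) 1) :
    HasDerivAt (fun s : ℝ => meanFun r ν (η + s • x) z) (gradForm r (η + s • x) x.ofLp ν z) s := by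
  have hν' : (0 : ℝ) < ν := by exact_mod_cast hν
  have hsν := Real.sqrt_pos.2 hν'
  set θ : ℝ → ℝ := fun s => (η + s • x) 1 with hθ
  have hcoord : ∀ j, HasDerivAt (fun s : ℝ => (η + s • x) j) (x j) s := by
    intro j
    have : HasDerivAt (fun s : ℝ => η j + s * x j) (1 * x j) s :=
      ((hasDerivAt_id' s).mul_const (x j)).const_add (η j)
    simpa using this
  have hsq : 0 < Real.sqrt (θ s) := Real.sqrt_pos.2 hs
  have hsqrt : HasDerivAt (fun s => Real.sqrt (θ s)) (x 1 / (2 * Real.sqrt (θ s))) s :=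
    (hcoord 1).sqrt hs.ne'
  have ha : HasDerivAt (fun s => scaledArg r ν (θ s))
      ((0 * (2 * Real.sqrt (θ s)) - r / Real.sqrt ν * (2 * (x 1 / (2 * Real.sqrt (θ s)))))
        / (2 * Real.sqrt (θ s)) ^ 2) s :=
    (hasDerivAt_const s (r / Real.sqrt ν)).fun_div (hsqrt.const_mul 2) (by positivity)
  have hm : HasDerivAt (fun s => meanProfile (scaledArg r ν (θ s))) _ s :=
    HasDerivAt.comp s (h₂ := meanProfile) (hasDerivAt_meanProfile (scaledArg r ν (θ s))) ha
  have hf := ((hcoord 0).fun_mul ((hcoord 2).mul_const z).fun_neg.exp).fun_mul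
    (hm.const_mul (1 / (r / Real.sqrt ν)))
  have hev : (fun s : ℝ => meanFun r ν (η + s • x) z) =ᶠ[𝓝 s] fun s =>
      (η + s • x) 0 * Real.exp (-((η + s • x) 2 * z)) *
        (1 / (r / Real.sqrt ν) * meanProfile (scaledArg r ν (θ s))) := by
    filter_upwards [(hcoord 1).continuousAt.eventually_const_lt hs] with s' hs'
    rw [meanFun, psi_eq_meanProfile hs' (by positivity)]
    rfl
  refine (hf.congr_of_eventuallyEq hev).congr_deriv ?_
  rw [gradForm, sum_mul_gradVec]
  have h2 : Real.sqrt (θ s) ^ 2 = (η + s • x) 1 := Real.sq_sqrt hs.le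
  have h3 : (η + s • x) 1 = θ s := rfl
  rw [h3] at h2 ⊢
  generalize Real.sqrt (θ s) = w at *
  rw [← h2]
  field_simp
  ring

/-- The mean value theorem on the segment expresses the increment through the gradient at an
intermediate point. Lipschitz continuity of the gradient then gives a quadratic error without second
derivatives. -/
theorem exists_taylor (hr : 0 < r) {η : EuclideanSpace ℝ (Fin 3)} {ρ : ℝ} (hρ : 0 ≤ ρ)
    (hball : ∀ η' ∈ Metric.closedBall η ρ, 0 < η' 1) (hν : 0 < ν) :
    ∃ C, 0 ≤ C ∧ ∀ η' ∈ Metric.closedBall η ρ, ∀ z ∈ Icc (0 : ℝ) 1,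
      (∀ x : EuclideanSpace ℝ (Fin 3),
        |gradForm r η' x.ofLp ν z - gradForm r η x.ofLp ν z| ≤ C * ‖η' - η‖ * ‖x‖ ∧
          |gradForm r η' x.ofLp ν z| ≤ C * ‖x‖) ∧
        |meanFun r ν η' z - meanFun r ν η z| ≤ C * ‖η' - η‖ ∧
        |meanFun r ν η' z - meanFun r ν η z - gradForm r η (η' - η).ofLp ν z|
          ≤ C * ‖η' - η‖ ^ 2 := by
  obtain ⟨C, hC0, hC⟩ := exists_gradForm_lipschitz r ν hρ hball
  refine ⟨C, hC0, fun η' hη' z hz => ⟨hC η' hη' z hz, ?_⟩⟩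
  have hmem : ∀ s ∈ Icc (0 : ℝ) 1, ‖s • (η' - η)‖ ≤ ‖η' - η‖ ∧
      η + s • (η' - η) ∈ Metric.closedBall η ρ := by
    intro s hs
    have h1 : ‖s • (η' - η)‖ ≤ ‖η' - η‖ := by
      rw [norm_smul, Real.norm_eq_abs, abs_of_nonneg hs.1]
      exact mul_le_of_le_one_left (norm_nonneg _) hs.2
    refine ⟨h1, ?_⟩
    rw [mem_closedBall_iff_norm] at hη' ⊢
    rw [add_sub_cancel_left]
    exact h1.trans hη'
  have hder : ∀ s ∈ Icc (0 : ℝ) 1, HasDerivAt (fun s : ℝ => meanFun r ν (η + s • (η' - η)) z)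
      (gradForm r (η + s • (η' - η)) (η' - η).ofLp ν z) s := fun s hs =>
    hasDerivAt_meanFun_line hr hν η (η' - η) z s (hball _ (hmem s hs).2)
  obtain ⟨s, hs, hs'⟩ := exists_hasDerivAt_eq_slope _ _ one_pos
    (fun s hs => (hder s hs).continuousAt.continuousWithinAt)
    (fun s hs => hder s (Ioo_subset_Icc_self hs))
  have hs1 := Ioo_subset_Icc_self hs
  simp only [one_smul, zero_smul, add_zero, add_sub_cancel, sub_zero, div_one] at hs'
  rw [← hs']
  have h := hC _ (hmem s hs1).2 z hz (η' - η)
  refine ⟨h.2, h.1.trans ?_⟩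
  rw [add_sub_cancel_left, pow_two, mul_assoc]
  gcongr
  exact (hmem s hs1).1

end Calculus


/-! ### Residuals of the realized variances -/

section Residuals

variable {Ω : Type*} {p : Params}
  {X : ℝ → ℝ → Ω → ℝ} {T b r : ℝ} {M N : ℕ → ℕ}

/-- The average over the spatial grid, summed over the two time scales. -/
noncomputable def gridAvg (M : ℕ) (g : Fin 2 → ℕ → ℝ) : ℝ :=
  1 / (M : ℝ) * ∑ ν : Fin 2, ∑ k ∈ Finset.range M, g ν k

lemma gridAvg_mono {M : ℕ} {g g' : Fin 2 → ℕ → ℝ} (h : ∀ ν, ∀ k < M, g ν k ≤ g' ν k) :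
    gridAvg M g ≤ gridAvg M g' := by
  unfold gridAvg
  gcongr with ν _ k hk
  exact h ν k (Finset.mem_range.1 hk)

lemma gridAvg_add (M : ℕ) (g g' : Fin 2 → ℕ → ℝ) :
    gridAvg M (fun ν k => g ν k + g' ν k) = gridAvg M g + gridAvg M g' := by
  simp only [gridAvg, Finset.sum_add_distrib, mul_add]

lemma gridAvg_sub (M : ℕ) (g g' : Fin 2 → ℕ → ℝ) :
    gridAvg M (fun ν k => g ν k - g' ν k) = gridAvg M g - gridAvg M g' := by
  simp only [gridAvg, Finset.sum_sub_distrib, mul_sub]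

lemma gridAvg_const_mul (M : ℕ) (c : ℝ) (g : Fin 2 → ℕ → ℝ) :
    gridAvg M (fun ν k => c * g ν k) = c * gridAvg M g := by
  simp only [gridAvg, ← Finset.mul_sum]
  ring

lemma gridAvg_nonneg {M : ℕ} {g : Fin 2 → ℕ → ℝ} (h : ∀ ν, ∀ k < M, 0 ≤ g ν k) :
    0 ≤ gridAvg M g :=
  mul_nonneg (by positivity) (Finset.sum_nonneg fun ν _ => Finset.sum_nonneg fun k hk =>
    h ν k (Finset.mem_range.1 hk))

lemma gridAvg_const {M : ℕ} (hM : 0 < M) (c : ℝ) : gridAvg M (fun _ _ => c) = 2 * c := by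
  have : (0 : ℝ) < M := by exact_mod_cast hM
  simp [gridAvg]
  field_simp

lemma abs_gridAvg_le (M : ℕ) (g : Fin 2 → ℕ → ℝ) : |gridAvg M g| ≤ gridAvg M fun ν k => |g ν k| := by
  unfold gridAvg
  rw [abs_mul, abs_of_nonneg (by positivity : (0 : ℝ) ≤ 1 / M)]
  gcongr
  exact (Finset.abs_sum_le_sum_abs _ _).trans
    (Finset.sum_le_sum fun ν _ => Finset.abs_sum_le_sum_abs _ _)

/-- Jensen's inequality. The factor 2 appears because `gridAvg` adds both time scales and so has
total mass 2; accordingly the mean is `gridAvg M g / 2`. -/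
lemma gridAvg_sq_le {M : ℕ} (hM : 0 < M) (g : Fin 2 → ℕ → ℝ) :
    gridAvg M g ^ 2 ≤ 2 * gridAvg M fun ν k => g ν k ^ 2 := by
  have h0 : (0 : ℝ) < M := by exact_mod_cast hM
  have h1 : 0 ≤ gridAvg M fun ν k => (g ν k - gridAvg M g / 2) ^ 2 :=
    gridAvg_nonneg fun _ _ _ => sq_nonneg _
  have h2 : (fun (ν : Fin 2) (k : ℕ) => (g ν k - gridAvg M g / 2) ^ 2)
      = fun ν k => (g ν k ^ 2 - gridAvg M g * g ν k) + gridAvg M g ^ 2 / 4 := by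
    funext ν k; ring
  rw [h2, gridAvg_add, gridAvg_sub, gridAvg_const hM, gridAvg_const_mul] at h1
  nlinarith

/-- Grid averages of continuous functions converge to integrals. -/
lemma tendsto_gridAvg (h : IsBalanced T b r M N) {F : Fin 2 → ℝ → ℝ} (hF : ∀ ν, Continuous (F ν)) :
    Tendsto (fun n => gridAvg (M n) fun ν k => F ν (gridMid b (M n) k)) atTop
      (𝓝 (∑ ν, 1 / (1 - 2 * b) * ∫ x in b..(1 - b), F ν x)) := by
  have h1 := tendsto_finsetSum Finset.univ fun ν (_ : ν ∈ Finset.univ) =>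
    (tendsto_midpoint_sum h.b_mem (hF ν)).comp h.tendsto_M
  refine h1.congr fun n => ?_
  simp only [gridAvg, Finset.mul_sum, Function.comp]

/-- The realized variance of the increments over `ν + 1` time steps at the spatial point `k`. -/
noncomputable def realizedVar (T b : ℝ) (M N : ℕ) (x : ℝ → ℝ → ℝ) (ν : Fin 2) (k : ℕ) : ℝ :=
  1 / (N * Real.sqrt ((ν + 1 : ℕ) * meshTime T N)) *
    ∑ i ∈ Finset.range (N - ν), obs T b M N x ν i k ^ 2

lemma contrast_eq_gridAvg (T b r : ℝ) (M N : ℕ) (x : ℝ → ℝ → ℝ) (η : EuclideanSpace ℝ (Fin 3)) :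
    contrast T b r M N x η = gridAvg M fun ν k =>
      (realizedVar T b M N x ν k - meanFun r (ν + 1) η (gridMid b M k)) ^ 2 := by
  rw [contrast, contrast1, contrast2, gridAvg, Fin.sum_univ_two, mul_add]
  congr 1
  · simp [realizedVar, obs_zero]
  · simp [realizedVar, obs_one, one_add_one_eq_two]

/-- The error of the realized variance. -/
noncomputable def residual (p : Params) (T b r : ℝ) (M N : ℕ) (X : ℝ → ℝ → Ω → ℝ) (ν : Fin 2) (k : ℕ)
    (ω : Ω) : ℝ :=
  realizedVar T b M N (fun t y => X t y ω) ν k - meanFun r (ν + 1) p.eta (gridMid b M k)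

/-- The bias of the realized variance. -/
noncomputable def resBias (p : Params) (T b r : ℝ) (M N : ℕ) (ν : Fin 2) (k : ℕ) : ℝ :=
  1 / (N * Real.sqrt ((ν + 1 : ℕ) * meshTime T N)) *
    ∑ i ∈ Finset.range (N - ν), covObs p T b M N ν i k ν i k
    - meanFun r (ν + 1) p.eta (gridMid b M k)

/-- The coefficients of a realized variance as a quadratic form. -/
noncomputable def resCoef (T : ℝ) (M N : ℕ) (ν : Fin 2) (k : ℕ) (a : ObsIdx M N) : ℝ :=
  if a.1 = ν then if (a.2.2 : ℕ) = k then 1 / (N * Real.sqrt ((ν + 1 : ℕ) * meshTime T N)) else 0 else 0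

lemma sum_resCoef_mul (T : ℝ) {M N : ℕ} (ν : Fin 2) {k : ℕ} (hk : k < M) (f : Fin 2 → ℕ → ℕ → ℝ) :
    ∑ a : ObsIdx M N, resCoef T M N ν k a * f a.1 a.2.1 a.2.2
      = 1 / (N * Real.sqrt ((ν + 1 : ℕ) * meshTime T N)) * ∑ i ∈ Finset.range (N - ν), f ν i k := by
  have h := sum_obsIdx M N fun ν' i k' => (if ν' = ν then if k' = k then
    1 / (N * Real.sqrt ((ν + 1 : ℕ) * meshTime T N)) else 0 else 0) * f ν' i k'
  simp only [resCoef]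
  rw [h, Finset.sum_eq_single ν, Finset.mul_sum]
  · refine Finset.sum_congr rfl fun i _ => ?_
    rw [Finset.sum_eq_single k]
    · simp
    · intro k' _ hk'; simp [hk']
    · intro hk'; exact absurd (Finset.mem_range.2 hk) hk'
  · intro ν' _ hν'; simp [hν']
  · simp

lemma residual_eq (p : Params) (T b r : ℝ) {M N : ℕ} (X : ℝ → ℝ → Ω → ℝ) (ν : Fin 2) {k : ℕ}
    (hk : k < M) (ω : Ω) :
    residual p T b r M N X ν k ω
      = quadForm (obsVec T b M N X) (obsCov p T b M N) (resCoef T M N ν k) ω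
        + resBias p T b r M N ν k := by
  have h := sum_resCoef_mul T (N := N) ν hk fun ν i k =>
    obs T b M N (fun t y => X t y ω) ν i k ^ 2 - covObs p T b M N ν i k ν i k
  have h' : quadForm (obsVec T b M N X) (obsCov p T b M N) (resCoef T M N ν k) ω
      = ∑ a : ObsIdx M N, resCoef T M N ν k a *
        (obs T b M N (fun t y => X t y ω) a.1 a.2.1 a.2.2 ^ 2
          - covObs p T b M N a.1 a.2.1 a.2.2 a.1 a.2.1 a.2.2) := rfl
  rw [h', h, Finset.sum_sub_distrib, residual, realizedVar, resBias]
  ring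

lemma meanFun_eta (p : Params) (r : ℝ) (ν : ℕ) (z : ℝ) :
    meanFun r ν p.eta z = p.sigmaSq * (p.weight z * p.weight z) * psi p.theta2 (r / Real.sqrt ν) := by
  rw [Params.weight, ← Real.exp_add, meanFun]
  have e0 : p.eta 0 = p.sigmaSq := rfl
  have e1 : p.eta 1 = p.theta2 := rfl
  have e2 : p.eta 2 = p.kappa := rfl
  rw [e0, e1, e2]
  congr 3
  ring

/-- There are two sources of bias. One is the covariance approximation, of relative order Δ. The
other arises for the two-step increments, of which there are N - 1 while the normalization is by N;
this costs 1/N = Δ/T. -/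
theorem exists_resBias_le (hp : p.Admissible) (h : IsBalanced T b r M N) :
    ∃ C : ℝ, 0 ≤ C ∧ ∀ (n : ℕ) (ν : Fin 2) (k : ℕ), k < M n →
      |resBias p T b r (M n) (N n) ν k| ≤ C * meshTime T (N n) := by
  obtain ⟨C, hC, hC'⟩ := exists_normalized_cov hp h
  choose K hK hmK using fun ν : Fin 2 => exists_abs_le_of_continuous
    (φ := meanFun r (ν + 1) p.eta) (by unfold meanFun; fun_prop)
  refine ⟨C + (K 0 + K 1) / T, by have := hK 0; have := hK 1; have := h.T_pos; positivity,
    fun n ν k hk => ?_⟩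
  have hD := h.meshTime_pos n
  have hs := Real.sqrt_pos.2 hD
  have hN : (0 : ℝ) < N n := by exact_mod_cast h.N_pos n
  have hνs : 1 ≤ Real.sqrt (ν + 1 : ℕ) := Real.one_le_sqrt.2 (by exact_mod_cast (by omega))
  have hν0 : 0 < Real.sqrt (ν + 1 : ℕ) := by linarith
  set z := gridMid b (M n) k
  set m := meanFun r (ν + 1) p.eta z with hm
  have hself : p.sigmaSq * (p.weight z * p.weight z) * limCov p.theta2 r ν ν 0 0
      = Real.sqrt (ν + 1 : ℕ) * m := by
    rw [limCov_self_zero hp.theta2_pos, hm, meanFun_eta]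
    ring
  have hνN : (ν : ℕ) ≤ N n := by have := h.N_pos n; omega
  have e1 : resBias p T b r (M n) (N n) ν k
      = 1 / (N n * Real.sqrt (ν + 1 : ℕ)) * ∑ i ∈ Finset.range (N n - ν),
        (covObs p T b (M n) (N n) ν i k ν i k / Real.sqrt (meshTime T (N n))
          - p.sigmaSq * (p.weight z * p.weight z) * limCov p.theta2 r ν ν ((i : ℤ) - i) ((k : ℤ) - k))
        - (ν : ℕ) / (N n) * m := by
    simp only [sub_self, hself]
    rw [resBias, Finset.sum_sub_distrib, Finset.sum_const, Finset.card_range, nsmul_eq_mul,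
      Nat.cast_sub hνN, ← Finset.sum_div, Real.sqrt_mul (by positivity), ← hm]
    field_simp
    ring
  have e2 : |∑ i ∈ Finset.range (N n - ν),
        (covObs p T b (M n) (N n) ν i k ν i k / Real.sqrt (meshTime T (N n))
          - p.sigmaSq * (p.weight z * p.weight z) * limCov p.theta2 r ν ν ((i : ℤ) - i) ((k : ℤ) - k))|
      ≤ N n * (C * meshTime T (N n)) := by
    refine (Finset.abs_sum_le_sum_abs _ _).trans ((Finset.sum_le_sum fun i hi =>
      hC' ν ν n i k i k (Finset.mem_range.1 hi) hk (Finset.mem_range.1 hi) hk).trans ?_)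
    rw [Finset.sum_const, Finset.card_range, nsmul_eq_mul]
    gcongr
    omega
  have e3 : |m| ≤ K 0 + K 1 := by
    have h1 := hmK ν z (gridMid_mem01 h.b_mem hk)
    have h2 := hK 0
    have h3 := hK 1
    fin_cases ν
    · exact h1.trans (by simp; linarith)
    · exact h1.trans (by simp; linarith)
  have e4 : (ν : ℕ) / (N n : ℝ) ≤ meshTime T (N n) / T := by
    rw [meshTime, div_div, mul_comm, ← div_div, div_self h.T_pos.ne']
    gcongr
    exact_mod_cast (by omega : (ν : ℕ) ≤ 1)
  rw [e1]
  refine (abs_sub _ _).trans ?_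
  rw [abs_mul, abs_mul, abs_of_nonneg (by positivity), abs_of_nonneg (a := ((ν : ℕ) : ℝ) / N n)
    (by positivity)]
  have hT := h.T_pos
  calc _ ≤ 1 / (N n * 1) * (N n * (C * meshTime T (N n))) + meshTime T (N n) / T * (K 0 + K 1) := by
        gcongr
    _ = _ := by field_simp

lemma sum_lag_sq_le {m : ℤ → ℤ → ℝ} (hm : Summable fun q : ℤ × ℤ => m q.1 q.2 ^ 2) (n i : ℕ) :
    ∑ j ∈ Finset.range n, m ((i : ℤ) - j) 0 ^ 2 ≤ sumSq m := by
  have hinj : Function.Injective fun j : ℕ => (((i : ℤ) - j, 0) : ℤ × ℤ) := by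
    intro j j' hj
    simpa using hj
  have := hm.sum_le_tsum ((Finset.range n).map ⟨_, hinj⟩) fun _ _ => sq_nonneg _
  rw [Finset.sum_map] at this
  exact this

lemma IsBalanced.tendsto_meshTime (h : IsBalanced T b r M N) :
    Tendsto (fun n => meshTime T (N n)) atTop (𝓝 0) :=
  (tendsto_const_div_atTop_nhds_zero_nat T).comp h.tendsto_N

/-- The score of the residuals in the direction `φ`, up to normalization, is the centred quadratic
functional plus a deterministic remainder. -/
lemma sqrt_mul_gridAvg_residual (h : IsBalanced T b r M N) (n : ℕ) (φ : Fin 2 → ℝ → ℝ) (ω : Ω) :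
    Real.sqrt ((M n : ℝ) * N n) * gridAvg (M n) (fun ν k =>
      residual p T b r (M n) (N n) X ν k ω * φ ν (gridMid b (M n) k))
      = obsForm p T b (M n) (N n) X φ ω + Real.sqrt ((M n : ℝ) * N n) * gridAvg (M n) (fun ν k =>
      resBias p T b r (M n) (N n) ν k * φ ν (gridMid b (M n) k)) := by
  have hD := h.meshTime_pos n
  have hs := Real.sqrt_pos.2 hD
  have hM : (0 : ℝ) < M n := by exact_mod_cast h.M_pos n
  have hN : (0 : ℝ) < N n := by exact_mod_cast h.N_pos n
  have hQ : 0 < Real.sqrt ((M n : ℝ) * N n) := Real.sqrt_pos.2 (by positivity)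
  have hQ2 : Real.sqrt ((M n : ℝ) * N n) ^ 2 = M n * N n := Real.sq_sqrt (by positivity)
  set q := Real.sqrt ((M n : ℝ) * N n) with hq
  rw [← sub_eq_iff_eq_add, ← mul_sub, ← gridAvg_sub]
  have e1 := sum_obsIdx (M n) (N n) fun ν i k => 1 / q
    * (1 / (Real.sqrt (ν + 1 : ℕ) * Real.sqrt (meshTime T (N n)))) * φ ν (gridMid b (M n) k)
    * (obs T b (M n) (N n) (fun t y => X t y ω) ν i k ^ 2 - covObs p T b (M n) (N n) ν i k ν i k)
  have e2 : obsForm p T b (M n) (N n) X φ ω = ∑ a : ObsIdx (M n) (N n), 1 / q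
    * (1 / (Real.sqrt (a.1 + 1 : ℕ) * Real.sqrt (meshTime T (N n)))) * φ a.1 (gridMid b (M n) a.2.2)
    * (obs T b (M n) (N n) (fun t y => X t y ω) a.1 a.2.1 a.2.2 ^ 2
      - covObs p T b (M n) (N n) a.1 a.2.1 a.2.2 a.1 a.2.1 a.2.2) := rfl
  rw [e2, e1, gridAvg, Finset.mul_sum, Finset.mul_sum]
  refine Finset.sum_congr rfl fun ν _ => ?_
  rw [Finset.sum_comm, Finset.mul_sum, Finset.mul_sum]
  refine Finset.sum_congr rfl fun k _ => ?_
  have hν0 : 0 < Real.sqrt (ν + 1 : ℕ) := Real.sqrt_pos.2 (by positivity)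
  rw [← sub_mul, residual, realizedVar, resBias, sub_sub_sub_cancel_right, ← mul_sub,
    ← Finset.sum_sub_distrib, ← Finset.mul_sum, Real.sqrt_mul (by positivity)]
  generalize (∑ i ∈ Finset.range (N n - ν), (obs T b (M n) (N n) (fun t y => X t y ω) ν i k ^ 2
    - covObs p T b (M n) (N n) ν i k ν i k)) = Y
  field_simp
  rw [hQ2]

theorem tendsto_gridAvg_resBias (hp : p.Admissible) (h : IsBalanced T b r M N) {φ : Fin 2 → ℝ → ℝ}
    (hφ : ∀ ν, Continuous (φ ν)) :
    Tendsto (fun n => Real.sqrt ((M n : ℝ) * N n) * gridAvg (M n) (fun ν k =>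
      resBias p T b r (M n) (N n) ν k * φ ν (gridMid b (M n) k))) atTop (𝓝 0) := by
  obtain ⟨B, hB, hB'⟩ := exists_resBias_le hp h
  choose K hK hφK using fun ν => exists_abs_le_of_continuous (hφ ν)
  have h1 : Tendsto (fun n => 2 * B * (K 0 + K 1) * (meshTime T (N n) * Real.sqrt ((M n : ℝ) * N n)))
      atTop (𝓝 0) := by simpa using h.tendsto_meshTime_mul.const_mul (2 * B * (K 0 + K 1))
  refine squeeze_zero_norm (fun n => ?_) h1
  rw [Real.norm_eq_abs, abs_mul, abs_of_nonneg (Real.sqrt_nonneg _)]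
  have h2 : |gridAvg (M n) (fun ν k => resBias p T b r (M n) (N n) ν k * φ ν (gridMid b (M n) k))|
      ≤ 2 * (B * meshTime T (N n) * (K 0 + K 1)) := by
    rw [← gridAvg_const (h.M_pos n)]
    refine (abs_gridAvg_le _ _).trans (gridAvg_mono fun ν k hk => ?_)
    rw [abs_mul]
    have h3 := hφK ν _ (gridMid_mem01 h.b_mem hk)
    have h4 : K ν ≤ K 0 + K 1 := by
      have := hK 0
      have := hK 1
      fin_cases ν <;> simp <;> linarith
    have h5 := hB' n ν k hk
    have h6 := (h.meshTime_pos n).le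
    exact mul_le_mul h5 (h3.trans h4) (abs_nonneg _) (by positivity)
  calc _ ≤ Real.sqrt ((M n : ℝ) * N n) * (2 * (B * meshTime T (N n) * (K 0 + K 1))) := by gcongr
    _ = _ := by ring

/-- The squared weight is exp(-κz), which turns g into h, and the factors 1/√((ν+1)(μ+1)) produce
the relative constants 2, 1 and √2 in U. The left side is half a variance, and U belongs to the
gradient of the contrast, whose factor 2 enters squared; hence 1/8. -/
lemma limVar_gradForm (p : Params) (b r : ℝ) (x : Fin 3 → ℝ) :
    limVar p b r (fun ν => gradForm r p.eta x (ν + 1))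
      = x ⬝ᵥ (matU b r p.eta).mulVec x / 8 := by
  have hw : ∀ ν : ℕ, (fun z => p.weight z ^ 2 * gradForm r p.eta x ν z)
      = weightedGradForm r p.eta x ν := by
    intro ν
    funext z
    rw [weightedGradForm_eq, Params.weight, ← Real.exp_nat_mul]
    have e2 : p.eta 2 = p.kappa := rfl
    rw [e2]
    congr 2
    push_cast
    ring
  have e0 : p.eta 0 = p.sigmaSq := rfl
  have e1 : p.eta 1 = p.theta2 := rfl
  rw [dotProduct_matU, e0, e1]
  simp only [limVar, Fin.sum_univ_two, hw]
  have s2 : Real.sqrt 2 * Real.sqrt 2 = 2 := Real.mul_self_sqrt (by norm_num)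
  have s20 : 0 < Real.sqrt 2 := Real.sqrt_pos.2 (by norm_num)
  have s3 : 1 / Real.sqrt 2 = Real.sqrt 2 / 2 := by field_simp; linarith
  simp only [Fin.val_zero, Fin.val_one, zero_add, one_add_one_eq_two, Nat.cast_one, Real.sqrt_one,
    one_mul, mul_one, Nat.cast_ofNat, s2, s3, div_one, limCov_zero_zero, limCov_zero_one,
    limCov_one_one, sumSq_limCov_one_zero]
  rw [innerB_comm (weightedGradForm r p.eta x 2) (weightedGradForm r p.eta x 1)]
  ring

variable [MeasurableSpace Ω] {P : Measure Ω} [IsProbabilityMeasure P]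

/-- A single spatial point suffices here: averaging in time with square summable correlations gives
variance O(1/N) = O(Δ), and the squared bias is O(Δ²). -/
theorem exists_integral_residual_sq_le (hp : p.Admissible) (hX : IsStationarySolution p X P)
    (h : IsBalanced T b r M N) :
    ∃ C : ℝ, 0 ≤ C ∧ ∀ (n : ℕ) (ν : Fin 2) (k : ℕ), k < M n →
      Integrable (fun ω => residual p T b r (M n) (N n) X ν k ω ^ 2) P ∧
      ∫ ω, residual p T b r (M n) (N n) X ν k ω ^ 2 ∂P
        ≤ C * (meshTime T (N n) + meshTime T (N n) ^ 2) := by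
  obtain ⟨C, hC, hC'⟩ := exists_normalized_cov hp h
  obtain ⟨B, hB, hB'⟩ := exists_resBias_le hp h
  obtain ⟨K, hK, hwK⟩ := exists_abs_le_of_continuous (continuous_weight p)
  have hT := h.T_pos
  have hsm := fun ν : Fin 2 => (decays_limCov hp.theta2_pos h.r_pos ν ν).summable_sq
  set L := fun ν : Fin 2 => sumSq (limCov p.theta2 r ν ν) with hL
  have hL0 : ∀ ν, 0 ≤ L ν := fun ν => tsum_nonneg fun _ => sq_nonneg _
  set A := 2 * ((p.sigmaSq * (K * K)) ^ 2 * (L 0 + L 1)) with hA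
  have hA0 : 0 ≤ A := by have := hL0 0; have := hL0 1; positivity
  have hvar : ∀ (n : ℕ) (ν : Fin 2) (k : ℕ), k < M n →
      2 * ∑ a, ∑ c, resCoef T (M n) (N n) ν k a * resCoef T (M n) (N n) ν k c
        * obsCov p T b (M n) (N n) a c ^ 2
      ≤ 2 * (A / T * meshTime T (N n) + 2 * C ^ 2 * meshTime T (N n) ^ 2) := by
    intro n ν k hk
    have hD := h.meshTime_pos n
    have hs := Real.sqrt_pos.2 hD
    have hN : (0 : ℝ) < N n := by exact_mod_cast h.N_pos n
    have hν1 : (1 : ℝ) ≤ (ν + 1 : ℕ) := by exact_mod_cast (by omega)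
    have e1 : ∑ a, ∑ c, resCoef T (M n) (N n) ν k a * resCoef T (M n) (N n) ν k c
        * obsCov p T b (M n) (N n) a c ^ 2
        = 1 / (N n ^ 2 * (ν + 1 : ℕ)) * ∑ i ∈ Finset.range (N n - ν), ∑ j ∈ Finset.range (N n - ν),
          (covObs p T b (M n) (N n) ν i k ν j k / Real.sqrt (meshTime T (N n))) ^ 2 := by
      have q1 : ∀ a : ObsIdx (M n) (N n), ∑ c, resCoef T (M n) (N n) ν k a
          * resCoef T (M n) (N n) ν k c * obsCov p T b (M n) (N n) a c ^ 2
          = resCoef T (M n) (N n) ν k a * (1 / (N n * Real.sqrt ((ν + 1 : ℕ) * meshTime T (N n))) *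
            ∑ j ∈ Finset.range (N n - ν), covObs p T b (M n) (N n) a.1 a.2.1 a.2.2 ν j k ^ 2) := by
        intro a
        rw [← sum_resCoef_mul T ν hk fun μ j l =>
          covObs p T b (M n) (N n) a.1 a.2.1 a.2.2 μ j l ^ 2, Finset.mul_sum]
        exact Finset.sum_congr rfl fun c _ => by rw [obsCov, Matrix.of_apply]; ring
      rw [Finset.sum_congr rfl fun a _ => q1 a, sum_resCoef_mul T ν hk fun ν' i k' =>
        (1 / (N n * Real.sqrt ((ν + 1 : ℕ) * meshTime T (N n))) *
            ∑ j ∈ Finset.range (N n - ν), covObs p T b (M n) (N n) ν' i k' ν j k ^ 2)]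
      simp only [Finset.mul_sum]
      refine Finset.sum_congr rfl fun i _ => Finset.sum_congr rfl fun j _ => ?_
      rw [div_pow, Real.sq_sqrt hD.le]
      have q2 : Real.sqrt ((ν + 1 : ℕ) * meshTime T (N n)) ^ 2 = (ν + 1 : ℕ) * meshTime T (N n) :=
        Real.sq_sqrt (by positivity)
      have q3 : 0 < Real.sqrt ((ν + 1 : ℕ) * meshTime T (N n)) := Real.sqrt_pos.2 (by positivity)
      calc _ = 1 / (N n ^ 2 * Real.sqrt ((ν + 1 : ℕ) * meshTime T (N n)) ^ 2)
            * covObs p T b (M n) (N n) ν i k ν j k ^ 2 := by field_simp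
        _ = _ := by rw [q2]; field_simp
    have e2 : ∀ i ∈ Finset.range (N n - ν), ∑ j ∈ Finset.range (N n - ν),
          (covObs p T b (M n) (N n) ν i k ν j k / Real.sqrt (meshTime T (N n))) ^ 2
        ≤ A + N n * (2 * (C * meshTime T (N n)) ^ 2) := by
      intro i hi
      have q1 : ∀ j ∈ Finset.range (N n - ν),
          (covObs p T b (M n) (N n) ν i k ν j k / Real.sqrt (meshTime T (N n))) ^ 2
          ≤ 2 * ((p.sigmaSq * (K * K)) ^ 2 * limCov p.theta2 r ν ν ((i : ℤ) - j) 0 ^ 2)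
            + 2 * (C * meshTime T (N n)) ^ 2 := by
        intro j hj
        have q2 := hC' ν ν n i k j k (Finset.mem_range.1 hi) hk (Finset.mem_range.1 hj) hk
        rw [sub_self (k : ℤ)] at q2
        have q3 := sq_le_sq.2 (q2.trans (le_abs_self _))
        have q4 := hwK _ (gridMid_mem01 h.b_mem hk)
        set w := p.weight (gridMid b (M n) k)
        have q5 : (p.sigmaSq * (w * w)) ^ 2 ≤ (p.sigmaSq * (K * K)) ^ 2 := by
          have := hp.sigmaSq_pos
          have q6 : w * w ≤ K * K := by
            rw [← abs_mul_abs_self w]; gcongr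
          have q7 := mul_self_nonneg w
          gcongr
        have q6 := mul_le_mul_of_nonneg_right q5 (sq_nonneg (limCov p.theta2 r ν ν ((i : ℤ) - j) 0))
        set u := covObs p T b (M n) (N n) ν i k ν j k / Real.sqrt (meshTime T (N n))
        set v := p.sigmaSq * (w * w) * limCov p.theta2 r ν ν ((i : ℤ) - j) 0 with hv
        have q7 : (p.sigmaSq * (w * w)) ^ 2 * limCov p.theta2 r ν ν ((i : ℤ) - j) 0 ^ 2 = v ^ 2 := by
          rw [hv]; ring
        nlinarith [sq_nonneg (u - 2 * v)]
      refine (Finset.sum_le_sum q1).trans ?_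
      rw [Finset.sum_add_distrib, ← Finset.mul_sum, ← Finset.mul_sum, Finset.sum_const,
        Finset.card_range, nsmul_eq_mul]
      have q2 : ∑ j ∈ Finset.range (N n - ν), limCov p.theta2 r ν ν ((i : ℤ) - j) 0 ^ 2
          ≤ L 0 + L 1 := by
        refine (sum_lag_sq_le (hsm ν) _ i).trans ?_
        have := hL0 0
        have := hL0 1
        change L ν ≤ L 0 + L 1
        fin_cases ν <;> simp <;> linarith
      rw [hA]
      gcongr
      omega
    rw [e1]
    have e3 := Finset.sum_le_sum e2
    rw [Finset.sum_const, Finset.card_range, nsmul_eq_mul] at e3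
    have e4 : ((N n - ν : ℕ) : ℝ) ≤ N n := by exact_mod_cast Nat.sub_le _ _
    have e5 : meshTime T (N n) / T = 1 / N n := by rw [meshTime]; field_simp
    calc _ ≤ 2 * (1 / (N n ^ 2 * 1) * (N n * (A + N n * (2 * (C * meshTime T (N n)) ^ 2)))) := by
          gcongr
          exact e3.trans (by gcongr)
      _ = 2 * (A * (1 / N n) + 2 * C ^ 2 * meshTime T (N n) ^ 2) := by field_simp
      _ = _ := by rw [← e5]; ring
  refine ⟨4 * (A / T) + 8 * C ^ 2 + 2 * B ^ 2, by positivity, fun n ν k hk => ?_⟩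
  have hG := (isGaussianVec_obsVec hp hX h n).integral_quadForm_sq (resCoef T (M n) (N n) ν k)
  have hm := (isGaussianVec_obsVec hp hX h n).aemeasurable_quadForm (resCoef T (M n) (N n) ν k)
  set Q := quadForm (obsVec T b (M n) (N n) X) (obsCov p T b (M n) (N n)) (resCoef T (M n) (N n) ν k)
  set β := resBias p T b r (M n) (N n) ν k with hβ
  have hres : (fun ω => residual p T b r (M n) (N n) X ν k ω ^ 2) = fun ω => (Q ω + β) ^ 2 := by
    funext ω; rw [residual_eq p T b r X ν hk]
  have hle : ∀ ω, (Q ω + β) ^ 2 ≤ 2 * Q ω ^ 2 + 2 * β ^ 2 := fun ω => by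
    nlinarith [sq_nonneg (Q ω - β)]
  have hinteg : Integrable (fun ω => 2 * Q ω ^ 2 + 2 * β ^ 2) P :=
    (hG.1.const_mul 2).add (integrable_const _)
  have hinteg' : Integrable (fun ω => (Q ω + β) ^ 2) P := by
    refine hinteg.mono' (by fun_prop) (ae_of_all _ fun ω => ?_)
    rw [Real.norm_eq_abs, abs_of_nonneg (sq_nonneg _)]
    exact hle ω
  rw [hres]
  refine ⟨hinteg', (integral_mono hinteg' hinteg hle).trans ?_⟩
  rw [integral_add (hG.1.const_mul 2) (integrable_const _), integral_const_mul, hG.2]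
  simp only [integral_const, probReal_univ, one_smul]
  have h1 := hvar n ν k hk
  have h2 := sq_le_sq.2 ((hB' n ν k hk).trans (le_abs_self _))
  rw [← hβ] at h2
  have hD := h.meshTime_pos n
  have h3 : 0 ≤ A / T * meshTime T (N n) ^ 2 := by positivity
  have h4 : 0 ≤ C ^ 2 * meshTime T (N n) := by positivity
  have h5 : 0 ≤ B ^ 2 * meshTime T (N n) := by positivity
  nlinarith

/-- The mean squared residual. -/
noncomputable def resSq (p : Params) (T b r : ℝ) (M N : ℕ) (X : ℝ → ℝ → Ω → ℝ) (ω : Ω) : ℝ :=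
  gridAvg M fun ν k => residual p T b r M N X ν k ω ^ 2

theorem tendsto_integral_resSq (hp : p.Admissible) (hX : IsStationarySolution p X P)
    (h : IsBalanced T b r M N) :
    (∀ n, Integrable (resSq p T b r (M n) (N n) X) P) ∧
      Tendsto (fun n => ∫ ω, resSq p T b r (M n) (N n) X ω ∂P) atTop (𝓝 0) := by
  obtain ⟨C, hC, hC'⟩ := exists_integral_residual_sq_le hp hX h
  have hi : ∀ n (ν : Fin 2), Integrable (fun ω => ∑ k ∈ Finset.range (M n),
      residual p T b r (M n) (N n) X ν k ω ^ 2) P := fun n ν =>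
    integrable_finsetSum _ fun k hk => (hC' n ν k (Finset.mem_range.1 hk)).1
  refine ⟨fun n => (integrable_finsetSum _ fun ν _ => hi n ν).const_mul _, ?_⟩
  have h1 : Tendsto (fun n => 2 * (C * (meshTime T (N n) + meshTime T (N n) ^ 2))) atTop (𝓝 0) := by
    have := ((h.tendsto_meshTime.add (h.tendsto_meshTime.pow 2)).const_mul C).const_mul 2
    simpa using this
  refine squeeze_zero (fun n => integral_nonneg fun ω => gridAvg_nonneg fun _ _ _ => sq_nonneg _)
    (fun n => ?_) h1
  have h2 : ∫ ω, resSq p T b r (M n) (N n) X ω ∂P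
      = gridAvg (M n) fun ν k => ∫ ω, residual p T b r (M n) (N n) X ν k ω ^ 2 ∂P := by
    simp only [resSq, gridAvg]
    rw [integral_const_mul, integral_finsetSum _ fun ν _ => hi n ν]
    congr 1
    exact Finset.sum_congr rfl fun ν _ =>
      integral_finsetSum _ fun k hk => (hC' n ν k (Finset.mem_range.1 hk)).1
  rw [h2, ← gridAvg_const (h.M_pos n)]
  exact gridAvg_mono fun ν k hk => (hC' n ν k hk).2

end Residuals


/-! ### Deterministic analysis of the contrast -/

section Contrast

variable {Ω : Type*} {p : Params} {X : ℝ → ℝ → Ω → ℝ} {T b r : ℝ} {M N : ℕ → ℕ}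
  {H : Set (EuclideanSpace ℝ (Fin 3))}

lemma continuous_meanFun (r : ℝ) (ν : ℕ) (η : EuclideanSpace ℝ (Fin 3)) :
    Continuous (meanFun r ν η) := by
  unfold meanFun
  fun_prop

lemma exists_closedBall_subset {η : EuclideanSpace ℝ (Fin 3)} {s : Set (EuclideanSpace ℝ (Fin 3))}
    (hs : s ∈ 𝓝 η) (h : 0 < η 1) :
    ∃ ρ > 0, ∀ η' ∈ Metric.closedBall η ρ, η' ∈ s ∧ 0 < η' 1 := by
  have h1 : {η' : EuclideanSpace ℝ (Fin 3) | 0 < η' 1} ∈ 𝓝 η :=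
    (isOpen_lt continuous_const (by fun_prop)).mem_nhds h
  obtain ⟨ρ, hρ, hsub⟩ := Metric.nhds_basis_closedBall.mem_iff.1 (inter_mem hs h1)
  exact ⟨ρ, hρ, fun _ hmem => hsub hmem⟩

/-- Off a neighbourhood of the true parameter, the mean functions stay apart. -/
theorem exists_separation (h : IsBalanced T b r M N) (hHc : IsCompact H)
    (hHpos : ∀ η ∈ H, 0 < η 0 ∧ 0 < η 1) {η₀ : EuclideanSpace ℝ (Fin 3)} (hη₀ : η₀ ∈ H) {ρ : ℝ}
    (hρ : 0 < ρ) :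
    ∃ c > 0, ∀ᶠ n in atTop, ∀ η ∈ H, ρ ≤ ‖η - η₀‖ → c ≤ gridAvg (M n) fun ν k =>
      (meanFun r (ν + 1) η (gridMid b (M n) k) - meanFun r (ν + 1) η₀ (gridMid b (M n) k)) ^ 2 := by
  have hK : IsCompact (H ∩ {η | ρ ≤ ‖η - η₀‖}) :=
    hHc.inter_right (isClosed_le continuous_const (by fun_prop))
  suffices hs : ∃ c > 0, ∀ᶠ n in atTop, ∀ η ∈ H ∩ {η | ρ ≤ ‖η - η₀‖}, c ≤ gridAvg (M n) fun ν k =>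
      (meanFun r (ν + 1) η (gridMid b (M n) k) - meanFun r (ν + 1) η₀ (gridMid b (M n) k)) ^ 2 by
    obtain ⟨c, hc, hs⟩ := hs
    exact ⟨c, hc, hs.mono fun n hn η hη hη' => hn η ⟨hη, hη'⟩⟩
  -- Compactness reduces the claim to a neighbourhood of each η₁ ≠ η₀. There the grid average at η₁
  -- converges to an integral, positive by identifiability, and Lipschitz continuity in η extends
  -- the lower bound to nearby parameters.
  refine hK.induction_on (p := fun s => ∃ c > 0, ∀ᶠ n in atTop, ∀ η ∈ s, c ≤ gridAvg (M n) fun ν k =>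
      (meanFun r (ν + 1) η (gridMid b (M n) k) - meanFun r (ν + 1) η₀ (gridMid b (M n) k)) ^ 2)
    ⟨1, one_pos, by simp⟩ ?_ ?_ ?_
  · rintro s t hst ⟨c, hc, ht⟩
    exact ⟨c, hc, ht.mono fun n hn η hη => hn η (hst hη)⟩
  · rintro s t ⟨c, hc, hs⟩ ⟨c', hc', ht⟩
    refine ⟨min c c', lt_min hc hc', ?_⟩
    filter_upwards [hs, ht] with n hn hn' η hη
    rcases hη with hη | hη
    · exact (min_le_left _ _).trans (hn η hη)
    · exact (min_le_right _ _).trans (hn' η hη)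
  · rintro η₁ ⟨hη₁, hη₁'⟩
    have hcont : ∀ ν : Fin 2, Continuous fun z =>
        meanFun r (ν + 1) η₁ z - meanFun r (ν + 1) η₀ z := fun ν =>
      (continuous_meanFun r _ η₁).sub (continuous_meanFun r _ η₀)
    have hlim := tendsto_gridAvg h fun ν => (hcont ν).pow 2
    set I := ∑ ν : Fin 2, 1 / (1 - 2 * b) * ∫ z in b..(1 - b),
      (meanFun r (ν + 1) η₁ z - meanFun r (ν + 1) η₀ z) ^ 2 with hI
    have hII : ∀ ν : Fin 2, innerB b (fun z => meanFun r (ν + 1) η₁ z - meanFun r (ν + 1) η₀ z)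
        (fun z => meanFun r (ν + 1) η₁ z - meanFun r (ν + 1) η₀ z)
        = 1 / (1 - 2 * b) * ∫ z in b..(1 - b),
          (meanFun r (ν + 1) η₁ z - meanFun r (ν + 1) η₀ z) ^ 2 := by
      intro ν
      simp only [innerB, pow_two]
    have hnn : ∀ ν : Fin 2, 0 ≤ 1 / (1 - 2 * b) * ∫ z in b..(1 - b),
          (meanFun r (ν + 1) η₁ z - meanFun r (ν + 1) η₀ z) ^ 2 := fun ν => by
      rw [← hII]; exact innerB_self_nonneg h.b_mem _
    have hIpos : 0 < I := by
      refine (Finset.sum_nonneg fun ν _ => hnn ν).lt_of_ne fun h0 => ?_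
      have h1 := (Finset.sum_eq_zero_iff_of_nonneg fun ν _ => hnn ν).1 h0.symm
      have h2 : ∀ ν : Fin 2, ∀ z ∈ Icc b (1 - b),
          meanFun r (ν + 1) η₁ z - meanFun r (ν + 1) η₀ z = 0 := fun ν =>
        eq_zero_of_innerB_self h.b_mem (hcont ν) ((hII ν).trans (h1 ν (Finset.mem_univ _)))
      have h3 : η₁ = η₀ := by
        refine eq_of_meanFun_eq h.r_pos h.b_mem.2 (hHpos _ hη₁).1 (hHpos _ hη₁).2 (hHpos _ hη₀).1
          (hHpos _ hη₀).2 ?_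
        rintro ν (rfl | rfl) z hz
        · exact sub_eq_zero.1 (h2 0 z hz)
        · exact sub_eq_zero.1 (h2 1 z hz)
      rw [mem_ofPred_eq, h3, sub_self, norm_zero] at hη₁'
      linarith
    obtain ⟨ρ₁, hρ₁, hball⟩ := exists_closedBall_subset univ_mem (hHpos _ hη₁).2
    choose C hC0 hC using fun ν : Fin 2 => exists_taylor (r := r) h.r_pos hρ₁.le
      (fun η' hη' => (hball η' hη').2) (Nat.succ_pos ν)
    set D := C 0 + C 1 + 1 with hD
    have hDpos : 0 < D := by have := hC0 0; have := hC0 1; positivity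
    have hCD : ∀ ν, C ν ≤ D := by
      intro ν
      have := hC0 0
      have := hC0 1
      fin_cases ν <;> simp [hD] <;> linarith
    -- If the mean functions move by at most e, then I/2 < 2·average + 4e² with 4e² = I/4, which
    -- leaves the lower bound I/8.
    set e := Real.sqrt I / 4 with he
    have hepos : 0 < e := by have := Real.sqrt_pos.2 hIpos; positivity
    have he2 : e ^ 2 = I / 16 := by rw [he, div_pow, Real.sq_sqrt hIpos.le]; norm_num
    refine ⟨Metric.closedBall η₁ (min ρ₁ (e / D)), mem_nhdsWithin_of_mem_nhds
      (Metric.closedBall_mem_nhds _ (by positivity)), I / 8, by positivity, ?_⟩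
    filter_upwards [hlim.eventually_const_lt (show I / 2 < I by linarith)] with n hn η hη
    simp only [Pi.pow_apply] at hn
    rw [mem_closedBall_iff_norm] at hη
    have hstep : ∀ (ν : Fin 2), ∀ k < M n,
        (meanFun r (ν + 1) η₁ (gridMid b (M n) k) - meanFun r (ν + 1) η₀ (gridMid b (M n) k)) ^ 2
        ≤ 2 * (meanFun r (ν + 1) η (gridMid b (M n) k) - meanFun r (ν + 1) η₀ (gridMid b (M n) k)) ^ 2
          + 2 * e ^ 2 := by
      intro ν k hk
      have h1 := (hC ν η (mem_closedBall_iff_norm.2 (hη.trans (min_le_left _ _))) _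
        (gridMid_mem01 h.b_mem hk)).2.1
      have h2 : C ν * ‖η - η₁‖ ≤ e := by
        calc _ ≤ D * (e / D) := mul_le_mul (hCD ν) (hη.trans (min_le_right _ _)) (norm_nonneg _) hDpos.le
          _ = e := by field_simp
      have h3 := sq_le_sq.2 ((h1.trans h2).trans (le_abs_self e))
      simp only [Nat.succ_eq_add_one] at h3
      nlinarith [sq_nonneg (meanFun r (ν + 1) η₁ (gridMid b (M n) k)
        - meanFun r (ν + 1) η₀ (gridMid b (M n) k)
        - 2 * (meanFun r (ν + 1) η (gridMid b (M n) k) - meanFun r (ν + 1) η₀ (gridMid b (M n) k)))]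
    have h1 := gridAvg_mono hstep
    rw [gridAvg_add, gridAvg_const_mul, gridAvg_const (h.M_pos n), he2] at h1
    linarith

/-- A minimizer of the contrast fits at least as well as the true parameter. -/
lemma gridAvg_meanFun_sub_sq_le {M N : ℕ} {ω : Ω} {η : EuclideanSpace ℝ (Fin 3)} (hη₀ : p.eta ∈ H)
    (hmin : IsMinOn (contrast T b r M N (fun t y => X t y ω)) H η) :
    (gridAvg M fun ν k => (meanFun r (ν + 1) η (gridMid b M k)
      - meanFun r (ν + 1) p.eta (gridMid b M k)) ^ 2) ≤ 4 * resSq p T b r M N X ω := by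
  have h1 := isMinOn_iff.1 hmin _ hη₀
  rw [contrast_eq_gridAvg, contrast_eq_gridAvg] at h1
  have h2 : ∀ (ν : Fin 2), ∀ k < M, (meanFun r (ν + 1) η (gridMid b M k)
      - meanFun r (ν + 1) p.eta (gridMid b M k)) ^ 2
      ≤ 2 * (realizedVar T b M N (fun t y => X t y ω) ν k - meanFun r (ν + 1) η (gridMid b M k)) ^ 2
        + 2 * residual p T b r M N X ν k ω ^ 2 := by
    intro ν k _
    rw [residual]
    nlinarith [sq_nonneg (realizedVar T b M N (fun t y => X t y ω) ν k
      - meanFun r (ν + 1) η (gridMid b M k) + (realizedVar T b M N (fun t y => X t y ω) ν k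
      - meanFun r (ν + 1) p.eta (gridMid b M k)))]
  have h3 := gridAvg_mono h2
  rw [gridAvg_add, gridAvg_const_mul, gridAvg_const_mul] at h3
  change _ ≤ 4 * gridAvg M fun ν k => residual p T b r M N X ν k ω ^ 2
  have h4 : gridAvg M (fun ν k => residual p T b r M N X ν k ω ^ 2) = gridAvg M (fun ν k =>
    (realizedVar T b M N (fun t y => X t y ω) ν k - meanFun r (ν + 1) p.eta (gridMid b M k)) ^ 2) := rfl
  rw [h4] at h3 ⊢
  linarith

/-- The first order condition at an interior minimizer. -/
lemma gridAvg_score_eq_zero {M N : ℕ} {x : ℝ → ℝ → ℝ} {η : EuclideanSpace ℝ (Fin 3)} (hr : 0 < r)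
    (hmin : IsMinOn (contrast T b r M N x) H η) (hH : H ∈ 𝓝 η) (hη : 0 < η 1)
    (v : EuclideanSpace ℝ (Fin 3)) :
    gridAvg M (fun ν k => (realizedVar T b M N x ν k - meanFun r (ν + 1) η (gridMid b M k))
      * gradForm r η v.ofLp (ν + 1) (gridMid b M k)) = 0 := by
  have hη' : 0 < (η + (0 : ℝ) • v) 1 := by simpa using hη
  have h1 : HasDerivAt (fun s : ℝ => contrast T b r M N x (η + s • v))
      (1 / (M : ℝ) * ∑ ν : Fin 2, ∑ k ∈ Finset.range M,
        ((2 : ℕ) : ℝ) * (realizedVar T b M N x ν k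
          - meanFun r (ν + 1) (η + (0 : ℝ) • v) (gridMid b M k)) ^ (2 - 1)
          * (-gradForm r (η + (0 : ℝ) • v) v.ofLp (ν + 1) (gridMid b M k))) 0 := by
    simp only [contrast_eq_gridAvg, gridAvg]
    refine (HasDerivAt.fun_sum fun ν _ => HasDerivAt.fun_sum fun k _ => ?_).const_mul _
    exact ((hasDerivAt_meanFun_line hr (Nat.succ_pos ν) η v (gridMid b M k) 0 hη').const_sub
      (realizedVar T b M N x ν k)).fun_pow 2
  have h2 : IsLocalMin (fun s : ℝ => contrast T b r M N x (η + s • v)) 0 := by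
    have h3 : Tendsto (fun s : ℝ => η + s • v) (𝓝 0) (𝓝 η) := by
      have : Continuous fun s : ℝ => η + s • v := by fun_prop
      simpa using this.tendsto 0
    have h4 := h3.eventually (hmin.isLocalMin hH)
    filter_upwards [h4] with s hs
    simpa using hs
  have h5 := h2.hasDerivAt_eq_zero h1
  simp only [zero_smul, add_zero] at h5
  have h6 : (fun (ν : Fin 2) (k : ℕ) => ((2 : ℕ) : ℝ) * (realizedVar T b M N x ν k
      - meanFun r (ν + 1) η (gridMid b M k)) ^ (2 - 1)
        * (-gradForm r η v.ofLp (ν + 1) (gridMid b M k)))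
      = fun ν k => (-2) * ((realizedVar T b M N x ν k - meanFun r (ν + 1) η (gridMid b M k))
      * gradForm r η v.ofLp (ν + 1) (gridMid b M k)) := by
    funext ν k
    norm_num
    ring
  have h7 := gridAvg_const_mul M (-2) fun ν k => (realizedVar T b M N x ν k
    - meanFun r (ν + 1) η (gridMid b M k)) * gradForm r η v.ofLp (ν + 1) (gridMid b M k)
  rw [← h6, gridAvg, h5] at h7
  linarith

lemma gridAvg_sum {ι : Type*} (M : ℕ) (s : Finset ι) (g : ι → Fin 2 → ℕ → ℝ) :
    gridAvg M (fun ν k => ∑ i ∈ s, g i ν k) = ∑ i ∈ s, gridAvg M (g i) := by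
  simp only [gridAvg]
  rw [← Finset.mul_sum]
  congr 1
  exact (Finset.sum_congr rfl fun ν _ => Finset.sum_comm).trans Finset.sum_comm

/-- The normalized Gram form of the gradients on the grid. -/
noncomputable def gramForm (b r : ℝ) (η : EuclideanSpace ℝ (Fin 3)) (M : ℕ) (x y : Fin 3 → ℝ) : ℝ :=
  gridAvg M fun ν k => gradForm r η x (ν + 1) (gridMid b M k) * gradForm r η y (ν + 1) (gridMid b M k)

lemma gramForm_eq (b r : ℝ) (η : EuclideanSpace ℝ (Fin 3)) (M : ℕ) (x y : Fin 3 → ℝ) :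
    gramForm b r η M x y = ∑ i, ∑ j, x i * y j * gramForm b r η M (Pi.single i 1) (Pi.single j 1) := by
  have h1 : ∀ (ν : ℕ) (z : ℝ) (i : Fin 3), gradForm r η (Pi.single i 1) ν z = gradVec r ν η z i := by
    intro ν z i
    simp [gradForm, Pi.single_apply]
  have h2 : ∀ (ν : ℕ) (z : ℝ), gradForm r η x ν z * gradForm r η y ν z
      = ∑ i, ∑ j, x i * y j * (gradVec r ν η z i * gradVec r ν η z j) := by
    intro ν z
    rw [gradForm, gradForm, Finset.sum_mul_sum]
    refine Finset.sum_congr rfl fun i _ => Finset.sum_congr rfl fun j _ => ?_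
    ring
  simp only [gramForm, h1, h2, gridAvg_sum, gridAvg_const_mul]

lemma tendsto_gramForm (h : IsBalanced T b r M N) (η : EuclideanSpace ℝ (Fin 3)) (x y : Fin 3 → ℝ) :
    Tendsto (fun n => gramForm b r η (M n) x y) atTop (𝓝 (x ⬝ᵥ (matV b r η).mulVec y / 2)) := by
  have h1 := tendsto_gridAvg h fun ν : Fin 2 =>
    (continuous_gradForm r η x (ν + 1)).mul (continuous_gradForm r η y (ν + 1))
  have h2 : x ⬝ᵥ (matV b r η).mulVec y / 2 = ∑ ν : Fin 2, 1 / (1 - 2 * b) * ∫ z in b..(1 - b),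
      gradForm r η x (ν + 1) z * gradForm r η y (ν + 1) z := by
    rw [dotProduct_matV, Fin.sum_univ_two]
    simp [innerB, one_add_one_eq_two]
  rw [h2]
  exact h1

/-- Uniform convergence of the Gram forms. -/
lemma exists_gramForm_error (h : IsBalanced T b r M N) (η : EuclideanSpace ℝ (Fin 3)) :
    ∃ e : ℕ → ℝ, Tendsto e atTop (𝓝 0) ∧ ∀ n, ∀ x y : EuclideanSpace ℝ (Fin 3),
      |gramForm b r η (M n) x.ofLp y.ofLp - x.ofLp ⬝ᵥ (matV b r η).mulVec y.ofLp / 2|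
        ≤ e n * ‖x‖ * ‖y‖ := by
  refine ⟨fun n => ∑ i, ∑ j, |gramForm b r η (M n) (Pi.single i 1) (Pi.single j 1)
    - matV b r η i j / 2|, ?_, fun n x y => ?_⟩
  · have h1 := tendsto_finsetSum Finset.univ fun i (_ : i ∈ Finset.univ) =>
      tendsto_finsetSum Finset.univ fun j (_ : j ∈ Finset.univ) =>
        ((tendsto_gramForm h η (Pi.single i 1) (Pi.single j 1)).sub_const
          (matV b r η i j / 2)).abs
    simpa using h1
  · have h1 : x.ofLp ⬝ᵥ (matV b r η).mulVec y.ofLp / 2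
        = ∑ i, ∑ j, x i * y j * (matV b r η i j / 2) := by
      simp only [dotProduct, Matrix.mulVec, Finset.mul_sum, Finset.sum_div]
      refine Finset.sum_congr rfl fun i _ => Finset.sum_congr rfl fun j _ => ?_
      ring
    rw [gramForm_eq, h1, ← Finset.sum_sub_distrib, Finset.sum_mul, Finset.sum_mul]
    refine (Finset.abs_sum_le_sum_abs _ _).trans (Finset.sum_le_sum fun i _ => ?_)
    rw [← Finset.sum_sub_distrib, Finset.sum_mul, Finset.sum_mul]
    refine (Finset.abs_sum_le_sum_abs _ _).trans (Finset.sum_le_sum fun j _ => ?_)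
    rw [← mul_sub, abs_mul, abs_mul, mul_comm, mul_assoc]
    gcongr
    · exact PiLp.norm_apply_le x i
    · exact PiLp.norm_apply_le y j

/-- The score at the true parameter in the direction `x`. -/
noncomputable def score (p : Params) (T b r : ℝ) (M N : ℕ) (X : ℝ → ℝ → Ω → ℝ) (x : Fin 3 → ℝ)
    (ω : Ω) : ℝ :=
  gridAvg M fun ν k => residual p T b r M N X ν k ω * gradForm r p.eta x (ν + 1) (gridMid b M k)

/-- Linearization of the first order condition. -/
theorem exists_score_sub_gramForm_le (hp : p.Admissible) (h : IsBalanced T b r M N)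
    (hHint : H ∈ 𝓝 p.eta) :
    ∃ ρ > 0, ∃ C, 0 ≤ C ∧ ∀ (n : ℕ) (ω : Ω) (η : EuclideanSpace ℝ (Fin 3)), ‖η - p.eta‖ < ρ →
      IsMinOn (contrast T b r (M n) (N n) (fun t y => X t y ω)) H η →
      ∀ x : EuclideanSpace ℝ (Fin 3),
        |score p T b r (M n) (N n) X x.ofLp ω - gramForm b r p.eta (M n) (η - p.eta).ofLp x.ofLp|
          ≤ C * ‖x‖ * ‖η - p.eta‖ *
            (Real.sqrt (2 * resSq p T b r (M n) (N n) X ω) + ‖η - p.eta‖) := by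
  have hη1 : 0 < p.eta 1 := hp.theta2_pos
  obtain ⟨ρ, hρ, hball⟩ := exists_closedBall_subset (interior_mem_nhds.2 hHint) hη1
  choose C hC0 hC using fun ν : Fin 2 => exists_taylor (r := r) h.r_pos hρ.le
    (fun η' hη' => (hball η' hη').2) (Nat.succ_pos ν)
  set D := C 0 + C 1 with hD
  have hD0 : 0 ≤ D := add_nonneg (hC0 0) (hC0 1)
  have hCD : ∀ ν, C ν ≤ D := by
    intro ν
    have := hC0 0
    have := hC0 1
    fin_cases ν <;> simp [hD] <;> linarith
  refine ⟨ρ, hρ, D + 4 * D ^ 2, by positivity, fun n ω η hη hmin x => ?_⟩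
  have hmem : η ∈ Metric.closedBall p.eta ρ := mem_closedBall_iff_norm.2 hη.le
  have hfoc := gridAvg_score_eq_zero h.r_pos hmin (mem_interior_iff_mem_nhds.1 (hball η hmem).1)
    (hball η hmem).2 x
  set d := η - p.eta with hd
  have hpt : ∀ (ν : Fin 2), ∀ k < M n,
      |residual p T b r (M n) (N n) X ν k ω * gradForm r p.eta x.ofLp (ν + 1) (gridMid b (M n) k)
        - gradForm r p.eta d.ofLp (ν + 1) (gridMid b (M n) k)
          * gradForm r p.eta x.ofLp (ν + 1) (gridMid b (M n) k)
        - (realizedVar T b (M n) (N n) (fun t y => X t y ω) ν k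
          - meanFun r (ν + 1) η (gridMid b (M n) k)) * gradForm r η x.ofLp (ν + 1) (gridMid b (M n) k)|
      ≤ D * ‖d‖ * ‖x‖ * |residual p T b r (M n) (N n) X ν k ω| + 2 * D ^ 2 * ‖d‖ ^ 2 * ‖x‖ := by
    intro ν k hk
    have hz := gridMid_mem01 h.b_mem hk
    obtain ⟨t1, t2, t3⟩ := hC ν η hmem _ hz
    have t4 := ((hC ν p.eta (Metric.mem_closedBall_self hρ.le) _ hz).1 x).2
    have t5 := (t1 x).1
    simp only [Nat.succ_eq_add_one] at t2 t3 t4 t5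
    rw [← hd] at t2 t3 t5
    have hx := norm_nonneg x
    have hdn := norm_nonneg d
    have t2' : |meanFun r (ν + 1) η (gridMid b (M n) k) - meanFun r (ν + 1) p.eta (gridMid b (M n) k)|
      ≤ D * ‖d‖ := t2.trans (by gcongr; exact hCD ν)
    have t3' := t3.trans (mul_le_mul_of_nonneg_right (hCD ν) (sq_nonneg ‖d‖))
    have t4' := t4.trans (mul_le_mul_of_nonneg_right (hCD ν) hx)
    have t5' := t5.trans (mul_le_mul_of_nonneg_right (mul_le_mul_of_nonneg_right (hCD ν) hdn) hx)
    rw [residual]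
    set Y := realizedVar T b (M n) (N n) (fun t y => X t y ω) ν k
    set f := meanFun r (ν + 1) η (gridMid b (M n) k)
    set f₀ := meanFun r (ν + 1) p.eta (gridMid b (M n) k)
    set g := gradForm r η x.ofLp (ν + 1) (gridMid b (M n) k)
    set g₀ := gradForm r p.eta x.ofLp (ν + 1) (gridMid b (M n) k)
    set q := gradForm r p.eta d.ofLp (ν + 1) (gridMid b (M n) k)
    -- The last product averages to 0 by the first order condition. The right side consists of the
    -- residual times the change of the gradient and of two terms quadratic in the parameter error.
    -- The former is controlled through the mean squared residual.
    have e1 : (Y - f₀) * g₀ - q * g₀ - (Y - f) * g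
        = -((g - g₀) * (Y - f₀)) + ((f - f₀) * (g - g₀) + (f - f₀ - q) * g₀) := by ring
    rw [e1]
    refine (abs_add_le _ _).trans (add_le_add ?_ ((abs_add_le _ _).trans ?_))
    · rw [abs_neg, abs_mul]
      gcongr
    · rw [abs_mul, abs_mul]
      calc _ ≤ D * ‖d‖ * (D * ‖d‖ * ‖x‖) + D * ‖d‖ ^ 2 * (D * ‖x‖) := by gcongr
        _ = _ := by ring
  have hsum := (abs_gridAvg_le _ _).trans (gridAvg_mono hpt)
  rw [gridAvg_sub, gridAvg_sub, hfoc, sub_zero, gridAvg_add, gridAvg_const_mul,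
    gridAvg_const (h.M_pos n)] at hsum
  have hZ : gridAvg (M n) (fun ν k => |residual p T b r (M n) (N n) X ν k ω|)
      ≤ Real.sqrt (2 * resSq p T b r (M n) (N n) X ω) := by
    refine Real.le_sqrt_of_sq_le ((gridAvg_sq_le (h.M_pos n) _).trans (le_of_eq ?_))
    simp only [sq_abs, resSq]
  have hx := norm_nonneg x
  have hdn := norm_nonneg d
  have hs := Real.sqrt_nonneg (2 * resSq p T b r (M n) (N n) X ω)
  refine hsum.trans ?_
  set s := Real.sqrt (2 * resSq p T b r (M n) (N n) X ω)
  calc _ ≤ D * ‖d‖ * ‖x‖ * s + 2 * (2 * D ^ 2 * ‖d‖ ^ 2 * ‖x‖) := by gcongr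
    _ ≤ D * ‖d‖ * ‖x‖ * s + 2 * (2 * D ^ 2 * ‖d‖ ^ 2 * ‖x‖)
        + (4 * D ^ 2 * (‖x‖ * ‖d‖ * s) + D * (‖x‖ * ‖d‖ * ‖d‖)) :=
      le_add_of_nonneg_right (by positivity)
    _ = _ := by ring

end Contrast


/-! ### Asymptotic normality -/

/-- If `u - W` is small relative to `W` wherever `Z` is small, and `Z` tends to `0` in `L¹` while `W`
is bounded in `L²`, then `u - W` tends to `0` in probability. -/
theorem tendstoInMeasure_sub_of_relative_bound {Ω E : Type*} [MeasurableSpace Ω] {P : Measure Ω}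
    [IsProbabilityMeasure P] [NormedAddCommGroup E] {u W : ℕ → Ω → E} {Z : ℕ → Ω → ℝ}
    (hZ0 : ∀ n ω, 0 ≤ Z n ω) (hZi : ∀ n, Integrable (Z n) P)
    (hZ : Tendsto (fun n => ∫ ω, Z n ω ∂P) atTop (𝓝 0))
    (hWi : ∀ n, Integrable (fun ω => ‖W n ω‖ ^ 2) P) {B : ℝ}
    (hW : ∀ᶠ n in atTop, ∫ ω, ‖W n ω‖ ^ 2 ∂P ≤ B)
    (hrel : ∀ κ > 0, ∃ z > 0, ∀ᶠ n in atTop, ∀ᵐ ω ∂P, Z n ω < z → ‖u n ω - W n ω‖ ≤ κ * ‖W n ω‖) :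
    TendstoInMeasure P (u - W) atTop 0 := by
  rw [tendstoInMeasure_iff_norm]
  intro ε hε
  rw [ENNReal.tendsto_nhds_zero]
  intro τ hτ
  rcases eq_or_ne τ ⊤ with rfl | hτtop
  · simp
  have hτ' : 0 < τ.toReal := ENNReal.toReal_pos hτ.ne' hτtop
  set t := τ.toReal with ht
  obtain ⟨n₀, hn₀⟩ := hW.exists
  have hB : 0 ≤ B := (integral_nonneg fun ω => sq_nonneg _).trans hn₀
  -- By Markov's inequality ‖W‖ ≥ L has probability at most B/L² ≤ t/2. The summand 1 keeps L
  -- positive when B = 0.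
  set L := Real.sqrt (2 * B / t + 1) with hL
  have hL2 : L ^ 2 = 2 * B / t + 1 := Real.sq_sqrt (by positivity)
  have hL0 : 0 < L := Real.sqrt_pos.2 (by positivity)
  obtain ⟨z, hz, hrel'⟩ := hrel (ε / (2 * L)) (by positivity)
  have hZ' := hZ.eventually_lt_const (show 0 < z * (t / 2) by positivity)
  filter_upwards [hW, hrel', hZ'] with n h1 h2 h3
  have m1 := mul_meas_ge_le_integral_of_nonneg (ae_of_all _ (hZ0 n)) (hZi n) z
  have m2 := mul_meas_ge_le_integral_of_nonneg (ae_of_all _ fun ω => sq_nonneg ‖W n ω‖) (hWi n) (L ^ 2)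
  have q1 : P.real {ω | z ≤ Z n ω} ≤ t / 2 := by
    have : z * P.real {ω | z ≤ Z n ω} ≤ z * (t / 2) := m1.trans h3.le
    exact le_of_mul_le_mul_left this hz
  have q2 : P.real {ω | L ^ 2 ≤ ‖W n ω‖ ^ 2} ≤ t / 2 := by
    have hL2pos : 0 < L ^ 2 := by positivity
    have : L ^ 2 * P.real {ω | L ^ 2 ≤ ‖W n ω‖ ^ 2} ≤ L ^ 2 * (t / 2) := by
      refine (m2.trans h1).trans ?_
      rw [hL2, add_mul, div_mul_div_comm]
      have : 2 * B * t / (t * 2) = B := by field_simp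
      rw [this]
      linarith
    exact le_of_mul_le_mul_left this hL2pos
  have hsub : P {ω | ε ≤ ‖(u - W) n ω - (0 : Ω → E) ω‖}
      ≤ P ({ω | z ≤ Z n ω} ∪ {ω | L ^ 2 ≤ ‖W n ω‖ ^ 2}) := by
    refine measure_mono_ae ?_
    filter_upwards [h2] with ω hω hmem
    by_contra hcon
    replace hcon : ¬(z ≤ Z n ω ∨ L ^ 2 ≤ ‖W n ω‖ ^ 2) := hcon
    rw [not_or] at hcon
    have c1 : Z n ω < z := not_le.1 hcon.1
    have c2 : ‖W n ω‖ ^ 2 < L ^ 2 := not_le.1 hcon.2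
    have c3 : ‖W n ω‖ ≤ L := le_of_lt (lt_of_pow_lt_pow_left₀ 2 hL0.le c2)
    have c4 : ε ≤ ‖u n ω - W n ω‖ := by
      have : ε ≤ ‖(u - W) n ω - (0 : Ω → E) ω‖ := hmem
      simpa using this
    have c5 : ε / (2 * L) * ‖W n ω‖ ≤ ε / (2 * L) * L := by gcongr
    have c6 : ε / (2 * L) * L = ε / 2 := by field_simp
    linarith [hω c1]
  refine hsub.trans ((measure_union_le _ _).trans ?_)
  rw [← ENNReal.ofReal_toReal hτtop, ← ht, ← add_halves t, ENNReal.ofReal_add (by positivity)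
    (by positivity)]
  refine add_le_add ?_ ?_
  · rw [← ofReal_measureReal]; exact ENNReal.ofReal_le_ofReal q1
  · rw [← ofReal_measureReal]; exact ENNReal.ofReal_le_ofReal q2

section Normality

variable {Ω : Type*} {p : Params} {X : ℝ → ℝ → Ω → ℝ} {T b r : ℝ} {M N : ℕ → ℕ}
  {H : Set (EuclideanSpace ℝ (Fin 3))}

lemma gradForm_sum (r : ℝ) (η : EuclideanSpace ℝ (Fin 3)) (t : Fin 3 → ℝ) (v : Fin 3 → Fin 3 → ℝ)
    (ν : ℕ) (z : ℝ) : gradForm r η (∑ j, t j • v j) ν z = ∑ j, t j * gradForm r η (v j) ν z := by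
  simp only [gradForm, Finset.sum_apply, Pi.smul_apply, smul_eq_mul, Finset.sum_mul, Finset.mul_sum]
  rw [Finset.sum_comm]
  refine Finset.sum_congr rfl fun j _ => Finset.sum_congr rfl fun i _ => ?_
  ring

lemma score_sum (p : Params) (T b r : ℝ) (M N : ℕ) (X : ℝ → ℝ → Ω → ℝ) (t : Fin 3 → ℝ)
    (v : Fin 3 → Fin 3 → ℝ) (ω : Ω) :
    score p T b r M N X (∑ j, t j • v j) ω = ∑ j, t j * score p T b r M N X (v j) ω := by
  simp only [score, ← gridAvg_const_mul, ← gridAvg_sum, gradForm_sum, Finset.mul_sum]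
  congr 1
  funext ν k
  exact Finset.sum_congr rfl fun j _ => by ring

/-- The direction `2 V⁻¹ t`. -/
noncomputable def newtonDir (b r : ℝ) (η : EuclideanSpace ℝ (Fin 3)) (t : Fin 3 → ℝ) : Fin 3 → ℝ :=
  (2 : ℝ) • (matV b r η)⁻¹.mulVec t

lemma newtonDir_eq_sum (b r : ℝ) (η : EuclideanSpace ℝ (Fin 3)) (t : Fin 3 → ℝ) :
    newtonDir b r η t = ∑ j, t j • newtonDir b r η (Pi.single j 1) := by
  ext i
  simp only [newtonDir, Matrix.mulVec_single_one, Pi.smul_apply, Finset.sum_apply, smul_eq_mul,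
    Matrix.mulVec, dotProduct, Finset.mul_sum, Matrix.col_apply]
  refine Finset.sum_congr rfl fun j _ => ?_
  ring

/-- The linear approximation of the normalized estimation error. -/
noncomputable def newtonStep (p : Params) (T b r : ℝ) (M N : ℕ) (X : ℝ → ℝ → Ω → ℝ) (ω : Ω) :
    EuclideanSpace ℝ (Fin 3) :=
  WithLp.toLp 2 fun j => Real.sqrt ((M : ℝ) * N) *
    score p T b r M N X (newtonDir b r p.eta (Pi.single j 1)) ω

lemma inner_newtonStep (p : Params) (T b r : ℝ) (M N : ℕ) (X : ℝ → ℝ → Ω → ℝ) (ω : Ω)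
    (t : EuclideanSpace ℝ (Fin 3)) :
    inner ℝ (newtonStep p T b r M N X ω) t
      = Real.sqrt ((M : ℝ) * N) * score p T b r M N X (newtonDir b r p.eta t.ofLp) ω := by
  rw [newtonDir_eq_sum, score_sum, Finset.mul_sum, PiLp.inner_apply]
  refine Finset.sum_congr rfl fun j _ => ?_
  simp only [newtonStep, RCLike.inner_apply, conj_trivial]
  ring

lemma norm_le_sum_abs (v : EuclideanSpace ℝ (Fin 3)) : ‖v‖ ≤ ∑ j, |v j| := by
  rw [EuclideanSpace.norm_eq, Real.sqrt_le_iff]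
  refine ⟨Finset.sum_nonneg fun j _ => abs_nonneg _, ?_⟩
  simp only [Fin.sum_univ_three, Real.norm_eq_abs]
  nlinarith [mul_nonneg (abs_nonneg (v 0)) (abs_nonneg (v 1)),
    mul_nonneg (abs_nonneg (v 0)) (abs_nonneg (v 2)), mul_nonneg (abs_nonneg (v 1)) (abs_nonneg (v 2))]

lemma Params.Admissible.posDef_matV (hp : p.Admissible) (h : IsBalanced T b r M N) :
    (matV b r p.eta).PosDef :=
  ParabolicSPDE.posDef_matV h.b_mem h.r_pos hp.sigmaSq_pos hp.theta2_pos

lemma matV_mulVec_newtonDir (hp : p.Admissible) (h : IsBalanced T b r M N) (t : Fin 3 → ℝ) :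
    (matV b r p.eta).mulVec (newtonDir b r p.eta t) = (2 : ℝ) • t := by
  have hu : IsUnit (matV b r p.eta).det :=
    (Matrix.isUnit_iff_isUnit_det _).1 (hp.posDef_matV h).isUnit
  rw [newtonDir, Matrix.mulVec_smul, Matrix.mulVec_mulVec, Matrix.mul_nonsing_inv _ hu,
    Matrix.one_mulVec]

/-- Where the residuals are small, a minimizer is close to the linear approximation. -/
theorem exists_norm_sub_newtonStep_le (hp : p.Admissible) (h : IsBalanced T b r M N)
    (hHc : IsCompact H) (hHpos : ∀ η ∈ H, 0 < η 0 ∧ 0 < η 1) (hHint : H ∈ 𝓝 p.eta) {κ : ℝ}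
    (hκ : 0 < κ) :
    ∃ z > 0, ∀ᶠ n in atTop, ∀ (ω : Ω) (η : EuclideanSpace ℝ (Fin 3)), η ∈ H →
      IsMinOn (contrast T b r (M n) (N n) (fun t y => X t y ω)) H η →
      resSq p T b r (M n) (N n) X ω < z →
      ‖Real.sqrt ((M n : ℝ) * N n) • (η - p.eta) - newtonStep p T b r (M n) (N n) X ω‖
        ≤ κ * ‖newtonStep p T b r (M n) (N n) X ω‖ := by
  obtain ⟨ρ, hρ, C, hC, hlin⟩ := exists_score_sub_gramForm_le (X := X) hp h hHint
  obtain ⟨e, he, hgram⟩ := exists_gramForm_error h p.eta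
  set x : Fin 3 → EuclideanSpace ℝ (Fin 3) := fun j =>
    WithLp.toLp 2 (newtonDir b r p.eta (Pi.single j 1)) with hx
  set Λ := ∑ j, ‖x j‖ with hΛ
  have hΛ0 : 0 ≤ Λ := Finset.sum_nonneg fun j _ => norm_nonneg _
  -- The error is first bounded by κ' times the norm of the scaled estimation error. The bound 1/2
  -- lets this be inverted to a bound relative to the Newton step, and κ/2 absorbs the factor 2 lost
  -- in doing so. The radius γ makes the sum of all coordinate errors at most κ'.
  set κ' := min (κ / 2) (1 / 2) with hκ'
  have hκ'0 : 0 < κ' := by positivity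
  set γ := κ' / (Λ * (2 * C + 1) + 1) with hγ
  have hγ0 : 0 < γ := by positivity
  have hγκ : Λ * ((2 * C + 1) * γ) ≤ κ' := by
    have e1 : γ * (Λ * (2 * C + 1) + 1) = κ' := by rw [hγ]; field_simp
    nlinarith
  -- Localization: if the mean squared residual is below c/4, a minimizer cannot lie outside the
  -- ball of radius min ρ γ, because it fits at least as well as the true parameter.
  obtain ⟨c, hc, hsep⟩ := exists_separation h hHc hHpos (mem_of_mem_nhds hHint) (lt_min hρ hγ0)
  refine ⟨min (γ ^ 2 / 2) (c / 4), by positivity, ?_⟩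
  filter_upwards [hsep, he.eventually_lt_const hγ0] with n hn hen ω η hη hmin hZ
  set Z := resSq p T b r (M n) (N n) X ω with hZdef
  set W := newtonStep p T b r (M n) (N n) X ω with hW
  set q := Real.sqrt ((M n : ℝ) * N n) with hq
  have hq0 : 0 ≤ q := Real.sqrt_nonneg _
  set d := η - p.eta with hd
  have hd' : ‖d‖ < min ρ γ := by
    by_contra hcon
    have h1 := hn η hη (not_lt.1 hcon)
    have h2 := gridAvg_meanFun_sub_sq_le (p := p) (mem_of_mem_nhds hHint) hmin
    have h3 := hZ.trans_le (min_le_right _ _)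
    linarith
  have hs : Real.sqrt (2 * Z) ≤ γ := by
    refine Real.sqrt_le_iff.2 ⟨hγ0.le, ?_⟩
    have := hZ.trans_le (min_le_left _ _)
    linarith
  have hdγ : ‖d‖ ≤ γ := (hd'.trans_le (min_le_right _ _)).le
  have hdn := norm_nonneg d
  have hcoord : ∀ j, |(q • d - W) j| ≤ q * (‖x j‖ * (‖d‖ * ((2 * C + 1) * γ))) := by
    intro j
    have h1 := hlin n ω η (hd'.trans_le (min_le_left _ _)) hmin (x j)
    have h2 := hgram n d (x j)
    have h3 : d.ofLp ⬝ᵥ (matV b r p.eta).mulVec (x j).ofLp / 2 = d j := by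
      change d.ofLp ⬝ᵥ (matV b r p.eta).mulVec (newtonDir b r p.eta (Pi.single j 1)) / 2 = d j
      rw [matV_mulVec_newtonDir hp h]
      simp
    rw [h3] at h2
    have hxj := norm_nonneg (x j)
    have h1' : |score p T b r (M n) (N n) X (x j).ofLp ω
        - gramForm b r p.eta (M n) d.ofLp (x j).ofLp| ≤ C * ‖x j‖ * ‖d‖ * (γ + γ) :=
      h1.trans (by gcongr)
    have h2' : |gramForm b r p.eta (M n) d.ofLp (x j).ofLp - d j| ≤ γ * ‖d‖ * ‖x j‖ :=
      h2.trans (by gcongr)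
    have h4 : (q • d - W) j = q * (d j - score p T b r (M n) (N n) X (x j).ofLp ω) := by
      rw [mul_sub]; rfl
    rw [h4, abs_mul, abs_of_nonneg hq0, abs_sub_comm]
    refine mul_le_mul_of_nonneg_left ((abs_sub_le _ _ _).trans ((add_le_add h1' h2').trans ?_)) hq0
    exact le_of_eq (by ring)
  have hmain : ‖q • d - W‖ ≤ κ' * ‖q • d‖ := by
    refine (norm_le_sum_abs _).trans ((Finset.sum_le_sum fun j _ => hcoord j).trans ?_)
    rw [← Finset.mul_sum, ← Finset.sum_mul, ← hΛ, norm_smul, Real.norm_eq_abs, abs_of_nonneg hq0]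
    calc _ = Λ * ((2 * C + 1) * γ) * (q * ‖d‖) := by ring
      _ ≤ _ := by gcongr
  -- Since κ' ≤ 1/2, the triangle inequality can be solved for the scaled error. No tightness of the
  -- estimator has to be established separately.
  have h5 : ‖q • d‖ ≤ 2 * ‖W‖ := by
    have h6 : ‖q • d‖ ≤ ‖q • d - W‖ + ‖W‖ := by
      simpa using norm_add_le (q • d - W) W
    have h7 : κ' * ‖q • d‖ ≤ 1 / 2 * ‖q • d‖ := by gcongr; exact min_le_right _ _
    linarith
  calc _ ≤ κ' * ‖q • d‖ := hmain
    _ ≤ κ / 2 * (2 * ‖W‖) := by gcongr; exact min_le_left _ _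
    _ = _ := by ring

lemma exists_sqrt_mul_score_eq (hp : p.Admissible) (h : IsBalanced T b r M N) (x : Fin 3 → ℝ) :
    ∃ c : ℕ → ℝ, Tendsto c atTop (𝓝 0) ∧ ∀ (X : ℝ → ℝ → Ω → ℝ) n,
      (fun ω => Real.sqrt ((M n : ℝ) * N n) * score p T b r (M n) (N n) X x ω)
        = fun ω => obsForm p T b (M n) (N n) X (fun ν => gradForm r p.eta x (ν + 1)) ω + c n :=
  ⟨_, tendsto_gridAvg_resBias hp h fun ν => continuous_gradForm r p.eta x (ν + 1),
    fun _ n => funext fun ω => sqrt_mul_gridAvg_residual h n _ ω⟩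

/-- The direction is 2V⁻¹t, so the quadratic form of U gains a factor 4 against 1/8. The result is
half the target variance, exactly the exponent of a Gaussian characteristic function. -/
lemma limVar_newtonDir (hp : p.Admissible) (h : IsBalanced T b r M N) (t : Fin 3 → ℝ) :
    limVar p b r (fun ν => gradForm r p.eta (newtonDir b r p.eta t) (ν + 1))
      = t ⬝ᵥ (asymptoticCov b r p.eta).mulVec t / 2 := by
  have hV : ((matV b r p.eta)⁻¹).transpose = (matV b r p.eta)⁻¹ := by
    have := (hp.posDef_matV h).isHermitian.inv
    rwa [Matrix.IsHermitian, Matrix.conjTranspose_eq_transpose_of_trivial] at this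
  rw [limVar_gradForm, asymptoticCov, newtonDir, Matrix.mulVec_smul, smul_dotProduct,
    dotProduct_smul, ← Matrix.mulVec_mulVec, ← Matrix.mulVec_mulVec,
    Matrix.dotProduct_mulVec t, ← Matrix.mulVec_transpose, hV]
  simp only [smul_eq_mul]
  ring

variable [MeasurableSpace Ω] {P : Measure Ω}

lemma expI_add_const (Y : Ω → ℝ) (c : ℝ) :
    expI P (fun ω => Y ω + c) = expI P Y * Complex.exp (c * Complex.I) := by
  rw [expI, expI, ← integral_mul_const]
  refine integral_congr_ae (ae_of_all _ fun ω => ?_)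
  simp only [Complex.ofReal_add, add_mul, Complex.exp_add]

variable [IsProbabilityMeasure P]

lemma aemeasurable_newtonStep (hp : p.Admissible) (hX : IsStationarySolution p X P)
    (h : IsBalanced T b r M N) (n : ℕ) :
    AEMeasurable (newtonStep p T b r (M n) (N n) X) P := by
  have h1 : AEMeasurable (fun ω j => Real.sqrt ((M n : ℝ) * N n) *
      score p T b r (M n) (N n) X (newtonDir b r p.eta (Pi.single j 1)) ω) P := by
    refine aemeasurable_pi_lambda _ fun j => ?_
    obtain ⟨c, -, hc⟩ := exists_sqrt_mul_score_eq (Ω := Ω) hp h (newtonDir b r p.eta (Pi.single j 1))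
    rw [hc X n]
    exact ((isGaussianVec_obsVec hp hX h n).aemeasurable_quadForm _).add_const _
  exact (by fun_prop : Measurable (WithLp.toLp (V := Fin 3 → ℝ) 2)).comp_aemeasurable h1

theorem tendsto_expI_inner_newtonStep (hp : p.Admissible) (hX : IsStationarySolution p X P)
    (h : IsBalanced T b r M N) (t : EuclideanSpace ℝ (Fin 3)) :
    Tendsto (fun n => expI P fun ω => inner ℝ (newtonStep p T b r (M n) (N n) X ω) t) atTop
      (𝓝 (Complex.exp ((-(t.ofLp ⬝ᵥ (asymptoticCov b r p.eta).mulVec t.ofLp / 2) : ℝ)))) := by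
  obtain ⟨c, hc0, hc⟩ := exists_sqrt_mul_score_eq (Ω := Ω) hp h (newtonDir b r p.eta t.ofLp)
  simp only [inner_newtonStep, hc X, expI_add_const]
  rw [← limVar_newtonDir hp h]
  have h1 : Tendsto (fun n => Complex.exp (c n * Complex.I)) atTop (𝓝 1) := by
    have h2 : Continuous fun x : ℝ => Complex.exp (x * Complex.I) := by fun_prop
    simpa [Function.comp_def] using (h2.tendsto 0).comp hc0
  have h3 := (tendsto_expI_obsForm hp hX h fun ν : Fin 2 =>
    continuous_gradForm r p.eta (newtonDir b r p.eta t.ofLp) (ν + 1)).mul h1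
  rw [mul_one] at h3
  exact h3

/-- Each coordinate is a centred quadratic functional plus a vanishing constant, and second moments
of such functionals converge. The bound supplies the tightness needed to turn the relative error
estimate into convergence in probability. -/
theorem exists_integral_norm_newtonStep_sq_le (hp : p.Admissible) (hX : IsStationarySolution p X P)
    (h : IsBalanced T b r M N) :
    (∀ n, Integrable (fun ω => ‖newtonStep p T b r (M n) (N n) X ω‖ ^ 2) P) ∧
      ∃ B, ∀ᶠ n in atTop, ∫ ω, ‖newtonStep p T b r (M n) (N n) X ω‖ ^ 2 ∂P ≤ B := by
  choose c hc0 hc using fun j : Fin 3 =>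
    exists_sqrt_mul_score_eq (Ω := Ω) hp h (newtonDir b r p.eta (Pi.single j 1))
  set F : Fin 3 → ℕ → Ω → ℝ := fun j n => obsForm p T b (M n) (N n) X
    (fun ν => gradForm r p.eta (newtonDir b r p.eta (Pi.single j 1)) (ν + 1)) with hF
  have hnorm : ∀ n ω, ‖newtonStep p T b r (M n) (N n) X ω‖ ^ 2 = ∑ j, (F j n ω + c j n) ^ 2 := by
    intro n ω
    rw [EuclideanSpace.norm_sq_eq]
    refine Finset.sum_congr rfl fun j _ => ?_
    rw [Real.norm_eq_abs, sq_abs, ← congrFun (hc j X n) ω]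
    rfl
  have hFi : ∀ j n, Integrable (fun ω => F j n ω ^ 2) P := fun j n =>
    ((isGaussianVec_obsVec hp hX h n).integral_quadForm_sq _).1
  have hFm : ∀ j n, AEMeasurable (F j n) P := fun j n =>
    (isGaussianVec_obsVec hp hX h n).aemeasurable_quadForm _
  have hle : ∀ j n ω, (F j n ω + c j n) ^ 2 ≤ 2 * F j n ω ^ 2 + 2 * c j n ^ 2 := fun j n ω => by
    nlinarith [sq_nonneg (F j n ω - c j n)]
  have hinteg : ∀ j n, Integrable (fun ω => 2 * F j n ω ^ 2 + 2 * c j n ^ 2) P := fun j n =>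
    ((hFi j n).const_mul 2).add (integrable_const _)
  have hinteg' : ∀ j n, Integrable (fun ω => (F j n ω + c j n) ^ 2) P := by
    intro j n
    refine (hinteg j n).mono' (((hFm j n).add_const _).pow_const 2).aestronglyMeasurable
      (ae_of_all _ fun ω => ?_)
    rw [Real.norm_eq_abs, abs_of_nonneg (sq_nonneg _)]
    exact hle j n ω
  simp only [hnorm]
  refine ⟨fun n => integrable_finsetSum _ fun j _ => hinteg' j n, ?_⟩
  have hlim : Tendsto (fun n => ∑ j, (2 * (∫ ω, F j n ω ^ 2 ∂P) + 2 * c j n ^ 2)) atTop (𝓝 _) :=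
    tendsto_finsetSum Finset.univ fun j (_ : j ∈ Finset.univ) =>
      ((tendsto_integral_obsForm_sq hp hX h fun ν : Fin 2 => continuous_gradForm r p.eta
        (newtonDir b r p.eta (Pi.single j 1)) (ν + 1)).const_mul 2).add
        (((hc0 j).pow 2).const_mul 2)
  obtain ⟨B, hB⟩ : ∃ B, ∀ᶠ n in atTop, ∑ j, (2 * (∫ ω, F j n ω ^ 2 ∂P) + 2 * c j n ^ 2) ≤ B :=
    ⟨_, hlim.eventually_le_const (lt_add_one _)⟩
  refine ⟨B, hB.mono fun n hn => ?_⟩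
  refine le_trans ?_ hn
  rw [integral_finsetSum _ fun j _ => hinteg' j n]
  refine Finset.sum_le_sum fun j _ => (integral_mono (hinteg' j n) (hinteg j n) (hle j n)).trans ?_
  rw [integral_add ((hFi j n).const_mul 2) (integrable_const _), integral_const_mul]
  simp

theorem tendstoInDistribution_newtonStep (hp : p.Admissible) (hX : IsStationarySolution p X P)
    (h : IsBalanced T b r M N) :
    TendstoInDistribution (fun n => newtonStep p T b r (M n) (N n) X) atTop
      (id : EuclideanSpace ℝ (Fin 3) → EuclideanSpace ℝ (Fin 3)) (fun _ => P)
      (multivariateGaussian 0 (asymptoticCov b r p.eta)) where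
  forall_aemeasurable := aemeasurable_newtonStep hp hX h
  tendsto := by
    refine ProbabilityMeasure.tendsto_iff_tendsto_charFun.2 fun t => ?_
    have hS : (asymptoticCov b r p.eta).PosSemidef :=
      (posDef_asymptoticCov h.b_mem h.r_pos hp.sigmaSq_pos hp.theta2_pos).posSemidef
    have h1 := tendsto_expI_inner_newtonStep hp hX h t
    have h2 : ∀ n, charFun (P.map (newtonStep p T b r (M n) (N n) X)) t
        = expI P fun ω => inner ℝ (newtonStep p T b r (M n) (N n) X ω) t := by
      intro n
      rw [charFun_apply, integral_map (aemeasurable_newtonStep hp hX h n) (by fun_prop), expI]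
    simp only [ProbabilityMeasure.coe_mk, h2, Measure.map_id]
    rw [charFun_multivariateGaussian hS]
    convert h1 using 3
    simp

end Normality

end ParabolicSPDE

theorem mainTheorem3 {Ω : Type*} [MeasurableSpace Ω] (P : Measure Ω) [IsProbabilityMeasure P]
    (p : Params) (hp : p.Admissible)
    (X : ℝ → ℝ → Ω → ℝ) (hX : IsStationarySolution p X P)
    (T b r : ℝ) (hT : 0 < T) (hb : b ∈ Set.Ioo (0 : ℝ) (1 / 2)) (hr : 0 < r)
    (M N : ℕ → ℕ) (hM : Tendsto M atTop atTop) (hN : Tendsto N atTop atTop)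
    (hbal : ∀ n, meshSpace b (M n) / Real.sqrt (meshTime T (N n)) = r)
    (H : Set (EuclideanSpace ℝ (Fin 3))) (hHc : IsCompact H)
    (hHpos : ∀ η ∈ H, 0 < η 0 ∧ 0 < η 1) (hHint : p.eta ∈ interior H)
    (est : ℕ → Ω → EuclideanSpace ℝ (Fin 3))
    (hest : ∀ n, IsLeastSquaresEstimator T b r (M n) (N n) X H (est n) P) :
    (Summable (fun q : ℤ × ℤ => coefA p.theta2 r q.1 q.2 ^ 2) ∧
      Summable (fun q : ℤ × ℤ => coefB p.theta2 r q.1 q.2 ^ 2) ∧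
      Summable (fun q : ℤ × ℤ => coefC p.theta2 r q.1 q.2 ^ 2)) ∧
    IsUnit (matV b r p.eta) ∧
    (asymptoticCov b r p.eta).PosDef ∧
    TendstoInDistribution
      (fun n ω => Real.sqrt ((M n : ℝ) * (N n : ℝ)) • (est n ω - p.eta)) atTop
      (id : EuclideanSpace ℝ (Fin 3) → EuclideanSpace ℝ (Fin 3)) (fun _ => P)
      (multivariateGaussian 0 (asymptoticCov b r p.eta)) := by
  have h : IsBalanced T b r M N := ⟨hT, hb, hr, hM, hN, hbal⟩
  have hH : H ∈ 𝓝 p.eta := mem_interior_iff_mem_nhds.1 hHint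
  refine ⟨⟨(decays_coefA hp.theta2_pos hr).summable_sq, (decays_coefB hp.theta2_pos hr).summable_sq,
    (decays_coefC hp.theta2_pos hr).summable_sq⟩, (hp.posDef_matV h).isUnit,
    posDef_asymptoticCov hb hr hp.sigmaSq_pos hp.theta2_pos, ?_⟩
  obtain ⟨hZi, hZ⟩ := tendsto_integral_resSq hp hX h
  obtain ⟨hWi, B, hW⟩ := exists_integral_norm_newtonStep_sq_le hp hX h
  -- Slutsky's lemma: the Newton step has the normal limit. Its distance to the scaled estimation
  -- error vanishes in probability, as the distance is relatively small wherever the mean squared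
  -- residual is small.
  refine tendstoInDistribution_of_tendstoInMeasure_sub _ _ (tendstoInDistribution_newtonStep hp hX h)
    (tendstoInMeasure_sub_of_relative_bound
      (fun n ω => gridAvg_nonneg fun _ _ _ => sq_nonneg _) hZi hZ hWi hW fun κ hκ => ?_)
    fun n => ((hest n).aemeasurable.sub_const _).fun_const_smul _
  obtain ⟨z, hz, hrel⟩ := exists_norm_sub_newtonStep_le (X := X) hp h hHc hHpos hH hκ
  refine ⟨z, hz, hrel.mono fun n hn => ?_⟩
  filter_upwards [(hest n).argmin] with ω hω hωz
  exact hn ω _ hω.1 hω.2 hωz
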